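/- Let $k$ be an algebraically closed field of characteristic $0$. A Poisson scheme over a ring $R$ is an $R$-scheme whose structure sheaf is a sheaf of Poisson $R$-algebras, and a Poisson morphism is a morphism of schemes whose pullback of functions preserves the Poisson brackets. Let $(X,\Lambda_0)$ and $(Y,\Pi_0)$ be nonsingular projective Poisson varieties over $k$ (integral, smooth and projective over $k$) and let $f:(X,\Lambda_0)\to(Y,\Pi_0)$ be a Poisson morphism over $k$. Let $f^*T_Y^\bullet$ be the complex of sheaves $f^*T_Y\xrightarrow{\pi}\wedge^2 f^*T_Y\xrightarrow{\pi}\wedge^3 f^*T_Y\to\cdots$ on $X$, with $f^*T_Y$ in degree $0$, where a local section $Q$ of $\wedge^q f^*T_Y=\mathcal{H}om(f^*\Omega^q_{Y/k},\mathcal{O}_X)$ is regarded as an alternating $k$-multilinear multiderivation from $\mathcal{O}_Y$ to $\mathcal{O}_X$ and $$\pi(Q)(a_1,\dots,a_{q+1})=\sum_{\sigma\in S_{q,1}}\operatorname{sgn}(\sigma)\,\Lambda_0\big(Q(a_{\sigma(1)},\dots,a_{\sigma(q)}),f^*a_{\sigma(q+1)}\big)-(-1)^{q-1}\sum_{\sigma\in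 S_{2,q-1}}\operatorname{sgn}(\sigma)\,Q\big(\Pi_0(a_{\sigma(1)},a_{\sigma(2)}),a_{\sigma(3)},\dots,a_{\sigma(q+1)}\big),$$ the sums being over shuffles. Let $T_Y^\bullet$ be the case $f=\mathrm{id}_Y$ of this complex, and let $f^*:\mathbb{H}^i(Y,T_Y^\bullet)\to\mathbb{H}^i(X,f^*T_Y^\bullet)$ be the homomorphism of (Čech) hypercohomology groups induced by $Q\mapsto f^*\circ Q$. Assume that 1. $f^*:\mathbb{H}^1(Y,T_Y^\bullet)\to\mathbb{H}^1(X,f^*T_Y^\bullet)$ is surjective; 2. $f^*:\mathbb{H}^2(Y,T_Y^\bullet)\to\mathbb{H}^2(X,f^*T_Y^\bullet)$ is injective. Let $\mathbf{Art}$ be the category of local Artinian $k$-algebras with residue field $k$. For $A\in\mathbf{Art}$, a flat Poisson deformation of $(X,\Lambda_0)$ over $A$ is a Poisson scheme $(\mathcal{X},\Lambda)$ flat over $\operatorname{Spec}A$ together with an identification of its base change to $\operatorname{Spec} k$ with $(X,\Lambda_0)$ as Poisson schemes; a deformation of $f$ over $A$ consists of flat Poisson deformations $(\mathcal{X},\Lambda)$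 of $(X,\Lambda_0)$ and $(\mathcal{Y},\Pi)$ of $(Y,\Pi_0)$ over $A$ and a Poisson morphism $\Psi:(\mathcal{X},\Lambda)\to(\mathcal{Y},\Pi)$ over $\operatorname{Spec}A$ which induces $f$ on the special fibres. Let $\mathrm{Def}_{(X,\Lambda_0)}(A)$ and $\mathrm{Def}_f(A)$ be the sets of isomorphism classes of such objects, where isomorphisms are Poisson isomorphisms over $\operatorname{Spec} A$ which induce the identity on the special fibres (and commute with the morphisms $\Psi$ in the case of $\mathrm{Def}_f$); they are functors of $A$ by base change. Then the forgetful morphism $f_X:\mathrm{Def}_f\to\mathrm{Def}_{(X,\Lambda_0)}$ is smooth, that is, for every surjection $A'\to A$ in $\mathbf{Art}$ the map $$\mathrm{Def}_f(A')\to\mathrm{Def}_f(A)\times_{\mathrm{Def}_{(X,\Lambda_0)}(A)}\mathrm{Def}_{(X,\Lambda_0)}(A')$$ is surjective. Moreover, for every $A\in\mathbf{Art}$ and every flat Poisson deformation $(\mathcal{X},\Lambda)$ of $(X,\Lambda_0)$ over $A$ there exist a flat Poisson deformation $(\mathcal{Y},\Pi)$ of $(Y,\Pi_0)$ over $A$ and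 a Poisson morphism $\Phi:(\mathcal{X},\Lambda)\to(\mathcal{Y},\Pi)$ over $\operatorname{Spec}A$ which induces $f$. -/

import Mathlib

open AlgebraicGeometry CategoryTheory TopologicalSpace

universe u

noncomputable section

namespace PoissonDeformationTheory

/-! ### Poisson schemes -/

/-- The ring map `R → Γ(X, U)` given by the structure morphism of an `R`-scheme. -/
def constants {R : Type u} [CommRing R] {X : Scheme.{u}} (p : X ⟶ Spec (.of R)) (U : X.Opens) :
    R →+* Γ(X, U) :=
  ((Scheme.ΓSpecIso (.of R)).inv ≫ p.appLE ⊤ U le_top).hom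

/-- Restriction of functions. -/
def resFun (X : Scheme.{u}) {U U' : X.Opens} (h : U' ≤ U) : Γ(X, U) →+* Γ(X, U') :=
  (X.presheaf.map (homOfLE h).op).hom

/-- Pullback of functions along `f`, restricted to an open `W ⊆ f⁻¹(V)`. -/
def pullFun {X Y : Scheme.{u}} (f : X ⟶ Y) (V : Y.Opens) (W : X.Opens) (h : W ≤ f ⁻¹ᵁ V) :
    Γ(Y, V) →+* Γ(X, W) :=
  (f.appLE V W h).hom

theorem resFun_resFun (X : Scheme.{u}) {U U' U'' : X.Opens} (h : U' ≤ U) (h' : U'' ≤ U')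
    (a : Γ(X, U)) : resFun X h' (resFun X h a) = resFun X (h'.trans h) a := by
  simp only [resFun, ← CommRingCat.comp_apply, ← Functor.map_comp]
  rfl

theorem resFun_pullFun {X Y : Scheme.{u}} (f : X ⟶ Y) {V : Y.Opens} {W W' : X.Opens}
    (e : W ≤ f ⁻¹ᵁ V) (h : W' ≤ W) (a : Γ(Y, V)) :
    resFun X h (pullFun f V W e a) = pullFun f V W' (h.trans e) a := by
  simp only [resFun, pullFun, ← CommRingCat.comp_apply, Scheme.Hom.appLE_map]

theorem pullFun_resFun {X Y : Scheme.{u}} (f : X ⟶ Y) {V V' : Y.Opens} {W : X.Opens}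
    (e : W ≤ f ⁻¹ᵁ V') (h : V' ≤ V) (a : Γ(Y, V)) :
    pullFun f V' W e (resFun Y h a) = pullFun f V W (fun _ hx => h (e hx)) a := by
  simp only [resFun, pullFun, ← CommRingCat.comp_apply, Scheme.Hom.map_appLE]

theorem pullFun_id (X : Scheme.{u}) {V W : X.Opens} (e : W ≤ 𝟙 X ⁻¹ᵁ V) (a : Γ(X, V)) :
    pullFun (𝟙 X) V W e a = resFun X (show W ≤ V from e) a := by
  simp only [resFun, pullFun, Scheme.Hom.appLE, Scheme.Hom.id_app]
  simp
  rfl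

theorem pullFun_pullFun_id {X Y : Scheme.{u}} (f : X ⟶ Y) {V V' : Y.Opens} {W : X.Opens}
    (e : W ≤ f ⁻¹ᵁ V') (h : V' ≤ 𝟙 Y ⁻¹ᵁ V) (a : Γ(Y, V)) :
    pullFun f V' W e (pullFun (𝟙 Y) V V' h a) = pullFun f V W (fun _ hx => h (e hx)) a := by
  rw [pullFun_id, pullFun_resFun]

/-- A Poisson scheme over `Spec R`: an `R`-scheme whose structure sheaf is a sheaf of
Poisson `R`-algebras. (`R`-bilinearity of the bracket amounts to biadditivity, the Leibniz rule
and the vanishing of brackets with elements coming from `R`.) -/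
structure PoissonScheme (R : Type u) [CommRing R] where
  scheme : Scheme.{u}
  str : scheme ⟶ Spec (.of R)
  bracket : ∀ U : scheme.Opens, Γ(scheme, U) → Γ(scheme, U) → Γ(scheme, U)
  bracket_add_left : ∀ U a b c, bracket U (a + b) c = bracket U a c + bracket U b c
  bracket_add_right : ∀ U a b c, bracket U a (b + c) = bracket U a b + bracket U a c
  bracket_self : ∀ U a, bracket U a a = 0
  bracket_mul_right : ∀ U a b c, bracket U a (b * c) = bracket U a b * c + b * bracket U a c
  bracket_const_right : ∀ U a (r : R), bracket U a (constants str U r) = 0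
  jacobi : ∀ U a b c,
    bracket U a (bracket U b c) + bracket U b (bracket U c a) + bracket U c (bracket U a b) = 0
  bracket_res : ∀ {U U' : scheme.Opens} (h : U' ≤ U) (a b : Γ(scheme, U)),
    resFun scheme h (bracket U a b) = bracket U' (resFun scheme h a) (resFun scheme h b)

/-- Pullback of functions along `f` respects the Poisson brackets. The base rings of the two
Poisson schemes may differ. -/
def IsPoissonMap {R S : Type u} [CommRing R] [CommRing S] (X : PoissonScheme R)
    (Y : PoissonScheme S) (f : X.scheme ⟶ Y.scheme) : Prop :=
  ∀ (V : Y.scheme.Opens) (a b : Γ(Y.scheme, V)),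
    pullFun f V (f ⁻¹ᵁ V) le_rfl (Y.bracket V a b) =
      X.bracket (f ⁻¹ᵁ V) (pullFun f V _ le_rfl a) (pullFun f V _ le_rfl b)

attribute [local instance] MvPolynomial.gradedAlgebra

theorem IsPoissonMap.pullFun_bracket {R S : Type u} [CommRing R] [CommRing S]
    {X : PoissonScheme R} {Y : PoissonScheme S} {f : X.scheme ⟶ Y.scheme}
    (hf : IsPoissonMap X Y f) {V : Y.scheme.Opens} {W : X.scheme.Opens} (e : W ≤ f ⁻¹ᵁ V)
    (a b : Γ(Y.scheme, V)) :
    pullFun f V W e (Y.bracket V a b) = X.bracket W (pullFun f V W e a) (pullFun f V W e b) := by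
  rw [← resFun_pullFun f le_rfl e, hf, X.bracket_res, resFun_pullFun, resFun_pullFun]

/-- `p : X → Spec k` factors through a closed immersion into a projective space over `k`. -/
def IsProjectiveOver {k : Type u} [Field k] {X : Scheme.{u}} (p : X ⟶ Spec (.of k)) : Prop :=
  ∃ (n : ℕ) (i : X ⟶ Proj (MvPolynomial.homogeneousSubmodule (Fin (n + 1)) k)),
    IsClosedImmersion i ∧
      i ≫ Proj.toSpecZero (MvPolynomial.homogeneousSubmodule (Fin (n + 1)) k) ≫
        Spec.map (CommRingCat.ofHom
          (algebraMap k (MvPolynomial.homogeneousSubmodule (Fin (n + 1)) k 0))) = p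

/-- A nonsingular projective Poisson variety over the (algebraically closed) field `k`. -/
structure PoissonScheme.IsNonsingularProjectiveVariety {k : Type u} [Field k]
    (X : PoissonScheme k) : Prop where
  isIntegral : IsIntegral X.scheme
  smooth : Smooth X.str
  projective : IsProjectiveOver X.str

/-! ### The complex `f^* T_Y^•` -/

section Polyvectors

variable {X Y : Scheme.{u}}

/-- Families of arbitrary functions `O_Y(V)^{q+1} → O_X(U ∩ f⁻¹(V))`, for `V` open in `Y`; the
sections of `⋀^{q+1} f^* T_Y` over `U` are carved out of these by `IsPolyvector`. -/
abbrev Sec (f : X ⟶ Y) (q : ℕ) (U : X.Opens) : Type u :=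
  ∀ V : Y.Opens, (Fin (q + 1) → Γ(Y, V)) → Γ(X, U ⊓ f ⁻¹ᵁ V)

/-- Sections over `U` of `⋀^{q+1} f^* T_Y = Hom(f^* Ω^{q+1}_{Y/k}, O_X)`, as alternating
`k`-multilinear multiderivations of the sheaf `O_Y` with values in `f_* (O_X|_U)`. -/
structure IsPolyvector {k : Type u} [Field k] (pY : Y ⟶ Spec (.of k)) (f : X ⟶ Y) {q : ℕ}
    {U : X.Opens} (D : Sec f q U) : Prop where
  add : ∀ V i a x y, D V (Function.update a i (x + y)) =
    D V (Function.update a i x) + D V (Function.update a i y)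
  leibniz : ∀ V i a x y, D V (Function.update a i (x * y)) =
    pullFun f V _ inf_le_right x * D V (Function.update a i y) +
      pullFun f V _ inf_le_right y * D V (Function.update a i x)
  const : ∀ V i a (c : k), D V (Function.update a i (constants pY V c)) = 0
  alternating : ∀ V a i j, i ≠ j → a i = a j → D V a = 0
  res : ∀ {V V' : Y.Opens} (h : V' ≤ V) (a : Fin (q + 1) → Γ(Y, V)),
    resFun X (inf_le_inf_left U (fun _ hx => h hx)) (D V a) = D V' (fun i => resFun Y h (a i))

/-- Restriction from `U` to `U' ⊆ U`. -/
def secRes (f : X ⟶ Y) (q : ℕ) {U U' : X.Opens} (h : U' ≤ U) : Sec f q U →+ Sec f q U' where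
  toFun D V a := resFun X (inf_le_inf_right (f ⁻¹ᵁ V) h) (D V a)
  map_zero' := by ext; simp
  map_add' _ _ := by ext; simp

/-- The homomorphism `f^*` from `Γ(W, ⋀^{q+1} T_Y)` to `Γ(U, ⋀^{q+1} f^* T_Y)`, for
`U ⊆ f⁻¹(W)`: compose with the pullback of functions. -/
def secPull (f : X ⟶ Y) (q : ℕ) {W : Y.Opens} {U : X.Opens} (h : U ≤ f ⁻¹ᵁ W) :
    Sec (𝟙 Y) q W →+ Sec f q U where
  toFun D V a := pullFun f (W ⊓ 𝟙 Y ⁻¹ᵁ V) (U ⊓ f ⁻¹ᵁ V)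
    (fun _ hx => ⟨h hx.1, hx.2⟩) (D V a)
  map_zero' := funext fun _ => funext fun _ => map_zero _
  map_add' _ _ := funext fun _ => funext fun _ => map_add _ _ _

end Polyvectors

section

variable {k : Type u} [Field k] {X Y : PoissonScheme k}

theorem PoissonScheme.bracket_zero_left (X : PoissonScheme k) (U) (b) : X.bracket U 0 b = 0 := by
  simpa using X.bracket_add_left U 0 0 b

/-- The differential `π : ⋀^{q+1} f^* T_Y → ⋀^{q+2} f^* T_Y`; the first sum is over the
`(q+1, 1)`-shuffles and the second one over the `(2, q)`-shuffles. For `f = 𝟙` this is the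
differential `[Π₀, -]` of `T_Y^•`. -/
def poissonDiff (f : X.scheme ⟶ Y.scheme) (q : ℕ) (U : X.scheme.Opens) :
    Sec f q U →+ Sec f (q + 1) U where
  toFun D V a :=
    ∑ i : Fin (q + 2), (-1 : ℤ) ^ (q + 1 + (i : ℕ)) •
        X.bracket _ (D V (i.removeNth a)) (pullFun f V _ inf_le_right (a i))
    - (-1 : ℤ) ^ q • ∑ j : Fin (q + 2), ∑ i : Fin (q + 1),
        if i.castSucc < j then
          (-1 : ℤ) ^ ((i : ℕ) + (j : ℕ) + 1) •
            D V (Fin.cons (Y.bracket V (a i.castSucc) (a j)) (i.removeNth (j.removeNth a)) :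
              Fin (q + 1) → Γ(Y.scheme, V))
        else 0
  map_zero' := by
    ext V a
    simp [PoissonScheme.bracket_zero_left]
  map_add' D E := by
    ext V a
    simp only [Pi.add_apply, X.bracket_add_left, smul_add, Finset.sum_add_distrib]
    have : ∀ (i : Fin (q + 1)) (j : Fin (q + 2)) (x y : Γ(X.scheme, U ⊓ f ⁻¹ᵁ V)),
        (if i.castSucc < j then x + y else 0) =
          (if i.castSucc < j then x else 0) + (if i.castSucc < j then y else 0) := by
      intro i j x y; split_ifs <;> simp
    simp only [this, Finset.sum_add_distrib, smul_add]
    abel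

end

/-! ### Čech hypercohomology -/

/-- An open cover of `X` indexed by the points of `X`: every point has a chosen neighbourhood.
Every open cover is refined by one of these. -/
structure PtCover (X : Scheme.{u}) where
  nhd : X → X.Opens
  mem : ∀ x, x ∈ nhd x

/-- `𝒰 ≤ 𝒰'` means that `𝒰'` refines `𝒰`. -/
instance (X : Scheme.{u}) : Preorder (PtCover X) where
  le 𝒰 𝒰' := ∀ x, 𝒰'.nhd x ≤ 𝒰.nhd x
  le_refl _ _ := le_rfl
  le_trans _ _ _ h h' x := (h' x).trans (h x)

namespace PtCover

/-- The intersection of the members with indices `s 0, …, s p`. -/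
def inter {X : Scheme.{u}} (𝒰 : PtCover X) {p : ℕ} (s : Fin (p + 1) → X) : X.Opens :=
  ⨅ i, 𝒰.nhd (s i)

theorem inter_comp_le {X : Scheme.{u}} (𝒰 : PtCover X) {p r : ℕ} (s : Fin (p + 1) → X)
    (t : Fin (r + 1) → Fin (p + 1)) : 𝒰.inter s ≤ 𝒰.inter (s ∘ t) :=
  le_iInf fun i => iInf_le _ (t i)

theorem inter_mono {X : Scheme.{u}} {𝒰 𝒰' : PtCover X} (h : 𝒰 ≤ 𝒰') {p : ℕ}
    (s : Fin (p + 1) → X) : 𝒰'.inter s ≤ 𝒰.inter s :=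
  iInf_mono fun i => h (s i)

/-- The cover `x ↦ f⁻¹(V_{f(x)})`. -/
def preimage {X Y : Scheme.{u}} (f : X ⟶ Y) (𝒱 : PtCover Y) : PtCover X where
  nhd x := f ⁻¹ᵁ 𝒱.nhd (f x)
  mem x := 𝒱.mem (f x)

theorem preimage_mono {X Y : Scheme.{u}} (f : X ⟶ Y) {𝒱 𝒱' : PtCover Y} (h : 𝒱 ≤ 𝒱') :
    𝒱.preimage f ≤ 𝒱'.preimage f :=
  fun x _ hz => h (f x) hz

theorem inter_preimage_le {X Y : Scheme.{u}} (f : X ⟶ Y) (𝒱 : PtCover Y) {p : ℕ}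
    (s : Fin (p + 1) → X) : (𝒱.preimage f).inter s ≤ f ⁻¹ᵁ 𝒱.inter (f ∘ s) := by
  intro z hz
  have hz' : ∀ i, f z ∈ 𝒱.nhd (f (s i)) := fun i => (iInf_le (fun i => f ⁻¹ᵁ 𝒱.nhd (f (s i))) i) hz
  change f z ∈ 𝒱.inter (f ∘ s)
  have : ((𝒱.inter (f ∘ s) : Y.Opens) : Set Y) = ⋂ i, (𝒱.nhd (f (s i)) : Set Y) := by
    simp [inter, Opens.coe_iInf]
  rw [← SetLike.mem_coe, this]
  exact Set.mem_iInter.2 hz'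

end PtCover

section Cech

variable {k : Type u} [Field k] {X Y : PoissonScheme k}

/-- Families indexed by bidegrees `(p, q)` and tuples `s` of `p + 1` points, with values over
`U_{s 0} ∩ … ∩ U_{s p}`. -/
abbrev Cochain (f : X.scheme ⟶ Y.scheme) (𝒰 : PtCover X.scheme) : Type u :=
  ∀ (p q : ℕ) (s : Fin (p + 1) → X.scheme), Sec f q (𝒰.inter s)

/-- The Čech differential `δ`, of bidegree `(1, 0)`. -/
def cechDiff (f : X.scheme ⟶ Y.scheme) (𝒰 : PtCover X.scheme) :
    Cochain f 𝒰 →+ Cochain f 𝒰 where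
  toFun c
    | 0, _, _ => 0
    | p + 1, q, s => ∑ j : Fin (p + 2), (-1 : ℤ) ^ (j : ℕ) •
        secRes f q (𝒰.inter_comp_le s j.succAbove) (c p q (s ∘ j.succAbove))
  map_zero' := by
    funext p q s
    cases p <;> simp
  map_add' c d := by
    funext p q s
    cases p <;> simp [Finset.sum_add_distrib]

/-- The differential `(-1)^p π`, of bidegree `(0, 1)`. -/
def vertDiff (f : X.scheme ⟶ Y.scheme) (𝒰 : PtCover X.scheme) :
    Cochain f 𝒰 →+ Cochain f 𝒰 where
  toFun c
    | _, 0, _ => 0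
    | p, q + 1, s => (-1 : ℤ) ^ p • poissonDiff f q (𝒰.inter s) (c p q s)
  map_zero' := by
    funext p q s
    cases q <;> simp
  map_add' c d := by
    funext p q s
    cases q <;> simp

/-- The differential of the total complex. -/
def totalDiff (f : X.scheme ⟶ Y.scheme) (𝒰 : PtCover X.scheme) :
    Cochain f 𝒰 →+ Cochain f 𝒰 :=
  cechDiff f 𝒰 + vertDiff f 𝒰

theorem IsPolyvector.zero (f : X.scheme ⟶ Y.scheme) {q : ℕ} {U : X.scheme.Opens} :
    IsPolyvector Y.str f (0 : Sec f q U) where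
  add := by simp
  leibniz := by simp
  const := by simp
  alternating := by simp
  res := by simp

theorem IsPolyvector.add' {f : X.scheme ⟶ Y.scheme} {q : ℕ} {U : X.scheme.Opens}
    {D E : Sec f q U} (hD : IsPolyvector Y.str f D) (hE : IsPolyvector Y.str f E) :
    IsPolyvector Y.str f (D + E) where
  add V i a x y := by simp only [Pi.add_apply, hD.add, hE.add]; abel
  leibniz V i a x y := by simp only [Pi.add_apply, hD.leibniz, hE.leibniz]; ring
  const V i a c := by simp only [Pi.add_apply, hD.const, hE.const, add_zero]
  alternating V a i j h h' := by
    simp only [Pi.add_apply, hD.alternating V a i j h h', hE.alternating V a i j h h', add_zero]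
  res h a := by simp only [Pi.add_apply, map_add, hD.res h a, hE.res h a]

theorem IsPolyvector.neg {f : X.scheme ⟶ Y.scheme} {q : ℕ} {U : X.scheme.Opens}
    {D : Sec f q U} (hD : IsPolyvector Y.str f D) : IsPolyvector Y.str f (-D) where
  add V i a x y := by simp only [Pi.neg_apply, hD.add]; abel
  leibniz V i a x y := by simp only [Pi.neg_apply, hD.leibniz]; ring
  const V i a c := by simp only [Pi.neg_apply, hD.const, neg_zero]
  alternating V a i j h h' := by simp only [Pi.neg_apply, hD.alternating V a i j h h', neg_zero]
  res h a := by simp only [Pi.neg_apply, map_neg, hD.res h a]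

/-- The degree `n` part `⨁_{p+q=n} C^p(𝒰, ⋀^{q+1} f^* T_Y)` of the total Čech complex
of `f^* T_Y^•`. -/
def cochains (f : X.scheme ⟶ Y.scheme) (𝒰 : PtCover X.scheme) (n : ℕ) :
    AddSubgroup (Cochain f 𝒰) where
  carrier := {c | (∀ p q s, IsPolyvector Y.str f (c p q s)) ∧ ∀ p q, p + q ≠ n → c p q = 0}
  zero_mem' := ⟨fun _ _ _ => IsPolyvector.zero f, fun _ _ _ => rfl⟩
  add_mem' hc hd := ⟨fun p q s => (hc.1 p q s).add' (hd.1 p q s), fun p q h => by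
    simp [hc.2 p q h, hd.2 p q h]⟩
  neg_mem' hc := ⟨fun p q s => (hc.1 p q s).neg, fun p q h => by simp [hc.2 p q h]⟩

/-- Cocycles of degree `n`. -/
def cocycles (f : X.scheme ⟶ Y.scheme) (𝒰 : PtCover X.scheme) (n : ℕ) :
    AddSubgroup (Cochain f 𝒰) :=
  cochains f 𝒰 n ⊓ (totalDiff f 𝒰).ker

/-- Coboundaries of degree `n`. -/
def coboundaries (f : X.scheme ⟶ Y.scheme) (𝒰 : PtCover X.scheme) :
    ℕ → AddSubgroup (Cochain f 𝒰)
  | 0 => ⊥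
  | n + 1 => (cochains f 𝒰 n).map (totalDiff f 𝒰)

/-- The `n`-th cohomology of the total Čech complex of `f^* T_Y^•` for the cover `𝒰`. -/
abbrev cechCoh (f : X.scheme ⟶ Y.scheme) (𝒰 : PtCover X.scheme) (n : ℕ) : Type u :=
  cocycles f 𝒰 n ⧸ (coboundaries f 𝒰 n).addSubgroupOf (cocycles f 𝒰 n)

/-- A homomorphism of Čech complexes induces a homomorphism in cohomology. -/
def cechCohMap {X' : PoissonScheme k} {f : X.scheme ⟶ Y.scheme} {f' : X'.scheme ⟶ Y.scheme}
    {𝒰 : PtCover X.scheme} {𝒰' : PtCover X'.scheme} (φ : Cochain f 𝒰 →+ Cochain f' 𝒰')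
    (hφ : ∀ n, ∀ c ∈ cochains f 𝒰 n, φ c ∈ cochains f' 𝒰' n)
    (hd : ∀ c, φ (totalDiff f 𝒰 c) = totalDiff f' 𝒰' (φ c)) (n : ℕ) :
    cechCoh f 𝒰 n →+ cechCoh f' 𝒰' n :=
  QuotientAddGroup.map _ _
    ((φ.comp (cocycles f 𝒰 n).subtype).codRestrict (cocycles f' 𝒰' n) fun c =>
      ⟨hφ n _ c.2.1, by
        have hc : totalDiff f 𝒰 c.1 = 0 := c.2.2
        change totalDiff f' 𝒰' (φ c.1) = 0
        rw [← hd, hc, map_zero]⟩)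
    (by
      rintro ⟨c, hc⟩ h
      change φ c ∈ coboundaries f' 𝒰' n
      have h' : c ∈ coboundaries f 𝒰 n := h
      cases n with
      | zero =>
        have : c = 0 := h'
        subst this
        simp [coboundaries]
      | succ n =>
        obtain ⟨b, hb, rfl⟩ := h'
        exact ⟨φ b, hφ n b hb, (hd b).symm⟩)

theorem secRes_poissonDiff (f : X.scheme ⟶ Y.scheme) (q : ℕ) {U U' : X.scheme.Opens}
    (h : U' ≤ U) (D : Sec f q U) :
    secRes f (q + 1) h (poissonDiff f q U D) = poissonDiff f q U' (secRes f q h D) := by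
  funext V a
  simp only [secRes, poissonDiff, AddMonoidHom.coe_mk, ZeroHom.coe_mk, map_sub, map_sum,
    map_zsmul, X.bracket_res, resFun_pullFun, apply_ite (resFun X.scheme _), map_zero]

theorem secRes_secRes (f : X.scheme ⟶ Y.scheme) (q : ℕ) {U U' U'' : X.scheme.Opens}
    (h : U' ≤ U) (h' : U'' ≤ U') (D : Sec f q U) :
    secRes f q h' (secRes f q h D) = secRes f q (h'.trans h) D := by
  funext V a
  simp only [secRes, AddMonoidHom.coe_mk, ZeroHom.coe_mk, resFun_resFun]

theorem IsPolyvector.secRes {f : X.scheme ⟶ Y.scheme} {q : ℕ} {U U' : X.scheme.Opens}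
    (h : U' ≤ U) {D : Sec f q U} (hD : IsPolyvector Y.str f D) :
    IsPolyvector Y.str f (secRes f q h D) where
  add V i a x y := by
    simp only [PoissonDeformationTheory.secRes, AddMonoidHom.coe_mk, ZeroHom.coe_mk, hD.add,
      map_add]
  leibniz V i a x y := by
    simp only [PoissonDeformationTheory.secRes, AddMonoidHom.coe_mk, ZeroHom.coe_mk, hD.leibniz,
      map_add, map_mul, resFun_pullFun]
  const V i a c := by
    simp only [PoissonDeformationTheory.secRes, AddMonoidHom.coe_mk, ZeroHom.coe_mk, hD.const,
      map_zero]
  alternating V a i j h h' := by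
    simp only [PoissonDeformationTheory.secRes, AddMonoidHom.coe_mk, ZeroHom.coe_mk,
      hD.alternating V a i j h h', map_zero]
  res h a := by
    simp only [PoissonDeformationTheory.secRes, AddMonoidHom.coe_mk, ZeroHom.coe_mk,
      ← hD.res h a, resFun_resFun]

theorem secPull_poissonDiff {f : X.scheme ⟶ Y.scheme} (hf : IsPoissonMap X Y f) (q : ℕ)
    {W : Y.scheme.Opens} {U : X.scheme.Opens} (h : U ≤ f ⁻¹ᵁ W) (D : Sec (𝟙 Y.scheme) q W) :
    secPull f (q + 1) h (poissonDiff (𝟙 Y.scheme) q W D) =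
      poissonDiff f q U (secPull f q h D) := by
  funext V a
  simp only [secPull, poissonDiff, AddMonoidHom.coe_mk, ZeroHom.coe_mk, map_sub, map_sum,
    map_zsmul]
  refine congrArg₂ _ (Finset.sum_congr rfl fun i _ => congrArg _ ?_)
    (congrArg _ (Finset.sum_congr rfl fun j _ => Finset.sum_congr rfl fun i _ => ?_))
  · exact (hf.pullFun_bracket _ _ _).trans (congrArg _ (pullFun_pullFun_id f _ _ _))
  · split_ifs
    · exact map_zsmul _ _ _
    · exact map_zero _

theorem IsPolyvector.secPull {f : X.scheme ⟶ Y.scheme} {q : ℕ} {W : Y.scheme.Opens}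
    {U : X.scheme.Opens} (h : U ≤ f ⁻¹ᵁ W) {D : Sec (𝟙 Y.scheme) q W}
    (hD : IsPolyvector Y.str (𝟙 Y.scheme) D) : IsPolyvector Y.str f (secPull f q h D) where
  add V i a x y := by
    simp only [PoissonDeformationTheory.secPull, AddMonoidHom.coe_mk, ZeroHom.coe_mk, hD.add,
      map_add]
  leibniz V i a x y := by
    simp only [PoissonDeformationTheory.secPull, AddMonoidHom.coe_mk, ZeroHom.coe_mk, hD.leibniz,
      map_add, map_mul]
    exact congrArg₂ _ (congrArg (· * _) (pullFun_pullFun_id f _ _ _))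
      (congrArg (· * _) (pullFun_pullFun_id f _ _ _))
  const V i a c := by
    simp only [PoissonDeformationTheory.secPull, AddMonoidHom.coe_mk, ZeroHom.coe_mk, hD.const,
      map_zero]
  alternating V a i j h h' := by
    simp only [PoissonDeformationTheory.secPull, AddMonoidHom.coe_mk, ZeroHom.coe_mk,
      hD.alternating V a i j h h', map_zero]
  res h a := by
    simp only [PoissonDeformationTheory.secPull, AddMonoidHom.coe_mk, ZeroHom.coe_mk,
      ← hD.res h a]
    exact (resFun_pullFun f _ _ _).trans (pullFun_resFun f _ _ _).symm

theorem secPull_secRes (f : X.scheme ⟶ Y.scheme) (q : ℕ) {W W' : Y.scheme.Opens}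
    {U U' : X.scheme.Opens} (h : W' ≤ W) (h' : U' ≤ U) (e : U ≤ f ⁻¹ᵁ W) (e' : U' ≤ f ⁻¹ᵁ W')
    (D : Sec (𝟙 Y.scheme) q W) :
    secPull f q e' (secRes (𝟙 Y.scheme) q h D) = secRes f q h' (secPull f q e D) := by
  funext V a
  simp only [secPull, secRes, AddMonoidHom.coe_mk, ZeroHom.coe_mk]
  exact (pullFun_resFun f _ _ _).trans (resFun_pullFun f _ _ _).symm

/-- Restriction of cochains to a finer cover. -/
def cochainRes (f : X.scheme ⟶ Y.scheme) {𝒰 𝒰' : PtCover X.scheme} (h : 𝒰 ≤ 𝒰') :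
    Cochain f 𝒰 →+ Cochain f 𝒰' where
  toFun c p q s := secRes f q (PtCover.inter_mono h s) (c p q s)
  map_zero' := by funext p q s; simp
  map_add' c d := by funext p q s; simp

/-- Pullback of cochains of `T_Y^•` on a cover `𝒱` of `Y` to cochains of `f^* T_Y^•` on the
preimage of `𝒱`. -/
def cochainPull (f : X.scheme ⟶ Y.scheme) (𝒱 : PtCover Y.scheme) :
    Cochain (𝟙 Y.scheme) 𝒱 →+ Cochain f (𝒱.preimage f) where
  toFun c p q s := secPull f q (PtCover.inter_preimage_le f 𝒱 s) (c p q (f ∘ s))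
  map_zero' := by funext p q s; simp
  map_add' c d := by funext p q s; simp

theorem cochainRes_mem (f : X.scheme ⟶ Y.scheme) {𝒰 𝒰' : PtCover X.scheme} (h : 𝒰 ≤ 𝒰') (n : ℕ)
    (c : Cochain f 𝒰) (hc : c ∈ cochains f 𝒰 n) : cochainRes f h c ∈ cochains f 𝒰' n :=
  ⟨fun p q s => (hc.1 p q s).secRes (PtCover.inter_mono h s), fun p q hpq => by
    funext s
    simp [cochainRes, hc.2 p q hpq]⟩

theorem cochainPull_mem (f : X.scheme ⟶ Y.scheme) (𝒱 : PtCover Y.scheme) (n : ℕ)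
    (c : Cochain (𝟙 Y.scheme) 𝒱) (hc : c ∈ cochains (𝟙 Y.scheme) 𝒱 n) :
    cochainPull f 𝒱 c ∈ cochains f (𝒱.preimage f) n :=
  ⟨fun p q s => (hc.1 p q (f ∘ s)).secPull (PtCover.inter_preimage_le f 𝒱 s), fun p q hpq => by
    funext s
    simp [cochainPull, hc.2 p q hpq]⟩

theorem cochainRes_totalDiff (f : X.scheme ⟶ Y.scheme) {𝒰 𝒰' : PtCover X.scheme} (h : 𝒰 ≤ 𝒰')
    (c : Cochain f 𝒰) :
    cochainRes f h (totalDiff f 𝒰 c) = totalDiff f 𝒰' (cochainRes f h c) := by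
  simp only [totalDiff, AddMonoidHom.add_apply, map_add]
  congr 1
  · funext p q s
    cases p with
    | zero => simp [cochainRes, cechDiff]
    | succ p =>
      simp only [cochainRes, cechDiff, AddMonoidHom.coe_mk, ZeroHom.coe_mk, map_sum, map_zsmul,
        secRes_secRes]
  · funext p q s
    cases q with
    | zero => simp [cochainRes, vertDiff]
    | succ q =>
      simp only [cochainRes, vertDiff, AddMonoidHom.coe_mk, ZeroHom.coe_mk, map_zsmul,
        secRes_poissonDiff]

theorem cochainPull_totalDiff {f : X.scheme ⟶ Y.scheme} (hf : IsPoissonMap X Y f)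
    (𝒱 : PtCover Y.scheme) (c : Cochain (𝟙 Y.scheme) 𝒱) :
    cochainPull f 𝒱 (totalDiff (𝟙 Y.scheme) 𝒱 c) =
      totalDiff f (𝒱.preimage f) (cochainPull f 𝒱 c) := by
  simp only [totalDiff, AddMonoidHom.add_apply, map_add]
  congr 1
  · funext p q s
    cases p with
    | zero => simp [cochainPull, cechDiff]
    | succ p =>
      simp only [cochainPull, cechDiff, AddMonoidHom.coe_mk, ZeroHom.coe_mk, map_sum, map_zsmul]
      refine Finset.sum_congr rfl fun j _ => ?_
      congr 1
      exact secPull_secRes f q _ _ _ _ _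
  · funext p q s
    cases q with
    | zero => simp [cochainPull, vertDiff]
    | succ q =>
      simp only [cochainPull, vertDiff, AddMonoidHom.coe_mk, ZeroHom.coe_mk, map_zsmul,
        secPull_poissonDiff hf]

open Classical in
/-- The hypercohomology group `ℍⁿ(X, f^* T_Y^•)`, where `T_Y` is placed in degree `0`: the direct
limit, over the open covers of `X`, of the cohomology of the total Čech complex. -/
abbrev hypercohomology (f : X.scheme ⟶ Y.scheme) (n : ℕ) : Type u :=
  AddCommGroup.DirectLimit (fun 𝒰 : PtCover X.scheme => cechCoh f 𝒰 n)
    fun _ _ h => cechCohMap (cochainRes f h) (cochainRes_mem f h) (cochainRes_totalDiff f h) n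

open Classical in
/-- The homomorphism `f^* : ℍⁿ(Y, T_Y^•) → ℍⁿ(X, f^* T_Y^•)` of a Poisson morphism `f`, where
`T_Y^•` is `(𝟙 Y)^* T_Y^•`. -/
def hyperPullback {f : X.scheme ⟶ Y.scheme} (hf : IsPoissonMap X Y f) (n : ℕ) :
    hypercohomology (X := Y) (Y := Y) (𝟙 Y.scheme) n →+ hypercohomology f n :=
  AddCommGroup.DirectLimit.lift _ _ _
    (fun 𝒱 : PtCover Y.scheme =>
      (AddCommGroup.DirectLimit.of (fun 𝒰 : PtCover X.scheme => cechCoh f 𝒰 n) _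
        (𝒱.preimage f)).comp
        (cechCohMap (cochainPull f 𝒱) (cochainPull_mem f 𝒱) (cochainPull_totalDiff hf 𝒱) n))
    (by
      intro 𝒱 𝒱' h x
      rw [AddMonoidHom.comp_apply, AddMonoidHom.comp_apply,
        ← AddCommGroup.DirectLimit.of_f (PtCover.preimage_mono f h)]
      congr 1
      induction x using QuotientAddGroup.induction_on with
      | H c =>
        refine congrArg (QuotientAddGroup.mk (s := _)) (Subtype.ext ?_)
        funext p q s
        exact secPull_secRes f q (PtCover.inter_mono h _)
          (PtCover.inter_mono (PtCover.preimage_mono f h) s)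
          (PtCover.inter_preimage_le f 𝒱 s) (PtCover.inter_preimage_le f 𝒱' s) _)

end Cech

/-! ### Local Artinian algebras and deformations -/

/-- Local Artinian `k`-algebras with residue field `k`; for a local `k`-algebra `A` the latter
means that there is a (necessarily unique) `k`-algebra homomorphism `A → k`. -/
structure Art (k : Type u) [Field k] where
  carrier : Type u
  [commRing : CommRing carrier]
  [algebra : Algebra k carrier]
  [isLocalRing : IsLocalRing carrier]
  [isArtinianRing : IsArtinianRing carrier]
  aug : carrier →ₐ[k] k

attribute [instance] Art.commRing Art.algebra Art.isLocalRing Art.isArtinianRing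

section Deformations

variable {k : Type u} [Field k]

/-- The morphism `Spec A → Spec A'` of a `k`-algebra homomorphism `A' → A`. -/
def specMap {A' A : Type u} [CommRing A'] [CommRing A] [Algebra k A'] [Algebra k A]
    (φ : A' →ₐ[k] A) : Spec (.of A) ⟶ Spec (.of A') :=
  Spec.map (CommRingCat.ofHom φ.toRingHom)

/-- A flat Poisson deformation of `(X, Λ₀)` over `Spec A`: a flat Poisson scheme over `Spec A`
with an identification of its base change to `Spec k` with `(X, Λ₀)`. (The Poisson structure of a
base change is the only one for which the projection respects the brackets.) -/
structure Deformation (X : PoissonScheme k) (A : Art k) where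
  total : PoissonScheme A.carrier
  flat : Flat total.str
  incl : X.scheme ⟶ total.scheme
  isPullback : IsPullback incl X.str total.str (specMap A.aug)
  incl_poisson : IsPoissonMap X total incl

/-- A Poisson isomorphism over `Spec A` inducing the identity on the special fibre. -/
def Deformation.IsIsom {X : PoissonScheme k} {A : Art k} {η η' : Deformation X A}
    (r : η.total.scheme ≅ η'.total.scheme) : Prop :=
  r.hom ≫ η'.total.str = η.total.str ∧ η.incl ≫ r.hom = η'.incl ∧
    IsPoissonMap η.total η'.total r.hom ∧ IsPoissonMap η'.total η.total r.inv

/-- An infinitesimal deformation of the Poisson morphism `f` over `Spec A`. -/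
structure MorDeformation (X Y : PoissonScheme k) (f : X.scheme ⟶ Y.scheme) (A : Art k) where
  dom : Deformation X A
  cod : Deformation Y A
  map : dom.total.scheme ⟶ cod.total.scheme
  map_str : map ≫ cod.total.str = dom.total.str
  map_poisson : IsPoissonMap dom.total cod.total map
  induces : dom.incl ≫ map = f ≫ cod.incl

theorem IsPoissonMap.refl {R : Type u} [CommRing R] (X : PoissonScheme R) :
    IsPoissonMap X X (𝟙 X.scheme) := fun V a b => by
  simp only [pullFun_id, X.bracket_res]

theorem IsPoissonMap.comp {R S T : Type u} [CommRing R] [CommRing S] [CommRing T]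
    {X : PoissonScheme R} {Y : PoissonScheme S} {Z : PoissonScheme T}
    {f : X.scheme ⟶ Y.scheme} {g : Y.scheme ⟶ Z.scheme}
    (hf : IsPoissonMap X Y f) (hg : IsPoissonMap Y Z g) : IsPoissonMap X Z (f ≫ g) := by
  have key : ∀ V (a : Γ(Z.scheme, V)), pullFun (f ≫ g) V _ le_rfl a =
      pullFun f (g ⁻¹ᵁ V) (f ⁻¹ᵁ g ⁻¹ᵁ V) le_rfl (pullFun g V _ le_rfl a) := by
    intro V a
    simp only [pullFun, ← CommRingCat.comp_apply, Scheme.Hom.appLE_comp_appLE]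
    rfl
  intro V a b
  rw [key, key, key, hg, hf]
  rfl

/-- Isomorphism of deformations of `(X, Λ₀)`. -/
instance Deformation.setoid (X : PoissonScheme k) (A : Art k) : Setoid (Deformation X A) where
  r η η' := ∃ r : η.total.scheme ≅ η'.total.scheme, Deformation.IsIsom r
  iseqv :=
    { refl := fun η => ⟨Iso.refl _, by simp, by simp, .refl _, .refl _⟩
      symm := fun {η η'} ⟨r, h₁, h₂, h₃, h₄⟩ =>
        ⟨r.symm, by simp [← h₁], by simp [← h₂], h₄, h₃⟩
      trans := fun {η η' η''} ⟨r, h₁, h₂, h₃, h₄⟩ ⟨r', h₁', h₂', h₃', h₄'⟩ =>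
        ⟨r ≪≫ r', by simp [h₁, h₁'], by simp [← h₂', ← h₂], h₃.comp h₃', h₄'.comp h₄⟩ }

/-- Isomorphism of deformations of `f`. -/
instance MorDeformation.setoid (X Y : PoissonScheme k) (f : X.scheme ⟶ Y.scheme) (A : Art k) :
    Setoid (MorDeformation X Y f A) where
  r ξ ξ' := ∃ (r : ξ.dom.total.scheme ≅ ξ'.dom.total.scheme)
    (s : ξ.cod.total.scheme ≅ ξ'.cod.total.scheme),
    Deformation.IsIsom r ∧ Deformation.IsIsom s ∧ r.hom ≫ ξ'.map = ξ.map ≫ s.hom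
  iseqv :=
    { refl := fun ξ => ⟨Iso.refl _, Iso.refl _, ⟨by simp, by simp, .refl _, .refl _⟩,
        ⟨by simp, by simp, .refl _, .refl _⟩, by simp⟩
      symm := fun {ξ ξ'} ⟨r, s, ⟨h₁, h₂, h₃, h₄⟩, ⟨g₁, g₂, g₃, g₄⟩, c⟩ =>
        ⟨r.symm, s.symm, ⟨by simp [← h₁], by simp [← h₂], h₄, h₃⟩,
          ⟨by simp [← g₁], by simp [← g₂], g₄, g₃⟩, by
            simp [Iso.inv_comp_eq, reassoc_of% c]⟩
      trans := fun {ξ ξ' ξ''} ⟨r, s, ⟨h₁, h₂, h₃, h₄⟩, ⟨g₁, g₂, g₃, g₄⟩, c⟩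
          ⟨r', s', ⟨h₁', h₂', h₃', h₄'⟩, ⟨g₁', g₂', g₃', g₄'⟩, c'⟩ =>
        ⟨r ≪≫ r', s ≪≫ s',
          ⟨by simp [h₁, h₁'], by simp [← h₂', ← h₂], h₃.comp h₃', h₄'.comp h₄⟩,
          ⟨by simp [g₁, g₁'], by simp [← g₂', ← g₂], g₃.comp g₃', g₄'.comp g₄⟩, by
            simp [c', reassoc_of% c]⟩ }

/-- The set `Def_{(X, Λ₀)}(A)`. -/
def DefX (X : PoissonScheme k) (A : Art k) : Type (u + 1) :=
  Quotient (Deformation.setoid X A)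

/-- The set `Def_f(A)`. -/
def DefMor (X Y : PoissonScheme k) (f : X.scheme ⟶ Y.scheme) (A : Art k) : Type (u + 1) :=
  Quotient (MorDeformation.setoid X Y f A)

/-- The forgetful morphism `f_X : Def_f(A) → Def_{(X, Λ₀)}(A)`. -/
def forgetX {X Y : PoissonScheme k} (f : X.scheme ⟶ Y.scheme) (A : Art k) :
    DefMor X Y f A → DefX X A :=
  Quotient.map MorDeformation.dom fun _ _ ⟨r, _, h, _⟩ => ⟨r, h⟩

/-- `j` exhibits the deformation `η` over `Spec A` as the base change along `Spec A → Spec A'` of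
the deformation `η'` over `Spec A'`. -/
def Deformation.IsBaseChange {X : PoissonScheme k} {A' A : Art k}
    (φ : A'.carrier →ₐ[k] A.carrier) {η' : Deformation X A'} {η : Deformation X A}
    (j : η.total.scheme ⟶ η'.total.scheme) : Prop :=
  IsPullback j η.total.str η'.total.str (specMap φ) ∧ η.incl ≫ j = η'.incl ∧
    IsPoissonMap η.total η'.total j

/-- The graph of the map `Def_{(X, Λ₀)}(A') → Def_{(X, Λ₀)}(A)` induced by `φ : A' → A`:
the class `y` is the class of the base change of a representative of `y'`. -/
def DefX.RestrictsTo {X : PoissonScheme k} {A' A : Art k} (φ : A'.carrier →ₐ[k] A.carrier)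
    (y' : DefX X A') (y : DefX X A) : Prop :=
  ∃ (η' : Deformation X A') (η : Deformation X A) (j : η.total.scheme ⟶ η'.total.scheme),
    y' = Quotient.mk _ η' ∧ y = Quotient.mk _ η ∧ Deformation.IsBaseChange φ j

/-- The graph of the map `Def_f(A') → Def_f(A)` induced by `φ : A' → A`. -/
def DefMor.RestrictsTo {X Y : PoissonScheme k} {f : X.scheme ⟶ Y.scheme} {A' A : Art k}
    (φ : A'.carrier →ₐ[k] A.carrier) (x' : DefMor X Y f A') (x : DefMor X Y f A) : Prop :=
  ∃ (ξ' : MorDeformation X Y f A') (ξ : MorDeformation X Y f A)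
    (i : ξ.dom.total.scheme ⟶ ξ'.dom.total.scheme) (j : ξ.cod.total.scheme ⟶ ξ'.cod.total.scheme),
    x' = Quotient.mk _ ξ' ∧ x = Quotient.mk _ ξ ∧ Deformation.IsBaseChange φ i ∧
      Deformation.IsBaseChange φ j ∧ i ≫ ξ'.map = ξ.map ≫ j

/-- Smoothness of the morphism of functors of Artin rings `f_X : Def_f → Def_{(X, Λ₀)}`: for every
surjection `A' → A`, the map `Def_f(A') → Def_f(A) ×_{Def_X(A)} Def_X(A')` is surjective. -/
def ForgetXIsSmooth {X Y : PoissonScheme k} (f : X.scheme ⟶ Y.scheme) : Prop :=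
  ∀ (A' A : Art k) (φ : A'.carrier →ₐ[k] A.carrier), Function.Surjective φ →
    ∀ (x : DefMor X Y f A) (y' : DefX X A'), DefX.RestrictsTo φ y' (forgetX f A x) →
      ∃ x' : DefMor X Y f A', DefMor.RestrictsTo φ x' x ∧ forgetX f A' x' = y'

end Deformations

end PoissonDeformationTheory

end

open PoissonDeformationTheory

/-! A surjection `A' → A` in `Art` decomposes into a bijection and small extensions, whose kernel is
spanned by an element `t` with annihilator the maximal ideal. So it is enough to treat a small
extension: given a deformation `𝒳 → 𝒴` of `f` over `A` and an extension `𝒳'` of `𝒳` over `A'`,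
extend `𝒴` and the morphism. Multiplication by `t` identifies the functions on the special fibre
with the functions over `A'` that vanish over `A`; hence the discrepancy between two lifts of the
same structure is `t` times a multiderivation on the special fibre.

Since `Y` is smooth, `𝒴` is locally a trivial deformation `A ⊗ B` of an affine open of `Y`. It is
described by transition automorphisms and local brackets, and the morphism by local homomorphisms.
Each of these lifts separately to `A' ⊗ B` (`exists_localData`): homomorphisms by infinitesimal
lifting, brackets through a `k`-linear section of `A' → A`. The lifts need not fit together. The
failures of the cocycle condition, of compatibility of transitions with brackets, and of the Jacobi
identity form a cochain `obs` of total degree 2 for `T_Y^•`. The failures of the local homomorphisms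
to agree with the transitions and with the brackets form a cochain `obsMap` of total degree 1 for
`f^* T_Y^•`. Evaluating composites in two ways shows that `obs` is a cocycle (`obs_mem_cocycles`)
and that `f^* obs = d obsMap` (`pull_obs`).

The pair is thus a cocycle of the mapping cone of `f^*`, whose cohomology in this degree sits
between `ℍ¹(Y) → ℍ¹(X)` and `ℍ²(Y) → ℍ²(X)`; surjectivity of the first map and injectivity of the
second make it vanish. Concretely (`exists_correction`), injectivity gives `obs = d a`. Then `obsMap
- f^* a` is a cocycle, and surjectivity allows `a` to be changed by a cocycle until `obsMap - f^* a
= d c`. Subtracting `t a` from the transitions and brackets and adding `t c` to the local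
homomorphisms removes all failures (`exists_gluingData`).

The corrected data glue: the spectra of the rings `A' ⊗ B` are nilpotent thickenings of affine opens
of `𝒴`, so their colimit is a scheme with `𝒴` as a surjective closed subscheme. It inherits
flatness, the bracket and the morphism (`exists_lift`). Noetherian induction passes to arbitrary
surjections (`exists_lift_of_surjective`). The last assertion of the theorem is the lifting of `f`
itself, seen as a deformation over `k`, along `A → k`. -/

noncomputable section

namespace PoissonDeformationTheory

section

/-! ### Small thickenings of rings -/

/-- An alternating biderivation `b` of a ring `M` which is linear over the constants `c : R → M`. -/
structure IsAltBider {R M : Type*} [CommRing R] [CommRing M] (c : R →+* M) (b : M → M → M) :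
    Prop where
  add_left : ∀ x y z, b (x + y) z = b x z + b y z
  add_right : ∀ x y z, b x (y + z) = b x y + b x z
  self : ∀ x, b x x = 0
  mul_right : ∀ x y z, b x (y * z) = b x y * z + y * b x z
  const_right : ∀ x r, b x (c r) = 0

/-- The Jacobiator of a bracket. -/
def jacobiator {M : Type*} [Add M] (b : M → M → M) (x y z : M) : M :=
  b (b x y) z + b (b y z) x + b (b z x) y

namespace IsAltBider

variable {R M : Type*} [CommRing R] [CommRing M] {c : R →+* M} {b : M → M → M}

theorem anti (h : IsAltBider c b) (x y : M) : b x y = -b y x := by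
  have := h.self (x + y)
  rw [h.add_left, h.add_right, h.add_right, h.self, h.self] at this
  linear_combination this

theorem zero_left (h : IsAltBider c b) (y : M) : b 0 y = 0 := by
  simpa using h.add_left 0 0 y

theorem zero_right (h : IsAltBider c b) (y : M) : b y 0 = 0 := by
  simpa using h.add_right y 0 0

theorem neg_left (h : IsAltBider c b) (x y : M) : b (-x) y = -b x y := by
  have := h.add_left x (-x) y
  rw [add_neg_cancel, h.zero_left] at this
  linear_combination -this

theorem neg_right (h : IsAltBider c b) (x y : M) : b x (-y) = -b x y := by
  rw [h.anti, h.neg_left, h.anti y, neg_neg]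

theorem sub_left (h : IsAltBider c b) (x y z : M) : b (x - y) z = b x z - b y z := by
  rw [sub_eq_add_neg, h.add_left, h.neg_left, sub_eq_add_neg]

theorem sub_right (h : IsAltBider c b) (x y z : M) : b x (y - z) = b x y - b x z := by
  rw [sub_eq_add_neg, h.add_right, h.neg_right, sub_eq_add_neg]

theorem mul_left (h : IsAltBider c b) (x y z : M) : b (x * y) z = b x z * y + x * b y z := by
  rw [h.anti, h.mul_right, h.anti z x, h.anti z y]; ring

theorem const_left (h : IsAltBider c b) (x : M) (r : R) : b (c r) x = 0 := by
  rw [h.anti, h.const_right, neg_zero]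

theorem const_mul_right (h : IsAltBider c b) (r : R) (x y : M) : b x (c r * y) = c r * b x y := by
  rw [h.mul_right, h.const_right, zero_mul, zero_add]

theorem const_mul_left (h : IsAltBider c b) (r : R) (x y : M) : b (c r * x) y = c r * b x y := by
  rw [h.mul_left, h.const_left, zero_mul, zero_add]

/-- This is the identity `[b, [b, b]] = 0` for the Schouten bracket, which needs no Jacobi identity
for `b`. It gives the closedness of the Jacobi component of the obstruction. -/
theorem jacobiator_closed (h : IsAltBider c b) (x y z w : M) :
    -(b (jacobiator b y z w) x) + b (jacobiator b x z w) y - b (jacobiator b x y w) z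
      + b (jacobiator b x y z) w
      - (jacobiator b (b x y) z w - jacobiator b (b x z) y w + jacobiator b (b y z) x w
        + jacobiator b (b x w) y z - jacobiator b (b y w) x z + jacobiator b (b z w) x y) = 0 := by
  simp only [jacobiator, h.add_left]
  -- Antisymmetry brings inner and then outer brackets into one fixed order; the remaining terms
  -- cancel as a formal sum.
  rw [h.anti z x, h.anti w x, h.anti w y]
  simp only [h.neg_left]
  rw [h.anti w (b x y), h.anti w (b x z), h.anti w (b y z), h.anti z (b x w), h.anti z (b y w),
    h.anti y (b z w), h.anti (b z w) (b x y), h.anti (b y w) (b x z), h.anti (b x w) (b y z)]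
  simp only [h.neg_left]
  abel

end IsAltBider

/-- `M → M₁` is the reduction modulo `t` and `M → M₀` the reduction modulo the kernel of
`aug : R → k`, where `t` spans a copy of `k` in `R` and `M` is flat over `R`. -/
structure SmallThick {R K M M₁ M₀ : Type*} [CommRing R] [CommRing K] [CommRing M] [CommRing M₁]
    [CommRing M₀] (aug : R →+* K) (t : R) (c : R →+* M) (q : M →+* M₁) (ρ : M →+* M₀) : Prop where
  rho_surj : Function.Surjective ρ
  q_surj : Function.Surjective q
  ker_rho : ∀ m, ρ m = 0 ↔ m ∈ (RingHom.ker aug).map c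
  ker_q : ∀ m, q m = 0 ↔ ∃ n, m = c t * n
  ann : ∀ m, c t * m = 0 ↔ ρ m = 0
  rho_t : ρ (c t) = 0

namespace SmallThick

variable {R K M M₁ M₀ : Type*} [CommRing R] [CommRing K] [CommRing M] [CommRing M₁]
    [CommRing M₀] {aug : R →+* K} {t : R} {c : R →+* M} {q : M →+* M₁} {ρ : M →+* M₀}

/-- The isomorphism of `M₀` with the kernel of `M → M₁`, given by multiplication by `t`. -/
def tau (h : SmallThick aug t c q ρ) (s : M₀) : M := c t * Function.surjInv h.rho_surj s

variable (h : SmallThick aug t c q ρ)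

include h in
theorem t_mul_congr {x y : M} (hxy : ρ x = ρ y) : c t * x = c t * y := by
  rw [← sub_eq_zero, ← mul_sub, h.ann, map_sub, hxy, sub_self]

theorem tau_rho (x : M) : h.tau (ρ x) = c t * x :=
  h.t_mul_congr (Function.surjInv_eq _ _)

theorem tau_add (x y : M₀) : h.tau (x + y) = h.tau x + h.tau y := by
  obtain ⟨x, rfl⟩ := h.rho_surj x
  obtain ⟨y, rfl⟩ := h.rho_surj y
  rw [← map_add, tau_rho, tau_rho, tau_rho, mul_add]

theorem tau_zero : h.tau 0 = 0 := by
  rw [← map_zero ρ, tau_rho, mul_zero]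

theorem tau_neg (x : M₀) : h.tau (-x) = -h.tau x := by
  obtain ⟨x, rfl⟩ := h.rho_surj x
  rw [← map_neg, tau_rho, tau_rho, mul_neg]

theorem tau_sub (x y : M₀) : h.tau (x - y) = h.tau x - h.tau y := by
  rw [sub_eq_add_neg, tau_add, tau_neg, sub_eq_add_neg]

theorem tau_inj {x y : M₀} (hxy : h.tau x = h.tau y) : x = y := by
  obtain ⟨x, rfl⟩ := h.rho_surj x
  obtain ⟨y, rfl⟩ := h.rho_surj y
  rwa [tau_rho, tau_rho, ← sub_eq_zero, ← mul_sub, h.ann, map_sub, sub_eq_zero] at hxy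

/-- The multiples of `t` are a module over the special fibre, so a Leibniz rule over `M` turns into
a Leibniz rule over `M₀` under `tau`. -/
theorem mul_tau (x : M) (y : M₀) : x * h.tau y = h.tau (ρ x * y) := by
  obtain ⟨y, rfl⟩ := h.rho_surj y
  rw [← map_mul, tau_rho, tau_rho]; ring

theorem q_tau (x : M₀) : q (h.tau x) = 0 :=
  (h.ker_q _).2 ⟨_, rfl⟩

theorem rho_tau (x : M₀) : ρ (h.tau x) = 0 := by
  rw [tau, map_mul, h.rho_t, zero_mul]

theorem exists_tau {x y : M} (hxy : q x = q y) : ∃ s, x = y + h.tau s := by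
  rw [← sub_eq_zero, ← map_sub, h.ker_q] at hxy
  obtain ⟨n, hn⟩ := hxy
  exact ⟨ρ n, by rw [tau_rho, ← hn]; ring⟩

include h in
theorem q_congr {x y : M} (hxy : q x = q y) : ρ x = ρ y := by
  obtain ⟨s, rfl⟩ := h.exists_tau hxy
  rw [map_add, h.rho_tau, add_zero]

theorem const_mul_tau {r : R} (hr : aug r = 0) (s : M₀) : c r * h.tau s = 0 := by
  rw [mul_tau, (h.ker_rho _).2 (Ideal.mem_map_of_mem c hr), zero_mul, tau_zero]

/-- The inverse of `tau`, extended by junk. -/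
def untau (x : M) : M₀ := Classical.epsilon fun s => x = h.tau s

theorem tau_untau {x : M} (hx : q x = 0) : h.tau (h.untau x) = x := by
  obtain ⟨s, hs⟩ := h.exists_tau (x := x) (y := 0) (by simp [hx])
  exact (Classical.epsilon_spec (p := fun s => x = h.tau s) ⟨s, by simpa using hs⟩).symm

include h in
theorem bracket_tau {b : M → M → M} {b₀ : M₀ → M₀ → M₀} (hb : IsAltBider c b)
    (hρ : ∀ x y, ρ (b x y) = b₀ (ρ x) (ρ y)) (x : M) (s : M₀) :
    b x (h.tau s) = h.tau (b₀ (ρ x) s) := by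
  obtain ⟨y, rfl⟩ := h.rho_surj s
  rw [tau_rho, hb.const_mul_right, ← hρ, tau_rho]

include h in
theorem bracket_tau_left {b : M → M → M} {b₀ : M₀ → M₀ → M₀} (hb : IsAltBider c b)
    (hρ : ∀ x y, ρ (b x y) = b₀ (ρ x) (ρ y)) (x : M) (s : M₀) :
    b (h.tau s) x = h.tau (b₀ s (ρ x)) := by
  obtain ⟨y, rfl⟩ := h.rho_surj s
  rw [tau_rho, hb.const_mul_left, ← hρ, tau_rho]

include h in
/-- An additive map linear over the constants whose values are multiples of `t` factors
through the reduction. -/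
theorem factors {P P₀ : Type*} [CommRing P] [CommRing P₀] {cP : R →+* P} {ρP : P →+* P₀}
    (hker : ∀ p, ρP p = 0 → p ∈ (RingHom.ker aug).map cP) {F : P → M}
    (hadd : ∀ x y, F (x + y) = F x + F y) (hc : ∀ r x, F (cP r * x) = c r * F x)
    (hF : ∀ x, q (F x) = 0) {x y : P} (hxy : ρP x = ρP y) : F x = F y := by
  have h0 : F 0 = 0 := by simpa using hadd 0 0
  -- On a generator `cP r` with `aug r = 0` the value of `F` is `c r` times a multiple of `t`, hence
  -- zero. The free factor `y` makes the induction over the ideal work.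
  have key : ∀ x ∈ (RingHom.ker aug).map cP, ∀ y, F (y * x) = 0 := by
    intro x hx
    refine Submodule.span_induction ?_ ?_ ?_ ?_ hx
    · rintro _ ⟨r, hr, rfl⟩ y
      rw [mul_comm, hc, ← h.tau_untau (hF y)]
      exact h.const_mul_tau hr _
    · intro y; rw [mul_zero, h0]
    · intro a b _ _ ha hb y
      rw [mul_add, hadd, ha, hb, add_zero]
    · intro a b _ hb y
      rw [smul_eq_mul, ← mul_assoc, hb]
  have := key (x - y) (hker _ (by rw [map_sub, hxy, sub_self])) 1
  rw [one_mul] at this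
  have h2 := hadd (x - y) y
  rwa [sub_add_cancel, this, zero_add] at h2

/-- A ring homomorphism which is compatible with the constants commutes with `tau`. -/
theorem map_tau {N N₁ N₀ : Type*} [CommRing N] [CommRing N₁] [CommRing N₀] {c' : R →+* N}
    {q' : N →+* N₁} {ρ' : N →+* N₀} (h' : SmallThick aug t c' q' ρ') {g : M →+* N} {g₀ : M₀ →+* N₀}
    (hc : ∀ r, g (c r) = c' r) (hg : ∀ x, ρ' (g x) = g₀ (ρ x)) (s : M₀) :
    g (h.tau s) = h'.tau (g₀ s) := by
  obtain ⟨x, rfl⟩ := h.rho_surj s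
  rw [tau_rho, map_mul, hc, ← hg, tau_rho]

end SmallThick

end

section

open scoped TensorProduct

/-! ### Trivial deformations of algebras -/

section Trivial

variable {k R B : Type*} [Field k] [CommRing R] [Algebra k R] [CommRing B] [Algebra k B]

/-- The inclusion `B → R ⊗ B`. -/
abbrev incl (k R B : Type*) [Field k] [CommRing R] [Algebra k R] [CommRing B] [Algebra k B] :
    B →+* R ⊗[k] B :=
  (Algebra.TensorProduct.includeRight : B →ₐ[k] R ⊗[k] B).toRingHom

theorem tmul_eq_algebraMap_mul (r : R) (b : B) :
    r ⊗ₜ[k] b = algebraMap R (R ⊗[k] B) r * incl k R B b := by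
  simp [incl, Algebra.TensorProduct.algebraMap_apply]

/-- Ring homomorphisms out of `R ⊗ B`. -/
def tensorLift {S : Type*} [CommRing S] (c : R →+* S) (h : B →+* S)
    (hk : ∀ a : k, c (algebraMap k R a) = h (algebraMap k B a)) : R ⊗[k] B →+* S :=
  letI : Algebra k S := (c.comp (algebraMap k R)).toAlgebra
  (Algebra.TensorProduct.lift (⟨c, fun _ => rfl⟩ : R →ₐ[k] S)
    (⟨h, fun a => (hk a).symm⟩ : B →ₐ[k] S) fun _ _ => mul_comm _ _).toRingHom

section

variable {S : Type*} [CommRing S] (c : R →+* S) (h : B →+* S)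
    (hk : ∀ a : k, c (algebraMap k R a) = h (algebraMap k B a))

theorem tensorLift_tmul (r : R) (b : B) : tensorLift c h hk (r ⊗ₜ b) = c r * h b := by
  let : Algebra k S := (c.comp (algebraMap k R)).toAlgebra
  exact Algebra.TensorProduct.lift_tmul _ _ _ _ _

@[simp]
theorem tensorLift_incl (b : B) : tensorLift c h hk (incl k R B b) = h b := by
  simp [incl, tensorLift_tmul]

@[simp]
theorem tensorLift_algebraMap (r : R) : tensorLift c h hk (algebraMap R _ r) = c r := by
  simp [Algebra.TensorProduct.algebraMap_apply, tensorLift_tmul]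

end

theorem tensorHom_ext {S : Type*} [CommRing S] {g g' : R ⊗[k] B →+* S}
    (hc : ∀ r, g (algebraMap R _ r) = g' (algebraMap R _ r))
    (h : ∀ b, g (incl k R B b) = g' (incl k R B b)) : g = g' := by
  refine RingHom.ext fun x => ?_
  induction x using TensorProduct.induction_on with
  | zero => simp
  | tmul r b => rw [tmul_eq_algebraMap_mul, map_mul, map_mul, hc, h]
  | add x y hx hy => rw [map_add, map_add, hx, hy]

/-- A `k`-bilinear alternating biderivation `B × B → R ⊗ B` extends to an `R`-bilinear one of
`R ⊗ B`. -/
theorem exists_isAltBider_extension (β : B → B → R ⊗[k] B)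
    (add_left : ∀ x y z, β (x + y) z = β x z + β y z)
    (add_right : ∀ x y z, β x (y + z) = β x y + β x z) (self : ∀ x, β x x = 0)
    (mul_right : ∀ x y z, β x (y * z) = β x y * incl k R B z + incl k R B y * β x z)
    (const_right : ∀ x a, β x (algebraMap k B a) = 0) :
    ∃ b : R ⊗[k] B → R ⊗[k] B → R ⊗[k] B, IsAltBider (algebraMap R _) b ∧
      ∀ r r' x y, b (r ⊗ₜ x) (r' ⊗ₜ y) = (r * r') • β x y := by
  have anti : ∀ x y, β x y = -β y x := by
    intro x y
    have := self (x + y)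
    rw [add_left, add_right, add_right, self, self] at this
    linear_combination this
  have smul_right : ∀ (a : k) x y, β x (a • y) = a • β x y := by
    intro a x y
    rw [Algebra.smul_def, mul_right, const_right, zero_mul, zero_add]
    simp only [incl, AlgHom.toRingHom_eq_coe, RingHom.coe_coe, AlgHom.commutes, Algebra.smul_def]
  have smul_left : ∀ (a : k) x y, β (a • x) y = a • β x y := by
    intro a x y
    rw [anti, smul_right, anti x y, smul_neg]
  -- Scalars are extended one variable at a time: the second variable here, the first one in `β₂`.
  let β₁ : B → R ⊗[k] B →ₗ[R] R ⊗[k] B := fun x =>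
    LinearMap.liftBaseChange R
      ({ toFun := β x, map_add' := add_right x, map_smul' := fun a y => smul_right a x y } :
        B →ₗ[k] R ⊗[k] B)
  have hβ₁ : ∀ x r y, β₁ x (r ⊗ₜ y) = r • β x y := fun x r y => by
    simp only [β₁, LinearMap.liftBaseChange_tmul]; rfl
  let β₂ : R ⊗[k] B →ₗ[R] R ⊗[k] B →ₗ[R] R ⊗[k] B :=
    LinearMap.liftBaseChange R
      ({ toFun := β₁
         map_add' := fun x y => by
          ext z
          simp [hβ₁, add_left]
         map_smul' := fun a x => by
          ext z
          simp [hβ₁, smul_left] } : B →ₗ[k] R ⊗[k] B →ₗ[R] R ⊗[k] B)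
  have hβ₂ : ∀ r r' x y, β₂ (r ⊗ₜ x) (r' ⊗ₜ y) = (r * r') • β x y := fun r r' x y => by
    simp only [β₂, LinearMap.liftBaseChange_tmul, LinearMap.smul_apply]
    change r • β₁ x (r' ⊗ₜ y) = _
    rw [hβ₁, smul_smul]
  -- Vanishing on the diagonal is not additive, so it cannot be read off pure tensors alone:
  -- antisymmetry has to cancel the cross terms.
  have anti₂ : ∀ x y, β₂ x y = -β₂ y x := by
    intro x y
    induction x using TensorProduct.induction_on with
    | zero => simp
    | add x x' hx hx' => rw [map_add, map_add, LinearMap.add_apply, hx, hx', neg_add]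
    | tmul r x =>
      induction y using TensorProduct.induction_on with
      | zero => simp
      | add y y' hx hx' => rw [map_add, map_add, LinearMap.add_apply, hx, hx', neg_add]
      | tmul r' y => rw [hβ₂, hβ₂, anti, smul_neg, mul_comm]
  refine ⟨fun x y => β₂ x y, ⟨?_, ?_, ?_, ?_, ?_⟩, hβ₂⟩
  · intro x y z; simp
  · intro x y z; simp
  · intro x
    induction x using TensorProduct.induction_on with
    | zero => simp
    | tmul r x => rw [hβ₂, self, smul_zero]
    | add x y hx hy =>
      simp only [map_add, LinearMap.add_apply, hx, hy, anti₂ y x]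
      abel
  · intro x y z
    induction x using TensorProduct.induction_on with
    | zero => simp
    | add x x' hx hx' => simp only [map_add, LinearMap.add_apply, hx, hx']; ring
    | tmul r x =>
      induction y using TensorProduct.induction_on with
      | zero => simp
      | add y y' hx hx' => simp only [map_add, add_mul, hx, hx']; ring
      | tmul r' y =>
        induction z using TensorProduct.induction_on with
        | zero => simp
        | add y y' hx hx' => simp only [map_add, mul_add, hx, hx']; ring
        | tmul r'' z =>
          rw [Algebra.TensorProduct.tmul_mul_tmul, hβ₂, hβ₂, hβ₂, mul_right]
          simp only [tmul_eq_algebraMap_mul, Algebra.smul_def, map_mul]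
          ring
  · intro x r
    induction x using TensorProduct.induction_on with
    | zero => simp
    | add x x' hx hx' => simp only [map_add, LinearMap.add_apply, hx, hx', add_zero]
    | tmul r' x =>
      rw [Algebra.TensorProduct.algebraMap_apply, Algebra.algebraMap_self, RingHom.id_apply, hβ₂]
      have := const_right x 1
      rw [map_one] at this
      rw [this, smul_zero]

end Trivial

/-! ### Lifting along nilpotent thickenings -/

/-- Infinitesimal lifting phrased with ring homomorphisms. Lifts are needed both over `k` and over a
larger coordinate ring, so no algebra structure is fixed beforehand. -/
theorem exists_lift_of_formallySmooth {K B S T : Type*} [CommRing K] [CommRing B] [CommRing S]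
    [CommRing T] {c : K →+* B} (hc : c.FormallySmooth) (c' : K →+* S) (p : S →+* T)
    (hp : Function.Surjective p) (hn : IsNilpotent (RingHom.ker p)) (h : B →+* T)
    (hh : ∀ a, h (c a) = p (c' a)) :
    ∃ g : B →+* S, (∀ a, g (c a) = c' a) ∧ ∀ b, p (g b) = h b := by
  algebraize [c, c', p.comp c']
  let p' : S →ₐ[K] T := ⟨p, fun _ => rfl⟩
  let h' : B →ₐ[K] T := ⟨h, hh⟩
  refine ⟨(Algebra.FormallySmooth.liftOfSurjective h' p' hp hn).toRingHom,
    fun a => AlgHom.commutes _ a, fun b => ?_⟩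
  exact Algebra.FormallySmooth.liftOfSurjective_apply h' p' hp hn b

theorem eq_of_formallyUnramified {K B S T : Type*} [CommRing K] [CommRing B] [CommRing S]
    [CommRing T] {c : K →+* B} (hc : c.FormallyUnramified) (p : S →+* T)
    (hn : IsNilpotent (RingHom.ker p)) {g g' : B →+* S} (h : ∀ a, g (c a) = g' (c a))
    (hp : ∀ b, p (g b) = p (g' b)) : g = g' := by
  algebraize [c, g.comp c]
  let G : B →ₐ[K] S := ⟨g, fun _ => rfl⟩
  let G' : B →ₐ[K] S := ⟨g', fun a => (h a).symm⟩
  have : G = G' := Algebra.FormallyUnramified.ext' p hn G G' hp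
  exact congrArg AlgHom.toRingHom this

/-! ### Flatness over local Artinian rings -/

/-- The ideal `ker aug` is the annihilator of `t` in `R`, and flatness lets the formation of this
annihilator commute with passage to `M`. -/
theorem const_mul_eq_zero_iff {R K M : Type*} [CommRing R] [CommRing K] [CommRing M]
    {aug : R →+* K} {t : R} (h₁ : ∀ r, r * t = 0 ↔ aug r = 0) {c : R →+* M} (hc : c.Flat) (m : M) :
    c t * m = 0 ↔ m ∈ (RingHom.ker aug).map c := by
  algebraize [c]
  constructor
  · intro h
    -- The equational criterion for flatness is applied to the one-term relation `t m = 0`: it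
    -- writes `m` as a combination of elements whose coefficients kill `t`.
    have h' : ∑ i : Fin 1, (fun _ => t : Fin 1 → R) i • (fun _ => m : Fin 1 → M) i = 0 := by
      simp only [Finset.univ_unique, Finset.sum_singleton, Algebra.smul_def]
      exact h
    obtain ⟨l, a, y, hay, hfa⟩ := Module.Flat.isTrivialRelation_of_sum_smul_eq_zero (R := R)
      (M := M) (f := fun _ : Fin 1 => t) (x := fun _ => m) h'
    rw [show m = _ from hay 0]
    refine Ideal.sum_mem _ fun j _ => ?_
    rw [Algebra.smul_def]
    refine Ideal.mul_mem_right _ _ (Ideal.mem_map_of_mem c ?_)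
    have := hfa j
    simp only [Finset.univ_unique, Finset.sum_singleton] at this
    exact (h₁ _).1 (by rw [mul_comm]; exact this)
  · intro h
    refine Submodule.span_induction ?_ ?_ ?_ ?_ h
    · rintro _ ⟨r, hr, rfl⟩
      rw [← map_mul, mul_comm, (h₁ r).2 hr, map_zero]
    · simp
    · intro x y _ _ hx hy; rw [mul_add, hx, hy, add_zero]
    · intro a x _ hx; rw [smul_eq_mul, mul_left_comm, hx, mul_zero]

/-- A flat deformation `N` of `B` whose reduction has a multiplicative section `h` is trivial.
Injectivity comes from flatness over a local ring, which keeps a lifted `k`-basis independent;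
surjectivity is Nakayama's lemma for a nilpotent ideal. -/
theorem tensorLift_bijective {k R B N : Type u} [Field k] [CommRing R] [Algebra k R]
    [IsLocalRing R] [CommRing B] [Algebra k B] [CommRing N] (aug : R →ₐ[k] k)
    (hnil : IsNilpotent (RingHom.ker aug)) {c : R →+* N} (hc : c.Flat) {h : B →+* N}
    (hk : ∀ a : k, c (algebraMap k R a) = h (algebraMap k B a)) {p : N →+* B}
    (hp : ∀ b, p (h b) = b) (hker : ∀ n, p n = 0 ↔ n ∈ (RingHom.ker aug).map c) :
    Function.Bijective (tensorLift c h hk) := by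
  have hpc : ∀ r, p (c r) = algebraMap k B (aug r) := by
    intro r
    have : p (c (r - algebraMap k R (aug r))) = 0 := by
      rw [hker]
      refine Ideal.mem_map_of_mem c ?_
      rw [RingHom.mem_ker, map_sub, AlgHom.commutes]
      exact sub_self _
    rwa [map_sub, map_sub, sub_eq_zero, hk, hp] at this
  constructor
  · algebraize [c]
    have hmax : RingHom.ker aug = IsLocalRing.maximalIdeal R := by
      have : (RingHom.ker aug).IsMaximal :=
        RingHom.ker_isMaximal_of_surjective aug fun a => ⟨algebraMap k R a, by simp⟩
      exact IsLocalRing.eq_maximalIdeal this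
    let b := Module.Basis.ofVectorSpace k B
    -- Over a local ring, independence in a flat module can be tested modulo the maximal ideal.
    -- There the coefficients may be taken in `k`, and `p` maps the relation to one between basis
    -- vectors.
    have li : LinearIndependent R (fun i => h (b i)) := by
      refine Module.IsLocalRing.linearIndependent_of_flat _ ?_
      rw [linearIndependent_iff']
      intro s g hg
      have hres : ∀ x : IsLocalRing.ResidueField R, ∃ a : k,
          x = IsLocalRing.residue R (algebraMap k R a) := by
        intro x
        obtain ⟨r, rfl⟩ := IsLocalRing.residue_surjective x
        refine ⟨aug r, ?_⟩
        rw [← sub_eq_zero, ← map_sub, IsLocalRing.residue_eq_zero_iff, ← hmax, RingHom.mem_ker,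
          map_sub, AlgHom.commutes]
        exact sub_self _
      choose γ hγ using fun i => hres (g i)
      have h1 : (TensorProduct.mk R (IsLocalRing.ResidueField R) N 1)
          (∑ i ∈ s, algebraMap k R (γ i) • h (b i)) = 0 := by
        rw [map_sum, ← hg]
        refine Finset.sum_congr rfl fun i _ => ?_
        rw [hγ i, LinearMap.map_smul]
        rfl
      have h2 : ∑ i ∈ s, algebraMap k R (γ i) • h (b i) ∈
          (IsLocalRing.maximalIdeal R) • (⊤ : Submodule R N) := by
        rw [← LinearMap.ker_tensorProductMk]
        exact h1
      have h3 : p (∑ i ∈ s, algebraMap k R (γ i) • h (b i)) = 0 := by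
        rw [hker, hmax]
        rw [Ideal.smul_top_eq_map] at h2
        exact h2
      have h4 : ∑ i ∈ s, γ i • b i = 0 := by
        rw [← h3, map_sum]
        refine Finset.sum_congr rfl fun i _ => ?_
        rw [Algebra.smul_def, Algebra.smul_def, map_mul, hp]
        change _ = p (c _) * _
        rw [hpc, AlgHom.commutes]
        rfl
      intro i hi
      rw [hγ, linearIndependent_iff'.1 b.linearIndependent s γ h4 i hi, map_zero, map_zero]
    rw [injective_iff_map_eq_zero]
    intro x hx
    let bR := Algebra.TensorProduct.basis R b
    have h5 : ∀ y, tensorLift c h hk y = ∑ i ∈ (bR.repr y).support, bR.repr y i • h (b i) := by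
      intro y
      conv_lhs => rw [← bR.linearCombination_repr y, Finsupp.linearCombination_apply, Finsupp.sum,
        map_sum]
      refine Finset.sum_congr rfl fun i _ => ?_
      rw [Algebra.smul_def, map_mul, tensorLift_algebraMap, Algebra.TensorProduct.basis_apply,
        tensorLift_tmul, map_one, one_mul, Algebra.smul_def]
      rfl
    have h6 := linearIndependent_iff'.1 li _ _ ((h5 x).symm.trans hx)
    have h7 : bR.repr x = 0 := by
      ext i
      by_contra hi
      exact hi (h6 i (Finsupp.mem_support_iff.2 hi))
    exact (LinearEquiv.map_eq_zero_iff _).1 h7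
  -- Successive approximation modulo the powers of `ker aug`, which reach zero.
  · have step : ∀ j : ℕ, ∀ n : N, ∃ x, n - tensorLift c h hk x ∈ ((RingHom.ker aug) ^ j).map c := by
      intro j
      induction j with
      | zero => intro n; exact ⟨0, by simp [Ideal.map_top]⟩
      | succ j ih =>
        intro n
        obtain ⟨x, hx⟩ := ih n
        have : ∀ d ∈ ((RingHom.ker aug) ^ j).map c, ∃ y,
            d - tensorLift c h hk y ∈ ((RingHom.ker aug) ^ (j + 1)).map c := by
          intro d hd
          suffices H : ∀ e, ∃ y, e * d - tensorLift c h hk y ∈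
              ((RingHom.ker aug) ^ (j + 1)).map c by simpa using H 1
          refine Submodule.span_induction ?_ ?_ ?_ ?_ hd
          · rintro _ ⟨r, hr, rfl⟩ e
            -- The error is `c r * (e - h (p e))`, and its second factor lies in the kernel of `p`:
            -- one power of the ideal is gained.
            refine ⟨r ⊗ₜ p e, ?_⟩
            rw [tensorLift_tmul, mul_comm e, ← mul_sub, pow_succ, Ideal.map_mul]
            refine Ideal.mul_mem_mul (Ideal.mem_map_of_mem c hr) ((hker _).1 ?_)
            rw [map_sub, hp, sub_self]
          · intro e; exact ⟨0, by simp⟩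
          · intro x y _ _ hx hy e
            obtain ⟨a, ha⟩ := hx e
            obtain ⟨b, hb⟩ := hy e
            refine ⟨a + b, ?_⟩
            rw [map_add, mul_add, add_sub_add_comm]
            exact Ideal.add_mem _ ha hb
          · intro a x _ hx e
            obtain ⟨b, hb⟩ := hx (e * a)
            exact ⟨b, by rwa [smul_eq_mul, ← mul_assoc]⟩
        obtain ⟨y, hy⟩ := this _ hx
        exact ⟨x + y, by rwa [map_add, ← sub_sub]⟩
    intro n
    obtain ⟨j, hj⟩ := hnil
    obtain ⟨x, hx⟩ := step j n
    rw [hj, Ideal.zero_eq_bot, Ideal.map_bot, Ideal.mem_bot, sub_eq_zero] at hx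
    exact ⟨x, hx.symm⟩

end

section

/-! ### Gluing sections -/

theorem resFun_self (X : Scheme.{u}) {U : X.Opens} (h : U ≤ U) (a : Γ(X, U)) :
    resFun X h a = a := by
  have : X.presheaf.map (homOfLE h).op = 𝟙 _ := X.presheaf.map_id _
  exact congrArg (fun g => g.hom a) this

theorem le_comp_preimage {X Y Z : Scheme.{u}} {f : X ⟶ Y} {g : Y ⟶ Z} {V : Z.Opens} {W : Y.Opens}
    {U : X.Opens} (h : U ≤ f ⁻¹ᵁ W) (h' : W ≤ g ⁻¹ᵁ V) : U ≤ (f ≫ g) ⁻¹ᵁ V :=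
  h.trans (f.preimage_mono h')

theorem pullFun_restrict {X Y : Scheme.{u}} (f : X ⟶ Y) {V V' : Y.Opens} {W : X.Opens}
    (e : W ≤ f ⁻¹ᵁ V') (h : V' ≤ V) (a : Γ(Y, V)) :
    pullFun f V' W e (resFun Y h a) = pullFun f V W (e.trans (f.preimage_mono h)) a :=
  pullFun_resFun f e h a

theorem pullFun_pullFun {X Y Z : Scheme.{u}} (f : X ⟶ Y) (g : Y ⟶ Z) {V : Z.Opens} {W : Y.Opens}
    {U : X.Opens} (h : U ≤ f ⁻¹ᵁ W) (h' : W ≤ g ⁻¹ᵁ V) (a : Γ(Z, V)) :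
    pullFun f W U h (pullFun g V W h' a) = pullFun (f ≫ g) V U (le_comp_preimage h h') a := by
  simp only [pullFun, ← CommRingCat.comp_apply, Scheme.Hom.appLE_comp_appLE]

theorem pullFun_congr {X Y : Scheme.{u}} {f g : X ⟶ Y} (hfg : f = g) {V : Y.Opens} {U : X.Opens}
    (h : U ≤ f ⁻¹ᵁ V) (a : Γ(Y, V)) : pullFun f V U h a = pullFun g V U (hfg ▸ h) a := by
  subst hfg; rfl

theorem section_ext (X : Scheme.{u}) {U : X.Opens} {s s' : Γ(X, U)}
    (h : ∀ x ∈ U, ∃ (N : X.Opens) (hN : N ≤ U), x ∈ N ∧ resFun X hN s = resFun X hN s') :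
    s = s' := by
  choose N hN hx hs using h
  refine X.sheaf.eq_of_locally_eq' (fun x : U => N x.1 x.2) U (fun x => homOfLE (hN x.1 x.2))
    (fun x hxU => Opens.mem_iSup.2 ⟨⟨x, hxU⟩, hx x hxU⟩) s s' fun x => hs x.1 x.2

/-- Agreement is only asked for near each point of an overlap, because the bases used later are not
closed under intersection. -/
theorem exists_glue (X : Scheme.{u}) {U : X.Opens} {ι : Type u} (N : ι → X.Opens)
    (hN : ∀ i, N i ≤ U) (hcov : ∀ x ∈ U, ∃ i, x ∈ N i) (s : ∀ i, Γ(X, N i))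
    (hs : ∀ i j x, x ∈ N i → x ∈ N j → ∃ (O : X.Opens) (hi : O ≤ N i) (hj : O ≤ N j),
      x ∈ O ∧ resFun X hi (s i) = resFun X hj (s j)) :
    ∃ a : Γ(X, U), ∀ i, resFun X (hN i) a = s i := by
  obtain ⟨a, ha, -⟩ := X.sheaf.existsUnique_gluing' N U (fun i => homOfLE (hN i))
    (fun x hx => Opens.mem_iSup.2 (hcov x hx)) s (fun i j => by
      refine section_ext X fun x hx => ?_
      obtain ⟨O, hi, hj, hxO, e⟩ := hs i j x hx.1 hx.2
      refine ⟨O, le_inf hi hj, hxO, ?_⟩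
      exact (resFun_resFun X inf_le_left (le_inf hi hj) (s i)).trans
        (e.trans (resFun_resFun X inf_le_right (le_inf hi hj) (s j)).symm))
  exact ⟨a, ha⟩

/-! ### Poisson brackets -/

theorem PoissonScheme.isAltBider {R : Type u} [CommRing R] (X : PoissonScheme R)
    (U : X.scheme.Opens) : IsAltBider (constants X.str U) (X.bracket U) where
  add_left := X.bracket_add_left U
  add_right := X.bracket_add_right U
  self := X.bracket_self U
  mul_right := X.bracket_mul_right U
  const_right := X.bracket_const_right U

theorem PoissonScheme.jacobiator_eq_zero {R : Type u} [CommRing R] (X : PoissonScheme R)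
    (U : X.scheme.Opens) (a b c) : jacobiator (X.bracket U) a b c = 0 := by
  have h := X.isAltBider U
  have := X.jacobi U c a b
  rw [jacobiator, h.anti (X.bracket U a b) c, h.anti (X.bracket U b c) a,
    h.anti (X.bracket U c a) b]
  linear_combination -this

theorem constants_apply {R : Type u} [CommRing R] {X : Scheme.{u}} (p : X ⟶ Spec (.of R))
    {U : X.Opens} (h : U ≤ p ⁻¹ᵁ ⊤) (r : R) :
    constants p U r = pullFun p ⊤ U h ((Scheme.ΓSpecIso (.of R)).inv.hom r) := rfl

theorem resFun_constants {R : Type u} [CommRing R] {X : Scheme.{u}} (p : X ⟶ Spec (.of R))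
    {U U' : X.Opens} (h : U' ≤ U) (r : R) : resFun X h (constants p U r) = constants p U' r := by
  have e : U ≤ p ⁻¹ᵁ ⊤ := fun _ _ => trivial
  rw [constants_apply p e, resFun_pullFun, constants_apply p (h.trans e)]

theorem pullFun_constants {R : Type u} [CommRing R] {X Y : Scheme.{u}} (f : X ⟶ Y)
    (p : X ⟶ Spec (.of R)) (p' : Y ⟶ Spec (.of R)) (hf : f ≫ p' = p)
    {V : Y.Opens} {U : X.Opens} (h : U ≤ f ⁻¹ᵁ V) (r : R) :
    pullFun f V U h (constants p' V r) = constants p U r := by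
  subst hf
  have e : V ≤ p' ⁻¹ᵁ ⊤ := fun _ _ => trivial
  rw [constants_apply p' e, pullFun_pullFun, ← constants_apply]

theorem pullFun_constants_of_comm {R S : Type u} [CommRing R] [CommRing S] {X Y : Scheme.{u}}
    (f : X ⟶ Y) (p : X ⟶ Spec (.of R)) (p' : Y ⟶ Spec (.of S)) (φ : S →+* R)
    (hf : f ≫ p' = p ≫ Spec.map (CommRingCat.ofHom φ))
    {V : Y.Opens} {U : X.Opens} (h : U ≤ f ⁻¹ᵁ V) (r : S) :
    pullFun f V U h (constants p' V r) = constants p U (φ r) := by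
  rw [pullFun_constants f (p ≫ Spec.map (CommRingCat.ofHom φ)) p' hf]
  have e : U ≤ p ⁻¹ᵁ ⊤ := fun _ _ => trivial
  have e' : (⊤ : (Spec (.of R)).Opens) ≤ Spec.map (CommRingCat.ofHom φ) ⁻¹ᵁ ⊤ := fun _ _ => trivial
  rw [constants_apply _ (fun _ _ => trivial : U ≤ (p ≫ Spec.map (CommRingCat.ofHom φ)) ⁻¹ᵁ ⊤),
    ← pullFun_pullFun p _ e e', constants_apply p e]
  congr 1
  have := Scheme.ΓSpecIso_inv_naturality (CommRingCat.ofHom φ)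
  have h2 := congrArg (fun g => g.hom r) this
  refine Eq.trans ?_ h2.symm
  have h3 : (Spec.map (CommRingCat.ofHom φ)).appLE ⊤ ⊤ e' =
    (Spec.map (CommRingCat.ofHom φ)).appTop := (Scheme.Hom.app_eq_appLE _).symm
  simp only [pullFun, h3]
  rfl

/-- To give a Poisson structure on a scheme it suffices to give compatible brackets on the
sections over the members of a basis. -/
theorem exists_poissonScheme_of_basis {R : Type u} [CommRing R] (X : Scheme.{u})
    (str : X ⟶ Spec (.of R)) {ι : Type u} (N : ι → X.Opens)
    (hN : ∀ (U : X.Opens), ∀ x ∈ U, ∃ i, x ∈ N i ∧ N i ≤ U)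
    (b : ∀ i, Γ(X, N i) → Γ(X, N i) → Γ(X, N i))
    (hb : ∀ i, IsAltBider (constants str (N i)) (b i))
    (hj : ∀ i x y z, jacobiator (b i) x y z = 0)
    (hres : ∀ i j (h : N i ≤ N j) x y, resFun X h (b j x y) = b i (resFun X h x) (resFun X h y)) :
    ∃ br : ∀ U : X.Opens, Γ(X, U) → Γ(X, U) → Γ(X, U),
      (∀ U, IsAltBider (constants str U) (br U)) ∧ (∀ U x y z, jacobiator (br U) x y z = 0) ∧
      (∀ {U U' : X.Opens} (h : U' ≤ U) a b, resFun X h (br U a b) =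
        br U' (resFun X h a) (resFun X h b)) ∧ ∀ i, br (N i) = b i := by
  have ex : ∀ (U : X.Opens) (x y : Γ(X, U)), ∃ z : Γ(X, U), ∀ i (h : N i ≤ U),
      resFun X h z = b i (resFun X h x) (resFun X h y) := by
    intro U x y
    obtain ⟨z, hz⟩ := exists_glue X (U := U) (fun i : {i // N i ≤ U} => N i.1) (fun i => i.2)
      (fun x hx => by
        obtain ⟨i, hi, hi'⟩ := hN U x hx
        exact ⟨⟨i, hi'⟩, hi⟩)
      (fun i => b i.1 (resFun X i.2 x) (resFun X i.2 y)) (fun i j x hi hj => by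
        obtain ⟨l, hl, hl'⟩ := hN (N i.1 ⊓ N j.1) x ⟨hi, hj⟩
        refine ⟨N l, hl'.trans inf_le_left, hl'.trans inf_le_right, hl, ?_⟩
        rw [hres, hres]
        simp only [resFun_resFun])
    exact ⟨z, fun i h => hz ⟨i, h⟩⟩
  choose br hbr using ex
  have ext : ∀ {U : X.Opens} {s s' : Γ(X, U)},
      (∀ i (h : N i ≤ U), resFun X h s = resFun X h s') → s = s' := by
    intro U s s' h
    refine section_ext X fun x hx => ?_
    obtain ⟨i, hi, hi'⟩ := hN U x hx
    exact ⟨N i, hi', hi, h i hi'⟩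
  refine ⟨br, fun U => ⟨?_, ?_, ?_, ?_, ?_⟩, ?_, ?_, ?_⟩
  · intro x y z; refine ext fun i h => ?_
    simp only [hbr, map_add, (hb i).add_left]
  · intro x y z; refine ext fun i h => ?_
    simp only [hbr, map_add, (hb i).add_right]
  · intro x; refine ext fun i h => ?_
    simp only [hbr, map_zero, (hb i).self]
  · intro x y z; refine ext fun i h => ?_
    simp only [hbr, map_add, map_mul, (hb i).mul_right]
  · intro x r; refine ext fun i h => ?_
    simp only [hbr, map_zero, resFun_constants, (hb i).const_right]
  · intro U x y z; refine ext fun i h => ?_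
    simp only [jacobiator, hbr, map_add, map_zero]
    exact hj i _ _ _
  · intro U U' h x y; refine ext fun i h' => ?_
    simp only [hbr, resFun_resFun]
  · intro i; funext x y
    rw [← resFun_self X le_rfl (br (N i) x y), hbr, resFun_self, resFun_self]

/-- The Poisson scheme defined by brackets on all sections. -/
def PoissonScheme.ofBrackets {R : Type u} [CommRing R] (X : Scheme.{u})
    (str : X ⟶ Spec (.of R)) (br : ∀ U : X.Opens, Γ(X, U) → Γ(X, U) → Γ(X, U))
    (h : ∀ U, IsAltBider (constants str U) (br U)) (hj : ∀ U x y z, jacobiator (br U) x y z = 0)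
    (hres : ∀ {U U' : X.Opens} (h : U' ≤ U) a b, resFun X h (br U a b) =
        br U' (resFun X h a) (resFun X h b)) : PoissonScheme R where
  scheme := X
  str := str
  bracket := br
  bracket_add_left U := (h U).add_left
  bracket_add_right U := (h U).add_right
  bracket_self U := (h U).self
  bracket_mul_right U := (h U).mul_right
  bracket_const_right U := (h U).const_right
  jacobi U a b c := by
    have := hj U a b c
    rw [jacobiator, (h U).anti (br U a b) c, (h U).anti (br U b c) a, (h U).anti (br U c a) b]
      at this
    linear_combination -this
  bracket_res := hres

/-- Compatibility with the brackets can be checked locally. -/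
theorem IsPoissonMap.of_local {R S : Type u} [CommRing R] [CommRing S] {X : PoissonScheme R}
    {Y : PoissonScheme S} {f : X.scheme ⟶ Y.scheme}
    (h : ∀ (x : X.scheme) (V : Y.scheme.Opens), f x ∈ V → ∃ (V' : Y.scheme.Opens)
      (U : X.scheme.Opens) (hU : U ≤ f ⁻¹ᵁ V'), V' ≤ V ∧ x ∈ U ∧
        ∀ a b, pullFun f V' U hU (Y.bracket V' a b) =
          X.bracket U (pullFun f V' U hU a) (pullFun f V' U hU b)) : IsPoissonMap X Y f := by
  intro V a b
  refine section_ext _ fun x hx => ?_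
  obtain ⟨V', U, hU, hV, hxU, H⟩ := h x V hx
  have hU' : U ≤ f ⁻¹ᵁ V := hU.trans (f.preimage_mono hV)
  refine ⟨U, hU', hxU, ?_⟩
  have := H (resFun _ hV a) (resFun _ hV b)
  rw [← Y.bracket_res, pullFun_restrict, pullFun_restrict, pullFun_restrict] at this
  rw [resFun_pullFun, X.bracket_res, resFun_pullFun, resFun_pullFun, this]

end

section

/-! ### Multiderivations -/

/-- Alternating multiderivations `B^{q+1} → M` over a ring homomorphism `ψ : B → M`, vanishing on
constants. -/
structure IsMultider {K B M : Type*} [CommRing K] [CommRing B] [CommRing M] (c : K →+* B)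
    (ψ : B →+* M) {q : ℕ} (E : (Fin (q + 1) → B) → M) : Prop where
  add : ∀ i a x y, E (Function.update a i (x + y)) =
    E (Function.update a i x) + E (Function.update a i y)
  leibniz : ∀ i a x y, E (Function.update a i (x * y)) =
    ψ x * E (Function.update a i y) + ψ y * E (Function.update a i x)
  const : ∀ i a r, E (Function.update a i (c r)) = 0
  alternating : ∀ a i j, i ≠ j → a i = a j → E a = 0

namespace IsMultider

variable {K B M : Type*} [CommRing K] [CommRing B] [CommRing M] {c : K →+* B} {ψ : B →+* M}

theorem of_one {F : B → M} (add : ∀ x y, F (x + y) = F x + F y)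
    (mul : ∀ x y, F (x * y) = ψ x * F y + ψ y * F x) (const : ∀ r, F (c r) = 0) :
    IsMultider c ψ (q := 0) fun a => F (a 0) where
  add i a x y := by fin_cases i; simp [add]
  leibniz i a x y := by fin_cases i; simp [mul]
  const i a r := by fin_cases i; simp [const]
  alternating a i j h := by
    fin_cases i; fin_cases j; exact absurd rfl h

theorem of_two {F : B → B → M} (add : ∀ z x y, F z (x + y) = F z x + F z y)
    (mul : ∀ z x y, F z (x * y) = ψ x * F z y + ψ y * F z x) (const : ∀ z r, F z (c r) = 0)
    (anti : ∀ x y, F x y = -F y x) (self : ∀ x, F x x = 0) :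
    IsMultider c ψ (q := 1) fun a => F (a 0) (a 1) where
  add i a x y := by
    fin_cases i
    · simp [anti _ (a 1), add]; ring
    · simp [add]
  leibniz i a x y := by
    fin_cases i
    · simp [anti _ (a 1), mul]; ring
    · simp [mul]
  const i a r := by
    fin_cases i
    · simp [anti _ (a 1), const]
    · simp [const]
  alternating a i j h e := by
    have h01 : a 0 = a 1 := by
      clear anti self add mul const
      fin_cases i <;> fin_cases j <;> first | exact absurd rfl h | exact e | exact e.symm
    exact h01 ▸ self (a 0)

/-- Cyclic symmetry transports the conditions from the last slot to the others. It is the form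
suited to a Jacobiator, which is cyclic by construction. -/
theorem of_three {F : B → B → B → M} (add : ∀ z w x y, F z w (x + y) = F z w x + F z w y)
    (mul : ∀ z w x y, F z w (x * y) = ψ x * F z w y + ψ y * F z w x)
    (const : ∀ z w r, F z w (c r) = 0)
    (cyc : ∀ x y z, F x y z = F y z x) (self : ∀ x y, F x x y = 0) :
    IsMultider c ψ (q := 2) fun a => F (a 0) (a 1) (a 2) where
  add i a x y := by
    fin_cases i
    · simp [cyc _ (a 1) (a 2), add]
    · simp [← cyc (a 2) (a 0), add]
    · simp [add]
  leibniz i a x y := by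
    fin_cases i
    · simp [cyc _ (a 1) (a 2), mul]
    · simp [← cyc (a 2) (a 0), mul]
    · simp [mul]
  const i a r := by
    fin_cases i
    · simp [cyc _ (a 1) (a 2), const]
    · simp [← cyc (a 2) (a 0), const]
    · simp [const]
  alternating a i j h e := by
    have h1 : ∀ x y, F x y x = 0 := fun x y => by rw [← cyc, self]
    have h2 : ∀ x y, F y x x = 0 := fun x y => by rw [cyc, self]
    have : a 0 = a 1 ∨ a 0 = a 2 ∨ a 1 = a 2 := by
      clear h1 h2 cyc self add mul const
      fin_cases i <;> fin_cases j <;> first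
        | exact absurd rfl h | exact .inl e | exact .inl e.symm | exact .inr (.inl e)
        | exact .inr (.inl e.symm) | exact .inr (.inr e) | exact .inr (.inr e.symm)
    rcases this with e | e | e
    · exact e ▸ self (a 0) (a 2)
    · exact e ▸ h1 (a 0) (a 1)
    · exact e ▸ h2 (a 1) (a 0)

end IsMultider

/-! ### Evaluation and construction of polyvectors -/

section

variable {X Y : Scheme.{u}} {f : X ⟶ Y} {q : ℕ}

/-- The value of a section of `⋀^{q+1} f^* T_Y` on functions on `R`, restricted to `N`. -/
def ev {U : X.Opens} (D : Sec f q U) (R : Y.Opens) (N : X.Opens) (h : N ≤ U ⊓ f ⁻¹ᵁ R)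
    (a : Fin (q + 1) → Γ(Y, R)) : Γ(X, N) :=
  resFun X h (D R a)

theorem ev_add {U : X.Opens} (D E : Sec f q U) {R : Y.Opens} {N : X.Opens}
    (h : N ≤ U ⊓ f ⁻¹ᵁ R) (a) : ev (D + E) R N h a = ev D R N h a + ev E R N h a :=
  map_add _ _ _

theorem ev_secRes {U U' : X.Opens} (hU : U' ≤ U) (D : Sec f q U) {R : Y.Opens} {N : X.Opens}
    (h : N ≤ U' ⊓ f ⁻¹ᵁ R) (a) :
    ev (secRes f q hU D) R N h a = ev D R N (h.trans (inf_le_inf_right _ hU)) a :=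
  resFun_resFun X _ _ _

theorem ev_secPull {W : Y.Opens} {U : X.Opens} (hU : U ≤ f ⁻¹ᵁ W) (D : Sec (𝟙 Y) q W)
    {R N' : Y.Opens} {N : X.Opens} (h : N ≤ U ⊓ f ⁻¹ᵁ R) (h' : N' ≤ W ⊓ 𝟙 Y ⁻¹ᵁ R)
    (hN : N ≤ f ⁻¹ᵁ N') (a) :
    ev (secPull f q hU D) R N h a = pullFun f N' N hN (ev D R N' h' a) :=
  (resFun_pullFun f _ _ _).trans (pullFun_resFun f hN h' _).symm

theorem ev_res {k : Type u} [Field k] {pY : Y ⟶ Spec (.of k)} {U : X.Opens} {D : Sec f q U}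
    (hD : IsPolyvector pY f D) {R R' : Y.Opens} {N N' : X.Opens} (h : N ≤ U ⊓ f ⁻¹ᵁ R)
    (h' : N' ≤ U ⊓ f ⁻¹ᵁ R') (hR : R' ≤ R) (hN : N' ≤ N) (a) :
    resFun X hN (ev D R N h a) = ev D R' N' h' fun i => resFun Y hR (a i) := by
  simp only [ev, ← hD.res hR, resFun_resFun]

theorem ev_isMultider {k : Type u} [Field k] {pY : Y ⟶ Spec (.of k)} {U : X.Opens} {D : Sec f q U}
    (hD : IsPolyvector pY f D) {R : Y.Opens} {N : X.Opens} (h : N ≤ U ⊓ f ⁻¹ᵁ R) :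
    IsMultider (constants pY R) (pullFun f R N (h.trans inf_le_right)) (ev D R N h) where
  add i a x y := by simp only [ev, hD.add, map_add]
  leibniz i a x y := by simp only [ev, hD.leibniz, map_add, map_mul, resFun_pullFun]
  const i a r := by simp only [ev, hD.const, map_zero]
  alternating a i j hij e := by simp only [ev, hD.alternating R a i j hij e, map_zero]

/-- Only compatibility with restriction is assumed, not the full polyvector axioms, so that the
criterion applies to values of the total differential. -/
theorem sec_ext {U : X.Opens} {D D' : Sec f q U}
    (hD : ∀ {V V' : Y.Opens} (h : V' ≤ V) (a : Fin (q + 1) → Γ(Y, V)),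
      resFun X (inf_le_inf_left U (f.preimage_mono h)) (D V a) = D V' fun i => resFun Y h (a i))
    (hD' : ∀ {V V' : Y.Opens} (h : V' ≤ V) (a : Fin (q + 1) → Γ(Y, V)),
      resFun X (inf_le_inf_left U (f.preimage_mono h)) (D' V a) = D' V' fun i => resFun Y h (a i))
    (h : ∀ x ∈ U, ∀ V : Y.Opens, f x ∈ V → ∃ (R : Y.Opens) (N : X.Opens) (hN : N ≤ U ⊓ f ⁻¹ᵁ R),
      x ∈ N ∧ R ≤ V ∧ ∀ a, ev D R N hN a = ev D' R N hN a) : D = D' := by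
  funext V a
  refine section_ext X fun x hx => ?_
  obtain ⟨R, N, hN, hxN, hRV, H⟩ := h x hx.1 V hx.2
  refine ⟨N, hN.trans (inf_le_inf_left U (f.preimage_mono hRV)), hxN, ?_⟩
  have := H fun i => resFun Y hRV (a i)
  simpa only [ev, ← hD hRV, ← hD' hRV, resFun_resFun] using this

/-- It suffices to prescribe the values for a cofinal system of pairs: a neighbourhood `N i` of a
point of `X` and a neighbourhood `R i` of its image. The value on functions on a larger `V` is glued
from the pairs with `R i ≤ V`. -/
theorem exists_polyvector {k : Type u} [Field k] (pY : Y ⟶ Spec (.of k)) {U : X.Opens}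
    {ι : Type u} (R : ι → Y.Opens) (N : ι → X.Opens) (hN : ∀ i, N i ≤ U ⊓ f ⁻¹ᵁ R i)
    (basis : ∀ x ∈ U, ∀ (N' : X.Opens) (V' : Y.Opens), x ∈ N' → f x ∈ V' →
      ∃ i, x ∈ N i ∧ N i ≤ N' ∧ R i ≤ V')
    (E : ∀ i, (Fin (q + 1) → Γ(Y, R i)) → Γ(X, N i))
    (hE : ∀ i, IsMultider (constants pY (R i)) (pullFun f (R i) (N i)
      ((hN i).trans inf_le_right)) (E i))
    (hres : ∀ i j (hR : R i ≤ R j) (hN : N i ≤ N j) a,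
      resFun X hN (E j a) = E i fun l => resFun Y hR (a l)) :
    ∃ D : Sec f q U, IsPolyvector pY f D ∧ ∀ i a, ev D (R i) (N i) (hN i) a = E i a := by
  have le : ∀ (V : Y.Opens) (i : {i // R i ≤ V}), N i.1 ≤ U ⊓ f ⁻¹ᵁ V := fun V i =>
    (hN i.1).trans (inf_le_inf_left U (f.preimage_mono i.2))
  have ex : ∀ (V : Y.Opens) (a : Fin (q + 1) → Γ(Y, V)), ∃ z : Γ(X, U ⊓ f ⁻¹ᵁ V),
      ∀ i : {i // R i ≤ V}, resFun X (le V i) z = E i.1 fun l => resFun Y i.2 (a l) := by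
    intro V a
    refine exists_glue X (fun i : {i // R i ≤ V} => N i.1) (le V)
      (fun x hx => ?_) (fun i => E i.1 fun l => resFun Y i.2 (a l)) (fun i j x hi hj => ?_)
    · obtain ⟨i, hi, -, hi'⟩ := basis x hx.1 ⊤ V trivial hx.2
      exact ⟨⟨i, hi'⟩, hi⟩
    · obtain ⟨l, hl, hl', hl''⟩ := basis x (hN i.1 hi).1 (N i.1 ⊓ N j.1) (R i.1 ⊓ R j.1) ⟨hi, hj⟩
        ⟨(hN i.1 hi).2, (hN j.1 hj).2⟩
      refine ⟨N l, hl'.trans inf_le_left, hl'.trans inf_le_right, hl, ?_⟩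
      rw [hres l i.1 (hl''.trans inf_le_left), hres l j.1 (hl''.trans inf_le_right)]
      simp only [resFun_resFun]
  choose D hD using ex
  have ext : ∀ {V : Y.Opens} {s s' : Γ(X, U ⊓ f ⁻¹ᵁ V)},
      (∀ i : {i // R i ≤ V}, resFun X (le V i) s = resFun X (le V i) s') → s = s' := by
    intro V s s' h
    refine section_ext X fun x hx => ?_
    obtain ⟨i, hi, -, hi'⟩ := basis x hx.1 ⊤ V trivial hx.2
    exact ⟨N i, le V ⟨i, hi'⟩, hi, h ⟨i, hi'⟩⟩
  have upd : ∀ {V V' : Y.Opens} (h : V' ≤ V) (a : Fin (q + 1) → Γ(Y, V)) (j) (x),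
      (fun l => resFun Y h (Function.update a j x l)) =
        Function.update (fun l => resFun Y h (a l)) j (resFun Y h x) := by
    intro V V' h a j x
    funext l
    by_cases hl : l = j
    · subst hl; simp
    · simp [hl]
  refine ⟨D, ⟨?_, ?_, ?_, ?_, ?_⟩, ?_⟩
  · intro V j a x y
    refine ext fun i => ?_
    simp only [hD, map_add, upd, (hE i.1).add]
  · intro V j a x y
    refine ext fun i => ?_
    simp only [hD, map_add, map_mul, upd, (hE i.1).leibniz, resFun_pullFun]
    rw [pullFun_resFun, pullFun_resFun]
  · intro V j a r
    refine ext fun i => ?_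
    simp only [hD, map_zero, upd, resFun_constants, (hE i.1).const]
  · intro V a i j hij e
    refine ext fun l => ?_
    rw [hD, map_zero]
    exact (hE l.1).alternating _ i j hij (by rw [e])
  · intro V V' h a
    refine ext fun i => ?_
    rw [resFun_resFun, hD]
    simp only [resFun_resFun]
    exact hD V a ⟨i.1, i.2.trans h⟩
  · intro i a
    have := hD (R i) a ⟨i, le_rfl⟩
    simp only [resFun_self] at this
    exact this

end

section

variable {k : Type u} [Field k] {X Y : PoissonScheme k} {f : X.scheme ⟶ Y.scheme}
  {U : X.scheme.Opens} {R : Y.scheme.Opens} {N : X.scheme.Opens}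

theorem ev_poissonDiff {q : ℕ} (D : Sec f q U) (h : N ≤ U ⊓ f ⁻¹ᵁ R) (a) :
    ev (poissonDiff f q U D) R N h a =
      ∑ i : Fin (q + 2), (-1 : ℤ) ^ (q + 1 + (i : ℕ)) •
        X.bracket N (ev D R N h (i.removeNth a)) (pullFun f R N (h.trans inf_le_right) (a i))
      - (-1 : ℤ) ^ q • ∑ j : Fin (q + 2), ∑ i : Fin (q + 1),
        if i.castSucc < j then
          (-1 : ℤ) ^ ((i : ℕ) + (j : ℕ) + 1) •
            ev D R N h (Fin.cons (Y.bracket R (a i.castSucc) (a j)) (i.removeNth (j.removeNth a)))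
        else 0 := by
  simp only [ev, poissonDiff, AddMonoidHom.coe_mk, ZeroHom.coe_mk, map_sub, map_sum, map_zsmul,
    X.bracket_res, resFun_pullFun]
  congr 2
  refine Finset.sum_congr rfl fun j _ => Finset.sum_congr rfl fun i _ => ?_
  split_ifs
  · exact map_zsmul _ _ _
  · exact map_zero _

/-- Obstruction theory only meets the differentials with `q ≤ 2`. These are written out without
shuffles here and below, ready for comparison with explicit bracket computations. -/
theorem ev_poissonDiff_zero (D : Sec f 0 U) (h : N ≤ U ⊓ f ⁻¹ᵁ R) (a : Fin 2 → Γ(Y.scheme, R)) :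
    ev (poissonDiff f 0 U D) R N h a =
      X.bracket N (ev D R N h ![a 0]) (pullFun f R N (h.trans inf_le_right) (a 1))
      - X.bracket N (ev D R N h ![a 1]) (pullFun f R N (h.trans inf_le_right) (a 0))
      - ev D R N h ![Y.bracket R (a 0) (a 1)] := by
  rw [ev_poissonDiff]
  have e0 : (Fin.removeNth (0 : Fin 2) a) = ![a 1] := by ext i; fin_cases i; rfl
  have e1 : (Fin.removeNth (1 : Fin 2) a) = ![a 0] := by ext i; fin_cases i; rfl
  simp [Fin.sum_univ_two, e0, e1]
  abel

theorem sum_castSucc_lt_three {M : Type*} [AddCommMonoid M] (G : Fin 3 → Fin 2 → M) :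
    (∑ j : Fin 3, ∑ i : Fin 2, if i.castSucc < j then G j i else 0) =
      G 1 0 + (G 2 0 + G 2 1) := by
  simp only [Fin.sum_univ_three, Fin.sum_univ_two]
  rw [if_neg (by decide), if_neg (by decide), if_pos (by decide), if_neg (by decide),
    if_pos (by decide), if_pos (by decide)]
  simp only [zero_add, add_zero]

theorem sum_castSucc_lt_four {M : Type*} [AddCommMonoid M] (G : Fin 4 → Fin 3 → M) :
    (∑ j : Fin 4, ∑ i : Fin 3, if i.castSucc < j then G j i else 0) =
      G 1 0 + (G 2 0 + G 2 1) + (G 3 0 + G 3 1 + G 3 2) := by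
  simp only [Fin.sum_univ_four, Fin.sum_univ_three]
  rw [if_neg (by decide), if_neg (by decide), if_neg (by decide), if_pos (by decide),
    if_neg (by decide), if_neg (by decide), if_pos (by decide), if_pos (by decide),
    if_neg (by decide), if_pos (by decide), if_pos (by decide), if_pos (by decide)]
  simp only [zero_add, add_zero]

theorem ev_poissonDiff_one (D : Sec f 1 U) (h : N ≤ U ⊓ f ⁻¹ᵁ R) (a : Fin 3 → Γ(Y.scheme, R)) :
    ev (poissonDiff f 1 U D) R N h a =
      X.bracket N (ev D R N h ![a 1, a 2]) (pullFun f R N (h.trans inf_le_right) (a 0))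
      - X.bracket N (ev D R N h ![a 0, a 2]) (pullFun f R N (h.trans inf_le_right) (a 1))
      + X.bracket N (ev D R N h ![a 0, a 1]) (pullFun f R N (h.trans inf_le_right) (a 2))
      + (ev D R N h ![Y.bracket R (a 0) (a 1), a 2] - ev D R N h ![Y.bracket R (a 0) (a 2), a 1]
        + ev D R N h ![Y.bracket R (a 1) (a 2), a 0]) := by
  rw [ev_poissonDiff, sum_castSucc_lt_three]
  have e0 : (Fin.removeNth (0 : Fin 3) a) = ![a 1, a 2] := by ext i; fin_cases i <;> rfl
  have e1 : (Fin.removeNth (1 : Fin 3) a) = ![a 0, a 2] := by ext i; fin_cases i <;> rfl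
  have e2 : (Fin.removeNth (2 : Fin 3) a) = ![a 0, a 1] := by ext i; fin_cases i <;> rfl
  have c : ∀ (b : Γ(Y.scheme, R)) (v : Fin 1 → Γ(Y.scheme, R)),
      (Fin.cons b v : Fin 2 → Γ(Y.scheme, R)) = ![b, v 0] := by
    intro b v; ext i; fin_cases i <;> rfl
  have r1 : ∀ x y : Γ(Y.scheme, R), (Fin.removeNth (1 : Fin 2) ![x, y]) 0 = x := fun _ _ => rfl
  simp [Fin.sum_univ_three, e0, e1, e2, c, r1]
  ring

theorem ev_poissonDiff_two (D : Sec f 2 U) (h : N ≤ U ⊓ f ⁻¹ᵁ R) (a : Fin 4 → Γ(Y.scheme, R)) :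
    ev (poissonDiff f 2 U D) R N h a =
      -X.bracket N (ev D R N h ![a 1, a 2, a 3]) (pullFun f R N (h.trans inf_le_right) (a 0))
      + X.bracket N (ev D R N h ![a 0, a 2, a 3]) (pullFun f R N (h.trans inf_le_right) (a 1))
      - X.bracket N (ev D R N h ![a 0, a 1, a 3]) (pullFun f R N (h.trans inf_le_right) (a 2))
      + X.bracket N (ev D R N h ![a 0, a 1, a 2]) (pullFun f R N (h.trans inf_le_right) (a 3))
      - (ev D R N h ![Y.bracket R (a 0) (a 1), a 2, a 3]
        - ev D R N h ![Y.bracket R (a 0) (a 2), a 1, a 3]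
        + ev D R N h ![Y.bracket R (a 1) (a 2), a 0, a 3]
        + ev D R N h ![Y.bracket R (a 0) (a 3), a 1, a 2]
        - ev D R N h ![Y.bracket R (a 1) (a 3), a 0, a 2]
        + ev D R N h ![Y.bracket R (a 2) (a 3), a 0, a 1]) := by
  rw [ev_poissonDiff, sum_castSucc_lt_four]
  have e0 : (Fin.removeNth (0 : Fin 4) a) = ![a 1, a 2, a 3] := by ext i; fin_cases i <;> rfl
  have e1 : (Fin.removeNth (1 : Fin 4) a) = ![a 0, a 2, a 3] := by ext i; fin_cases i <;> rfl
  have e2 : (Fin.removeNth (2 : Fin 4) a) = ![a 0, a 1, a 3] := by ext i; fin_cases i <;> rfl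
  have e3 : (Fin.removeNth (3 : Fin 4) a) = ![a 0, a 1, a 2] := by ext i; fin_cases i <;> rfl
  have c : ∀ (b : Γ(Y.scheme, R)) (v : Fin 2 → Γ(Y.scheme, R)),
      (Fin.cons b v : Fin 3 → Γ(Y.scheme, R)) = ![b, v 0, v 1] := by
    intro b v; ext i; fin_cases i <;> rfl
  have r10 : ∀ x y z : Γ(Y.scheme, R), (Fin.removeNth (1 : Fin 3) ![x, y, z]) 0 = x :=
    fun _ _ _ => rfl
  have r11 : ∀ x y z : Γ(Y.scheme, R), (Fin.removeNth (1 : Fin 3) ![x, y, z]) 1 = z :=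
    fun _ _ _ => rfl
  have r20 : ∀ x y z : Γ(Y.scheme, R), (Fin.removeNth (2 : Fin 3) ![x, y, z]) 0 = x :=
    fun _ _ _ => rfl
  have r21 : ∀ x y z : Γ(Y.scheme, R), (Fin.removeNth (2 : Fin 3) ![x, y, z]) 1 = y :=
    fun _ _ _ => rfl
  simp [Fin.sum_univ_four, e0, e1, e2, e3, c, r10, r11, r20, r21]
  ring

theorem ev_cechDiff {𝒰 : PtCover X.scheme} (c : Cochain f 𝒰) (p q : ℕ)
    (s : Fin (p + 2) → X.scheme) (h : N ≤ 𝒰.inter s ⊓ f ⁻¹ᵁ R) (a) :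
    ev (cechDiff f 𝒰 c (p + 1) q s) R N h a = ∑ j : Fin (p + 2), (-1 : ℤ) ^ (j : ℕ) •
      ev (c p q (s ∘ j.succAbove)) R N
        (h.trans (inf_le_inf_right _ (𝒰.inter_comp_le s j.succAbove))) a := by
  simp only [cechDiff, AddMonoidHom.coe_mk, ZeroHom.coe_mk, ev, Finset.sum_apply, map_sum,
    Pi.smul_apply, map_zsmul]
  refine Finset.sum_congr rfl fun j _ => congrArg _ ?_
  exact resFun_resFun _ _ _ _

theorem ev_cochain_congr {𝒰 : PtCover X.scheme} (c : Cochain f 𝒰) {p q : ℕ}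
    {s s' : Fin (p + 1) → X.scheme} (hs : s = s') (h : N ≤ 𝒰.inter s ⊓ f ⁻¹ᵁ R)
    (h' : N ≤ 𝒰.inter s' ⊓ f ⁻¹ᵁ R) (a) : ev (c p q s) R N h a = ev (c p q s') R N h' a := by
  subst hs; rfl

end

end

section

/-! ### Hypercohomology classes -/

instance (X : Scheme.{u}) : IsDirectedOrder (PtCover X) where
  directed 𝒰 𝒰' := ⟨⟨fun x => 𝒰.nhd x ⊓ 𝒰'.nhd x, fun x => ⟨𝒰.mem x, 𝒰'.mem x⟩⟩,
    fun _ => inf_le_left, fun _ => inf_le_right⟩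

instance (X : Scheme.{u}) : Nonempty (PtCover X) := ⟨⟨fun _ => ⊤, fun _ => trivial⟩⟩

section

variable {k : Type u} [Field k] {X Y : PoissonScheme k} {f : X.scheme ⟶ Y.scheme}

theorem cochainRes_cochainRes {𝒰 𝒰' 𝒰'' : PtCover X.scheme} (h : 𝒰 ≤ 𝒰') (h' : 𝒰' ≤ 𝒰'')
    (c : Cochain f 𝒰) :
    cochainRes f h' (cochainRes f h c) = cochainRes f (h.trans h') c := by
  funext p q s
  exact secRes_secRes f q (PtCover.inter_mono h s) (PtCover.inter_mono h' s) _

theorem cochainRes_self {𝒰 : PtCover X.scheme} (h : 𝒰 ≤ 𝒰) (c : Cochain f 𝒰) :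
    cochainRes f h c = c := by
  funext p q s V a
  exact resFun_self _ _ _

theorem cochainPull_cochainRes {𝒱 𝒱' : PtCover Y.scheme} (h : 𝒱 ≤ 𝒱')
    (c : Cochain (X := Y) (Y := Y) (𝟙 Y.scheme) 𝒱) :
    cochainPull f 𝒱' (cochainRes (X := Y) (Y := Y) (𝟙 Y.scheme) h c) =
      cochainRes f (PtCover.preimage_mono f h) (cochainPull f 𝒱 c) := by
  funext p q s
  exact secPull_secRes f q (PtCover.inter_mono h _)
    (PtCover.inter_mono (PtCover.preimage_mono f h) s) (PtCover.inter_preimage_le f 𝒱 s)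
    (PtCover.inter_preimage_le f 𝒱' s) _

theorem cochainRes_mem_cocycles {𝒰 𝒰' : PtCover X.scheme} (h : 𝒰 ≤ 𝒰') {n : ℕ} {c : Cochain f 𝒰}
    (hc : c ∈ cocycles f 𝒰 n) : cochainRes f h c ∈ cocycles f 𝒰' n :=
  ⟨cochainRes_mem f h n c hc.1, by
    have hc' : totalDiff f 𝒰 c = 0 := hc.2
    change totalDiff f 𝒰' _ = 0
    rw [← cochainRes_totalDiff, hc', map_zero]⟩

theorem cochainPull_mem_cocycles (hf : IsPoissonMap X Y f) {𝒱 : PtCover Y.scheme} {n : ℕ}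
    {c : Cochain (X := Y) (Y := Y) (𝟙 Y.scheme) 𝒱} (hc : c ∈ cocycles (X := Y) (𝟙 Y.scheme) 𝒱 n) :
    cochainPull f 𝒱 c ∈ cocycles f (𝒱.preimage f) n :=
  ⟨cochainPull_mem f 𝒱 n c hc.1, by
    have hc' : totalDiff (X := Y) (𝟙 Y.scheme) 𝒱 c = 0 := hc.2
    change totalDiff f _ _ = 0
    rw [← cochainPull_totalDiff hf, hc', map_zero]⟩

open Classical in
/-- The hypercohomology class of a cocycle. -/
def hyperClass {𝒰 : PtCover X.scheme} {n : ℕ} (c : cocycles f 𝒰 n) : hypercohomology f n :=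
  AddCommGroup.DirectLimit.of (fun 𝒰 : PtCover X.scheme => cechCoh f 𝒰 n) _ 𝒰
    (QuotientAddGroup.mk c)

/-- Needed for exactness of the limit: a class that vanishes in hypercohomology vanishes on some
finer cover. -/
instance (n : ℕ) : DirectedSystem (fun 𝒰 : PtCover X.scheme => cechCoh f 𝒰 n)
    fun _ _ h => cechCohMap (cochainRes f h) (cochainRes_mem f h) (cochainRes_totalDiff f h) n where
  map_self 𝒰 x := by
    induction x using QuotientAddGroup.induction_on with
    | H c => exact congrArg (QuotientAddGroup.mk (s := _)) (Subtype.ext (cochainRes_self le_rfl _))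
  map_map 𝒰 𝒰' 𝒰'' h h' x := by
    induction x using QuotientAddGroup.induction_on with
    | H c =>
      exact congrArg (QuotientAddGroup.mk (s := _)) (Subtype.ext (cochainRes_cochainRes h h' _))

theorem hyperClass_sub {𝒰 : PtCover X.scheme} {n : ℕ} (c d : cocycles f 𝒰 n) :
    hyperClass (c - d) = hyperClass c - hyperClass d := by
  rw [hyperClass, QuotientAddGroup.mk_sub, map_sub]; rfl

theorem hyperClass_res {𝒰 𝒰' : PtCover X.scheme} {n : ℕ} (h : 𝒰 ≤ 𝒰') (c : cocycles f 𝒰 n) :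
    hyperClass (⟨cochainRes f h c.1, cochainRes_mem_cocycles h c.2⟩ : cocycles f 𝒰' n) =
      hyperClass c := by
  classical
  exact AddCommGroup.DirectLimit.of_f (G := fun 𝒰 : PtCover X.scheme => cechCoh f 𝒰 n)
    (f := fun _ _ h => cechCohMap (cochainRes f h) (cochainRes_mem f h)
      (cochainRes_totalDiff f h) n) h (QuotientAddGroup.mk c)

theorem exists_hyperClass {n : ℕ} (x : hypercohomology f n) :
    ∃ (𝒰 : PtCover X.scheme) (c : cocycles f 𝒰 n), x = hyperClass c := by
  classical
  induction x using AddCommGroup.DirectLimit.induction_on with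
  | ih 𝒰 x =>
    induction x using QuotientAddGroup.induction_on with
    | H c => exact ⟨𝒰, c, rfl⟩

theorem hyperClass_eq_zero {𝒰 : PtCover X.scheme} {n : ℕ} {c : cocycles f 𝒰 n}
    (h : hyperClass c = 0) :
    ∃ (𝒰' : PtCover X.scheme) (h : 𝒰 ≤ 𝒰'), cochainRes f h c.1 ∈ coboundaries f 𝒰' n := by
  classical
  obtain ⟨𝒰', h', e⟩ := AddCommGroup.DirectLimit.of.zero_exact
    (G := fun 𝒰 : PtCover X.scheme => cechCoh f 𝒰 n)
    (f := fun _ _ h => cechCohMap (cochainRes f h) (cochainRes_mem f h)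
      (cochainRes_totalDiff f h) n) 𝒰 (QuotientAddGroup.mk c) h
  exact ⟨𝒰', h', (QuotientAddGroup.eq_zero_iff (⟨cochainRes f h' c.1,
    cochainRes_mem_cocycles h' c.2⟩ : cocycles f 𝒰' n)).1 e⟩

theorem hyperClass_coboundary {𝒰 : PtCover X.scheme} {n : ℕ} {c : cocycles f 𝒰 n}
    (h : c.1 ∈ coboundaries f 𝒰 n) : hyperClass c = 0 := by
  rw [hyperClass, (QuotientAddGroup.eq_zero_iff c).2 h, map_zero]

theorem hyperPullback_hyperClass (hf : IsPoissonMap X Y f) {𝒱 : PtCover Y.scheme} {n : ℕ}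
    (c : cocycles (X := Y) (Y := Y) (𝟙 Y.scheme) 𝒱 n) : hyperPullback hf n (hyperClass c) =
      hyperClass (⟨cochainPull f 𝒱 c.1, cochainPull_mem_cocycles hf c.2⟩ :
        cocycles f (𝒱.preimage f) n) := by
  classical
  exact AddCommGroup.DirectLimit.lift_of _ _ _ _ _

/-- If `f^*` is surjective on `ℍ¹` and injective on `ℍ²`, the second cohomology of the mapping
cone of `f^*` vanishes. -/
theorem exists_correction (hf : IsPoissonMap X Y f) (h₁ : Function.Surjective (hyperPullback hf 1))
    (h₂ : Function.Injective (hyperPullback hf 2)) {𝒱 : PtCover Y.scheme} {𝒰 : PtCover X.scheme}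
    (hle : 𝒱.preimage f ≤ 𝒰) {o : Cochain (X := Y) (Y := Y) (𝟙 Y.scheme) 𝒱}
    (ho : o ∈ cocycles (X := Y) (Y := Y) (𝟙 Y.scheme) 𝒱 2) {l : Cochain f 𝒰}
    (hl : l ∈ cochains f 𝒰 1) (hol : cochainRes f hle (cochainPull f 𝒱 o) = totalDiff f 𝒰 l) :
    ∃ (𝒱' : PtCover Y.scheme) (𝒰' : PtCover X.scheme) (hv : 𝒱 ≤ 𝒱') (hu : 𝒰 ≤ 𝒰')
      (hle' : 𝒱'.preimage f ≤ 𝒰') (a : Cochain (X := Y) (Y := Y) (𝟙 Y.scheme) 𝒱')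
      (c : Cochain f 𝒰'), a ∈ cochains (X := Y) (Y := Y) (𝟙 Y.scheme) 𝒱' 1 ∧ c ∈ cochains f 𝒰' 0 ∧
      totalDiff (X := Y) (Y := Y) (𝟙 Y.scheme) 𝒱' a =
        cochainRes (X := Y) (Y := Y) (𝟙 Y.scheme) hv o ∧
      cochainRes f hle' (cochainPull f 𝒱' a) + totalDiff f 𝒰' c = cochainRes f hu l := by
  -- The pullback of the class of `o` is represented by the coboundary of `l`, so injectivity on
  -- `ℍ²` kills the class of `o`; on a finer cover `o` becomes `d b`.
  have z : hyperClass (⟨o, ho⟩ : cocycles (X := Y) (Y := Y) (𝟙 Y.scheme) 𝒱 2) = 0 := by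
    apply h₂
    rw [hyperPullback_hyperClass, map_zero, ← hyperClass_res hle]
    refine hyperClass_coboundary ⟨l, hl, hol.symm⟩
  obtain ⟨𝒱₁, hv₁, b, hb, e₁⟩ := hyperClass_eq_zero z
  obtain ⟨𝒰₁, hu₁, hle₁⟩ := exists_ge_ge 𝒰 (𝒱₁.preimage f)
  -- Both `l` and `f^* b` have differential `f^* o`, so their difference is a 1-cocycle.
  let l' : Cochain f 𝒰₁ := cochainRes f hu₁ l - cochainRes f hle₁ (cochainPull f 𝒱₁ b)
  have hl' : l' ∈ cocycles f 𝒰₁ 1 := by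
    refine ⟨AddSubgroup.sub_mem _ (cochainRes_mem f _ _ _ hl)
      (cochainRes_mem f _ _ _ (cochainPull_mem f _ _ _ hb)), ?_⟩
    change totalDiff f 𝒰₁ (_ - _) = 0
    rw [map_sub, ← cochainRes_totalDiff, ← cochainRes_totalDiff, ← cochainPull_totalDiff hf, e₁,
      ← hol, cochainPull_cochainRes, cochainRes_cochainRes, cochainRes_cochainRes, sub_self]
  -- Surjectivity on `ℍ¹` provides a cocycle `w` on `Y` whose pullback is cohomologous to `l'`.
  obtain ⟨x, hx⟩ := h₁ (hyperClass ⟨l', hl'⟩)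
  obtain ⟨𝒱₀, w₀, rfl⟩ := exists_hyperClass x
  obtain ⟨𝒱₂, hv₂, hv₀⟩ := exists_ge_ge 𝒱₁ 𝒱₀
  rw [← hyperClass_res hv₀, hyperPullback_hyperClass] at hx
  set w := cochainRes (X := Y) (Y := Y) (𝟙 Y.scheme) hv₀ w₀.1 with hw
  have hwc : w ∈ cocycles (X := Y) (𝟙 Y.scheme) 𝒱₂ 1 := cochainRes_mem_cocycles hv₀ w₀.2
  obtain ⟨𝒰₂, hu₂, hle₂⟩ := exists_ge_ge 𝒰₁ (𝒱₂.preimage f)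
  have z' : hyperClass (f := f) (𝒰 := 𝒰₂) (n := 1) (⟨cochainRes f hu₂ l',
      cochainRes_mem_cocycles hu₂ hl'⟩ - ⟨cochainRes f hle₂ (cochainPull f 𝒱₂ w),
        cochainRes_mem_cocycles hle₂ (cochainPull_mem_cocycles hf hwc)⟩) = 0 := by
    rw [hyperClass_sub, hyperClass_res hu₂ ⟨l', hl'⟩, ← hx,
      hyperClass_res hle₂ ⟨cochainPull f 𝒱₂ w, cochainPull_mem_cocycles hf hwc⟩, sub_self]
  obtain ⟨𝒰₃, hu₃, c, hc, e₃⟩ := hyperClass_eq_zero z'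
  -- Adding the cocycle `w` to `b` leaves `d b` unchanged and makes the difference from `l` a
  -- coboundary `d c`.
  refine ⟨𝒱₂, 𝒰₃, hv₁.trans hv₂, (hu₁.trans hu₂).trans hu₃, hle₂.trans hu₃,
    cochainRes (X := Y) (Y := Y) (𝟙 Y.scheme) hv₂ b + w, c,
    add_mem (cochainRes_mem _ _ _ _ hb) hwc.1, hc, ?_, ?_⟩
  · have hw0 : totalDiff (X := Y) (Y := Y) (𝟙 Y.scheme) 𝒱₂ w = 0 := hwc.2
    rw [map_add, ← cochainRes_totalDiff, e₁, cochainRes_cochainRes, hw0, add_zero]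
  · rw [e₃]
    change _ + cochainRes f hu₃ (cochainRes f hu₂ (_ - _) - cochainRes f hle₂ (cochainPull f 𝒱₂ w))
      = _
    simp only [map_add, map_sub, cochainPull_cochainRes, cochainRes_cochainRes]
    abel

end

end

section

/-! ### Nilpotent thickenings of schemes -/

section

variable {X Y S : Scheme.{u}}

/-- Separatedness descends along surjective closed immersions. -/
theorem isSeparated_of_surjective_closedImmersion (e : X ⟶ Y) (g : Y ⟶ S) [IsClosedImmersion e]
    [Surjective e] [IsSeparated (e ≫ g)] : IsSeparated g := by
  refine ⟨?_⟩
  refine IsClosedImmersion.of_isPreimmersion _ ?_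
  let m := Limits.pullback.map (e ≫ g) (e ≫ g) g g e e (𝟙 S) (by simp) (by simp)
  have : MorphismProperty.IsStableUnderComposition @IsClosedImmersion.{u} :=
    MorphismProperty.IsMultiplicative.toIsStableUnderComposition
  have hm : IsClosedImmersion m := MorphismProperty.pullbackMap (P := @IsClosedImmersion)
    ‹_› ‹_› rfl rfl
  have h : e ≫ Limits.pullback.diagonal g = Limits.pullback.diagonal (e ≫ g) ≫ m := by
    apply Limits.pullback.hom_ext
    · dsimp only [m, Limits.pullback.map]
      rw [Category.assoc, Category.assoc, Limits.pullback.lift_fst]; simp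
    · dsimp only [m, Limits.pullback.map]
      rw [Category.assoc, Category.assoc, Limits.pullback.lift_snd]; simp
  -- Precomposition with the surjection `e` does not change the image of the diagonal, and `h`
  -- exhibits that composite as a closed immersion.
  have : Set.range (Limits.pullback.diagonal g) = Set.range (e ≫ Limits.pullback.diagonal g) := by
    ext y
    simp only [Set.mem_range, Scheme.Hom.comp_apply]
    exact ⟨fun ⟨x, hx⟩ => (e.surjective x).imp fun z hz => by rw [hz, hx],
      fun ⟨x, hx⟩ => ⟨_, hx⟩⟩
  rw [this, h]
  exact (Limits.pullback.diagonal (e ≫ g) ≫ m).isClosedEmbedding.isClosed_range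

theorem isAffineOpen_inf {R : Type u} [CommRing R] (p : X ⟶ Spec (.of R)) [IsSeparated p]
    {U V : X.Opens} (hU : IsAffineOpen U) (hV : IsAffineOpen V) : IsAffineOpen (U ⊓ V) :=
  (isAffineHom_diagonal_iff (f := p)).mp inferInstance ⊤ (isAffineOpen_top _) U (by simp) V
    (by simp) hU hV

/-- A nilpotent thickening has the same opens as its special fibre; inclusions are therefore tested
there. -/
theorem preimage_le_preimage_iff (e : X ⟶ Y) [Surjective e] {U V : Y.Opens} :
    e ⁻¹ᵁ U ≤ e ⁻¹ᵁ V ↔ U ≤ V := by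
  refine ⟨fun h y hy => ?_, fun h => e.preimage_mono h⟩
  obtain ⟨x, rfl⟩ := e.surjective y
  exact h hy

theorem exists_preimage_eq (e : X ⟶ Y) [IsClosedImmersion e] (V : X.Opens) :
    ∃ U : Y.Opens, e ⁻¹ᵁ U = V := by
  obtain ⟨U, hU, h⟩ := e.isClosedEmbedding.isInducing.isOpen_iff.1 V.2
  exact ⟨⟨U, hU⟩, Opens.ext h⟩

theorem exists_affine_preimage_le (e : X ⟶ Y) [IsClosedImmersion e] {x : X} {V : X.Opens}
    (hx : x ∈ V) : ∃ U : Y.affineOpens, x ∈ e ⁻¹ᵁ U.1 ∧ e ⁻¹ᵁ U.1 ≤ V := by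
  obtain ⟨U, rfl⟩ := exists_preimage_eq e V
  obtain ⟨_, ⟨W, hW, rfl⟩, hxW, hWU⟩ :=
    Y.isBasis_affineOpens.exists_subset_of_mem_open (show e x ∈ (U : Set Y) from hx) U.2
  exact ⟨⟨W, hW⟩, hxW, e.preimage_mono hWU⟩

theorem exists_affine_le {y : Y} {V : Y.Opens} (hy : y ∈ V) :
    ∃ U : Y.affineOpens, y ∈ U.1 ∧ U.1 ≤ V := by
  obtain ⟨_, ⟨W, hW, rfl⟩, hxW, hWU⟩ :=
    Y.isBasis_affineOpens.exists_subset_of_mem_open (show y ∈ (V : Set Y) from hy) V.2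
  exact ⟨⟨W, hW⟩, hxW, hWU⟩

end

section

variable {R R' : Type u} [CommRing R] [CommRing R'] {X X' : Scheme.{u}} {i : X ⟶ X'}
  {p : X ⟶ Spec (.of R)} {p' : X' ⟶ Spec (.of R')} {φ : R' →+* R}

theorem flat_constants [Flat p] {U : X.Opens} (hU : IsAffineOpen U) : (constants p U).Flat := by
  have h1 := p.flat_appLE (isAffineOpen_top _) hU le_top
  have h2 : ((Scheme.ΓSpecIso (.of R)).inv.hom).Flat :=
    RingHom.Flat.of_bijective (ConcreteCategory.bijective_of_isIso (Scheme.ΓSpecIso (.of R)).inv)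
  exact h2.comp h1

theorem formallySmooth_constants [Smooth p] {U : X.Opens} (hU : IsAffineOpen U) :
    (constants p U).FormallySmooth := by
  have h1 := (p.smooth_appLE (isAffineOpen_top _) hU le_top).formallySmooth
  have h2 : ((Scheme.ΓSpecIso (.of R)).inv.hom).FormallySmooth :=
    RingHom.FormallySmooth.of_bijective (ConcreteCategory.bijective_of_isIso (Scheme.ΓSpecIso (.of R)).inv)
  exact h2.comp h1

/-- Restriction between affine opens is étale, so a lift over a large affine open induces one and
only one compatible lift over each smaller one. -/
theorem etale_resFun {U U' : X.Opens} (hU : IsAffineOpen U) (hU' : IsAffineOpen U') (h : U' ≤ U) :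
    (resFun X h).Etale := by
  have := HasRingHomProperty.appLE @Etale (𝟙 X) inferInstance ⟨U, hU⟩ ⟨U', hU'⟩ h
  have h2 : (𝟙 X : X ⟶ X).appLE U U' h = X.presheaf.map (homOfLE h).op := Category.id_comp _
  rwa [h2] at this

theorem formallySmooth_resFun {U U' : X.Opens} (hU : IsAffineOpen U) (hU' : IsAffineOpen U')
    (h : U' ≤ U) : (resFun X h).FormallySmooth :=
  ((RingHom.etale_iff_formallyUnramified_and_smooth _).1 (etale_resFun hU hU' h)).2.formallySmooth

theorem formallyUnramified_resFun {U U' : X.Opens} (hU : IsAffineOpen U) (hU' : IsAffineOpen U')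
    (h : U' ≤ U) : (resFun X h).FormallyUnramified :=
  RingHom.Etale.formallyUnramified _ (etale_resFun hU hU' h)

theorem isPushout_pullFun (H : IsPullback i p p' (Spec.map (CommRingCat.ofHom φ)))
    {U : X'.Opens} (hU : IsAffineOpen U) :
    IsPushout (CommRingCat.ofHom (constants p' U)) (CommRingCat.ofHom φ)
      (CommRingCat.ofHom (pullFun i U (i ⁻¹ᵁ U) le_rfl))
      (CommRingCat.ofHom (constants p (i ⁻¹ᵁ U))) := by
  have h := isIso_pushoutSection_of_isAffineOpen H (US := ⊤) (UT := ⊤) (UX := U) le_top le_top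
    (UY := i ⁻¹ᵁ U) (by simp) (isAffineOpen_top _) (isAffineOpen_top _) hU
  replace h := (isIso_pushoutSection_iff H _ _ _).1 h
  refine IsPushout.of_iso h (Scheme.ΓSpecIso _) (Iso.refl _) (Scheme.ΓSpecIso _) (Iso.refl _)
    ?_ ?_ ?_ ?_
  · ext; simp [constants]
  · rw [← Scheme.ΓSpecIso_naturality, Scheme.Hom.appTop, Scheme.Hom.app_eq_appLE]; rfl
  · ext; simp [pullFun]
  · ext; simp [constants]

theorem isClosedImmersion_of_isPullback (H : IsPullback i p p' (Spec.map (CommRingCat.ofHom φ)))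
    (hφ : Function.Surjective φ) : IsClosedImmersion i :=
  MorphismProperty.of_isPullback (P := @IsClosedImmersion) H.flip
    (IsClosedImmersion.spec_of_surjective _ hφ)

theorem surjective_of_isPullback (H : IsPullback i p p' (Spec.map (CommRingCat.ofHom φ)))
    (hφ : Function.Surjective φ) (hn : IsNilpotent (RingHom.ker φ)) : Surjective i := by
  refine MorphismProperty.of_isPullback (P := @Surjective) H.flip ⟨?_⟩
  have h2 : Set.range (PrimeSpectrum.comap φ) = Set.univ := by
    rw [_root_.range_comap_of_surjective _ _ hφ]
    refine Set.eq_univ_of_forall fun x a ha => ?_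
    obtain ⟨n, hn⟩ := hn
    have : a ^ n ∈ RingHom.ker φ ^ n := Ideal.pow_mem_pow ha n
    rw [hn] at this
    exact x.2.mem_of_pow_mem n (by rw [(Ideal.mem_bot).1 this]; exact x.asIdeal.zero_mem)
  exact Set.range_eq_univ.1 h2

theorem pullFun_surjective [IsClosedImmersion i] {U : X'.Opens} (hU : IsAffineOpen U) :
    Function.Surjective (pullFun i U (i ⁻¹ᵁ U) le_rfl) := by
  have := i.app_surjective U hU
  rwa [Scheme.Hom.app_eq_appLE] at this

theorem pullFun_eq_zero_iff (H : IsPullback i p p' (Spec.map (CommRingCat.ofHom φ)))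
    (hφ : Function.Surjective φ) {U : X'.Opens} (hU : IsAffineOpen U) (m : Γ(X', U)) :
    pullFun i U (i ⁻¹ᵁ U) le_rfl m = 0 ↔ m ∈ (RingHom.ker φ).map (constants p' U) := by
  constructor
  · intro hm
    let J := (RingHom.ker φ).map (constants p' U)
    -- The quotient by `J` receives compatible maps from `Γ(X', U)` and from `R`. As the functions
    -- on the preimage are a pushout, they map to this quotient, which bounds the kernel by `J`.
    let g : R →+* Γ(X', U) ⧸ J := RingHom.liftOfSurjective φ hφ
      ⟨(Ideal.Quotient.mk J).comp (constants p' U), fun r hr => by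
        rw [RingHom.mem_ker, RingHom.comp_apply, Ideal.Quotient.eq_zero_iff_mem]
        exact Ideal.mem_map_of_mem _ hr⟩
    have hg : ∀ r, g (φ r) = Ideal.Quotient.mk J (constants p' U r) := fun r =>
      RingHom.liftOfRightInverse_comp_apply _ _ _ _ _
    have hp := isPushout_pullFun H hU
    let d := hp.desc (CommRingCat.ofHom (Ideal.Quotient.mk J)) (CommRingCat.ofHom g)
      (by ext r; exact (hg r).symm)
    have hd : ∀ m, d.hom (pullFun i U (i ⁻¹ᵁ U) le_rfl m) = Ideal.Quotient.mk J m := fun m =>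
      congrArg (fun g => g.hom m) (hp.inl_desc (CommRingCat.ofHom (Ideal.Quotient.mk J))
        (CommRingCat.ofHom g) (by ext r; exact (hg r).symm))
    have := hd m
    rw [hm, map_zero] at this
    exact Ideal.Quotient.eq_zero_iff_mem.1 this.symm
  · intro hm
    have : (RingHom.ker φ).map (constants p' U) ≤
        RingHom.ker (pullFun i U (i ⁻¹ᵁ U) le_rfl) := by
      rw [Ideal.map_le_iff_le_comap]
      intro r hr
      rw [Ideal.mem_comap, RingHom.mem_ker, pullFun_constants_of_comm i p p' φ H.w,
        (RingHom.mem_ker).1 hr, map_zero]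
    exact this hm

theorem isNilpotent_ker_pullFun (H : IsPullback i p p' (Spec.map (CommRingCat.ofHom φ)))
    (hφ : Function.Surjective φ) (hn : IsNilpotent (RingHom.ker φ)) {U : X'.Opens}
    (hU : IsAffineOpen U) : IsNilpotent (RingHom.ker (pullFun i U (i ⁻¹ᵁ U) le_rfl)) := by
  have : RingHom.ker (pullFun i U (i ⁻¹ᵁ U) le_rfl) = (RingHom.ker φ).map (constants p' U) :=
    Ideal.ext fun m => pullFun_eq_zero_iff H hφ hU m
  rw [this]
  obtain ⟨n, hn⟩ := hn
  exact ⟨n, by rw [← Ideal.map_pow, hn]; exact Ideal.map_bot⟩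

end

section

variable {k : Type u} [Field k]

theorem Art.aug_surjective (A : Art k) : Function.Surjective A.aug :=
  fun a => ⟨algebraMap k A.carrier a, by simp⟩

theorem Art.ker_aug (A : Art k) : RingHom.ker A.aug.toRingHom = IsLocalRing.maximalIdeal A.carrier := by
  have : (RingHom.ker A.aug.toRingHom).IsMaximal :=
    RingHom.ker_isMaximal_of_surjective _ A.aug_surjective
  exact IsLocalRing.eq_maximalIdeal this

theorem Art.isNilpotent_ker_aug (A : Art k) : IsNilpotent (RingHom.ker A.aug.toRingHom) := by
  rw [A.ker_aug, ← IsLocalRing.jacobson_eq_maximalIdeal ⊥ bot_ne_top]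
  exact IsArtinianRing.isNilpotent_jacobson_bot

/-- An element minus its augmentation is nilpotent, and nilpotents die in the field `k`; hence every
algebra homomorphism respects the augmentations. -/
theorem Art.aug_comp {A' A : Art k} (φ : A'.carrier →ₐ[k] A.carrier) (r : A'.carrier) :
    A.aug (φ r) = A'.aug r := by
  have h : A'.aug (r - algebraMap k _ (A'.aug r)) = 0 := by simp
  have h1 : r - algebraMap k _ (A'.aug r) ∈ RingHom.ker A'.aug.toRingHom := h
  obtain ⟨n, hn⟩ := A'.isNilpotent_ker_aug
  have h2 := Ideal.pow_mem_pow h1 n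
  rw [hn] at h2
  have h3 : A.aug (φ ((r - algebraMap k _ (A'.aug r)) ^ n)) = 0 := by
    rw [(Ideal.mem_bot).1 h2, map_zero, map_zero]
  rw [map_pow, map_pow] at h3
  -- The exponent is raised by one because `n` itself might be `0`.
  have h4 := pow_eq_zero_iff (n := n + 1) (by omega) |>.1
    (show (A.aug (φ (r - algebraMap k _ (A'.aug r)))) ^ (n + 1) = 0 by rw [pow_succ, h3, zero_mul])
  rw [map_sub, map_sub, sub_eq_zero] at h4
  simpa using h4

theorem Art.isNilpotent_ker {A' A : Art k} (φ : A'.carrier →ₐ[k] A.carrier) :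
    IsNilpotent (RingHom.ker φ.toRingHom) := by
  obtain ⟨n, hn⟩ := A'.isNilpotent_ker_aug
  refine ⟨n, le_bot_iff.1 (le_trans (Ideal.pow_right_mono ?_ n) hn.le)⟩
  intro r hr
  have h : φ r = 0 := hr
  change A'.aug r = 0
  rw [← Art.aug_comp φ, h, map_zero]

end

end

section

/-! ### Differences of lifts -/

namespace IsAltBider

variable {R M : Type*} [CommRing R] [CommRing M] {c : R →+* M} {b : M → M → M}

theorem jacobiator_cyc (b : M → M → M) (x y z : M) : jacobiator b x y z = jacobiator b y z x := by
  simp only [jacobiator]; ring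

theorem jacobiator_self (h : IsAltBider c b) (x y : M) : jacobiator b x x y = 0 := by
  simp only [jacobiator, h.self, h.zero_left, h.anti y x, h.neg_left]; ring

theorem jacobiator_add (h : IsAltBider c b) (x y z w : M) :
    jacobiator b x y (z + w) = jacobiator b x y z + jacobiator b x y w := by
  simp only [jacobiator, h.add_left, h.add_right]; ring

theorem jacobiator_const (h : IsAltBider c b) (x y : M) (r : R) : jacobiator b x y (c r) = 0 := by
  simp only [jacobiator, h.const_left, h.const_right, h.zero_left, add_zero]

/-- The mixed terms, products of two brackets, cancel. So the Jacobiator of any biderivation is a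
derivation in each slot, and a failure of the Jacobi identity is a section of `⋀³ T_Y`. -/
theorem jacobiator_mul (h : IsAltBider c b) (x y z w : M) :
    jacobiator b x y (z * w) = jacobiator b x y z * w + z * jacobiator b x y w := by
  simp only [jacobiator, h.mul_left, h.mul_right, h.add_left]
  rw [h.anti w y, h.anti z y]
  ring

end IsAltBider

theorem update_vec_one {B : Type*} (a x : B) : Function.update ![a] 0 x = ![x] := by
  ext i; fin_cases i; rfl

theorem update_vec_two_zero {B : Type*} (a b x : B) : Function.update ![a, b] 0 x = ![x, b] := by
  ext i; fin_cases i <;> rfl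

theorem update_vec_two_one {B : Type*} (a b x : B) : Function.update ![a, b] 1 x = ![a, x] := by
  ext i; fin_cases i <;> rfl

namespace IsMultider

variable {K B M : Type*} [CommRing K] [CommRing B] [CommRing M] {c : K →+* B} {ψ : B →+* M}

section

variable {E : (Fin 1 → B) → M} (hE : IsMultider c ψ (q := 0) E)

include hE

theorem add_one (x y : B) : E ![x + y] = E ![x] + E ![y] := by
  rw [← update_vec_one 0, ← update_vec_one 0 x, ← update_vec_one 0 y]
  exact hE.add 0 ![0] x y

theorem mul_one (x y : B) : E ![x * y] = ψ x * E ![y] + ψ y * E ![x] := by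
  rw [← update_vec_one 0, ← update_vec_one 0 x, ← update_vec_one 0 y]
  exact hE.leibniz 0 ![0] x y

theorem const_one (a : K) : E ![c a] = 0 := by
  rw [← update_vec_one 0]
  exact hE.const 0 ![0] a

end

section

variable {E : (Fin 2 → B) → M} (hE : IsMultider c ψ (q := 1) E)

include hE

theorem add_left_two (x y z : B) : E ![x + y, z] = E ![x, z] + E ![y, z] := by
  rw [← update_vec_two_zero 0, ← update_vec_two_zero 0 z x, ← update_vec_two_zero 0 z y]
  exact hE.add 0 ![0, z] x y

theorem add_right_two (x y z : B) : E ![z, x + y] = E ![z, x] + E ![z, y] := by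
  rw [← update_vec_two_one z 0, ← update_vec_two_one z 0 x, ← update_vec_two_one z 0 y]
  exact hE.add 1 ![z, 0] x y

theorem mul_right_two (x y z : B) : E ![z, x * y] = ψ x * E ![z, y] + ψ y * E ![z, x] := by
  rw [← update_vec_two_one z 0, ← update_vec_two_one z 0 x, ← update_vec_two_one z 0 y]
  exact hE.leibniz 1 ![z, 0] x y

theorem const_right_two (z : B) (a : K) : E ![z, c a] = 0 := by
  rw [← update_vec_two_one z 0]
  exact hE.const 1 ![z, 0] a

theorem self_two (x : B) : E ![x, x] = 0 :=
  hE.alternating ![x, x] 0 1 (by decide) rfl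

theorem anti_two (x y : B) : E ![x, y] = -E ![y, x] := by
  have := hE.self_two (x + y)
  rw [hE.add_left_two, hE.add_right_two, hE.add_right_two, hE.self_two, hE.self_two] at this
  linear_combination this

end

end IsMultider

namespace SmallThick

variable {R K M M₁ M₀ : Type*} [CommRing R] [CommRing K] [CommRing M] [CommRing M₁]
  [CommRing M₀] {aug : R →+* K} {t : R} {c : R →+* M} {q : M →+* M₁} {ρ : M →+* M₀}
  (h : SmallThick aug t c q ρ)
  {P P₀ : Type*} [CommRing P] [CommRing P₀] {cP : R →+* P} {ρP : P →+* P₀}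
  (hsurj : Function.Surjective ρP) (hker : ∀ p, ρP p = 0 → p ∈ (RingHom.ker aug).map cP)
  {c₀ : K →+* P₀} (hc₀ : ∀ a, ∃ r, c₀ a = ρP (cP r))
  {ψ : P₀ →+* M₀}

include hsurj hker hc₀

/-- Two lifts of a homomorphism differ by a derivation. -/
theorem exists_der {g g' : P →+* M} (hg : ∀ r, g (cP r) = c r) (hg' : ∀ r, g' (cP r) = c r)
    (hq : ∀ p, q (g p) = q (g' p)) (hψ : ∀ p, ρ (g p) = ψ (ρP p)) :
    ∃ E : (Fin 1 → P₀) → M₀, IsMultider c₀ ψ E ∧ ∀ p, g p = g' p + h.tau (E ![ρP p]) := by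
  have hψ' : ∀ p, ρ (g' p) = ψ (ρP p) := fun p => by rw [← hψ]; exact h.q_congr (hq p).symm
  have hd : ∀ x, q (g x - g' x) = 0 := fun x => by rw [map_sub, hq, sub_self]
  -- The difference of the two lifts is linear over the constants with values in the multiples of
  -- `t`, so it depends only on the reduction to the special fibre.
  have hfac : ∀ {x y}, ρP x = ρP y → g x - g' x = g y - g' y :=
    h.factors hker (F := fun p => g p - g' p) (fun x y => by simp only [map_add]; ring)
      (fun r x => by simp only [map_mul, hg, hg']; ring) hd
  let D : P₀ → M₀ := fun x => h.untau (g (Function.surjInv hsurj x) - g' (Function.surjInv hsurj x))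
  have hD : ∀ p, h.tau (D (ρP p)) = g p - g' p := fun p => by
    rw [h.tau_untau (hd _)]
    exact hfac (Function.surjInv_eq hsurj _)
  refine ⟨fun a => D (a 0), IsMultider.of_one ?_ ?_ ?_, fun p => ?_⟩
  · intro x y
    obtain ⟨x, rfl⟩ := hsurj x
    obtain ⟨y, rfl⟩ := hsurj y
    apply h.tau_inj
    rw [h.tau_add, ← map_add, hD, hD, hD, map_add, map_add]; ring
  · intro x y
    obtain ⟨x, rfl⟩ := hsurj x
    obtain ⟨y, rfl⟩ := hsurj y
    apply h.tau_inj
    rw [h.tau_add, ← map_mul, ← hψ x, ← hψ' y, ← h.mul_tau, ← h.mul_tau, hD, hD, hD, map_mul,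
      map_mul]
    ring
  · intro a
    obtain ⟨r, hr⟩ := hc₀ a
    apply h.tau_inj
    rw [hr, hD, hg, hg', sub_self, h.tau_zero]
  · simp only [Matrix.cons_val_fin_one, hD]; ring

/-- A biderivation with values in the multiples of `t` comes from one of the reductions. -/
theorem exists_bider {g : P →+* M} (hψ : ∀ p, ρ (g p) = ψ (ρP p)) {d : P → P → M}
    (add_right : ∀ x y z, d x (y + z) = d x y + d x z) (anti : ∀ x y, d x y = -d y x)
    (self : ∀ x, d x x = 0) (mul_right : ∀ x y z, d x (y * z) = d x y * g z + g y * d x z)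
    (const_right : ∀ x r, d x (cP r) = 0) (hg : ∀ r, g (cP r) = c r)
    (hd : ∀ x y, q (d x y) = 0) :
    ∃ E : (Fin 2 → P₀) → M₀, IsMultider c₀ ψ E ∧ ∀ x y, d x y = h.tau (E ![ρP x, ρP y]) := by
  have hr : ∀ {x y y'}, ρP y = ρP y' → d x y = d x y' := fun {x} =>
    h.factors hker (F := d x) (add_right x)
      (fun r y => by rw [mul_right, const_right, hg]; ring) (hd x)
  have hfac : ∀ {x x' y y'}, ρP x = ρP x' → ρP y = ρP y' → d x y = d x' y' := by
    intro x x' y y' hx hy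
    rw [hr hy, anti, hr hx, ← anti]
  let D : P₀ → P₀ → M₀ := fun x y =>
    h.untau (d (Function.surjInv hsurj x) (Function.surjInv hsurj y))
  have hD : ∀ x y, h.tau (D (ρP x) (ρP y)) = d x y := fun x y => by
    rw [h.tau_untau (hd _ _)]
    exact hfac (Function.surjInv_eq hsurj _) (Function.surjInv_eq hsurj _)
  refine ⟨fun a => D (a 0) (a 1), IsMultider.of_two ?_ ?_ ?_ ?_ ?_, fun x y => (hD x y).symm⟩
  · intro z x y
    obtain ⟨x, rfl⟩ := hsurj x
    obtain ⟨y, rfl⟩ := hsurj y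
    obtain ⟨z, rfl⟩ := hsurj z
    apply h.tau_inj
    rw [h.tau_add, ← map_add, hD, hD, hD, add_right]
  · intro z x y
    obtain ⟨x, rfl⟩ := hsurj x
    obtain ⟨y, rfl⟩ := hsurj y
    obtain ⟨z, rfl⟩ := hsurj z
    apply h.tau_inj
    rw [h.tau_add, ← map_mul, ← hψ x, ← hψ y, ← h.mul_tau, ← h.mul_tau, hD, hD, hD, mul_right]
    ring
  · intro z a
    obtain ⟨z, rfl⟩ := hsurj z
    obtain ⟨r, hr⟩ := hc₀ a
    apply h.tau_inj
    rw [hr, hD, const_right, h.tau_zero]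
  · intro x y
    obtain ⟨x, rfl⟩ := hsurj x
    obtain ⟨y, rfl⟩ := hsurj y
    apply h.tau_inj
    rw [h.tau_neg, hD, hD, anti]
  · intro x
    obtain ⟨x, rfl⟩ := hsurj x
    apply h.tau_inj
    rw [hD, self, h.tau_zero]

omit hsurj hker hc₀ in
/-- The Jacobiator of a biderivation, if it is a multiple of `t`. -/
theorem exists_trider (hsurj : Function.Surjective ρ)
    (hker : ∀ p, ρ p = 0 → p ∈ (RingHom.ker aug).map c) {c₀ : K →+* M₀}
    (hc₀ : ∀ a, ∃ r, c₀ a = ρ (c r)) {ψ : M₀ →+* M₀} (hψ : ∀ x, ψ x = x)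
    {b : M → M → M} (hb : IsAltBider c b) (hd : ∀ x y z, q (jacobiator b x y z) = 0) :
    ∃ E : (Fin 3 → M₀) → M₀, IsMultider c₀ ψ E ∧
      ∀ x y z, jacobiator b x y z = h.tau (E ![ρ x, ρ y, ρ z]) := by
  have hr : ∀ {x y z z'}, ρ z = ρ z' → jacobiator b x y z = jacobiator b x y z' := fun {x y} =>
    h.factors hker (F := jacobiator b x y) (hb.jacobiator_add x y)
      (fun r y => by rw [hb.jacobiator_mul, hb.jacobiator_const]; ring) (hd x y)
  have cyc := IsAltBider.jacobiator_cyc b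
  have hfac : ∀ {x x' y y' z z'}, ρ x = ρ x' → ρ y = ρ y' → ρ z = ρ z' →
      jacobiator b x y z = jacobiator b x' y' z' := by
    intro x x' y y' z z' hx hy hz
    rw [hr hz, cyc, hr hx, cyc, hr hy, cyc]
  let D : M₀ → M₀ → M₀ → M₀ := fun x y z => h.untau (jacobiator b (Function.surjInv hsurj x)
    (Function.surjInv hsurj y) (Function.surjInv hsurj z))
  have hD : ∀ x y z, h.tau (D (ρ x) (ρ y) (ρ z)) = jacobiator b x y z := fun x y z => by
    rw [h.tau_untau (hd _ _ _)]
    exact hfac (Function.surjInv_eq hsurj _) (Function.surjInv_eq hsurj _)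
      (Function.surjInv_eq hsurj _)
  refine ⟨fun a => D (a 0) (a 1) (a 2), IsMultider.of_three ?_ ?_ ?_ ?_ ?_,
    fun x y z => (hD x y z).symm⟩
  · intro z w x y
    obtain ⟨x, rfl⟩ := hsurj x
    obtain ⟨y, rfl⟩ := hsurj y
    obtain ⟨z, rfl⟩ := hsurj z
    obtain ⟨w, rfl⟩ := hsurj w
    apply h.tau_inj
    rw [h.tau_add, ← map_add, hD, hD, hD, hb.jacobiator_add]
  · intro z w x y
    obtain ⟨x, rfl⟩ := hsurj x
    obtain ⟨y, rfl⟩ := hsurj y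
    obtain ⟨z, rfl⟩ := hsurj z
    obtain ⟨w, rfl⟩ := hsurj w
    apply h.tau_inj
    rw [h.tau_add, ← map_mul, hψ, hψ, ← h.mul_tau, ← h.mul_tau, hD, hD, hD, hb.jacobiator_mul]
    ring
  · intro z w a
    obtain ⟨z, rfl⟩ := hsurj z
    obtain ⟨w, rfl⟩ := hsurj w
    obtain ⟨r, hr⟩ := hc₀ a
    apply h.tau_inj
    rw [hr, hD, hb.jacobiator_const, h.tau_zero]
  · intro x y z
    obtain ⟨x, rfl⟩ := hsurj x
    obtain ⟨y, rfl⟩ := hsurj y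
    obtain ⟨z, rfl⟩ := hsurj z
    apply h.tau_inj
    rw [hD, hD, cyc]
  · intro x y
    obtain ⟨x, rfl⟩ := hsurj x
    obtain ⟨y, rfl⟩ := hsurj y
    apply h.tau_inj
    rw [hD, hb.jacobiator_self, h.tau_zero]

omit hsurj hker hc₀ in
/-- The modification of a homomorphism by a derivation. -/
theorem exists_add_der {g : P →+* M} (hg : ∀ r, g (cP r) = c r) (hψ : ∀ p, ρ (g p) = ψ (ρP p))
    {E : (Fin 1 → P₀) → M₀} (hE : IsMultider c₀ ψ E)
    (hc₁ : ∀ r, ∃ a, ρP (cP r) = c₀ a) :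
    ∃ g' : P →+* M, (∀ r, g' (cP r) = c r) ∧ (∀ p, q (g' p) = q (g p)) ∧
      ∀ p, g' p = g p + h.tau (E ![ρP p]) := by
  have add := hE.add_one
  have mul := hE.mul_one
  have const := hE.const_one
  have E1 : E ![1] = 0 := by simpa using const 1
  have E0 : E ![0] = 0 := by simpa using const 0
  refine ⟨⟨⟨⟨fun p => g p + h.tau (E ![ρP p]), ?_⟩, ?_⟩, ?_, ?_⟩, ?_, ?_, fun p => rfl⟩
  · simp only [map_one, E1, h.tau_zero, add_zero]
  · intro x y
    simp only [map_mul, mul, h.tau_add, ← hψ]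
    rw [← h.mul_tau, ← h.mul_tau]
    -- Multiples of `t` have zero product, because they reduce to `0` on the special fibre; this
    -- makes the perturbed map multiplicative.
    have : h.tau (E ![ρP x]) * h.tau (E ![ρP y]) = 0 := by
      rw [h.mul_tau, h.rho_tau, zero_mul, h.tau_zero]
    linear_combination -this
  · simp only [map_zero, E0, h.tau_zero, add_zero]
  · intro x y
    simp only [map_add, add, h.tau_add]; ring
  · intro r
    obtain ⟨a, ha⟩ := hc₁ r
    change g (cP r) + h.tau (E ![ρP (cP r)]) = c r
    rw [ha, const, h.tau_zero, add_zero, hg]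
  · intro p
    change q (g p + h.tau (E ![ρP p])) = q (g p)
    rw [map_add, h.q_tau, add_zero]

omit hsurj hker hc₀ in
/-- The modification of a biderivation by a biderivation. -/
theorem isAltBider_sub {b : M → M → M} (hb : IsAltBider c b) {c₀ : K →+* M₀} {ψ : M₀ →+* M₀}
    (hψ : ∀ x, ψ x = x) {E : (Fin 2 → M₀) → M₀} (hE : IsMultider c₀ ψ E)
    (hc₁ : ∀ r, ∃ a, ρ (c r) = c₀ a) :
    IsAltBider c fun x y => b x y - h.tau (E ![ρ x, ρ y]) := by
  have mul1 : ∀ x y z, E ![z, x * y] = x * E ![z, y] + y * E ![z, x] := fun x y z => by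
    rw [hE.mul_right_two, hψ, hψ]
  refine ⟨?_, ?_, ?_, ?_, ?_⟩
  · intro x y z; rw [map_add, hE.add_left_two, h.tau_add, hb.add_left]; ring
  · intro x y z; rw [map_add, hE.add_right_two, h.tau_add, hb.add_right]; ring
  · intro x
    rw [hb.self, hE.self_two, h.tau_zero, sub_zero]
  · intro x y z
    rw [map_mul, mul1, h.tau_add, ← h.mul_tau, ← h.mul_tau, hb.mul_right]; ring
  · intro x r
    obtain ⟨a, ha⟩ := hc₁ r
    rw [ha, hE.const_right_two, h.tau_zero, hb.const_right, sub_zero]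

end SmallThick

end

section

open TensorProduct

/-! ### Small extensions -/

variable {k : Type u} [Field k]

instance (Y : PoissonScheme k) (U : Y.scheme.Opens) : Algebra k Γ(Y.scheme, U) :=
  (constants Y.str U).toAlgebra

theorem algebraMap_eq_constants (Y : PoissonScheme k) (U : Y.scheme.Opens) (a : k) :
    algebraMap k Γ(Y.scheme, U) a = constants Y.str U a := rfl

/-- Reduction of `A ⊗ B` modulo the maximal ideal of `A`. -/
def redTensor (A : Art k) (B : Type u) [CommRing B] [Algebra k B] : A.carrier ⊗[k] B →+* B :=
  tensorLift ((algebraMap k B).comp A.aug.toRingHom) (RingHom.id B) (fun a => by simp)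

theorem redTensor_algebraMap (A : Art k) (B : Type u) [CommRing B] [Algebra k B] (r : A.carrier) :
    redTensor A B (algebraMap A.carrier _ r) = algebraMap k B (A.aug r) :=
  tensorLift_algebraMap _ _ _ _

@[simp]
theorem redTensor_incl (A : Art k) (B : Type u) [CommRing B] [Algebra k B] (b : B) :
    redTensor A B (incl k A.carrier B b) = b :=
  tensorLift_incl _ _ _ _

theorem redTensor_surjective (A : Art k) (B : Type u) [CommRing B] [Algebra k B] :
    Function.Surjective (redTensor A B) := fun b => ⟨_, redTensor_incl A B b⟩

theorem redTensor_eq_zero_iff (A : Art k) (B : Type u) [CommRing B] [Algebra k B]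
    (p : A.carrier ⊗[k] B) : redTensor A B p = 0 ↔
      p ∈ (RingHom.ker A.aug.toRingHom).map (algebraMap A.carrier (A.carrier ⊗[k] B)) := by
  constructor
  · intro h
    suffices p - incl k A.carrier B (redTensor A B p) ∈
        (RingHom.ker A.aug.toRingHom).map (algebraMap A.carrier (A.carrier ⊗[k] B)) by
      simpa [h] using this
    clear h
    induction p using TensorProduct.induction_on with
    | zero => simp
    | tmul r b =>
      have : r ⊗ₜ[k] b - incl k A.carrier B (redTensor A B (r ⊗ₜ b)) =
          incl k A.carrier B b * algebraMap A.carrier (A.carrier ⊗[k] B)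
            (r - algebraMap k _ (A.aug r)) := by
        rw [tmul_eq_algebraMap_mul, map_mul, redTensor_algebraMap, redTensor_incl, map_sub, map_mul]
        have : algebraMap A.carrier (A.carrier ⊗[k] B) (algebraMap k _ (A.aug r)) =
            incl k A.carrier B (algebraMap k B (A.aug r)) := by
          rw [← IsScalarTower.algebraMap_apply]
          exact (AlgHom.commutes _ _).symm
        rw [this]; ring
      rw [this]
      refine Ideal.mul_mem_left _ _ (Ideal.mem_map_of_mem _ ?_)
      change A.aug _ = 0
      simp
    | add x y hx hy =>
      rw [map_add, map_add, add_sub_add_comm]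
      exact Ideal.add_mem _ hx hy
  · intro h
    have : (RingHom.ker A.aug.toRingHom).map (algebraMap A.carrier (A.carrier ⊗[k] B)) ≤
        RingHom.ker (redTensor A B) := by
      rw [Ideal.map_le_iff_le_comap]
      intro r hr
      have hr' : A.aug r = 0 := hr
      rw [Ideal.mem_comap, RingHom.mem_ker, redTensor_algebraMap, hr', map_zero]
    exact this h

/-- Functoriality of `R ⊗ B` in `B`. -/
def mapTensor (R : Type u) [CommRing R] [Algebra k R] {B B' : Type u} [CommRing B] [Algebra k B]
    [CommRing B'] [Algebra k B'] (g : B →+* B') (hg : ∀ a, g (algebraMap k B a) = algebraMap k B' a) :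
    R ⊗[k] B →+* R ⊗[k] B' :=
  (Algebra.TensorProduct.map (AlgHom.id R R) (⟨g, hg⟩ : B →ₐ[k] B')).toRingHom

section

variable (R : Type u) [CommRing R] [Algebra k R] {B B' : Type u} [CommRing B] [Algebra k B]
    [CommRing B'] [Algebra k B'] (g : B →+* B') (hg : ∀ a, g (algebraMap k B a) = algebraMap k B' a)

@[simp]
theorem mapTensor_algebraMap (r : R) :
    mapTensor R g hg (algebraMap R _ r) = algebraMap R _ r := by
  simp [mapTensor, Algebra.TensorProduct.algebraMap_apply]

@[simp]
theorem mapTensor_incl (b : B) : mapTensor R g hg (incl k R B b) = incl k R B' (g b) := by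
  simp [mapTensor, incl]

theorem mapTensor_tmul (r : R) (b : B) : mapTensor R g hg (r ⊗ₜ b) = r ⊗ₜ g b := by
  simp [mapTensor]

end

/-- A lifting problem for a deformation of `f` along a small extension `A' → A`, whose kernel is
spanned by `t`. -/
structure SmallSetup (X Y : PoissonScheme k) (f : X.scheme ⟶ Y.scheme) where
  A' : Art k
  A : Art k
  φ : A'.carrier →ₐ[k] A.carrier
  φ_surj : Function.Surjective φ
  t : A'.carrier
  mul_t : ∀ r, r * t = 0 ↔ A'.aug r = 0
  ker_φ : ∀ r, φ r = 0 ↔ ∃ s, r = t * s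
  ξ : MorDeformation X Y f A
  η : Deformation X A'
  i : ξ.dom.total.scheme ⟶ η.total.scheme
  isBaseChange : Deformation.IsBaseChange φ i
  smooth : Smooth Y.str
  separated : IsSeparated Y.str
  f_poisson : IsPoissonMap X Y f

namespace SmallSetup

variable {X Y : PoissonScheme k} {f : X.scheme ⟶ Y.scheme} (S : SmallSetup X Y f)

/-- The deformation of the target. -/
abbrev 𝒴 : Scheme.{u} := S.ξ.cod.total.scheme

/-- The given deformation of the source over the larger base. -/
abbrev 𝒳' : Scheme.{u} := S.η.total.scheme

/-- The special fibre of the target. -/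
abbrev e : Y.scheme ⟶ S.𝒴 := S.ξ.cod.incl

/-- The part of the special fibre in `W`. -/
abbrev fib (W : S.𝒴.affineOpens) : Y.scheme.Opens := S.e ⁻¹ᵁ W.1

/-- The trivial deformation of the coordinate ring of `fib W`. -/
abbrev P (W : S.𝒴.affineOpens) : Type u := S.A'.carrier ⊗[k] Γ(Y.scheme, S.fib W)

/-- Constants of `P W`. -/
abbrev cP (W : S.𝒴.affineOpens) : S.A'.carrier →+* S.P W := algebraMap S.A'.carrier (S.P W)

/-- Reduction of `P W`. -/
abbrev ρ (W : S.𝒴.affineOpens) : S.P W →+* Γ(Y.scheme, S.fib W) := redTensor S.A' _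

/-- Restriction. -/
def resP {W W' : S.𝒴.affineOpens} (h : W' ≤ W) : S.P W →+* S.P W' :=
  mapTensor S.A'.carrier (resFun Y.scheme (S.e.preimage_mono h)) fun a =>
    resFun_constants Y.str _ a

@[simp]
theorem resP_cP {W W' : S.𝒴.affineOpens} (h : W' ≤ W) (r) : S.resP h (S.cP W r) = S.cP W' r :=
  mapTensor_algebraMap _ _ _ _

@[simp]
theorem resP_incl {W W' : S.𝒴.affineOpens} (h : W' ≤ W) (b) :
    S.resP h (incl k _ _ b) = incl k _ _ (resFun Y.scheme (S.e.preimage_mono h) b) :=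
  mapTensor_incl _ _ _ _

theorem resP_resP {W W' W'' : S.𝒴.affineOpens} (h : W' ≤ W) (h' : W'' ≤ W') (p : S.P W) :
    S.resP h' (S.resP h p) = S.resP (h'.trans h) p := by
  have : (S.resP h').comp (S.resP h) = S.resP (h'.trans h) :=
    tensorHom_ext (fun r => by simp only [RingHom.comp_apply, resP_cP])
      (fun b => by simp only [RingHom.comp_apply, resP_incl, resFun_resFun])
  exact RingHom.congr_fun this p

theorem resP_self {W : S.𝒴.affineOpens} (h : W ≤ W) (p : S.P W) : S.resP h p = p := by
  have : S.resP h = RingHom.id _ :=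
    tensorHom_ext (fun r => by rw [resP_cP, RingHom.id_apply])
      (fun b => by rw [resP_incl, resFun_self, RingHom.id_apply])
  exact RingHom.congr_fun this p

theorem ρ_resP {W W' : S.𝒴.affineOpens} (h : W' ≤ W) (p : S.P W) :
    S.ρ W' (S.resP h p) = resFun Y.scheme (S.e.preimage_mono h) (S.ρ W p) := by
  have : (S.ρ W').comp (S.resP h) = (resFun Y.scheme (S.e.preimage_mono h)).comp (S.ρ W) :=
    tensorHom_ext (fun r => by
      simp only [RingHom.comp_apply, resP_cP, redTensor_algebraMap]
      exact (resFun_constants Y.str _ _).symm) (fun b => by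
        simp only [RingHom.comp_apply, resP_incl, redTensor_incl])
  exact RingHom.congr_fun this p

instance : IsClosedImmersion S.e :=
  isClosedImmersion_of_isPullback S.ξ.cod.isPullback S.A.aug_surjective

instance : Surjective S.e :=
  surjective_of_isPullback S.ξ.cod.isPullback S.A.aug_surjective S.A.isNilpotent_ker_aug

instance : IsClosedImmersion S.i :=
  isClosedImmersion_of_isPullback S.isBaseChange.1 S.φ_surj

instance : IsClosedImmersion S.η.incl :=
  isClosedImmersion_of_isPullback S.η.isPullback S.A'.aug_surjective

instance : Surjective S.η.incl :=
  surjective_of_isPullback S.η.isPullback S.A'.aug_surjective S.A'.isNilpotent_ker_aug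

instance : Flat S.ξ.cod.total.str := S.ξ.cod.flat

instance : Flat S.η.total.str := S.η.flat

/-- Inherited from `Y`, which is a surjective closed subscheme of `𝒴`. It makes the overlaps of
affine charts affine. -/
instance : IsSeparated S.ξ.cod.total.str := by
  have : IsSeparated Y.str := S.separated
  have : IsSeparated (specMap S.A.aug) := inferInstanceAs (IsSeparated (Spec.map _))
  have : IsSeparated (S.e ≫ S.ξ.cod.total.str) := by
    rw [S.ξ.cod.isPullback.w]; infer_instance
  exact isSeparated_of_surjective_closedImmersion S.e _

theorem isAffineOpen_fib (W : S.𝒴.affineOpens) : IsAffineOpen (S.fib W) := W.2.preimage S.e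

theorem φ_t : S.φ S.t = 0 := (S.ker_φ _).2 ⟨1, by simp⟩

theorem aug_t : S.A'.aug S.t = 0 := by rw [← Art.aug_comp S.φ, S.φ_t, map_zero]

theorem mem_map_ker_φ {M : Type*} [CommRing M] (c : S.A'.carrier →+* M) (m : M) :
    m ∈ (RingHom.ker S.φ.toRingHom).map c ↔ ∃ n, m = c S.t * n := by
  have : RingHom.ker S.φ.toRingHom = Ideal.span {S.t} := by
    ext r
    rw [Ideal.mem_span_singleton']
    exact (S.ker_φ r).trans ⟨fun ⟨s, hs⟩ => ⟨s, by rw [hs, mul_comm]⟩,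
      fun ⟨s, hs⟩ => ⟨s, by rw [← hs, mul_comm]⟩⟩
  rw [this, Ideal.map_span, Set.image_singleton, Ideal.mem_span_singleton']
  exact ⟨fun ⟨s, hs⟩ => ⟨s, by rw [← hs, mul_comm]⟩, fun ⟨s, hs⟩ => ⟨s, by rw [hs, mul_comm]⟩⟩

/-- The two reductions are those to the deformation over `A` and to the special fibre; flatness of
`𝒳'` enters through `ann`. -/
theorem thickX {U : S.𝒳'.Opens} (hU : IsAffineOpen U) :
    SmallThick S.A'.aug.toRingHom S.t (constants S.η.total.str U)
      (pullFun S.i U (S.i ⁻¹ᵁ U) le_rfl) (pullFun S.η.incl U (S.η.incl ⁻¹ᵁ U) le_rfl) where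
  rho_surj := pullFun_surjective hU
  q_surj := pullFun_surjective hU
  ker_rho := pullFun_eq_zero_iff S.η.isPullback S.A'.aug_surjective hU
  ker_q m := (pullFun_eq_zero_iff S.isBaseChange.1 S.φ_surj hU m).trans (S.mem_map_ker_φ _ _)
  ann m := (const_mul_eq_zero_iff S.mul_t (flat_constants hU) m).trans
    (pullFun_eq_zero_iff S.η.isPullback S.A'.aug_surjective hU m).symm
  rho_t := (pullFun_eq_zero_iff S.η.isPullback S.A'.aug_surjective hU _).2
    (Ideal.mem_map_of_mem _ S.aug_t)

/-- Compatible charts of `𝒴`: isomorphisms of its small affine opens with trivial deformations. -/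
structure Charts (𝒱 : PtCover Y.scheme) where
  r : ∀ {x : Y.scheme} {W : S.𝒴.affineOpens}, S.fib W ≤ 𝒱.nhd x →
    (Γ(Y.scheme, S.fib W) →+* Γ(S.𝒴, W.1))
  r_const : ∀ {x : Y.scheme} {W : S.𝒴.affineOpens} (h : S.fib W ≤ 𝒱.nhd x) (a : k),
    r h (constants Y.str _ a) = constants S.ξ.cod.total.str W.1 (algebraMap k _ a)
  e_r : ∀ {x : Y.scheme} {W : S.𝒴.affineOpens} (h : S.fib W ≤ 𝒱.nhd x) (b),
    pullFun S.e W.1 (S.fib W) le_rfl (r h b) = b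
  r_res : ∀ {x : Y.scheme} {W W' : S.𝒴.affineOpens} (h : S.fib W ≤ 𝒱.nhd x) (h' : W' ≤ W) (b),
    resFun S.𝒴 h' (r h b) = r (x := x) ((S.e.preimage_mono h').trans h)
      (resFun Y.scheme (S.e.preimage_mono h') b)

namespace Charts

variable {S} {𝒱 : PtCover Y.scheme} (C : S.Charts 𝒱) {x : Y.scheme} {W W' : S.𝒴.affineOpens}
  (h : S.fib W ≤ 𝒱.nhd x)

/-- Reduction of `P W` modulo `t`, followed by the chart. -/
def q : S.P W →+* Γ(S.𝒴, W.1) :=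
  tensorLift ((constants S.ξ.cod.total.str W.1).comp S.φ.toRingHom) (C.r h) (fun a => by
    rw [RingHom.comp_apply, algebraMap_eq_constants, C.r_const]
    exact congrArg _ (S.φ.commutes a))

@[simp]
theorem q_cP (r) : C.q h (S.cP W r) = constants S.ξ.cod.total.str W.1 (S.φ r) :=
  tensorLift_algebraMap _ _ _ _

@[simp]
theorem q_incl (b) : C.q h (incl k _ _ b) = C.r h b :=
  tensorLift_incl _ _ _ _

theorem q_resP (h' : W' ≤ W) (p : S.P W) :
    C.q (x := x) ((S.e.preimage_mono h').trans h) (S.resP h' p) = resFun S.𝒴 h' (C.q h p) := by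
  have : (C.q (x := x) ((S.e.preimage_mono h').trans h)).comp (S.resP h') =
      (resFun S.𝒴 h').comp (C.q h) :=
    tensorHom_ext (fun r => by simp only [RingHom.comp_apply, resP_cP, q_cP, resFun_constants])
      (fun b => by simp only [RingHom.comp_apply, resP_incl, q_incl, C.r_res h h'])
  exact RingHom.congr_fun this p

theorem e_q (p : S.P W) : pullFun S.e W.1 (S.fib W) le_rfl (C.q h p) = S.ρ W p := by
  have : (pullFun S.e W.1 (S.fib W) le_rfl).comp (C.q h) = S.ρ W :=
    tensorHom_ext (fun r => by
      rw [RingHom.comp_apply, q_cP, pullFun_constants_of_comm S.e Y.str _ S.A.aug.toRingHom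
        S.ξ.cod.isPullback.w, redTensor_algebraMap, algebraMap_eq_constants]
      exact congrArg _ (Art.aug_comp S.φ r))
      (fun b => by simp only [RingHom.comp_apply, q_incl, C.e_r, redTensor_incl])
  exact RingHom.congr_fun this p

/-- A chart is a multiplicative section of the reduction to the special fibre, so by flatness it
trivialises the deformation over `W`. -/
theorem chart_bijective : Function.Bijective (tensorLift (R := S.A.carrier)
    (constants S.ξ.cod.total.str W.1) (C.r h) (fun a => (C.r_const h a).symm)) :=
  tensorLift_bijective S.A.aug S.A.isNilpotent_ker_aug (flat_constants W.2) _ (C.e_r h)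
    (pullFun_eq_zero_iff S.ξ.cod.isPullback S.A.aug_surjective W.2)

/-- Base change of the constants along `φ`. -/
theorem q_eq (p : S.P W) : C.q h p = tensorLift (R := S.A.carrier)
    (constants S.ξ.cod.total.str W.1) (C.r h) (fun a => (C.r_const h a).symm)
      (Algebra.TensorProduct.map S.φ (AlgHom.id k Γ(Y.scheme, S.fib W)) p) := by
  have : C.q h = (tensorLift (R := S.A.carrier)
    (constants S.ξ.cod.total.str W.1) (C.r h) (fun a => (C.r_const h a).symm)).comp
      (Algebra.TensorProduct.map S.φ (AlgHom.id k Γ(Y.scheme, S.fib W))).toRingHom :=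
    tensorHom_ext (fun r => by
      simp [RingHom.comp_apply, Algebra.TensorProduct.algebraMap_apply, tensorLift_tmul, q,
        -q_cP])
      (fun b => by simp [RingHom.comp_apply, incl, tensorLift_tmul, q, -q_incl])
  exact RingHom.congr_fun this p

/-- Under the trivialisation, `q` is the base change of `φ` along `k → B`. Its surjectivity and its
kernel thus come from right exactness of the tensor product. -/
theorem thick : SmallThick S.A'.aug.toRingHom S.t (S.cP W) (C.q h) (S.ρ W) where
  rho_surj := redTensor_surjective _ _
  q_surj y := by
    obtain ⟨z, rfl⟩ := (C.chart_bijective h).2 y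
    obtain ⟨p, rfl⟩ := TensorProduct.map_surjective (g := S.φ.toLinearMap)
      (g' := (LinearMap.id : Γ(Y.scheme, S.fib W) →ₗ[k] _)) S.φ_surj Function.surjective_id z
    exact ⟨p, C.q_eq h p⟩
  ker_rho := redTensor_eq_zero_iff _ _
  ker_q m := by
    rw [q_eq, ← map_zero (tensorLift (R := S.A.carrier) (constants S.ξ.cod.total.str W.1) (C.r h)
      (fun a => (C.r_const h a).symm)), (C.chart_bijective h).1.eq_iff]
    have := Algebra.TensorProduct.rTensor_ker (R := k) (C := Γ(Y.scheme, S.fib W)) S.φ S.φ_surj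
    have h2 := SetLike.ext_iff.1 this m
    exact h2.trans (S.mem_map_ker_φ _ _)
  ann m := (const_mul_eq_zero_iff S.mul_t
    ((RingHom.flat_algebraMap_iff).2 inferInstance) m).trans (redTensor_eq_zero_iff _ _ _).symm
  rho_t := (redTensor_eq_zero_iff _ _ _).2 (Ideal.mem_map_of_mem _ S.aug_t)

end Charts

end SmallSetup

end

section

open TensorProduct

variable {k : Type u} [Field k]

/-! ### Local lifts -/

theorem SmallThick.isNilpotent_ker {R K M M₁ M₀ : Type*} [CommRing R] [CommRing K] [CommRing M]
    [CommRing M₁] [CommRing M₀] {aug : R →+* K} {t : R} {c : R →+* M} {q : M →+* M₁}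
    {ρ : M →+* M₀} (h : SmallThick aug t c q ρ) : IsNilpotent (RingHom.ker q) := by
  refine ⟨2, ?_⟩
  rw [pow_two, Ideal.zero_eq_bot, ← le_bot_iff, Ideal.mul_le]
  intro x hx y hy
  rw [← h.tau_untau hx, ← h.tau_untau hy, h.mul_tau, h.rho_tau, zero_mul, h.tau_zero]
  exact Ideal.zero_mem _

/-- Compatible lifts of a compatible family of homomorphisms from the coordinate rings of affine
opens of a smooth scheme. -/
theorem exists_family_lift {Y : PoissonScheme k} [Smooth Y.str] {I : Type u} (le : I → I → Prop)
    (trans : ∀ i j l, le i j → le j l → le i l) (top : I) (htop : ∀ i, le i top) (w : I → Y.scheme.Opens) (hw : ∀ i, IsAffineOpen (w i))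
    (wm : ∀ i j, le i j → w i ≤ w j) (R T : I → Type u) [∀ i, CommRing (R i)]
    [∀ i, CommRing (T i)] (resR : ∀ i j, le i j → R j →+* R i)
    (resR_resR : ∀ i j l (h : le i j) (h' : le j l) s,
      resR i j h (resR j l h' s) = resR i l (trans i j l h h') s)
    (resT : ∀ i j, le i j → T j →+* T i) (p : ∀ i, R i →+* T i)
    (hp : ∀ i, Function.Surjective (p i)) (hnil : ∀ i, IsNilpotent (RingHom.ker (p i)))
    (p_res : ∀ i j (h : le i j) s, p i (resR i j h s) = resT i j h (p j s)) (cR : ∀ i, k →+* R i)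
    (cR_res : ∀ i j (h : le i j) a, resR i j h (cR j a) = cR i a)
    (h : ∀ i, Γ(Y.scheme, w i) →+* T i) (hk : ∀ i a, h i (constants Y.str _ a) = p i (cR i a))
    (h_res : ∀ i j (hij : le i j) b,
      h i (resFun Y.scheme (wm i j hij) b) = resT i j hij (h j b)) :
    ∃ g : ∀ i, Γ(Y.scheme, w i) →+* R i, (∀ i a, g i (constants Y.str _ a) = cR i a) ∧
      (∀ i b, p i (g i b) = h i b) ∧
      ∀ i j (hij : le i j) b, g i (resFun Y.scheme (wm i j hij) b) = resR i j hij (g j b) := by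
  -- Smoothness of `Y` is used once, on the largest open `top`.
  obtain ⟨g₀, hg₀, hpg₀⟩ := exists_lift_of_formallySmooth
    (formallySmooth_constants (p := Y.str) (hw top)) (cR top) (p top) (hp top) (hnil top) (h top)
    (hk top)
  -- The other lifts are extensions of `g₀` along étale restriction maps; uniqueness of such
  -- extensions then makes the whole family compatible.
  have ex : ∀ i, ∃ g : Γ(Y.scheme, w i) →+* R i,
      (∀ a, g (resFun Y.scheme (wm i top (htop i)) a) = resR i top (htop i) (g₀ a)) ∧ ∀ b, p i (g b) = h i b :=
    fun i => exists_lift_of_formallySmooth (formallySmooth_resFun (hw top) (hw i) (wm i top (htop i)))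
      ((resR i top (htop i)).comp g₀) (p i) (hp i) (hnil i) (h i) fun a => by
        rw [h_res, RingHom.comp_apply, p_res, hpg₀]
  choose g hg hpg using ex
  refine ⟨g, fun i a => ?_, hpg, fun i j hij b => ?_⟩
  · rw [← resFun_constants Y.str (wm i top (htop i)), hg, hg₀, cR_res]
  · have : (g i).comp (resFun Y.scheme (wm i j hij)) = (resR i j hij).comp (g j) := by
      refine eq_of_formallyUnramified (formallyUnramified_resFun (hw top) (hw j) (wm j top (htop j)))
        (p i) (hnil i) (fun a => ?_) (fun b => ?_)
      · rw [RingHom.comp_apply, RingHom.comp_apply, resFun_resFun, hg, hg, resR_resR]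
      · rw [RingHom.comp_apply, RingHom.comp_apply, hpg, p_res, hpg, h_res]
    exact RingHom.congr_fun this b

namespace SmallSetup

variable {X Y : PoissonScheme k} {f : X.scheme ⟶ Y.scheme} (S : SmallSetup X Y f)

theorem fib_mono {W W' : S.𝒴.affineOpens} (h : W' ≤ W) : S.fib W' ≤ S.fib W :=
  S.e.preimage_mono h

theorem le_of_fib_le {W W' : S.𝒴.affineOpens} (h : S.fib W' ≤ S.fib W) : W' ≤ W :=
  (preimage_le_preimage_iff S.e (U := W'.1) (V := W.1)).1 h

/-- Deformations of smooth affine schemes are trivial: the identity of the coordinate ring of the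
special fibre lifts through the nilpotent thickening. -/
theorem exists_chart (V : S.𝒴.affineOpens) :
    ∃ r : ∀ i : {W : S.𝒴.affineOpens // W ≤ V}, Γ(Y.scheme, S.fib i.1) →+* Γ(S.𝒴, i.1.1),
      (∀ i a, r i (constants Y.str _ a) = constants S.ξ.cod.total.str i.1.1 (algebraMap k _ a)) ∧
      (∀ i b, pullFun S.e i.1.1 (S.fib i.1) le_rfl (r i b) = b) ∧
      ∀ (i j : {W : S.𝒴.affineOpens // W ≤ V}) (h : i.1.1 ≤ j.1.1) b,
        r i (resFun Y.scheme (S.e.preimage_mono h) b) = resFun S.𝒴 h (r j b) := by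
  have := S.smooth
  obtain ⟨r, h₁, h₂, h₃⟩ := exists_family_lift (Y := Y)
    (I := {W : S.𝒴.affineOpens // W ≤ V}) (fun i j => i.1.1 ≤ j.1.1)
    (fun i j l h h' => h.trans h') ⟨V, le_rfl⟩ (fun i => i.2)
    (fun i => S.fib i.1) (fun i => S.isAffineOpen_fib i.1) (fun i j h => S.e.preimage_mono h)
    (fun i => Γ(S.𝒴, i.1.1)) (fun i => Γ(Y.scheme, S.fib i.1))
    (fun i j h => resFun S.𝒴 h) (fun i j l h h' s => resFun_resFun S.𝒴 h' h s)
    (fun i j h => resFun Y.scheme (S.e.preimage_mono h))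
    (fun i => pullFun S.e i.1.1 (S.fib i.1) le_rfl)
    (fun i => pullFun_surjective i.1.2)
    (fun i => isNilpotent_ker_pullFun S.ξ.cod.isPullback S.A.aug_surjective
      S.A.isNilpotent_ker_aug i.1.2)
    (fun i j h s => by rw [resFun_pullFun, pullFun_restrict])
    (fun i => (constants S.ξ.cod.total.str i.1.1).comp (algebraMap k S.A.carrier))
    (fun i j h a => by rw [RingHom.comp_apply, RingHom.comp_apply, resFun_constants])
    (fun i => RingHom.id _)
    (fun i a => by
      rw [RingHom.comp_apply, pullFun_constants_of_comm S.e Y.str _ S.A.aug.toRingHom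
        S.ξ.cod.isPullback.w, RingHom.id_apply]
      exact congrArg _ (S.A.aug.commutes a).symm)
    (fun i j h b => by rw [RingHom.id_apply, RingHom.id_apply])
  exact ⟨r, h₁, h₂, h₃⟩

theorem exists_charts : ∃ V : Y.scheme → S.𝒴.affineOpens, ∃ hV : ∀ x, x ∈ S.fib (V x),
    Nonempty (S.Charts ⟨fun x => S.fib (V x), hV⟩) := by
  have ex : ∀ x : Y.scheme, ∃ V : S.𝒴.affineOpens, x ∈ S.fib V := fun x => by
    obtain ⟨V, hV, -⟩ := exists_affine_le (y := S.e x) (V := (⊤ : S.𝒴.Opens)) trivial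
    exact ⟨V, hV⟩
  choose V hV using ex
  refine ⟨V, hV, ?_⟩
  have ex := fun x => S.exists_chart (V x)
  choose r hr₁ hr₂ hr₃ using ex
  exact ⟨⟨fun {x W} h => r x ⟨W, S.le_of_fib_le h⟩, fun {x W} h a => hr₁ x ⟨W, _⟩ a,
    fun {x W} h b => hr₂ x ⟨W, _⟩ b, fun {x W W'} h h' b =>
      (hr₃ x ⟨W', le_trans h' (S.le_of_fib_le h)⟩ ⟨W, S.le_of_fib_le h⟩ h' b).symm⟩⟩

/-- Lifts over `A'` of the gluing data of `𝒴`, of its Poisson structure and of the morphism. -/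
structure LocalData (𝒱 : PtCover Y.scheme) (𝒰 : PtCover X.scheme) extends S.Charts 𝒱 where
  le : 𝒱.preimage f ≤ 𝒰
  θ : ∀ {x y : Y.scheme} {W : S.𝒴.affineOpens}, S.fib W ≤ 𝒱.nhd x → S.fib W ≤ 𝒱.nhd y →
    (S.P W →+* S.P W)
  θ_cP : ∀ {x y : Y.scheme} {W : S.𝒴.affineOpens} (hx : S.fib W ≤ 𝒱.nhd x)
    (hy : S.fib W ≤ 𝒱.nhd y) (r), θ hx hy (S.cP W r) = S.cP W r
  q_θ : ∀ {x y : Y.scheme} {W : S.𝒴.affineOpens} (hx : S.fib W ≤ 𝒱.nhd x)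
    (hy : S.fib W ≤ 𝒱.nhd y) (p), toCharts.q hx (θ hx hy p) = toCharts.q hy p
  θ_res : ∀ {x y : Y.scheme} {W W' : S.𝒴.affineOpens} (hx : S.fib W ≤ 𝒱.nhd x)
    (hy : S.fib W ≤ 𝒱.nhd y) (h : W' ≤ W) (p), S.resP h (θ hx hy p) =
      θ (x := x) (y := y) ((S.e.preimage_mono h).trans hx) ((S.e.preimage_mono h).trans hy)
        (S.resP h p)
  br : ∀ {x : Y.scheme} {W : S.𝒴.affineOpens}, S.fib W ≤ 𝒱.nhd x → S.P W → S.P W → S.P W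
  br_bider : ∀ {x : Y.scheme} {W : S.𝒴.affineOpens} (hx : S.fib W ≤ 𝒱.nhd x),
    IsAltBider (S.cP W) (br hx)
  q_br : ∀ {x : Y.scheme} {W : S.𝒴.affineOpens} (hx : S.fib W ≤ 𝒱.nhd x) (p p'),
    toCharts.q hx (br hx p p') = S.ξ.cod.total.bracket W.1 (toCharts.q hx p) (toCharts.q hx p')
  br_res : ∀ {x : Y.scheme} {W W' : S.𝒴.affineOpens} (hx : S.fib W ≤ 𝒱.nhd x) (h : W' ≤ W) (p p'),
    S.resP h (br hx p p') =
      br (x := x) ((S.e.preimage_mono h).trans hx) (S.resP h p) (S.resP h p')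
  g : ∀ {z : X.scheme} {U : S.𝒳'.affineOpens} {W : S.𝒴.affineOpens},
    S.η.incl ⁻¹ᵁ U.1 ≤ 𝒰.nhd z → S.fib W ≤ 𝒱.nhd (f z) → S.i ⁻¹ᵁ U.1 ≤ S.ξ.map ⁻¹ᵁ W.1 →
    (S.P W →+* Γ(S.𝒳', U.1))
  g_cP : ∀ {z : X.scheme} {U : S.𝒳'.affineOpens} {W : S.𝒴.affineOpens}
    (hU : S.η.incl ⁻¹ᵁ U.1 ≤ 𝒰.nhd z) (hW : S.fib W ≤ 𝒱.nhd (f z))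
    (hUW : S.i ⁻¹ᵁ U.1 ≤ S.ξ.map ⁻¹ᵁ W.1) (r),
    g hU hW hUW (S.cP W r) = constants S.η.total.str U.1 r
  i_g : ∀ {z : X.scheme} {U : S.𝒳'.affineOpens} {W : S.𝒴.affineOpens}
    (hU : S.η.incl ⁻¹ᵁ U.1 ≤ 𝒰.nhd z) (hW : S.fib W ≤ 𝒱.nhd (f z))
    (hUW : S.i ⁻¹ᵁ U.1 ≤ S.ξ.map ⁻¹ᵁ W.1) (p),
    pullFun S.i U.1 (S.i ⁻¹ᵁ U.1) le_rfl (g hU hW hUW p) =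
      pullFun S.ξ.map W.1 (S.i ⁻¹ᵁ U.1) hUW (toCharts.q hW p)
  g_res : ∀ {z : X.scheme} {U U' : S.𝒳'.affineOpens} {W W' : S.𝒴.affineOpens}
    (hU : S.η.incl ⁻¹ᵁ U.1 ≤ 𝒰.nhd z) (hW : S.fib W ≤ 𝒱.nhd (f z))
    (hUW : S.i ⁻¹ᵁ U.1 ≤ S.ξ.map ⁻¹ᵁ W.1) (hUW' : S.i ⁻¹ᵁ U'.1 ≤ S.ξ.map ⁻¹ᵁ W'.1)
    (h : U' ≤ U) (h' : W' ≤ W) (p),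
    resFun S.𝒳' h (g hU hW hUW p) = g (z := z) ((S.η.incl.preimage_mono h).trans hU)
      ((S.e.preimage_mono h').trans hW) hUW' (S.resP h' p)

namespace Charts

variable {S} {𝒱 : PtCover Y.scheme} (C : S.Charts 𝒱)

/-- The inverse of a chart. -/
def unchart {x : Y.scheme} {W : S.𝒴.affineOpens} (h : S.fib W ≤ 𝒱.nhd x) :
    Γ(S.𝒴, W.1) →+* S.A.carrier ⊗[k] Γ(Y.scheme, S.fib W) :=
  (RingEquiv.ofBijective _ (C.chart_bijective h)).symm.toRingHom

theorem unchart_r {x : Y.scheme} {W : S.𝒴.affineOpens} (h : S.fib W ≤ 𝒱.nhd x) (b) :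
    C.unchart h (C.r h b) = incl k _ _ b := by
  refine (RingEquiv.symm_apply_eq _).2 ?_
  exact (tensorLift_incl _ _ (fun a => (C.r_const h a).symm) _).symm

theorem chart_unchart {x : Y.scheme} {W : S.𝒴.affineOpens} (h : S.fib W ≤ 𝒱.nhd x) (y) :
    tensorLift (R := S.A.carrier) (constants S.ξ.cod.total.str W.1) (C.r h)
      (fun a => (C.r_const h a).symm) (C.unchart h y) = y :=
  (RingEquiv.ofBijective _ (C.chart_bijective h)).apply_symm_apply y

theorem unchart_res {x : Y.scheme} {W W' : S.𝒴.affineOpens} (h : S.fib W ≤ 𝒱.nhd x) (h' : W' ≤ W)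
    (y) : C.unchart (x := x) ((S.e.preimage_mono h').trans h) (resFun S.𝒴 h' y) =
      mapTensor S.A.carrier (resFun Y.scheme (S.e.preimage_mono h'))
        (fun a => resFun_constants Y.str _ a) (C.unchart h y) := by
  refine (RingEquiv.symm_apply_eq _).2 ?_
  obtain ⟨z, rfl⟩ := (C.chart_bijective h).2 y
  have : (resFun S.𝒴 h').comp (tensorLift (R := S.A.carrier) (constants S.ξ.cod.total.str W.1)
      (C.r h) (fun a => (C.r_const h a).symm)) =
    (tensorLift (R := S.A.carrier) (constants S.ξ.cod.total.str W'.1)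
      (C.r (x := x) ((S.e.preimage_mono h').trans h)) (fun a => (C.r_const _ a).symm)).comp
      (mapTensor S.A.carrier (resFun Y.scheme (S.e.preimage_mono h'))
        (fun a => resFun_constants Y.str _ a)) :=
    tensorHom_ext (fun r => by
      simp only [RingHom.comp_apply, tensorLift_algebraMap, mapTensor_algebraMap,
        resFun_constants])
      (fun b => by simp only [RingHom.comp_apply, tensorLift_incl, mapTensor_incl, C.r_res h h'])
  have h2 := RingHom.congr_fun this z
  rw [RingHom.comp_apply] at h2
  rw [h2, RingHom.comp_apply]
  have h3 : C.unchart h (tensorLift (R := S.A.carrier) (constants S.ξ.cod.total.str W.1)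
      (C.r h) (fun a => (C.r_const h a).symm) z) = z :=
    (RingEquiv.ofBijective _ (C.chart_bijective h)).symm_apply_apply z
  rw [h3]
  rfl

/-- The chart transports the Poisson structure of `𝒴` to the trivial deformation over `A`, and this
lifts to a family of biderivations over `A'`. -/
theorem exists_brackets :
    ∃ br : ∀ {x : Y.scheme} {W : S.𝒴.affineOpens}, S.fib W ≤ 𝒱.nhd x → S.P W → S.P W → S.P W,
    (∀ {x : Y.scheme} {W : S.𝒴.affineOpens} (hx : S.fib W ≤ 𝒱.nhd x),
      IsAltBider (S.cP W) (br hx)) ∧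
    (∀ {x : Y.scheme} {W : S.𝒴.affineOpens} (hx : S.fib W ≤ 𝒱.nhd x) (p p'),
      C.q hx (br hx p p') = S.ξ.cod.total.bracket W.1 (C.q hx p) (C.q hx p')) ∧
    (∀ {x : Y.scheme} {W W' : S.𝒴.affineOpens} (hx : S.fib W ≤ 𝒱.nhd x) (h : W' ≤ W) (p p'),
      S.resP h (br hx p p') =
        br (x := x) ((S.e.preimage_mono h).trans hx) (S.resP h p) (S.resP h p')) := by
  -- A `k`-linear section of `φ` induces a lifting `A ⊗ B → A' ⊗ B` which is linear over `B` and
  -- natural in `B`. It is not multiplicative, but linearity over `B` is all that the Leibniz rule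
  -- on elements of `B` requires.
  obtain ⟨σ, hσ⟩ := S.φ.toLinearMap.exists_rightInverse_of_surjective
    (LinearMap.range_eq_top.2 S.φ_surj)
  let sg : ∀ W : S.𝒴.affineOpens, S.A.carrier ⊗[k] Γ(Y.scheme, S.fib W) →ₗ[k] S.P W :=
    fun W => TensorProduct.map σ LinearMap.id
  have sg_tmul : ∀ W r b, sg W (r ⊗ₜ b) = σ r ⊗ₜ b := fun W r b => rfl
  have sg_mul : ∀ W n b, sg W (n * incl k _ _ b) = sg W n * incl k _ _ b := by
    intro W n b
    induction n using TensorProduct.induction_on with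
    | zero => simp only [zero_mul, map_zero]
    | tmul r c =>
      have h1 : (r ⊗ₜ[k] c) * incl k S.A.carrier _ b = r ⊗ₜ (c * b) := by
        simp [incl, Algebra.TensorProduct.tmul_mul_tmul]
      rw [h1, sg_tmul, sg_tmul]
      simp [incl, Algebra.TensorProduct.tmul_mul_tmul]
    | add x y hx hy => rw [add_mul, map_add, hx, hy, map_add, add_mul]
  have sg_res : ∀ {W W' : S.𝒴.affineOpens} (h : W' ≤ W) n,
      sg W' (mapTensor S.A.carrier (resFun Y.scheme (S.e.preimage_mono h))
        (fun a => resFun_constants Y.str _ a) n) = S.resP h (sg W n) := by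
    intro W W' h n
    induction n using TensorProduct.induction_on with
    | zero => simp only [map_zero]
    | tmul r c => rw [mapTensor_tmul, sg_tmul, sg_tmul, resP, mapTensor_tmul]
    | add x y hx hy => rw [map_add, map_add, map_add, map_add, hx, hy]
  have φ_sg : ∀ W n, Algebra.TensorProduct.map S.φ (AlgHom.id k Γ(Y.scheme, S.fib W)) (sg W n) =
      n := by
    intro W n
    induction n using TensorProduct.induction_on with
    | zero => simp only [map_zero]
    | tmul r c =>
      rw [sg_tmul, Algebra.TensorProduct.map_tmul]
      congr 1
      exact LinearMap.congr_fun hσ r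
    | add x y hx hy => rw [map_add, map_add, hx, hy]
  -- The bracket of `𝒴` on two elements of `B`, read in the chart and lifted by `σ`. Its bilinear
  -- extension to `A' ⊗ B` is the lifted bracket, for which the Jacobi identity may fail.
  let β : ∀ {x : Y.scheme} {W : S.𝒴.affineOpens} (_ : S.fib W ≤ 𝒱.nhd x),
      Γ(Y.scheme, S.fib W) → Γ(Y.scheme, S.fib W) → S.P W := fun {x W} h a b =>
    sg W (C.unchart h (S.ξ.cod.total.bracket W.1 (C.r h a) (C.r h b)))
  have ex : ∀ {x : Y.scheme} {W : S.𝒴.affineOpens} (h : S.fib W ≤ 𝒱.nhd x),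
      ∃ b : S.P W → S.P W → S.P W, IsAltBider (S.cP W) b ∧
        ∀ r r' x y, b (r ⊗ₜ x) (r' ⊗ₜ y) = (r * r') • β h x y := by
    intro x W h
    have hb := S.ξ.cod.total.isAltBider W.1
    refine exists_isAltBider_extension (β h) ?_ ?_ ?_ ?_ ?_
    · intro a b c; simp only [β, map_add, hb.add_left]
    · intro a b c; simp only [β, map_add, hb.add_right]
    · intro a; simp only [β, hb.self, map_zero]
    · intro a b c
      simp only [β]
      rw [map_mul, hb.mul_right, map_add, map_mul, map_mul, C.unchart_r, C.unchart_r, map_add,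
        sg_mul, mul_comm (incl k _ _ b), sg_mul, mul_comm _ (incl k _ _ b)]
    · intro a r
      simp only [β]
      rw [algebraMap_eq_constants, C.r_const, hb.const_right, map_zero, map_zero]
  choose br hbr hbr' using @ex
  refine ⟨@br, @hbr, ?_, ?_⟩
  · intro x W hx p p'
    have hb := S.ξ.cod.total.isAltBider W.1
    induction p using TensorProduct.induction_on with
    | zero => rw [(hbr hx).zero_left, map_zero, hb.zero_left]
    | add a b ha hb' => rw [(hbr hx).add_left, map_add, map_add, ha, hb', hb.add_left]
    | tmul r a =>
      induction p' using TensorProduct.induction_on with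
      | zero => rw [(hbr hx).zero_right, map_zero, hb.zero_right]
      | add a b ha hb' => rw [(hbr hx).add_right, map_add, map_add, ha, hb', hb.add_right]
      | tmul r' b =>
        have e1 : C.q hx (β hx a b) = S.ξ.cod.total.bracket W.1 (C.r hx a) (C.r hx b) := by
          rw [q_eq, φ_sg, chart_unchart]
        have e2 : ∀ r b, C.q hx (r ⊗ₜ b) = constants S.ξ.cod.total.str W.1 (S.φ r) * C.r hx b :=
          fun r b => tensorLift_tmul _ _ _ _ _
        rw [hbr', Algebra.smul_def, map_mul, e1, q_cP, e2, e2, hb.const_mul_left,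
          hb.const_mul_right, map_mul, map_mul]
        ring
  · intro x W W' hx h p p'
    have hx' : S.fib W' ≤ 𝒱.nhd x := (S.e.preimage_mono h).trans hx
    induction p using TensorProduct.induction_on with
    | zero => rw [(hbr hx).zero_left, map_zero, (hbr hx').zero_left]
    | add a b ha hb' => rw [(hbr hx).add_left, map_add, map_add, ha, hb', (hbr _).add_left]
    | tmul r a =>
      induction p' using TensorProduct.induction_on with
      | zero => rw [(hbr hx).zero_right, map_zero, (hbr hx').zero_right]
      | add a b ha hb' => rw [(hbr hx).add_right, map_add, map_add, ha, hb', (hbr _).add_right]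
      | tmul r' b =>
        have e1 : S.resP h (β hx a b) = β (x := x) hx' (resFun Y.scheme (S.e.preimage_mono h) a)
            (resFun Y.scheme (S.e.preimage_mono h) b) := by
          simp only [β]
          rw [← sg_res, ← C.unchart_res hx h, S.ξ.cod.total.bracket_res, C.r_res hx h,
            C.r_res hx h]
        have e2 : ∀ r b, S.resP h (r ⊗ₜ b) = r ⊗ₜ resFun Y.scheme (S.e.preimage_mono h) b :=
          fun r b => mapTensor_tmul _ _ _ _ _
        rw [e2, e2, hbr', hbr', Algebra.smul_def, map_mul, e1, resP_cP, Algebra.smul_def]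

end Charts

end SmallSetup

end

/-! ### Lifting the transition maps and the morphism -/

section

open TensorProduct

variable {k : Type u} [Field k]

namespace SmallSetup

variable {X Y : PoissonScheme k} {f : X.scheme ⟶ Y.scheme} (S : SmallSetup X Y f)

theorem preimage_i_le {U : S.𝒳'.Opens} {W : S.𝒴.Opens} (h : S.i ⁻¹ᵁ U ≤ S.ξ.map ⁻¹ᵁ W) :
    S.η.incl ⁻¹ᵁ U ≤ f ⁻¹ᵁ S.e ⁻¹ᵁ W := by
  have h1 : S.ξ.dom.incl ≫ S.i = S.η.incl := S.isBaseChange.2.1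
  rw [← h1, ← Scheme.Hom.comp_preimage f S.e, ← S.ξ.induces]
  exact S.ξ.dom.incl.preimage_mono h

variable {S} {V : Y.scheme → S.𝒴.affineOpens} {hV : ∀ x, x ∈ S.fib (V x)}
  (C : S.Charts ⟨fun x => S.fib (V x), hV⟩)

/-- The chart at `y` is lifted through the reduction defined by the chart at `x`, and extended
linearly over `A'`. The choices for different pairs are unrelated, so no cocycle condition holds
yet. -/
theorem Charts.exists_transition (x y : Y.scheme) :
    ∃ θ : ∀ i : {W : S.𝒴.affineOpens // S.fib W ≤ S.fib (V x) ∧ S.fib W ≤ S.fib (V y)},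
        S.P i.1 →+* S.P i.1,
      (∀ i a, θ i (S.cP i.1 a) = S.cP i.1 a) ∧
      (∀ i p, C.q (x := x) i.2.1 (θ i p) = C.q (x := y) i.2.2 p) ∧
      ∀ i j (h : i.1 ≤ j.1) p, S.resP h (θ j p) = θ i (S.resP h p) := by
  have := S.smooth
  -- The overlap is affine by separatedness and serves as the largest member of the family.
  have hVV : IsAffineOpen ((V x).1 ⊓ (V y).1) :=
    isAffineOpen_inf S.ξ.cod.total.str (V x).2 (V y).2
  obtain ⟨g, h₁, h₂, h₃⟩ := exists_family_lift (Y := Y)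
    (I := {W : S.𝒴.affineOpens // S.fib W ≤ S.fib (V x) ∧ S.fib W ≤ S.fib (V y)})
    (fun i j => i.1 ≤ j.1)
    (fun i j l h h' => h.trans h')
    ⟨⟨_, hVV⟩, S.e.preimage_mono inf_le_left, S.e.preimage_mono inf_le_right⟩
    (fun i => show i.1.1 ≤ (V x).1 ⊓ (V y).1 from
      le_inf (S.le_of_fib_le i.2.1) (S.le_of_fib_le i.2.2))
    (fun i => S.fib i.1) (fun i => S.isAffineOpen_fib i.1) (fun i j h => S.e.preimage_mono h)
    (fun i => S.P i.1) (fun i => Γ(S.𝒴, i.1.1))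
    (fun i j h => S.resP h) (fun i j l h h' s => S.resP_resP h' h s)
    (fun i j h => resFun S.𝒴 h)
    (fun i => C.q (x := x) i.2.1) (fun i => (C.thick i.2.1).q_surj)
    (fun i => (C.thick i.2.1).isNilpotent_ker)
    (fun i j h s => C.q_resP (x := x) j.2.1 h s)
    (fun i => (S.cP i.1).comp (algebraMap k S.A'.carrier))
    (fun i j h a => by rw [RingHom.comp_apply, RingHom.comp_apply, resP_cP])
    (fun i => C.r (x := y) i.2.2)
    (fun i a => by
      rw [RingHom.comp_apply, Charts.q_cP, C.r_const]
      exact congrArg _ (S.φ.commutes a).symm)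
    (fun i j h b => (C.r_res (x := y) j.2.2 h b).symm)
  have hk : ∀ (i : {W : S.𝒴.affineOpens // S.fib W ≤ S.fib (V x) ∧ S.fib W ≤ S.fib (V y)}) a,
      S.cP i.1 (algebraMap k S.A'.carrier a) = g i (algebraMap k _ a) := fun i a => (h₁ i a).symm
  refine ⟨fun i => tensorLift (S.cP i.1) (g i) (hk i), fun i a => tensorLift_algebraMap _ _ _ _,
    fun i p => ?_, fun i j h p => ?_⟩
  · have : (C.q (x := x) i.2.1).comp (tensorLift (S.cP i.1) (g i) (hk i)) =
        C.q (x := y) i.2.2 := tensorHom_ext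
      (fun r => by simp only [RingHom.comp_apply, tensorLift_algebraMap, Charts.q_cP])
      (fun b => by simp only [RingHom.comp_apply, tensorLift_incl, Charts.q_incl, h₂])
    exact RingHom.congr_fun this p
  · have : (S.resP h).comp (tensorLift (S.cP j.1) (g j) (hk j)) =
        (tensorLift (S.cP i.1) (g i) (hk i)).comp (S.resP h) := tensorHom_ext
      (fun r => by simp only [RingHom.comp_apply, tensorLift_algebraMap, resP_cP])
      (fun b => by simp only [RingHom.comp_apply, tensorLift_incl, resP_incl, h₃ i j h])
    exact RingHom.congr_fun this p

/-- The morphism over `A`, read in a chart of the target, is lifted to functions on `𝒳'`; only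
smoothness of `Y` matters, not of `X`. -/
theorem Charts.exists_local_map (z : X.scheme) (U₀ : S.𝒳'.affineOpens)
    (hU₀ : S.i ⁻¹ᵁ U₀.1 ≤ S.ξ.map ⁻¹ᵁ (V (f z)).1) :
    ∃ g : ∀ i : {UW : S.𝒳'.affineOpens × S.𝒴.affineOpens // S.η.incl ⁻¹ᵁ UW.1.1 ≤ S.η.incl ⁻¹ᵁ U₀.1 ∧
        S.fib UW.2 ≤ S.fib (V (f z)) ∧ S.i ⁻¹ᵁ UW.1.1 ≤ S.ξ.map ⁻¹ᵁ UW.2.1},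
        S.P i.1.2 →+* Γ(S.𝒳', i.1.1.1),
      (∀ i a, g i (S.cP i.1.2 a) = constants S.η.total.str i.1.1.1 a) ∧
      (∀ i p, pullFun S.i i.1.1.1 (S.i ⁻¹ᵁ i.1.1.1) le_rfl (g i p) =
        pullFun S.ξ.map i.1.2.1 (S.i ⁻¹ᵁ i.1.1.1) i.2.2.2 (C.q (x := f z) i.2.2.1 p)) ∧
      ∀ i j (h : i.1.1 ≤ j.1.1 ∧ i.1.2 ≤ j.1.2) p,
        resFun S.𝒳' h.1 (g j p) = g i (S.resP h.2 p) := by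
  have := S.smooth
  obtain ⟨g, h₁, h₂, h₃⟩ := exists_family_lift (Y := Y)
    (I := {UW : S.𝒳'.affineOpens × S.𝒴.affineOpens // S.η.incl ⁻¹ᵁ UW.1.1 ≤ S.η.incl ⁻¹ᵁ U₀.1 ∧
        S.fib UW.2 ≤ S.fib (V (f z)) ∧ S.i ⁻¹ᵁ UW.1.1 ≤ S.ξ.map ⁻¹ᵁ UW.2.1})
    (fun i j => i.1.1 ≤ j.1.1 ∧ i.1.2 ≤ j.1.2)
    (fun i j l h h' => ⟨h.1.trans h'.1, h.2.trans h'.2⟩)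
    ⟨⟨U₀, V (f z)⟩, le_rfl, le_rfl, hU₀⟩
    (fun i => ⟨(preimage_le_preimage_iff S.η.incl (U := i.1.1.1) (V := U₀.1)).1 i.2.1,
      S.le_of_fib_le i.2.2.1⟩)
    (fun i => S.fib i.1.2) (fun i => S.isAffineOpen_fib i.1.2) (fun i j h => S.e.preimage_mono h.2)
    (fun i => Γ(S.𝒳', i.1.1.1)) (fun i => Γ(S.ξ.dom.total.scheme, S.i ⁻¹ᵁ i.1.1.1))
    (fun i j h => resFun S.𝒳' h.1) (fun i j l h h' s => resFun_resFun S.𝒳' h'.1 h.1 s)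
    (fun i j h => resFun S.ξ.dom.total.scheme (S.i.preimage_mono h.1))
    (fun i => pullFun S.i i.1.1.1 (S.i ⁻¹ᵁ i.1.1.1) le_rfl)
    (fun i => pullFun_surjective i.1.1.2)
    (fun i => isNilpotent_ker_pullFun S.isBaseChange.1 S.φ_surj
      (Art.isNilpotent_ker S.φ) i.1.1.2)
    (fun i j h s => by rw [resFun_pullFun, pullFun_restrict])
    (fun i => (constants S.η.total.str i.1.1.1).comp (algebraMap k S.A'.carrier))
    (fun i j h a => by rw [RingHom.comp_apply, RingHom.comp_apply, resFun_constants])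
    (fun i => (pullFun S.ξ.map i.1.2.1 (S.i ⁻¹ᵁ i.1.1.1) i.2.2.2).comp (C.r (x := f z) i.2.2.1))
    (fun i a => by
      rw [RingHom.comp_apply, RingHom.comp_apply, C.r_const,
        pullFun_constants S.ξ.map _ _ S.ξ.map_str,
        pullFun_constants_of_comm S.i S.ξ.dom.total.str _ S.φ.toRingHom S.isBaseChange.1.w]
      exact congrArg _ (S.φ.commutes a).symm)
    (fun i j h b => by
      rw [RingHom.comp_apply, RingHom.comp_apply, ← C.r_res (x := f z) j.2.2.1 h.2,
        resFun_pullFun, pullFun_restrict])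
  have hk : ∀ (i : {UW : S.𝒳'.affineOpens × S.𝒴.affineOpens //
        S.η.incl ⁻¹ᵁ UW.1.1 ≤ S.η.incl ⁻¹ᵁ U₀.1 ∧
        S.fib UW.2 ≤ S.fib (V (f z)) ∧ S.i ⁻¹ᵁ UW.1.1 ≤ S.ξ.map ⁻¹ᵁ UW.2.1}) a,
      constants S.η.total.str i.1.1.1 (algebraMap k S.A'.carrier a) = g i (algebraMap k _ a) :=
    fun i a => (h₁ i a).symm
  refine ⟨fun i => tensorLift (constants S.η.total.str i.1.1.1) (g i) (hk i),
    fun i a => tensorLift_algebraMap _ _ _ _, fun i p => ?_, fun i j h p => ?_⟩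
  · have : (pullFun S.i i.1.1.1 (S.i ⁻¹ᵁ i.1.1.1) le_rfl).comp
        (tensorLift (constants S.η.total.str i.1.1.1) (g i) (hk i)) =
        (pullFun S.ξ.map i.1.2.1 (S.i ⁻¹ᵁ i.1.1.1) i.2.2.2).comp (C.q (x := f z) i.2.2.1) :=
      tensorHom_ext
      (fun r => by
        simp only [RingHom.comp_apply, tensorLift_algebraMap, Charts.q_cP]
        rw [pullFun_constants S.ξ.map _ _ S.ξ.map_str,
          pullFun_constants_of_comm S.i S.ξ.dom.total.str _ S.φ.toRingHom S.isBaseChange.1.w]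
        rfl)
      (fun b => by
        rw [RingHom.comp_apply, RingHom.comp_apply, tensorLift_incl, Charts.q_incl, h₂,
          RingHom.comp_apply])
    exact RingHom.congr_fun this p
  · have : (resFun S.𝒳' h.1).comp (tensorLift (constants S.η.total.str j.1.1.1) (g j) (hk j)) =
        (tensorLift (constants S.η.total.str i.1.1.1) (g i) (hk i)).comp (S.resP h.2) :=
      tensorHom_ext
      (fun r => by
        simp only [RingHom.comp_apply, tensorLift_algebraMap, resP_cP, resFun_constants])
      (fun b => by simp only [RingHom.comp_apply, tensorLift_incl, resP_incl, h₃ i j h])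
    exact RingHom.congr_fun this p

variable (S) in
theorem exists_localData : ∃ (𝒱 : PtCover Y.scheme) (𝒰 : PtCover X.scheme),
    Nonempty (S.LocalData 𝒱 𝒰) := by
  obtain ⟨V, hV, ⟨C⟩⟩ := S.exists_charts
  have ex : ∀ z : X.scheme, ∃ U : S.𝒳'.affineOpens, z ∈ S.η.incl ⁻¹ᵁ U.1 ∧
      S.i ⁻¹ᵁ U.1 ≤ S.ξ.map ⁻¹ᵁ (V (f z)).1 := by
    intro z
    have hz : S.ξ.dom.incl z ∈ S.ξ.map ⁻¹ᵁ (V (f z)).1 := by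
      have h1 : S.ξ.map (S.ξ.dom.incl z) = S.e (f z) := by
        rw [← Scheme.Hom.comp_apply, S.ξ.induces, Scheme.Hom.comp_apply]
      change S.ξ.map (S.ξ.dom.incl z) ∈ (V (f z)).1
      rw [h1]
      exact hV (f z)
    obtain ⟨U, hU, hU'⟩ := exists_affine_preimage_le S.i hz
    refine ⟨U, ?_, hU'⟩
    have h1 : S.η.incl z = S.i (S.ξ.dom.incl z) := by
      rw [← Scheme.Hom.comp_apply, S.isBaseChange.2.1]
    change S.η.incl z ∈ U.1
    rw [h1]
    exact hU
  choose U hU hUV using ex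
  have exθ := fun x y => C.exists_transition x y
  choose θ θ₁ θ₂ θ₃ using exθ
  obtain ⟨br, b₁, b₂, b₃⟩ := C.exists_brackets
  have exg := fun z => C.exists_local_map z (U z) (hUV z)
  choose g g₁ g₂ g₃ using exg
  refine ⟨⟨fun x => S.fib (V x), hV⟩, ⟨fun z => S.η.incl ⁻¹ᵁ (U z).1, hU⟩, ⟨{ C with
    le := fun z => S.preimage_i_le (hUV z)
    θ := fun {x y W} hx hy => θ x y ⟨W, hx, hy⟩
    θ_cP := fun {x y W} hx hy r => θ₁ x y ⟨W, hx, hy⟩ r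
    q_θ := fun {x y W} hx hy p => θ₂ x y ⟨W, hx, hy⟩ p
    θ_res := fun {x y W W'} hx hy h p =>
      θ₃ x y ⟨W', (S.e.preimage_mono h).trans hx, (S.e.preimage_mono h).trans hy⟩ ⟨W, hx, hy⟩ h p
    br := @br
    br_bider := @b₁
    q_br := @b₂
    br_res := @b₃
    g := fun {z U W} h h' h'' => g z ⟨⟨U, W⟩, h, h', h''⟩
    g_cP := fun {z U W} h h' h'' r => g₁ z ⟨⟨U, W⟩, h, h', h''⟩ r
    i_g := fun {z U W} h h' h'' p => g₂ z ⟨⟨U, W⟩, h, h', h''⟩ p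
    g_res := fun {z U U' W W'} hU hW hUW hUW' h h' p =>
      g₃ z ⟨⟨U', W'⟩, (S.η.incl.preimage_mono h).trans hU, (S.e.preimage_mono h').trans hW, hUW'⟩
        ⟨⟨U, W⟩, hU, hW, hUW⟩ ⟨h, h'⟩ p }⟩⟩

end SmallSetup

end

section

open TensorProduct

variable {k : Type u} [Field k]

/-! ### Sections over small affine opens -/

theorem vec_one_eq {B : Type*} (a : Fin 1 → B) : a = ![a 0] := by ext i; fin_cases i; rfl

theorem vec_two_eq {B : Type*} (a : Fin 2 → B) : a = ![a 0, a 1] := by ext i; fin_cases i <;> rfl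

theorem vec_three_eq {B : Type*} (a : Fin 3 → B) : a = ![a 0, a 1, a 2] := by
  ext i; fin_cases i <;> rfl

section

variable {X Y : PoissonScheme k} {f : X.scheme ⟶ Y.scheme}

/-- Compatibility with restriction of functions. -/
def IsResCompatible {q : ℕ} {N : X.scheme.Opens} (D : Sec f q N) : Prop :=
  ∀ {V V' : Y.scheme.Opens} (h : V' ≤ V) (a : Fin (q + 1) → Γ(Y.scheme, V)),
    resFun X.scheme (inf_le_inf_left N (f.preimage_mono h)) (D V a) =
      D V' fun i => resFun Y.scheme h (a i)

/-- This weak property of the total differential is what the extensionality criteria require, so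
stability of polyvectors under `π` is never needed. -/
theorem isResCompatible_totalDiff {𝒰 : PtCover X.scheme} {n : ℕ} {c : Cochain f 𝒰}
    (hc : c ∈ cochains f 𝒰 n) (p q : ℕ) (s) : IsResCompatible (totalDiff f 𝒰 c p q s) := by
  intro V V' h a
  change resFun X.scheme _ (cechDiff f 𝒰 c p q s V a + vertDiff f 𝒰 c p q s V a) =
    cechDiff f 𝒰 c p q s V' _ + vertDiff f 𝒰 c p q s V' _
  rw [map_add]
  congr 1
  · cases p with
    | zero => exact map_zero _
    | succ p =>
      simp only [cechDiff, AddMonoidHom.coe_mk, ZeroHom.coe_mk, Finset.sum_apply, Pi.smul_apply,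
        map_sum, map_zsmul]
      refine Finset.sum_congr rfl fun j _ => congrArg _ ?_
      exact ((hc.1 p q (s ∘ j.succAbove)).secRes (𝒰.inter_comp_le s j.succAbove)).res h a
  · cases q with
    | zero => exact map_zero _
    | succ q =>
      have hD := fun a => (hc.1 p q s).res h a
      simp only [vertDiff, poissonDiff, AddMonoidHom.coe_mk, ZeroHom.coe_mk, Pi.smul_apply,
        map_zsmul, map_sub, map_sum, X.bracket_res, hD, resFun_pullFun]
      refine congrArg _ (congrArg₂ _ (Finset.sum_congr rfl fun i _ => congrArg _ ?_)
        (congrArg _ (Finset.sum_congr rfl fun j _ => Finset.sum_congr rfl fun i _ => ?_)))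
      · rw [pullFun_restrict]; rfl
      · split_ifs
        · rw [map_zsmul, hD]
          refine congrArg _ (congrArg _ (funext fun l => ?_))
          refine Fin.cases ?_ (fun l => ?_) l
          · exact Y.bracket_res h _ _
          · rfl
        · exact map_zero _

theorem totalDiff_eq_zero_of_ne {𝒰 : PtCover X.scheme} {n : ℕ} {c : Cochain f 𝒰}
    (hc : c ∈ cochains f 𝒰 n) {p q : ℕ} (h : p + q ≠ n + 1) : totalDiff f 𝒰 c p q = 0 := by
  have h1 : cechDiff f 𝒰 c p q = 0 := by
    funext s
    cases p with
    | zero => rfl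
    | succ p =>
      simp only [cechDiff, AddMonoidHom.coe_mk, ZeroHom.coe_mk]
      refine Finset.sum_eq_zero fun j _ => ?_
      rw [hc.2 p q (by omega), Pi.zero_apply, map_zero, smul_zero]
  have h2 : vertDiff f 𝒰 c p q = 0 := by
    funext s
    cases q with
    | zero => rfl
    | succ q =>
      simp only [vertDiff, AddMonoidHom.coe_mk, ZeroHom.coe_mk]
      rw [hc.2 p q (by omega), Pi.zero_apply, map_zero, smul_zero]
      rfl
  change cechDiff f 𝒰 c p q + vertDiff f 𝒰 c p q = 0
  rw [h1, h2, add_zero]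

end

namespace SmallSetup

variable {X Y : PoissonScheme k} {f : X.scheme ⟶ Y.scheme} (S : SmallSetup X Y f)

/-- Pairs `(U, W)` with `U` mapping into `W` are cofinal around a point and its image. The condition
is imposed over `A`, because no morphism exists on `𝒳'` yet. -/
theorem exists_pair {x : X.scheme} {N : X.scheme.Opens} (hx : x ∈ N) {W : S.𝒴.affineOpens}
    (hW : f x ∈ S.fib W) : ∃ U : S.𝒳'.affineOpens, x ∈ S.η.incl ⁻¹ᵁ U.1 ∧ S.η.incl ⁻¹ᵁ U.1 ≤ N ∧
      S.i ⁻¹ᵁ U.1 ≤ S.ξ.map ⁻¹ᵁ W.1 := by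
  have hc : IsClosedImmersion S.ξ.dom.incl :=
    isClosedImmersion_of_isPullback S.ξ.dom.isPullback S.A.aug_surjective
  obtain ⟨N₁, rfl⟩ := exists_preimage_eq S.ξ.dom.incl N
  have hz : S.ξ.dom.incl x ∈ N₁ ⊓ S.ξ.map ⁻¹ᵁ W.1 := by
    refine ⟨hx, ?_⟩
    have h1 : S.ξ.map (S.ξ.dom.incl x) = S.e (f x) := by
      rw [← Scheme.Hom.comp_apply, S.ξ.induces, Scheme.Hom.comp_apply]
    change S.ξ.map (S.ξ.dom.incl x) ∈ W.1
    rw [h1]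
    exact hW
  obtain ⟨U, hU, hU'⟩ := exists_affine_preimage_le S.i hz
  have h1 : S.ξ.dom.incl ≫ S.i = S.η.incl := S.isBaseChange.2.1
  rw [← h1]
  exact ⟨U, hU, S.ξ.dom.incl.preimage_mono (hU'.trans inf_le_left), hU'.trans inf_le_right⟩

theorem le_of_incl_le {U U' : S.𝒳'.affineOpens} (h : S.η.incl ⁻¹ᵁ U'.1 ≤ S.η.incl ⁻¹ᵁ U.1) :
    U' ≤ U :=
  (preimage_le_preimage_iff S.η.incl (U := U'.1) (V := U.1)).1 h

/-- Here the intermediate ring is the plain quotient by `t`, independent of any chart. Since `tau`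
does not involve `q`, the resulting `τ` agrees definitionally with the one from `Charts.thick`. -/
theorem thickP (W : S.𝒴.affineOpens) : SmallThick S.A'.aug.toRingHom S.t (S.cP W)
    (Ideal.Quotient.mk (Ideal.span {S.cP W S.t})) (S.ρ W) where
  rho_surj := redTensor_surjective _ _
  q_surj := Ideal.Quotient.mk_surjective
  ker_rho := redTensor_eq_zero_iff _ _
  ker_q m := by
    rw [Ideal.Quotient.eq_zero_iff_mem, Ideal.mem_span_singleton']
    exact ⟨fun ⟨s, hs⟩ => ⟨s, by rw [← hs, mul_comm]⟩, fun ⟨s, hs⟩ => ⟨s, by rw [hs, mul_comm]⟩⟩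
  ann m := (const_mul_eq_zero_iff S.mul_t
    ((RingHom.flat_algebraMap_iff).2 inferInstance) m).trans (redTensor_eq_zero_iff _ _ _).symm
  rho_t := (redTensor_eq_zero_iff _ _ _).2 (Ideal.mem_map_of_mem _ S.aug_t)

/-- Multiplication by `t`, from the special fibre to `P W`. -/
abbrev τ (W : S.𝒴.affineOpens) : Γ(Y.scheme, S.fib W) → S.P W := (S.thickP W).tau

/-- Multiplication by `t`, from the special fibre to functions on `𝒳'`. -/
abbrev τX (U : S.𝒳'.affineOpens) : Γ(X.scheme, S.η.incl ⁻¹ᵁ U.1) → Γ(S.𝒳', U.1) :=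
  (S.thickX U.2).tau

/-- Restriction of functions on `𝒳'` to the special fibre. -/
abbrev ρX (U : S.𝒳'.affineOpens) : Γ(S.𝒳', U.1) →+* Γ(X.scheme, S.η.incl ⁻¹ᵁ U.1) :=
  pullFun S.η.incl U.1 (S.η.incl ⁻¹ᵁ U.1) le_rfl

/-- Pullback of functions on the special fibres. -/
def fR {U : S.𝒳'.affineOpens} {W : S.𝒴.affineOpens} (h : S.i ⁻¹ᵁ U.1 ≤ S.ξ.map ⁻¹ᵁ W.1) :
    Γ(Y.scheme, S.fib W) →+* Γ(X.scheme, S.η.incl ⁻¹ᵁ U.1) :=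
  pullFun f (S.fib W) (S.η.incl ⁻¹ᵁ U.1) (S.preimage_i_le h)

/-- Evaluation of a polyvector field on functions on `fib W`. -/
def evY {q : ℕ} {O : Y.scheme.Opens} (D : Sec (𝟙 Y.scheme) q O) {W : S.𝒴.affineOpens}
    (h : S.fib W ≤ O) (a : Fin (q + 1) → Γ(Y.scheme, S.fib W)) : Γ(Y.scheme, S.fib W) :=
  ev D (S.fib W) (S.fib W) (le_inf h le_rfl) a

/-- Evaluation of a section of `⋀ f^* T_Y`. -/
def evX {q : ℕ} {N : X.scheme.Opens} (D : Sec f q N) {U : S.𝒳'.affineOpens} {W : S.𝒴.affineOpens}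
    (h : S.η.incl ⁻¹ᵁ U.1 ≤ N) (hUW : S.i ⁻¹ᵁ U.1 ≤ S.ξ.map ⁻¹ᵁ W.1)
    (a : Fin (q + 1) → Γ(Y.scheme, S.fib W)) : Γ(X.scheme, S.η.incl ⁻¹ᵁ U.1) :=
  ev D (S.fib W) (S.η.incl ⁻¹ᵁ U.1) (le_inf h (S.preimage_i_le hUW)) a

theorem pullFun_one (W : S.𝒴.affineOpens) (h : S.fib W ≤ 𝟙 Y.scheme ⁻¹ᵁ S.fib W) (a) :
    pullFun (𝟙 Y.scheme) (S.fib W) (S.fib W) h a = a := by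
  rw [pullFun_id, resFun_self]

theorem resP_τ {W W' : S.𝒴.affineOpens} (h : W' ≤ W) (s) :
    S.resP h (S.τ W s) = S.τ W' (resFun Y.scheme (S.e.preimage_mono h) s) :=
  (S.thickP W).map_tau (S.thickP W') (S.resP_cP h) (S.ρ_resP h) s

theorem resFun_τX {U U' : S.𝒳'.affineOpens} (h : U' ≤ U) (s) :
    resFun S.𝒳' h (S.τX U s) = S.τX U' (resFun X.scheme (S.η.incl.preimage_mono h) s) :=
  (S.thickX U.2).map_tau (S.thickX U'.2) (resFun_constants _ _)
    (fun x => by rw [pullFun_restrict, resFun_pullFun]) s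

theorem evY_isMultider {q : ℕ} {O : Y.scheme.Opens} {D : Sec (𝟙 Y.scheme) q O}
    (hD : IsPolyvector Y.str (𝟙 Y.scheme) D) {W : S.𝒴.affineOpens} (h : S.fib W ≤ O) :
    IsMultider (constants Y.str (S.fib W)) (RingHom.id _) (S.evY D h) := by
  have := ev_isMultider hD (R := S.fib W) (N := S.fib W) (le_inf h le_rfl)
  have e : pullFun (𝟙 Y.scheme) (S.fib W) (S.fib W) le_rfl = RingHom.id _ :=
    RingHom.ext fun a => S.pullFun_one W _ a
  rw [← e]
  exact this

theorem evX_isMultider {q : ℕ} {N : X.scheme.Opens} {D : Sec f q N}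
    (hD : IsPolyvector Y.str f D) {U : S.𝒳'.affineOpens} {W : S.𝒴.affineOpens}
    (h : S.η.incl ⁻¹ᵁ U.1 ≤ N) (hUW : S.i ⁻¹ᵁ U.1 ≤ S.ξ.map ⁻¹ᵁ W.1) :
    IsMultider (constants Y.str (S.fib W)) (S.fR hUW) (S.evX D h hUW) :=
  ev_isMultider hD (R := S.fib W) (N := S.η.incl ⁻¹ᵁ U.1) (le_inf h (S.preimage_i_le hUW))

theorem evY_res {q : ℕ} {O : Y.scheme.Opens} {D : Sec (𝟙 Y.scheme) q O}
    (hD : IsPolyvector Y.str (𝟙 Y.scheme) D) {W W' : S.𝒴.affineOpens} (h : S.fib W ≤ O)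
    (h' : W' ≤ W) (a) : resFun Y.scheme (S.e.preimage_mono h') (S.evY D h a) =
      S.evY D ((S.e.preimage_mono h').trans h) fun i =>
        resFun Y.scheme (S.e.preimage_mono h') (a i) :=
  ev_res hD _ _ _ _ a

theorem evX_res {q : ℕ} {N : X.scheme.Opens} {D : Sec f q N}
    (hD : IsPolyvector Y.str f D) {U U' : S.𝒳'.affineOpens} {W W' : S.𝒴.affineOpens}
    (h : S.η.incl ⁻¹ᵁ U.1 ≤ N) (hUW : S.i ⁻¹ᵁ U.1 ≤ S.ξ.map ⁻¹ᵁ W.1) (hU : U' ≤ U) (hW : W' ≤ W)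
    (hUW' : S.i ⁻¹ᵁ U'.1 ≤ S.ξ.map ⁻¹ᵁ W'.1) (a) :
    resFun X.scheme (S.η.incl.preimage_mono hU) (S.evX D h hUW a) =
      S.evX D ((S.η.incl.preimage_mono hU).trans h) hUW' fun i =>
        resFun Y.scheme (S.e.preimage_mono hW) (a i) :=
  ev_res hD _ _ _ _ a

/-- A family of polyvector fields described by multiples of `t` over the affine opens. -/
theorem exists_secY {q : ℕ} (O : Y.scheme.Opens)
    (F : ∀ W : S.𝒴.affineOpens, S.fib W ≤ O → (Fin (q + 1) → S.P W) → S.P W)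
    (hE : ∀ W h, ∃ E : (Fin (q + 1) → Γ(Y.scheme, S.fib W)) → Γ(Y.scheme, S.fib W),
      IsMultider (constants Y.str (S.fib W)) (RingHom.id _) E ∧
        ∀ p, F W h p = S.τ W (E fun i => S.ρ W (p i)))
    (hF : ∀ W W' (h : S.fib W ≤ O) (h' : W' ≤ W) p, S.resP h' (F W h p) =
      F W' ((S.e.preimage_mono h').trans h) fun i => S.resP h' (p i)) :
    ∃ D : Sec (𝟙 Y.scheme) q O, IsPolyvector Y.str (𝟙 Y.scheme) D ∧
      ∀ W h p, F W h p = S.τ W (S.evY D h fun i => S.ρ W (p i)) := by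
  choose E hE₁ hE₂ using hE
  obtain ⟨D, hD, hDE⟩ := exists_polyvector Y.str (f := 𝟙 Y.scheme) (U := O)
    (ι := {W : S.𝒴.affineOpens // S.fib W ≤ O}) (fun i => S.fib i.1) (fun i => S.fib i.1)
    (fun i => le_inf i.2 le_rfl) (fun x hx N' V' hN' hV' => by
      obtain ⟨W, h1, h2⟩ := exists_affine_preimage_le S.e (x := x) (V := O ⊓ (N' ⊓ V'))
        ⟨hx, hN', hV'⟩
      exact ⟨⟨W, h2.trans inf_le_left⟩, h1, h2.trans (inf_le_right.trans inf_le_left),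
        h2.trans (inf_le_right.trans inf_le_right)⟩)
    (fun i => E i.1 i.2) (fun i => by
      have e : pullFun (𝟙 Y.scheme) (S.fib i.1) (S.fib i.1) le_rfl = RingHom.id _ :=
        RingHom.ext fun a => S.pullFun_one i.1 _ a
      have := hE₁ i.1 i.2
      rw [← e] at this
      exact this) (fun i j hR hN a => by
      have h' : i.1 ≤ j.1 := S.le_of_fib_le hR
      -- Arguments are lifted to `P`, where compatibility is known for `F`; injectivity of `τ`
      -- brings it back to `E`.
      have ex : ∀ l, ∃ p, S.ρ j.1 p = a l := fun l => redTensor_surjective _ _ (a l)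
      choose p hp using ex
      obtain rfl : (fun l => S.ρ j.1 (p l)) = a := funext hp
      apply (S.thickP i.1).tau_inj
      have h1 := hF j.1 i.1 j.2 h' p
      rw [hE₂, hE₂, S.resP_τ] at h1
      simp only [S.ρ_resP] at h1
      exact h1)
  exact ⟨D, hD, fun W h p => by rw [hE₂, ← hDE ⟨W, h⟩]; rfl⟩

/-- A family of sections of `⋀ f^* T_Y` described by multiples of `t` over the affine opens. -/
theorem exists_secX {q : ℕ} (N : X.scheme.Opens) (O : Y.scheme.Opens) (hNO : N ≤ f ⁻¹ᵁ O)
    (F : ∀ (U : S.𝒳'.affineOpens) (W : S.𝒴.affineOpens), S.η.incl ⁻¹ᵁ U.1 ≤ N → S.fib W ≤ O →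
      S.i ⁻¹ᵁ U.1 ≤ S.ξ.map ⁻¹ᵁ W.1 → (Fin (q + 1) → S.P W) → Γ(S.𝒳', U.1))
    (hE : ∀ U W hU hW hUW, ∃ E : (Fin (q + 1) → Γ(Y.scheme, S.fib W)) →
        Γ(X.scheme, S.η.incl ⁻¹ᵁ U.1),
      IsMultider (constants Y.str (S.fib W)) (S.fR hUW) E ∧
        ∀ p, F U W hU hW hUW p = S.τX U (E fun i => S.ρ W (p i)))
    (hF : ∀ (U U' : S.𝒳'.affineOpens) (W W' : S.𝒴.affineOpens) hU hW hUW hUW' (h : U' ≤ U)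
      (h' : W' ≤ W) p,
      resFun S.𝒳' h (F U W hU hW hUW p) = F U' W' ((S.η.incl.preimage_mono h).trans hU)
        ((S.e.preimage_mono h').trans hW) hUW' fun i => S.resP h' (p i)) :
    ∃ D : Sec f q N, IsPolyvector Y.str f D ∧
      ∀ U W hU hW hUW p, F U W hU hW hUW p = S.τX U (S.evX D hU hUW fun i => S.ρ W (p i)) := by
  choose E hE₁ hE₂ using hE
  obtain ⟨D, hD, hDE⟩ := exists_polyvector Y.str (f := f) (U := N)
    (ι := {UW : S.𝒳'.affineOpens × S.𝒴.affineOpens // S.η.incl ⁻¹ᵁ UW.1.1 ≤ N ∧ S.fib UW.2 ≤ O ∧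
      S.i ⁻¹ᵁ UW.1.1 ≤ S.ξ.map ⁻¹ᵁ UW.2.1})
    (fun i => S.fib i.1.2) (fun i => S.η.incl ⁻¹ᵁ i.1.1.1)
    (fun i => le_inf i.2.1 (S.preimage_i_le i.2.2.2)) (fun x hx N' V' hN' hV' => by
      obtain ⟨W, h1, h2⟩ := exists_affine_preimage_le S.e (x := f x) (V := O ⊓ V') ⟨hNO hx, hV'⟩
      obtain ⟨U, h3, h4, h5⟩ := S.exists_pair (x := x) (N := N ⊓ N') ⟨hx, hN'⟩ h1
      exact ⟨⟨⟨U, W⟩, h4.trans inf_le_left, h2.trans inf_le_left, h5⟩, h3, h4.trans inf_le_right,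
        h2.trans inf_le_right⟩)
    (fun i => E i.1.1 i.1.2 i.2.1 i.2.2.1 i.2.2.2) (fun i => hE₁ _ _ _ _ _) (fun i j hR hN a => by
      have h' : i.1.2 ≤ j.1.2 := S.le_of_fib_le hR
      have h : i.1.1 ≤ j.1.1 := S.le_of_incl_le hN
      have ex : ∀ l, ∃ p, S.ρ j.1.2 p = a l := fun l => redTensor_surjective _ _ (a l)
      choose p hp using ex
      obtain rfl : (fun l => S.ρ j.1.2 (p l)) = a := funext hp
      apply (S.thickX i.1.1.2).tau_inj
      have h1 := hF j.1.1 i.1.1 j.1.2 i.1.2 j.2.1 j.2.2.1 j.2.2.2 i.2.2.2 h h' p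
      rw [hE₂, hE₂, S.resFun_τX] at h1
      simp only [S.ρ_resP] at h1
      exact h1)
  exact ⟨D, hD, fun U W hU hW hUW p => by rw [hE₂, ← hDE ⟨⟨U, W⟩, hU, hW, hUW⟩]; rfl⟩

theorem secY_ext {q : ℕ} {O : Y.scheme.Opens} {D D' : Sec (𝟙 Y.scheme) q O}
    (hD : IsResCompatible (X := Y) D) (hD' : IsResCompatible (X := Y) D')
    (h : ∀ (W : S.𝒴.affineOpens) (h : S.fib W ≤ O) (p : Fin (q + 1) → S.P W),
      S.evY D h (fun i => S.ρ W (p i)) = S.evY D' h (fun i => S.ρ W (p i))) : D = D' := by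
  refine sec_ext hD hD' fun x hx V hV => ?_
  obtain ⟨W, h1, h2⟩ := exists_affine_preimage_le S.e (x := x) (V := O ⊓ V) ⟨hx, hV⟩
  refine ⟨S.fib W, S.fib W, le_inf (h2.trans inf_le_left) le_rfl, h1, h2.trans inf_le_right,
    fun a => ?_⟩
  have ex : ∀ l, ∃ p, S.ρ W p = a l := fun l => redTensor_surjective _ _ (a l)
  choose p hp using ex
  obtain rfl : (fun l => S.ρ W (p l)) = a := funext hp
  exact h W (h2.trans inf_le_left) p

theorem secX_ext {q : ℕ} {N : X.scheme.Opens} (O : Y.scheme.Opens) (hNO : N ≤ f ⁻¹ᵁ O)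
    {D D' : Sec f q N}
    (hD : IsResCompatible D) (hD' : IsResCompatible D')
    (h : ∀ (U : S.𝒳'.affineOpens) (W : S.𝒴.affineOpens) (hU : S.η.incl ⁻¹ᵁ U.1 ≤ N)
      (_ : S.fib W ≤ O) (hUW : S.i ⁻¹ᵁ U.1 ≤ S.ξ.map ⁻¹ᵁ W.1) (p : Fin (q + 1) → S.P W),
      S.evX D hU hUW (fun i => S.ρ W (p i)) = S.evX D' hU hUW (fun i => S.ρ W (p i))) :
    D = D' := by
  refine sec_ext hD hD' fun x hx V hV => ?_
  obtain ⟨W, h1, h2⟩ := exists_affine_preimage_le S.e (x := f x) (V := O ⊓ V) ⟨hNO hx, hV⟩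
  obtain ⟨U, h3, h4, h5⟩ := S.exists_pair (x := x) (N := N) hx h1
  refine ⟨S.fib W, S.η.incl ⁻¹ᵁ U.1, le_inf h4 (S.preimage_i_le h5), h3, h2.trans inf_le_right,
    fun a => ?_⟩
  have ex : ∀ l, ∃ p, S.ρ W p = a l := fun l => redTensor_surjective _ _ (a l)
  choose p hp using ex
  obtain rfl : (fun l => S.ρ W (p l)) = a := funext hp
  exact h U W h4 (h2.trans inf_le_left) h5 p

end SmallSetup

end

section

open TensorProduct

variable {k : Type u} [Field k]

/-! ### The obstruction cochains -/

theorem PtCover.le_inter_iff {X : Scheme.{u}} {𝒰 : PtCover X} {p : ℕ} {s : Fin (p + 1) → X}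
    {N : X.Opens} : N ≤ 𝒰.inter s ↔ ∀ i, N ≤ 𝒰.nhd (s i) := le_iInf_iff

theorem PtCover.le_inter_one {X : Scheme.{u}} {𝒰 : PtCover X} {x : X} {N : X.Opens}
    (h : N ≤ 𝒰.nhd x) : N ≤ 𝒰.inter ![x] :=
  le_inter_iff.2 fun i => by fin_cases i; exact h

theorem PtCover.le_inter_two {X : Scheme.{u}} {𝒰 : PtCover X} {x y : X} {N : X.Opens}
    (h : N ≤ 𝒰.nhd x) (h' : N ≤ 𝒰.nhd y) : N ≤ 𝒰.inter ![x, y] :=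
  le_inter_iff.2 fun i => by fin_cases i; exacts [h, h']

theorem PtCover.le_inter_three {X : Scheme.{u}} {𝒰 : PtCover X} {x y z : X} {N : X.Opens}
    (h : N ≤ 𝒰.nhd x) (h' : N ≤ 𝒰.nhd y) (h'' : N ≤ 𝒰.nhd z) : N ≤ 𝒰.inter ![x, y, z] :=
  le_inter_iff.2 fun i => by fin_cases i; exacts [h, h', h'']

namespace SmallSetup

variable {X Y : PoissonScheme k} {f : X.scheme ⟶ Y.scheme} (S : SmallSetup X Y f)

section Formulas

variable {W : S.𝒴.affineOpens} {U : S.𝒳'.affineOpens} {O : Y.scheme.Opens} {N : X.scheme.Opens}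

theorem evY_poissonDiff_zero (D : Sec (𝟙 Y.scheme) 0 O) (h : S.fib W ≤ O) (a b) :
    S.evY (poissonDiff (X := Y) (Y := Y) (𝟙 Y.scheme) 0 O D) h ![a, b] =
      Y.bracket _ (S.evY D h ![a]) b - Y.bracket _ (S.evY D h ![b]) a
        - S.evY D h ![Y.bracket _ a b] := by
  refine (ev_poissonDiff_zero (X := Y) D _ _).trans ?_
  simp only [pullFun_one]
  rfl

theorem evY_poissonDiff_one (D : Sec (𝟙 Y.scheme) 1 O) (h : S.fib W ≤ O) (a b c) :
    S.evY (poissonDiff (X := Y) (Y := Y) (𝟙 Y.scheme) 1 O D) h ![a, b, c] =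
      Y.bracket _ (S.evY D h ![b, c]) a - Y.bracket _ (S.evY D h ![a, c]) b
        + Y.bracket _ (S.evY D h ![a, b]) c
        + (S.evY D h ![Y.bracket _ a b, c] - S.evY D h ![Y.bracket _ a c, b]
          + S.evY D h ![Y.bracket _ b c, a]) := by
  refine (ev_poissonDiff_one (X := Y) D _ _).trans ?_
  simp only [pullFun_one]
  rfl

theorem evY_poissonDiff_two (D : Sec (𝟙 Y.scheme) 2 O) (h : S.fib W ≤ O) (a b c d) :
    S.evY (poissonDiff (X := Y) (Y := Y) (𝟙 Y.scheme) 2 O D) h ![a, b, c, d] =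
      -Y.bracket _ (S.evY D h ![b, c, d]) a + Y.bracket _ (S.evY D h ![a, c, d]) b
        - Y.bracket _ (S.evY D h ![a, b, d]) c + Y.bracket _ (S.evY D h ![a, b, c]) d
        - (S.evY D h ![Y.bracket _ a b, c, d] - S.evY D h ![Y.bracket _ a c, b, d]
          + S.evY D h ![Y.bracket _ b c, a, d] + S.evY D h ![Y.bracket _ a d, b, c]
          - S.evY D h ![Y.bracket _ b d, a, c] + S.evY D h ![Y.bracket _ c d, a, b]) := by
  refine (ev_poissonDiff_two (X := Y) D _ _).trans ?_
  simp only [pullFun_one]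
  rfl

theorem evX_poissonDiff_zero (D : Sec f 0 N) (h : S.η.incl ⁻¹ᵁ U.1 ≤ N)
    (hUW : S.i ⁻¹ᵁ U.1 ≤ S.ξ.map ⁻¹ᵁ W.1) (a b) :
    S.evX (poissonDiff f 0 N D) h hUW ![a, b] =
      X.bracket _ (S.evX D h hUW ![a]) (S.fR hUW b) - X.bracket _ (S.evX D h hUW ![b]) (S.fR hUW a)
        - S.evX D h hUW ![Y.bracket _ a b] :=
  ev_poissonDiff_zero (X := X) D _ _

theorem evX_poissonDiff_one (D : Sec f 1 N) (h : S.η.incl ⁻¹ᵁ U.1 ≤ N)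
    (hUW : S.i ⁻¹ᵁ U.1 ≤ S.ξ.map ⁻¹ᵁ W.1) (a b c) :
    S.evX (poissonDiff f 1 N D) h hUW ![a, b, c] =
      X.bracket _ (S.evX D h hUW ![b, c]) (S.fR hUW a)
        - X.bracket _ (S.evX D h hUW ![a, c]) (S.fR hUW b)
        + X.bracket _ (S.evX D h hUW ![a, b]) (S.fR hUW c)
        + (S.evX D h hUW ![Y.bracket _ a b, c] - S.evX D h hUW ![Y.bracket _ a c, b]
          + S.evX D h hUW ![Y.bracket _ b c, a]) :=
  ev_poissonDiff_one (X := X) D _ _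

variable {𝒱 : PtCover Y.scheme} {𝒰 : PtCover X.scheme} {q : ℕ}

theorem evY_cechDiff_one (c : Cochain (X := Y) (Y := Y) (𝟙 Y.scheme) 𝒱) {x y : Y.scheme}
    (h : S.fib W ≤ 𝒱.inter ![x, y]) (hx : S.fib W ≤ 𝒱.inter ![x]) (hy : S.fib W ≤ 𝒱.inter ![y])
    (a) : S.evY (cechDiff (X := Y) (Y := Y) (𝟙 Y.scheme) 𝒱 c 1 q ![x, y]) h a =
      S.evY (c 0 q ![y]) hy a - S.evY (c 0 q ![x]) hx a := by
  refine (ev_cechDiff (X := Y) c 0 q ![x, y] _ a).trans ?_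
  rw [Fin.sum_univ_two]
  have e0 : ![x, y] ∘ Fin.succAbove 0 = ![y] := by ext i; fin_cases i; rfl
  have e1 : ![x, y] ∘ Fin.succAbove 1 = ![x] := by ext i; fin_cases i; rfl
  rw [ev_cochain_congr (X := Y) c e0 _ (le_inf hy le_rfl),
    ev_cochain_congr (X := Y) c e1 _ (le_inf hx le_rfl)]
  simp [evY, sub_eq_add_neg]

theorem evY_cechDiff_two (c : Cochain (X := Y) (Y := Y) (𝟙 Y.scheme) 𝒱) {x y z : Y.scheme}
    (h : S.fib W ≤ 𝒱.inter ![x, y, z]) (hyz : S.fib W ≤ 𝒱.inter ![y, z])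
    (hxz : S.fib W ≤ 𝒱.inter ![x, z]) (hxy : S.fib W ≤ 𝒱.inter ![x, y]) (a) :
    S.evY (cechDiff (X := Y) (Y := Y) (𝟙 Y.scheme) 𝒱 c 2 q ![x, y, z]) h a =
      S.evY (c 1 q ![y, z]) hyz a - S.evY (c 1 q ![x, z]) hxz a + S.evY (c 1 q ![x, y]) hxy a := by
  refine (ev_cechDiff (X := Y) c 1 q ![x, y, z] _ a).trans ?_
  rw [Fin.sum_univ_three]
  have e0 : ![x, y, z] ∘ Fin.succAbove 0 = ![y, z] := by ext i; fin_cases i <;> rfl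
  have e1 : ![x, y, z] ∘ Fin.succAbove 1 = ![x, z] := by ext i; fin_cases i <;> rfl
  have e2 : ![x, y, z] ∘ Fin.succAbove 2 = ![x, y] := by ext i; fin_cases i <;> rfl
  rw [ev_cochain_congr (X := Y) c e0 _ (le_inf hyz le_rfl),
    ev_cochain_congr (X := Y) c e1 _ (le_inf hxz le_rfl),
    ev_cochain_congr (X := Y) c e2 _ (le_inf hxy le_rfl)]
  simp [evY, sub_eq_add_neg]

theorem evY_cechDiff_three (c : Cochain (X := Y) (Y := Y) (𝟙 Y.scheme) 𝒱) {x y z w : Y.scheme}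
    (h : S.fib W ≤ 𝒱.inter ![x, y, z, w]) (h₀ : S.fib W ≤ 𝒱.inter ![y, z, w])
    (h₁ : S.fib W ≤ 𝒱.inter ![x, z, w]) (h₂ : S.fib W ≤ 𝒱.inter ![x, y, w])
    (h₃ : S.fib W ≤ 𝒱.inter ![x, y, z]) (a) :
    S.evY (cechDiff (X := Y) (Y := Y) (𝟙 Y.scheme) 𝒱 c 3 q ![x, y, z, w]) h a =
      S.evY (c 2 q ![y, z, w]) h₀ a - S.evY (c 2 q ![x, z, w]) h₁ a
        + S.evY (c 2 q ![x, y, w]) h₂ a - S.evY (c 2 q ![x, y, z]) h₃ a := by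
  refine (ev_cechDiff (X := Y) c 2 q ![x, y, z, w] _ a).trans ?_
  rw [Fin.sum_univ_four]
  have e0 : ![x, y, z, w] ∘ Fin.succAbove 0 = ![y, z, w] := by ext i; fin_cases i <;> rfl
  have e1 : ![x, y, z, w] ∘ Fin.succAbove 1 = ![x, z, w] := by ext i; fin_cases i <;> rfl
  have e2 : ![x, y, z, w] ∘ Fin.succAbove 2 = ![x, y, w] := by ext i; fin_cases i <;> rfl
  have e3 : ![x, y, z, w] ∘ Fin.succAbove 3 = ![x, y, z] := by ext i; fin_cases i <;> rfl
  rw [ev_cochain_congr (X := Y) c e0 _ (le_inf h₀ le_rfl),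
    ev_cochain_congr (X := Y) c e1 _ (le_inf h₁ le_rfl),
    ev_cochain_congr (X := Y) c e2 _ (le_inf h₂ le_rfl),
    ev_cochain_congr (X := Y) c e3 _ (le_inf h₃ le_rfl)]
  have : (-1 : ℤ) ^ ((3 : Fin 4) : ℕ) = -1 := by decide
  rw [this]
  simp [evY, sub_eq_add_neg]

theorem evX_cechDiff_one (c : Cochain f 𝒰) {u v : X.scheme}
    (hUW : S.i ⁻¹ᵁ U.1 ≤ S.ξ.map ⁻¹ᵁ W.1)
    (h : S.η.incl ⁻¹ᵁ U.1 ≤ 𝒰.inter ![u, v]) (hu : S.η.incl ⁻¹ᵁ U.1 ≤ 𝒰.inter ![u])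
    (hv : S.η.incl ⁻¹ᵁ U.1 ≤ 𝒰.inter ![v]) (a) : S.evX (cechDiff f 𝒰 c 1 q ![u, v]) h hUW a =
      S.evX (c 0 q ![v]) hv hUW a - S.evX (c 0 q ![u]) hu hUW a := by
  refine (ev_cechDiff (X := X) c 0 q ![u, v] _ a).trans ?_
  rw [Fin.sum_univ_two]
  have e0 : ![u, v] ∘ Fin.succAbove 0 = ![v] := by ext i; fin_cases i; rfl
  have e1 : ![u, v] ∘ Fin.succAbove 1 = ![u] := by ext i; fin_cases i; rfl
  rw [ev_cochain_congr (X := X) c e0 _ (le_inf hv (S.preimage_i_le hUW)),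
    ev_cochain_congr (X := X) c e1 _ (le_inf hu (S.preimage_i_le hUW))]
  simp [evX, sub_eq_add_neg]

theorem evX_cechDiff_two (c : Cochain f 𝒰) {u v w : X.scheme}
    (hUW : S.i ⁻¹ᵁ U.1 ≤ S.ξ.map ⁻¹ᵁ W.1)
    (h : S.η.incl ⁻¹ᵁ U.1 ≤ 𝒰.inter ![u, v, w]) (hvw : S.η.incl ⁻¹ᵁ U.1 ≤ 𝒰.inter ![v, w])
    (huw : S.η.incl ⁻¹ᵁ U.1 ≤ 𝒰.inter ![u, w]) (huv : S.η.incl ⁻¹ᵁ U.1 ≤ 𝒰.inter ![u, v]) (a) :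
    S.evX (cechDiff f 𝒰 c 2 q ![u, v, w]) h hUW a =
      S.evX (c 1 q ![v, w]) hvw hUW a - S.evX (c 1 q ![u, w]) huw hUW a
        + S.evX (c 1 q ![u, v]) huv hUW a := by
  refine (ev_cechDiff (X := X) c 1 q ![u, v, w] _ a).trans ?_
  rw [Fin.sum_univ_three]
  have e0 : ![u, v, w] ∘ Fin.succAbove 0 = ![v, w] := by ext i; fin_cases i <;> rfl
  have e1 : ![u, v, w] ∘ Fin.succAbove 1 = ![u, w] := by ext i; fin_cases i <;> rfl
  have e2 : ![u, v, w] ∘ Fin.succAbove 2 = ![u, v] := by ext i; fin_cases i <;> rfl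
  rw [ev_cochain_congr (X := X) c e0 _ (le_inf hvw (S.preimage_i_le hUW)),
    ev_cochain_congr (X := X) c e1 _ (le_inf huw (S.preimage_i_le hUW)),
    ev_cochain_congr (X := X) c e2 _ (le_inf huv (S.preimage_i_le hUW))]
  simp [evX, sub_eq_add_neg]

/-- The section over `X` obtained from a cochain on `Y`. -/
theorem evX_cochainPull (hle : 𝒱.preimage f ≤ 𝒰) (c : Cochain (X := Y) (Y := Y) (𝟙 Y.scheme) 𝒱)
    {p : ℕ} (s : Fin (p + 1) → X.scheme) (hUW : S.i ⁻¹ᵁ U.1 ≤ S.ξ.map ⁻¹ᵁ W.1)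
    (h : S.η.incl ⁻¹ᵁ U.1 ≤ 𝒰.inter s) {s' : Fin (p + 1) → Y.scheme} (hs : f ∘ s = s')
    (hW : S.fib W ≤ 𝒱.inter s') (a) :
    S.evX (cochainRes f hle (cochainPull f 𝒱 c) p q s) h hUW a =
      S.fR hUW (S.evY (c p q s') hW a) := by
  subst hs
  exact (ev_secRes (PtCover.inter_mono hle s) _ _ a).trans
    (ev_secPull (PtCover.inter_preimage_le f 𝒱 s) _ _ (le_inf hW le_rfl) (S.preimage_i_le hUW) a)

theorem evY_cochainRes {𝒱' : PtCover Y.scheme} (hle : 𝒱 ≤ 𝒱')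
    (c : Cochain (X := Y) (Y := Y) (𝟙 Y.scheme) 𝒱) {p : ℕ} (s : Fin (p + 1) → Y.scheme)
    (h : S.fib W ≤ 𝒱'.inter s) (h' : S.fib W ≤ 𝒱.inter s) (a) :
    S.evY (cochainRes (X := Y) (Y := Y) (𝟙 Y.scheme) hle c p q s) h a = S.evY (c p q s) h' a :=
  ev_secRes (PtCover.inter_mono hle s) _ _ a

theorem evX_cochainRes {𝒰' : PtCover X.scheme} (hle : 𝒰 ≤ 𝒰') (c : Cochain f 𝒰) {p : ℕ}
    (s : Fin (p + 1) → X.scheme) (h : S.η.incl ⁻¹ᵁ U.1 ≤ 𝒰'.inter s)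
    (h' : S.η.incl ⁻¹ᵁ U.1 ≤ 𝒰.inter s) (hUW : S.i ⁻¹ᵁ U.1 ≤ S.ξ.map ⁻¹ᵁ W.1) (a) :
    S.evX (cochainRes f hle c p q s) h hUW a = S.evX (c p q s) h' hUW a :=
  ev_secRes (PtCover.inter_mono hle s) _ _ a

end Formulas

namespace LocalData

variable {S} {𝒱 : PtCover Y.scheme} {𝒰 : PtCover X.scheme} (L : S.LocalData 𝒱 𝒰)

section

variable {x y z : Y.scheme} {W : S.𝒴.affineOpens} (hx : S.fib W ≤ 𝒱.nhd x)
  (hy : S.fib W ≤ 𝒱.nhd y)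

theorem ρ_θ (p) : S.ρ W (L.θ hx hy p) = S.ρ W p := by
  rw [← L.toCharts.e_q hx, L.q_θ, L.toCharts.e_q]

/-- Transitions reduce to the identity on the special fibre, hence fix multiples of `t`. Corrections
can thus be compared across charts as sections over `Y`. -/
theorem θ_τ (s) : L.θ hx hy (S.τ W s) = S.τ W s :=
  (S.thickP W).map_tau (S.thickP W) (g₀ := RingHom.id _) (L.θ_cP hx hy) (L.ρ_θ hx hy) s

theorem ρ_br (p p') : S.ρ W (L.br hx p p') = Y.bracket (S.fib W) (S.ρ W p) (S.ρ W p') := by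
  rw [← L.toCharts.e_q hx, L.q_br, S.ξ.cod.incl_poisson.pullFun_bracket, L.toCharts.e_q,
    L.toCharts.e_q]

theorem br_τ (p s) : L.br hx p (S.τ W s) = S.τ W (Y.bracket _ (S.ρ W p) s) :=
  (S.thickP W).bracket_tau (L.br_bider hx) (L.ρ_br hx) p s

theorem br_τ_left (p s) : L.br hx (S.τ W s) p = S.τ W (Y.bracket _ s (S.ρ W p)) :=
  (S.thickP W).bracket_tau_left (L.br_bider hx) (L.ρ_br hx) p s

end

section

variable {z : X.scheme} {U : S.𝒳'.affineOpens} {W : S.𝒴.affineOpens}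
  (hU : S.η.incl ⁻¹ᵁ U.1 ≤ 𝒰.nhd z) (hW : S.fib W ≤ 𝒱.nhd (f z))
  (hUW : S.i ⁻¹ᵁ U.1 ≤ S.ξ.map ⁻¹ᵁ W.1)

theorem ρX_g (p) : S.ρX U (L.g hU hW hUW p) = S.fR hUW (S.ρ W p) := by
  have h1 : S.ξ.dom.incl ≫ S.i = S.η.incl := S.isBaseChange.2.1
  have h3 : S.η.incl ⁻¹ᵁ U.1 ≤ S.ξ.dom.incl ⁻¹ᵁ S.i ⁻¹ᵁ U.1 := by
    rw [← Scheme.Hom.comp_preimage, h1]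
  rw [ρX, ← pullFun_congr h1 h3, ← pullFun_pullFun S.ξ.dom.incl S.i h3 le_rfl, L.i_g,
    pullFun_pullFun, ← L.toCharts.e_q hW, fR, pullFun_pullFun]
  exact pullFun_congr S.ξ.induces _ _

/-- The local lifts act on corrections by `f^*`; this is where the pullback of cochains comes from.
-/
theorem g_τ (s) : L.g hU hW hUW (S.τ W s) = S.τX U (S.fR hUW s) :=
  (S.thickP W).map_tau (S.thickX U.2) (L.g_cP hU hW hUW) (L.ρX_g hU hW hUW) s

end

end LocalData

theorem ρX_bracket (U : S.𝒳'.affineOpens) (a b) :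
    S.ρX U (S.η.total.bracket U.1 a b) = X.bracket _ (S.ρX U a) (S.ρX U b) :=
  S.η.incl_poisson.pullFun_bracket _ _ _

theorem bracket_τX (U : S.𝒳'.affineOpens) (a s) :
    S.η.total.bracket U.1 a (S.τX U s) = S.τX U (X.bracket _ (S.ρX U a) s) :=
  (S.thickX U.2).bracket_tau (S.η.total.isAltBider U.1) (S.ρX_bracket U) a s

theorem bracket_τX_left (U : S.𝒳'.affineOpens) (a s) :
    S.η.total.bracket U.1 (S.τX U s) a = S.τX U (X.bracket _ s (S.ρX U a)) :=
  (S.thickX U.2).bracket_tau_left (S.η.total.isAltBider U.1) (S.ρX_bracket U) a s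

end SmallSetup

end

/-! ### Existence of the obstruction cochains -/

section

open TensorProduct

variable {k : Type u} [Field k]

namespace SmallSetup

variable {X Y : PoissonScheme k} {f : X.scheme ⟶ Y.scheme} {S : SmallSetup X Y f}

theorem ρ_surjective (W : S.𝒴.affineOpens) : Function.Surjective (S.ρ W) :=
  redTensor_surjective _ _

theorem mem_of_ρ_eq_zero (W : S.𝒴.affineOpens) (p) (h : S.ρ W p = 0) :
    p ∈ (RingHom.ker S.A'.aug.toRingHom).map (S.cP W) :=
  (redTensor_eq_zero_iff _ _ _).1 h

theorem ρ_cP (W : S.𝒴.affineOpens) (r) :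
    S.ρ W (S.cP W r) = constants Y.str (S.fib W) (S.A'.aug r) := redTensor_algebraMap _ _ _

theorem exists_const_eq (W : S.𝒴.affineOpens) (a : k) :
    ∃ r, constants Y.str (S.fib W) a = S.ρ W (S.cP W r) :=
  ⟨algebraMap k _ a, by rw [ρ_cP, AlgHom.commutes]; rfl⟩

namespace LocalData

variable {𝒱 : PtCover Y.scheme} {𝒰 : PtCover X.scheme} (L : S.LocalData 𝒱 𝒰)

/-- `θ` over two steps and over one step both lift the same change of charts over `A`, so they
differ by `t` times a vector field. -/
theorem exists_obs_gluing (s : Fin 3 → Y.scheme) :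
    ∃ D : Sec (𝟙 Y.scheme) 0 (𝒱.inter s), IsPolyvector Y.str (𝟙 Y.scheme) D ∧
      ∀ (W : S.𝒴.affineOpens) (h : S.fib W ≤ 𝒱.inter s) (h₀ : S.fib W ≤ 𝒱.nhd (s 0))
        (h₁ : S.fib W ≤ 𝒱.nhd (s 1)) (h₂ : S.fib W ≤ 𝒱.nhd (s 2)) (p),
        L.θ h₀ h₁ (L.θ h₁ h₂ p) = L.θ h₀ h₂ p + S.τ W (S.evY D h ![S.ρ W p]) := by
  have hs : ∀ {W : S.𝒴.affineOpens}, S.fib W ≤ 𝒱.inter s → ∀ i, S.fib W ≤ 𝒱.nhd (s i) :=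
    fun h i => PtCover.le_inter_iff.1 h i
  obtain ⟨D, hD, H⟩ := S.exists_secY (𝒱.inter s)
    (fun W h p => L.θ (hs h 0) (hs h 1) (L.θ (hs h 1) (hs h 2) (p 0)) -
      L.θ (hs h 0) (hs h 2) (p 0)) (fun W h => by
      obtain ⟨E, hE, hE'⟩ := (L.thick (hs h 0)).exists_der (ρ_surjective W) (mem_of_ρ_eq_zero W)
        (exists_const_eq W) (ψ := RingHom.id _)
        (g := (L.θ (hs h 0) (hs h 1)).comp (L.θ (hs h 1) (hs h 2))) (g' := L.θ (hs h 0) (hs h 2))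
        (fun r => by rw [RingHom.comp_apply, θ_cP, θ_cP]) (fun r => by rw [θ_cP])
        (fun p => by rw [RingHom.comp_apply, q_θ, q_θ, q_θ])
        (fun p => by rw [RingHom.comp_apply, ρ_θ, ρ_θ, RingHom.id_apply])
      refine ⟨E, hE, fun p => ?_⟩
      have := hE' (p 0)
      rw [RingHom.comp_apply] at this
      rw [this, add_sub_cancel_left, vec_one_eq fun i => S.ρ W (p i)]
      rfl)
    (fun W W' h h' p => by rw [map_sub, θ_res, θ_res, θ_res])
  refine ⟨D, hD, fun W h h₀ h₁ h₂ p => ?_⟩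
  have := H W h ![p]
  rw [vec_one_eq fun i => S.ρ W (![p] i)] at this
  rw [add_comm]
  exact sub_eq_iff_eq_add.1 this

/-- Over `A` both charts carry the bracket of `𝒴`, so the transition preserves the lifted brackets
up to `t` times a bivector field. -/
theorem exists_obs_bracket (s : Fin 2 → Y.scheme) :
    ∃ D : Sec (𝟙 Y.scheme) 1 (𝒱.inter s), IsPolyvector Y.str (𝟙 Y.scheme) D ∧
      ∀ (W : S.𝒴.affineOpens) (h : S.fib W ≤ 𝒱.inter s) (h₀ : S.fib W ≤ 𝒱.nhd (s 0))
        (h₁ : S.fib W ≤ 𝒱.nhd (s 1)) (p p'), L.θ h₀ h₁ (L.br h₁ p p') =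
          L.br h₀ (L.θ h₀ h₁ p) (L.θ h₀ h₁ p') + S.τ W (S.evY D h ![S.ρ W p, S.ρ W p']) := by
  have hs : ∀ {W : S.𝒴.affineOpens}, S.fib W ≤ 𝒱.inter s → ∀ i, S.fib W ≤ 𝒱.nhd (s i) :=
    fun h i => PtCover.le_inter_iff.1 h i
  obtain ⟨D, hD, H⟩ := S.exists_secY (𝒱.inter s)
    (fun W h p => L.θ (hs h 0) (hs h 1) (L.br (hs h 1) (p 0) (p 1)) -
      L.br (hs h 0) (L.θ (hs h 0) (hs h 1) (p 0)) (L.θ (hs h 0) (hs h 1) (p 1))) (fun W h => by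
      have b₀ := L.br_bider (hs h 0)
      have b₁ := L.br_bider (hs h 1)
      obtain ⟨E, hE, hE'⟩ := (L.thick (hs h 0)).exists_bider (ρ_surjective W) (mem_of_ρ_eq_zero W)
        (exists_const_eq W) (ψ := RingHom.id _) (g := L.θ (hs h 0) (hs h 1))
        (fun p => by rw [ρ_θ, RingHom.id_apply])
        (d := fun p p' => L.θ (hs h 0) (hs h 1) (L.br (hs h 1) p p') -
          L.br (hs h 0) (L.θ (hs h 0) (hs h 1) p) (L.θ (hs h 0) (hs h 1) p'))
        (fun x y z => by simp only [b₁.add_right, map_add, b₀.add_right]; ring)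
        (fun x y => by
          rw [b₁.anti, b₀.anti, map_neg]; ring)
        (fun x => by rw [b₁.self, b₀.self, map_zero, sub_zero])
        (fun x y z => by simp only [b₁.mul_right, map_add, map_mul, b₀.mul_right]; ring)
        (fun x r => by simp only [b₁.const_right, θ_cP, b₀.const_right, map_zero, sub_zero])
        (L.θ_cP _ _)
        (fun x y => by simp only [map_sub, q_θ, q_br, sub_self])
      refine ⟨E, hE, fun p => ?_⟩
      rw [vec_two_eq fun i => S.ρ W (p i)]
      exact hE' (p 0) (p 1))
    (fun W W' h h' p => by rw [map_sub, θ_res, br_res, br_res, θ_res, θ_res])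
  refine ⟨D, hD, fun W h h₀ h₁ p p' => ?_⟩
  have := H W h ![p, p']
  rw [vec_two_eq fun i => S.ρ W (![p, p'] i)] at this
  rw [add_comm]
  exact sub_eq_iff_eq_add.1 this

/-- The Jacobi identity holds over `A`, so the Jacobiator of the lifted bracket is `t` times a
trivector field. -/
theorem exists_obs_jacobi (s : Fin 1 → Y.scheme) :
    ∃ D : Sec (𝟙 Y.scheme) 2 (𝒱.inter s), IsPolyvector Y.str (𝟙 Y.scheme) D ∧
      ∀ (W : S.𝒴.affineOpens) (h : S.fib W ≤ 𝒱.inter s) (h₀ : S.fib W ≤ 𝒱.nhd (s 0)) (p p' p''),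
        jacobiator (L.br h₀) p p' p'' = S.τ W (S.evY D h ![S.ρ W p, S.ρ W p', S.ρ W p'']) := by
  have hs : ∀ {W : S.𝒴.affineOpens}, S.fib W ≤ 𝒱.inter s → ∀ i, S.fib W ≤ 𝒱.nhd (s i) :=
    fun h i => PtCover.le_inter_iff.1 h i
  obtain ⟨D, hD, H⟩ := S.exists_secY (𝒱.inter s)
    (fun W h p => jacobiator (L.br (hs h 0)) (p 0) (p 1) (p 2)) (fun W h => by
      obtain ⟨E, hE, hE'⟩ := (L.thick (hs h 0)).exists_trider (ρ_surjective W)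
        (mem_of_ρ_eq_zero W) (exists_const_eq W) (ψ := RingHom.id _) (fun x => rfl)
        (L.br_bider (hs h 0)) (fun x y z => by
          simp only [jacobiator, map_add, q_br]
          exact S.ξ.cod.total.jacobiator_eq_zero W.1 _ _ _)
      refine ⟨E, hE, fun p => ?_⟩
      rw [vec_three_eq fun i => S.ρ W (p i)]
      exact hE' (p 0) (p 1) (p 2))
    (fun W W' h h' p => by simp only [jacobiator, map_add, br_res])
  refine ⟨D, hD, fun W h h₀ p p' p'' => ?_⟩
  have := H W h ![p, p', p'']
  rw [vec_three_eq fun i => S.ρ W (![p, p', p''] i)] at this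
  exact this

/-- On an overlap both local homomorphisms lift the one morphism over `A`; their discrepancy is a
derivation along `f`. -/
theorem exists_obs_map (s : Fin 2 → X.scheme) :
    ∃ D : Sec f 0 (𝒰.inter s), IsPolyvector Y.str f D ∧
      ∀ (U : S.𝒳'.affineOpens) (W : S.𝒴.affineOpens) (h : S.η.incl ⁻¹ᵁ U.1 ≤ 𝒰.inter s)
        (h₀ : S.η.incl ⁻¹ᵁ U.1 ≤ 𝒰.nhd (s 0)) (h₁ : S.η.incl ⁻¹ᵁ U.1 ≤ 𝒰.nhd (s 1))
        (w₀ : S.fib W ≤ 𝒱.nhd (f (s 0))) (w₁ : S.fib W ≤ 𝒱.nhd (f (s 1)))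
        (hUW : S.i ⁻¹ᵁ U.1 ≤ S.ξ.map ⁻¹ᵁ W.1) (p),
        L.g h₀ w₀ hUW (L.θ w₀ w₁ p) =
          L.g h₁ w₁ hUW p + S.τX U (S.evX D h hUW ![S.ρ W p]) := by
  have hs : ∀ {U : S.𝒳'.affineOpens}, S.η.incl ⁻¹ᵁ U.1 ≤ 𝒰.inter s →
    ∀ i, S.η.incl ⁻¹ᵁ U.1 ≤ 𝒰.nhd (s i) := fun h i => PtCover.le_inter_iff.1 h i
  have hw : ∀ {W : S.𝒴.affineOpens}, S.fib W ≤ 𝒱.inter (f ∘ s) →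
    ∀ i, S.fib W ≤ 𝒱.nhd (f (s i)) := fun h i => PtCover.le_inter_iff.1 h i
  obtain ⟨D, hD, H⟩ := S.exists_secX (𝒰.inter s) (𝒱.inter (f ∘ s))
    ((PtCover.inter_mono L.le s).trans (PtCover.inter_preimage_le f 𝒱 s))
    (fun U W h w hUW p => L.g (hs h 0) (hw w 0) hUW (L.θ (hw w 0) (hw w 1) (p 0)) -
      L.g (hs h 1) (hw w 1) hUW (p 0)) (fun U W h w hUW => by
      obtain ⟨E, hE, hE'⟩ := (S.thickX U.2).exists_der (ρ_surjective W) (mem_of_ρ_eq_zero W)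
        (exists_const_eq W) (ψ := S.fR hUW)
        (g := (L.g (hs h 0) (hw w 0) hUW).comp (L.θ (hw w 0) (hw w 1)))
        (g' := L.g (hs h 1) (hw w 1) hUW)
        (fun r => by rw [RingHom.comp_apply, θ_cP, g_cP]) (fun r => by rw [g_cP])
        (fun p => by rw [RingHom.comp_apply, i_g, i_g, q_θ])
        (fun p => by
          rw [RingHom.comp_apply]
          exact (L.ρX_g _ _ _ _).trans (by rw [ρ_θ]))
      refine ⟨E, hE, fun p => ?_⟩
      have := hE' (p 0)
      rw [RingHom.comp_apply] at this
      rw [this, add_sub_cancel_left, vec_one_eq fun i => S.ρ W (p i)])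
    (fun U U' W W' hU hW hUW hUW' h h' p => by
      rw [map_sub, L.g_res _ _ hUW hUW' h h', L.g_res _ _ hUW hUW' h h', θ_res])
  refine ⟨D, hD, fun U W h h₀ h₁ w₀ w₁ hUW p => ?_⟩
  have w : S.fib W ≤ 𝒱.inter (f ∘ s) :=
    PtCover.le_inter_iff.2 fun i => by fin_cases i; exacts [w₀, w₁]
  have := H U W h w hUW ![p]
  rw [vec_one_eq fun i => S.ρ W (![p] i)] at this
  rw [add_comm]
  exact sub_eq_iff_eq_add.1 this

/-- The morphism over `A` is Poisson, so its local lift is Poisson up to `t` times a biderivation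
along `f`. -/
theorem exists_obs_poisson (s : Fin 1 → X.scheme) :
    ∃ D : Sec f 1 (𝒰.inter s), IsPolyvector Y.str f D ∧
      ∀ (U : S.𝒳'.affineOpens) (W : S.𝒴.affineOpens) (h : S.η.incl ⁻¹ᵁ U.1 ≤ 𝒰.inter s)
        (h₀ : S.η.incl ⁻¹ᵁ U.1 ≤ 𝒰.nhd (s 0)) (w₀ : S.fib W ≤ 𝒱.nhd (f (s 0)))
        (hUW : S.i ⁻¹ᵁ U.1 ≤ S.ξ.map ⁻¹ᵁ W.1) (p p'),
        L.g h₀ w₀ hUW (L.br w₀ p p') =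
          S.η.total.bracket U.1 (L.g h₀ w₀ hUW p) (L.g h₀ w₀ hUW p') +
            S.τX U (S.evX D h hUW ![S.ρ W p, S.ρ W p']) := by
  have hs : ∀ {U : S.𝒳'.affineOpens}, S.η.incl ⁻¹ᵁ U.1 ≤ 𝒰.inter s →
    ∀ i, S.η.incl ⁻¹ᵁ U.1 ≤ 𝒰.nhd (s i) := fun h i => PtCover.le_inter_iff.1 h i
  have hw : ∀ {W : S.𝒴.affineOpens}, S.fib W ≤ 𝒱.inter (f ∘ s) →
    ∀ i, S.fib W ≤ 𝒱.nhd (f (s i)) := fun h i => PtCover.le_inter_iff.1 h i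
  obtain ⟨D, hD, H⟩ := S.exists_secX (𝒰.inter s) (𝒱.inter (f ∘ s))
    ((PtCover.inter_mono L.le s).trans (PtCover.inter_preimage_le f 𝒱 s))
    (fun U W h w hUW p => L.g (hs h 0) (hw w 0) hUW (L.br (hw w 0) (p 0) (p 1)) -
      S.η.total.bracket U.1 (L.g (hs h 0) (hw w 0) hUW (p 0))
        (L.g (hs h 0) (hw w 0) hUW (p 1))) (fun U W h w hUW => by
      have b₀ := S.η.total.isAltBider U.1
      have b₁ := L.br_bider (hw w 0)
      obtain ⟨E, hE, hE'⟩ := (S.thickX U.2).exists_bider (ρ_surjective W) (mem_of_ρ_eq_zero W)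
        (exists_const_eq W) (ψ := S.fR hUW) (g := L.g (hs h 0) (hw w 0) hUW)
        (fun p => L.ρX_g _ _ _ p)
        (d := fun p p' => L.g (hs h 0) (hw w 0) hUW (L.br (hw w 0) p p') -
          S.η.total.bracket U.1 (L.g (hs h 0) (hw w 0) hUW p) (L.g (hs h 0) (hw w 0) hUW p'))
        (fun x y z => by simp only [b₁.add_right, map_add, b₀.add_right]; ring)
        (fun x y => by
          rw [b₁.anti, b₀.anti, map_neg]; ring)
        (fun x => by rw [b₁.self, b₀.self, map_zero, sub_zero])
        (fun x y z => by simp only [b₁.mul_right, map_add, map_mul, b₀.mul_right]; ring)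
        (fun x r => by simp only [b₁.const_right, g_cP, b₀.const_right, map_zero, sub_zero])
        (L.g_cP _ _ _)
        (fun x y => by
          rw [map_sub, i_g, S.isBaseChange.2.2.pullFun_bracket, i_g, i_g, q_br,
            S.ξ.map_poisson.pullFun_bracket, sub_self])
      refine ⟨E, hE, fun p => ?_⟩
      rw [vec_two_eq fun i => S.ρ W (p i)]
      exact hE' (p 0) (p 1))
    (fun U U' W W' hU hW hUW hUW' h h' p => by
      rw [map_sub, L.g_res _ _ hUW hUW' h h', S.η.total.bracket_res, L.g_res _ _ hUW hUW' h h',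
        L.g_res _ _ hUW hUW' h h', br_res])
  refine ⟨D, hD, fun U W h h₀ w₀ hUW p p' => ?_⟩
  have w : S.fib W ≤ 𝒱.inter (f ∘ s) :=
    PtCover.le_inter_iff.2 fun i => by fin_cases i; exact w₀
  have := H U W h w hUW ![p, p']
  rw [vec_two_eq fun i => S.ρ W (![p, p'] i)] at this
  rw [add_comm]
  exact sub_eq_iff_eq_add.1 this

end LocalData

end SmallSetup

end

/-! ### The obstruction is a cocycle -/

section

open TensorProduct

variable {k : Type u} [Field k]

theorem eq_vec_four {B : Type*} (a : Fin 4 → B) : a = ![a 0, a 1, a 2, a 3] := by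
  ext i; fin_cases i <;> rfl

namespace SmallSetup

variable {X Y : PoissonScheme k} {f : X.scheme ⟶ Y.scheme} {S : SmallSetup X Y f}

section

variable {W : S.𝒴.affineOpens} {U : S.𝒳'.affineOpens}

theorem τ_add (x y) : S.τ W (x + y) = S.τ W x + S.τ W y := (S.thickP W).tau_add x y
theorem τ_sub (x y) : S.τ W (x - y) = S.τ W x - S.τ W y := (S.thickP W).tau_sub x y
theorem τ_neg (x) : S.τ W (-x) = -S.τ W x := (S.thickP W).tau_neg x
theorem τ_zero : S.τ W 0 = 0 := (S.thickP W).tau_zero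
theorem τ_inj {x y} (h : S.τ W x = S.τ W y) : x = y := (S.thickP W).tau_inj h
theorem ρ_τ (x) : S.ρ W (S.τ W x) = 0 := (S.thickP W).rho_tau x
theorem τX_add (x y) : S.τX U (x + y) = S.τX U x + S.τX U y := (S.thickX U.2).tau_add x y
theorem τX_sub (x y) : S.τX U (x - y) = S.τX U x - S.τX U y := (S.thickX U.2).tau_sub x y
theorem τX_neg (x) : S.τX U (-x) = -S.τX U x := (S.thickX U.2).tau_neg x
theorem τX_zero : S.τX U 0 = 0 := (S.thickX U.2).tau_zero
theorem τX_inj {x y} (h : S.τX U x = S.τX U y) : x = y := (S.thickX U.2).tau_inj h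
theorem ρX_τX (x) : S.ρX U (S.τX U x) = 0 := (S.thickX U.2).rho_tau x

end

section Formulas

variable {W : S.𝒴.affineOpens} {U : S.𝒳'.affineOpens} {𝒱 : PtCover Y.scheme}
  {𝒰 : PtCover X.scheme} (c : Cochain (X := Y) (Y := Y) (𝟙 Y.scheme) 𝒱) (d : Cochain f 𝒰)

theorem evY_totalDiff (p q : ℕ) (s) (h : S.fib W ≤ 𝒱.inter s) (a) :
    S.evY (totalDiff (X := Y) (Y := Y) (𝟙 Y.scheme) 𝒱 c p q s) h a =
      S.evY (cechDiff (X := Y) (Y := Y) (𝟙 Y.scheme) 𝒱 c p q s) h a +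
      S.evY (vertDiff (X := Y) (Y := Y) (𝟙 Y.scheme) 𝒱 c p q s) h a :=
  ev_add _ _ _ a

theorem evX_totalDiff (p q : ℕ) (s) (h : S.η.incl ⁻¹ᵁ U.1 ≤ 𝒰.inter s)
    (hUW : S.i ⁻¹ᵁ U.1 ≤ S.ξ.map ⁻¹ᵁ W.1) (a) :
    S.evX (totalDiff f 𝒰 d p q s) h hUW a = S.evX (cechDiff f 𝒰 d p q s) h hUW a +
      S.evX (vertDiff f 𝒰 d p q s) h hUW a :=
  ev_add _ _ _ a

theorem evY_zero {q : ℕ} {O : Y.scheme.Opens} (h : S.fib W ≤ O) (a) :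
    S.evY (0 : Sec (𝟙 Y.scheme) q O) h a = 0 := map_zero _

theorem evY_neg {q : ℕ} {O : Y.scheme.Opens} (D : Sec (𝟙 Y.scheme) q O) (h : S.fib W ≤ O) (a) :
    S.evY (-D) h a = -S.evY D h a := map_neg _ _

theorem evX_add {q : ℕ} {N : X.scheme.Opens} (D D' : Sec f q N) (h : S.η.incl ⁻¹ᵁ U.1 ≤ N)
    (hUW : S.i ⁻¹ᵁ U.1 ≤ S.ξ.map ⁻¹ᵁ W.1) (a) :
    S.evX (D + D') h hUW a = S.evX D h hUW a + S.evX D' h hUW a := ev_add _ _ _ a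

theorem evY_vertDiff (p q : ℕ) (s) (h : S.fib W ≤ 𝒱.inter s) (a) :
    S.evY (vertDiff (X := Y) (Y := Y) (𝟙 Y.scheme) 𝒱 c p (q + 1) s) h a =
      (-1 : ℤ) ^ p • S.evY (poissonDiff (X := Y) (Y := Y) (𝟙 Y.scheme) q _ (c p q s)) h a :=
  map_zsmul _ _ _

theorem evX_vertDiff (p q : ℕ) (s) (h : S.η.incl ⁻¹ᵁ U.1 ≤ 𝒰.inter s)
    (hUW : S.i ⁻¹ᵁ U.1 ≤ S.ξ.map ⁻¹ᵁ W.1) (a) :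
    S.evX (vertDiff f 𝒰 d p (q + 1) s) h hUW a =
      (-1 : ℤ) ^ p • S.evX (poissonDiff f q _ (d p q s)) h hUW a :=
  map_zsmul _ _ _

theorem evY_vertDiff_zero (p : ℕ) (s) (h : S.fib W ≤ 𝒱.inter s) (a) :
    S.evY (vertDiff (X := Y) (Y := Y) (𝟙 Y.scheme) 𝒱 c p 0 s) h a = 0 := map_zero _

theorem evX_vertDiff_zero (p : ℕ) (s) (h : S.η.incl ⁻¹ᵁ U.1 ≤ 𝒰.inter s)
    (hUW : S.i ⁻¹ᵁ U.1 ≤ S.ξ.map ⁻¹ᵁ W.1) (a) :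
    S.evX (vertDiff f 𝒰 d p 0 s) h hUW a = 0 := map_zero _

theorem evY_cechDiff_zero (q : ℕ) (s) (h : S.fib W ≤ 𝒱.inter s) (a) :
    S.evY (cechDiff (X := Y) (Y := Y) (𝟙 Y.scheme) 𝒱 c 0 q s) h a = 0 := map_zero _

theorem evX_cechDiff_zero (q : ℕ) (s) (h : S.η.incl ⁻¹ᵁ U.1 ≤ 𝒰.inter s)
    (hUW : S.i ⁻¹ᵁ U.1 ≤ S.ξ.map ⁻¹ᵁ W.1) (a) :
    S.evX (cechDiff f 𝒰 d 0 q s) h hUW a = 0 := map_zero _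

end Formulas

namespace LocalData

variable {𝒱 : PtCover Y.scheme} {𝒰 : PtCover X.scheme} (L : S.LocalData 𝒱 𝒰)

/-- The obstruction to a choice of local data being a Poisson deformation of the target. -/
def obs : Cochain (X := Y) (Y := Y) (𝟙 Y.scheme) 𝒱
  | 2, 0, s => (L.exists_obs_gluing s).choose
  | 1, 1, s => (L.exists_obs_bracket s).choose
  | 0, 2, s => (L.exists_obs_jacobi s).choose
  | _, _, _ => 0

/-- The obstruction to the local maps being a Poisson morphism. -/
def obsMap : Cochain f 𝒰
  | 1, 0, s => (L.exists_obs_map s).choose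
  | 0, 1, s => (L.exists_obs_poisson s).choose
  | _, _, _ => 0

theorem obs_mem : L.obs ∈ cochains (X := Y) (Y := Y) (𝟙 Y.scheme) 𝒱 2 := by
  refine ⟨fun p q s => ?_, fun p q h => funext fun s => ?_⟩
  · unfold obs
    split
    · exact (L.exists_obs_gluing _).choose_spec.1
    · exact (L.exists_obs_bracket _).choose_spec.1
    · exact (L.exists_obs_jacobi _).choose_spec.1
    · exact IsPolyvector.zero (X := Y) _
  · unfold obs
    split
    · omega
    · omega
    · omega
    · rfl

theorem obsMap_mem : L.obsMap ∈ cochains f 𝒰 1 := by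
  refine ⟨fun p q s => ?_, fun p q h => funext fun s => ?_⟩
  · unfold obsMap
    split
    · exact (L.exists_obs_map _).choose_spec.1
    · exact (L.exists_obs_poisson _).choose_spec.1
    · exact IsPolyvector.zero _
  · unfold obsMap
    split
    · omega
    · omega
    · rfl

section

variable {W : S.𝒴.affineOpens} {x y z : Y.scheme}

theorem θ_comp (hx : S.fib W ≤ 𝒱.nhd x) (hy : S.fib W ≤ 𝒱.nhd y) (hz : S.fib W ≤ 𝒱.nhd z)
    (h : S.fib W ≤ 𝒱.inter ![x, y, z]) (p) :
    L.θ hx hy (L.θ hy hz p) = L.θ hx hz p + S.τ W (S.evY (L.obs 2 0 ![x, y, z]) h ![S.ρ W p]) :=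
  (L.exists_obs_gluing ![x, y, z]).choose_spec.2 W h hx hy hz p

theorem θ_bracket (hx : S.fib W ≤ 𝒱.nhd x) (hy : S.fib W ≤ 𝒱.nhd y)
    (h : S.fib W ≤ 𝒱.inter ![x, y]) (p p') : L.θ hx hy (L.br hy p p') =
      L.br hx (L.θ hx hy p) (L.θ hx hy p') +
        S.τ W (S.evY (L.obs 1 1 ![x, y]) h ![S.ρ W p, S.ρ W p']) :=
  (L.exists_obs_bracket ![x, y]).choose_spec.2 W h hx hy p p'

theorem br_jacobi (hx : S.fib W ≤ 𝒱.nhd x) (h : S.fib W ≤ 𝒱.inter ![x]) (p p' p'') :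
    jacobiator (L.br hx) p p' p'' =
      S.τ W (S.evY (L.obs 0 2 ![x]) h ![S.ρ W p, S.ρ W p', S.ρ W p'']) :=
  (L.exists_obs_jacobi ![x]).choose_spec.2 W h hx p p' p''

end

section

variable {U : S.𝒳'.affineOpens} {W : S.𝒴.affineOpens} {u v : X.scheme}

theorem g_θ (hu : S.η.incl ⁻¹ᵁ U.1 ≤ 𝒰.nhd u) (hv : S.η.incl ⁻¹ᵁ U.1 ≤ 𝒰.nhd v)
    (wu : S.fib W ≤ 𝒱.nhd (f u)) (wv : S.fib W ≤ 𝒱.nhd (f v))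
    (hUW : S.i ⁻¹ᵁ U.1 ≤ S.ξ.map ⁻¹ᵁ W.1) (h : S.η.incl ⁻¹ᵁ U.1 ≤ 𝒰.inter ![u, v]) (p) :
    L.g hu wu hUW (L.θ wu wv p) =
      L.g hv wv hUW p + S.τX U (S.evX (L.obsMap 1 0 ![u, v]) h hUW ![S.ρ W p]) :=
  (L.exists_obs_map ![u, v]).choose_spec.2 U W h hu hv wu wv hUW p

theorem g_bracket (hu : S.η.incl ⁻¹ᵁ U.1 ≤ 𝒰.nhd u) (wu : S.fib W ≤ 𝒱.nhd (f u))
    (hUW : S.i ⁻¹ᵁ U.1 ≤ S.ξ.map ⁻¹ᵁ W.1) (h : S.η.incl ⁻¹ᵁ U.1 ≤ 𝒰.inter ![u]) (p p') :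
    L.g hu wu hUW (L.br wu p p') =
      S.η.total.bracket U.1 (L.g hu wu hUW p) (L.g hu wu hUW p') +
        S.τX U (S.evX (L.obsMap 0 1 ![u]) h hUW ![S.ρ W p, S.ρ W p']) :=
  (L.exists_obs_poisson ![u]).choose_spec.2 U W h hu wu hUW p p'

end

/-- The composite of three consecutive transitions, bracketed in the two possible ways, gives the
Čech cocycle identity. -/
theorem obs_totalDiff_three_zero (s) :
    totalDiff (X := Y) (Y := Y) (𝟙 Y.scheme) 𝒱 L.obs 3 0 s = 0 := by
  obtain ⟨x, y, z, w, rfl⟩ : ∃ x y z w, s = ![x, y, z, w] := ⟨_, _, _, _, eq_vec_four s⟩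
  refine S.secY_ext (isResCompatible_totalDiff (X := Y) L.obs_mem 3 0 _)
    (fun _ _ => map_zero _) fun W h p => ?_
  have H := PtCover.le_inter_iff.1 h
  have hx : S.fib W ≤ 𝒱.nhd x := H 0
  have hy : S.fib W ≤ 𝒱.nhd y := H 1
  have hz : S.fib W ≤ 𝒱.nhd z := H 2
  have hw : S.fib W ≤ 𝒱.nhd w := H 3
  have h₀ := PtCover.le_inter_three hy hz hw
  have h₁ := PtCover.le_inter_three hx hz hw
  have h₂ := PtCover.le_inter_three hx hy hw
  have h₃ := PtCover.le_inter_three hx hy hz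
  rw [evY_totalDiff, evY_vertDiff_zero, add_zero, evY_cechDiff_three S _ h h₀ h₁ h₂ h₃, evY_zero,
    vec_one_eq fun i => S.ρ W (p i)]
  generalize p 0 = p
  have e1 : L.θ hx hy (L.θ hy hz (L.θ hz hw p)) = L.θ hx hw p +
      S.τ W (S.evY (L.obs 2 0 ![x, y, w]) h₂ ![S.ρ W p]) +
      S.τ W (S.evY (L.obs 2 0 ![y, z, w]) h₀ ![S.ρ W p]) := by
    rw [L.θ_comp hy hz hw h₀, map_add, L.θ_comp hx hy hw h₂, θ_τ]
  rw [L.θ_comp hx hy hz h₃, L.θ_comp hx hz hw h₁, ρ_θ] at e1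
  apply τ_inj
  rw [τ_sub, τ_add, τ_sub, τ_zero]
  linear_combination -e1

/-- Two consecutive transitions are applied to a bracket, once step by step and once through their
composite. The derivation correcting the composite contributes the term `π`. -/
theorem obs_totalDiff_two_one (s) :
    totalDiff (X := Y) (Y := Y) (𝟙 Y.scheme) 𝒱 L.obs 2 1 s = 0 := by
  obtain ⟨x, y, z, rfl⟩ : ∃ x y z, s = ![x, y, z] := ⟨_, _, _, vec_three_eq s⟩
  refine S.secY_ext (isResCompatible_totalDiff (X := Y) L.obs_mem 2 1 _)
    (fun _ _ => map_zero _) fun W h p => ?_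
  have H := PtCover.le_inter_iff.1 h
  have hx : S.fib W ≤ 𝒱.nhd x := H 0
  have hy : S.fib W ≤ 𝒱.nhd y := H 1
  have hz : S.fib W ≤ 𝒱.nhd z := H 2
  have hyz := PtCover.le_inter_two hy hz
  have hxz := PtCover.le_inter_two hx hz
  have hxy := PtCover.le_inter_two hx hy
  rw [evY_totalDiff, evY_vertDiff, evY_cechDiff_two S _ h hyz hxz hxy, evY_zero,
    vec_two_eq fun i => S.ρ W (p i), evY_poissonDiff_zero]
  generalize p 0 = p, p 1 = p'
  have e1 : L.θ hx hy (L.θ hy hz (L.br hz p p')) =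
      L.br hx (L.θ hx hz p + S.τ W (S.evY (L.obs 2 0 ![x, y, z]) h ![S.ρ W p]))
        (L.θ hx hz p' + S.τ W (S.evY (L.obs 2 0 ![x, y, z]) h ![S.ρ W p'])) +
      S.τ W (S.evY (L.obs 1 1 ![x, y]) hxy ![S.ρ W p, S.ρ W p']) +
      S.τ W (S.evY (L.obs 1 1 ![y, z]) hyz ![S.ρ W p, S.ρ W p']) := by
    rw [L.θ_bracket hy hz hyz, map_add, L.θ_bracket hx hy hxy, θ_τ, L.θ_comp hx hy hz h,
      L.θ_comp hx hy hz h, ρ_θ, ρ_θ]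
  have b := L.br_bider hx
  rw [L.θ_comp hx hy hz h, L.θ_bracket hx hz hxz, ρ_br, b.add_left, b.add_right, b.add_right,
    br_τ_left, br_τ, br_τ, ρ_θ, ρ_θ, ρ_τ, (Y.isAltBider _).zero_left,
    τ_zero,
    (Y.isAltBider _).anti (S.ρ W p) (S.evY (L.obs 2 0 ![x, y, z]) h ![S.ρ W p'])] at e1
  apply τ_inj
  simp only [even_two, Even.neg_pow, one_pow, one_smul, τ_sub,
    τ_add, τ_zero, τ_neg] at e1 ⊢
  linear_combination -e1

/-- A transition carries the Jacobiator of one local bracket to that of the other, up to the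
linearised Jacobiator of the bracket discrepancy, which is its `π`. -/
theorem obs_totalDiff_one_two (s) :
    totalDiff (X := Y) (Y := Y) (𝟙 Y.scheme) 𝒱 L.obs 1 2 s = 0 := by
  obtain ⟨x, y, rfl⟩ : ∃ x y, s = ![x, y] := ⟨_, _, vec_two_eq s⟩
  refine S.secY_ext (isResCompatible_totalDiff (X := Y) L.obs_mem 1 2 _)
    (fun _ _ => map_zero _) fun W h p => ?_
  have H := PtCover.le_inter_iff.1 h
  have hx : S.fib W ≤ 𝒱.nhd x := H 0
  have hy : S.fib W ≤ 𝒱.nhd y := H 1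
  have hx1 := PtCover.le_inter_one hx
  have hy1 := PtCover.le_inter_one hy
  rw [evY_totalDiff, evY_vertDiff, evY_cechDiff_one S _ h hx1 hy1, evY_zero,
    vec_three_eq fun i => S.ρ W (p i), evY_poissonDiff_one]
  generalize p 0 = a, p 1 = b, p 2 = c
  have bx := L.br_bider hx
  have key : ∀ a b c, L.θ hx hy (L.br hy (L.br hy a b) c) =
      L.br hx (L.br hx (L.θ hx hy a) (L.θ hx hy b)) (L.θ hx hy c) +
      S.τ W (Y.bracket _ (S.evY (L.obs 1 1 ![x, y]) h ![S.ρ W a, S.ρ W b]) (S.ρ W c)) +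
      S.τ W (S.evY (L.obs 1 1 ![x, y]) h ![Y.bracket _ (S.ρ W a) (S.ρ W b), S.ρ W c]) := by
    intro a b c
    rw [L.θ_bracket hx hy h, L.θ_bracket hx hy h, bx.add_left, br_τ_left, ρ_θ, ρ_br]
  have e1 := L.br_jacobi hx hx1 (L.θ hx hy a) (L.θ hx hy b) (L.θ hx hy c)
  have e2 := congrArg (L.θ hx hy) (L.br_jacobi hy hy1 a b c)
  simp only [jacobiator] at e1 e2
  rw [map_add, map_add, key, key, key, θ_τ] at e2
  rw [ρ_θ, ρ_θ, ρ_θ] at e1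
  have hm := S.evY_isMultider (L.obs_mem.1 1 1 ![x, y]) h
  rw [hm.anti_two (S.ρ W c) (S.ρ W a), (Y.isAltBider _).anti (S.ρ W c) (S.ρ W a),
    (Y.isAltBider _).neg_left] at e2
  have e3 : S.evY (L.obs 1 1 ![x, y]) h ![-Y.bracket _ (S.ρ W a) (S.ρ W c), S.ρ W b] =
      -S.evY (L.obs 1 1 ![x, y]) h ![Y.bracket _ (S.ρ W a) (S.ρ W c), S.ρ W b] := by
    have h0 := hm.add_left_two (Y.bracket _ (S.ρ W a) (S.ρ W c))
      (-Y.bracket _ (S.ρ W a) (S.ρ W c)) (S.ρ W b)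
    have h1 := hm.add_left_two 0 0 (S.ρ W b)
    rw [add_zero] at h1
    rw [add_neg_cancel] at h0
    linear_combination -h0 - h1
  rw [e3] at e2
  apply τ_inj
  simp only [pow_one, neg_smul, one_smul, τ_sub,
    τ_add, τ_zero, τ_neg] at e1 e2 ⊢
  linear_combination e1 - e2

/-- This is `jacobiator_closed` for the lifted bracket, divided by `t`. -/
theorem obs_totalDiff_zero_three (s) :
    totalDiff (X := Y) (Y := Y) (𝟙 Y.scheme) 𝒱 L.obs 0 3 s = 0 := by
  obtain ⟨x, rfl⟩ : ∃ x, s = ![x] := ⟨_, vec_one_eq s⟩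
  refine S.secY_ext (isResCompatible_totalDiff (X := Y) L.obs_mem 0 3 _)
    (fun _ _ => map_zero _) fun W h p => ?_
  have H := PtCover.le_inter_iff.1 h
  have hx : S.fib W ≤ 𝒱.nhd x := H 0
  rw [evY_totalDiff, evY_vertDiff, evY_cechDiff_zero, evY_zero,
    eq_vec_four fun i => S.ρ W (p i), evY_poissonDiff_two]
  generalize p 0 = a, p 1 = b, p 2 = c, p 3 = d
  have e1 := (L.br_bider hx).jacobiator_closed a b c d
  simp only [L.br_jacobi hx h, br_τ_left, ρ_br] at e1
  apply τ_inj
  simp only [pow_zero, one_smul, τ_sub,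
    τ_add, τ_zero, τ_neg] at e1 ⊢
  linear_combination e1

theorem obs_mem_cocycles : L.obs ∈ cocycles (X := Y) (Y := Y) (𝟙 Y.scheme) 𝒱 2 := by
  refine ⟨L.obs_mem, ?_⟩
  change totalDiff (X := Y) (Y := Y) (𝟙 Y.scheme) 𝒱 L.obs = 0
  funext p q s
  by_cases h : p + q = 3
  · obtain ⟨rfl, rfl⟩ | ⟨rfl, rfl⟩ | ⟨rfl, rfl⟩ | ⟨rfl, rfl⟩ : (p = 3 ∧ q = 0) ∨ (p = 2 ∧ q = 1) ∨
        (p = 1 ∧ q = 2) ∨ (p = 0 ∧ q = 3) := by omega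
    · exact L.obs_totalDiff_three_zero s
    · exact L.obs_totalDiff_two_one s
    · exact L.obs_totalDiff_one_two s
    · exact L.obs_totalDiff_zero_three s
  · rw [totalDiff_eq_zero_of_ne (X := Y) L.obs_mem h]
    rfl

end LocalData

end SmallSetup

end

/-! ### The pullback of the obstruction is a coboundary -/

section

open TensorProduct

variable {k : Type u} [Field k]

namespace SmallSetup

variable {X Y : PoissonScheme k} {f : X.scheme ⟶ Y.scheme} {S : SmallSetup X Y f}

namespace LocalData

variable {𝒱 : PtCover Y.scheme} {𝒰 : PtCover X.scheme} (L : S.LocalData 𝒱 𝒰)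

theorem isResCompatible_pull (p q : ℕ) (s) :
    IsResCompatible (cochainRes f L.le (cochainPull f 𝒱 L.obs) p q s) := fun h a =>
  ((cochainRes_mem f L.le 2 _ (cochainPull_mem f 𝒱 2 _ L.obs_mem)).1 p q s).res h a

include L in
theorem inter_le_preimage {p : ℕ} (s : Fin (p + 1) → X.scheme) :
    𝒰.inter s ≤ f ⁻¹ᵁ 𝒱.inter (f ∘ s) :=
  (PtCover.inter_mono L.le s).trans (PtCover.inter_preimage_le f 𝒱 s)

/-- Obtained by applying the local homomorphism at `u` to the relation between the three
transitions. -/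
theorem pull_obs_two_zero (s) : cochainRes f L.le (cochainPull f 𝒱 L.obs) 2 0 s =
    totalDiff f 𝒰 L.obsMap 2 0 s := by
  obtain ⟨u, v, w, rfl⟩ : ∃ u v w, s = ![u, v, w] := ⟨_, _, _, vec_three_eq s⟩
  refine S.secX_ext _ (L.inter_le_preimage _) (L.isResCompatible_pull _ _ _)
    (isResCompatible_totalDiff L.obsMap_mem _ _ _) fun U W h hW hUW p => ?_
  have H := PtCover.le_inter_iff.1 h
  have hu : S.η.incl ⁻¹ᵁ U.1 ≤ 𝒰.nhd u := H 0
  have hv : S.η.incl ⁻¹ᵁ U.1 ≤ 𝒰.nhd v := H 1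
  have hw : S.η.incl ⁻¹ᵁ U.1 ≤ 𝒰.nhd w := H 2
  have HW := PtCover.le_inter_iff.1 hW
  have wu : S.fib W ≤ 𝒱.nhd (f u) := HW 0
  have wv : S.fib W ≤ 𝒱.nhd (f v) := HW 1
  have ww : S.fib W ≤ 𝒱.nhd (f w) := HW 2
  have hvw := PtCover.le_inter_two hv hw
  have huw := PtCover.le_inter_two hu hw
  have huv := PtCover.le_inter_two hu hv
  have w₃ := PtCover.le_inter_three wu wv ww
  have hs : f ∘ ![u, v, w] = ![f u, f v, f w] := by ext i; fin_cases i <;> rfl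
  rw [S.evX_cochainPull L.le L.obs _ hUW h hs w₃, evX_totalDiff, evX_vertDiff_zero, add_zero,
    evX_cechDiff_two S _ hUW h hvw huw huv, vec_one_eq fun i => S.ρ W (p i)]
  generalize p 0 = p
  have e1 := congrArg (L.g hu wu hUW) (L.θ_comp wu wv ww w₃ p)
  rw [map_add, L.g_θ hu hv wu wv hUW huv, L.g_θ hv hw wv ww hUW hvw, L.g_θ hu hw wu ww hUW huw,
    g_τ, ρ_θ] at e1
  apply τX_inj
  simp only [τX_add, τX_sub]
  linear_combination -e1

/-- The local homomorphism at `u` is applied to the formula for a transition of a bracket; the rest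
is the defect of each local homomorphism. -/
theorem pull_obs_one_one (s) : cochainRes f L.le (cochainPull f 𝒱 L.obs) 1 1 s =
    totalDiff f 𝒰 L.obsMap 1 1 s := by
  obtain ⟨u, v, rfl⟩ : ∃ u v, s = ![u, v] := ⟨_, _, vec_two_eq s⟩
  refine S.secX_ext _ (L.inter_le_preimage _) (L.isResCompatible_pull _ _ _)
    (isResCompatible_totalDiff L.obsMap_mem _ _ _) fun U W h hW hUW p => ?_
  have H := PtCover.le_inter_iff.1 h
  have hu : S.η.incl ⁻¹ᵁ U.1 ≤ 𝒰.nhd u := H 0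
  have hv : S.η.incl ⁻¹ᵁ U.1 ≤ 𝒰.nhd v := H 1
  have HW := PtCover.le_inter_iff.1 hW
  have wu : S.fib W ≤ 𝒱.nhd (f u) := HW 0
  have wv : S.fib W ≤ 𝒱.nhd (f v) := HW 1
  have hu₁ := PtCover.le_inter_one hu
  have hv₁ := PtCover.le_inter_one hv
  have w₂ := PtCover.le_inter_two wu wv
  have hs : f ∘ ![u, v] = ![f u, f v] := by ext i; fin_cases i <;> rfl
  rw [S.evX_cochainPull L.le L.obs _ hUW h hs w₂, evX_totalDiff, evX_vertDiff,
    evX_cechDiff_one S _ hUW h hu₁ hv₁, vec_two_eq fun i => S.ρ W (p i), evX_poissonDiff_zero]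
  generalize p 0 = p, p 1 = p'
  have e1 := congrArg (L.g hu wu hUW) (L.θ_bracket wu wv w₂ p p')
  have b := S.η.total.isAltBider U.1
  rw [map_add, L.g_θ hu hv wu wv hUW h, L.g_bracket hv wv hUW hv₁, L.g_bracket hu wu hUW hu₁,
    L.g_θ hu hv wu wv hUW h, L.g_θ hu hv wu wv hUW h, g_τ, ρ_θ, ρ_θ, ρ_br, b.add_left, b.add_right,
    b.add_right, bracket_τX, bracket_τX, bracket_τX_left, ρX_g, ρX_g, ρX_τX,
    (X.isAltBider _).zero_left, τX_zero,
    (X.isAltBider _).anti (S.fR hUW (S.ρ W p))] at e1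
  apply τX_inj
  simp only [pow_one, neg_smul, one_smul, τX_add, τX_sub, τX_neg] at e1 ⊢
  linear_combination -e1

/-- The Jacobi identity does hold on `𝒳'`, so the image of the Jacobiator upstairs is only the
linearised contribution of the bracket defect of the local homomorphism. -/
theorem pull_obs_zero_two (s) : cochainRes f L.le (cochainPull f 𝒱 L.obs) 0 2 s =
    totalDiff f 𝒰 L.obsMap 0 2 s := by
  obtain ⟨u, rfl⟩ : ∃ u, s = ![u] := ⟨_, vec_one_eq s⟩
  refine S.secX_ext _ (L.inter_le_preimage _) (L.isResCompatible_pull _ _ _)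
    (isResCompatible_totalDiff L.obsMap_mem _ _ _) fun U W h hW hUW p => ?_
  have hu : S.η.incl ⁻¹ᵁ U.1 ≤ 𝒰.nhd u := PtCover.le_inter_iff.1 h 0
  have wu : S.fib W ≤ 𝒱.nhd (f u) := PtCover.le_inter_iff.1 hW 0
  have w₁ := PtCover.le_inter_one wu
  have hs : f ∘ ![u] = ![f u] := by ext i; fin_cases i; rfl
  rw [S.evX_cochainPull L.le L.obs _ hUW h hs w₁, evX_totalDiff, evX_vertDiff, evX_cechDiff_zero,
    vec_three_eq fun i => S.ρ W (p i), evX_poissonDiff_one]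
  generalize p 0 = a, p 1 = b, p 2 = c
  have bX := S.η.total.isAltBider U.1
  have key : ∀ a b c, L.g hu wu hUW (L.br wu (L.br wu a b) c) =
      S.η.total.bracket U.1 (S.η.total.bracket U.1 (L.g hu wu hUW a) (L.g hu wu hUW b))
        (L.g hu wu hUW c) +
      S.τX U (X.bracket _ (S.evX (L.obsMap 0 1 ![u]) h hUW ![S.ρ W a, S.ρ W b])
        (S.fR hUW (S.ρ W c))) +
      S.τX U (S.evX (L.obsMap 0 1 ![u]) h hUW ![Y.bracket _ (S.ρ W a) (S.ρ W b), S.ρ W c]) := by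
    intro a b c
    rw [L.g_bracket hu wu hUW h, L.g_bracket hu wu hUW h, bX.add_left, bracket_τX_left, ρX_g,
      ρ_br]
  have e1 := S.η.total.jacobiator_eq_zero U.1 (L.g hu wu hUW a) (L.g hu wu hUW b)
    (L.g hu wu hUW c)
  have e2 := congrArg (L.g hu wu hUW) (L.br_jacobi wu w₁ a b c)
  simp only [jacobiator] at e1 e2
  rw [map_add, map_add, key, key, key, g_τ] at e2
  have hm := S.evX_isMultider (L.obsMap_mem.1 0 1 ![u]) h hUW
  rw [hm.anti_two (S.ρ W c) (S.ρ W a), (Y.isAltBider _).anti (S.ρ W c) (S.ρ W a),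
    (X.isAltBider _).neg_left] at e2
  have e3 : S.evX (L.obsMap 0 1 ![u]) h hUW ![-Y.bracket _ (S.ρ W a) (S.ρ W c), S.ρ W b] =
      -S.evX (L.obsMap 0 1 ![u]) h hUW ![Y.bracket _ (S.ρ W a) (S.ρ W c), S.ρ W b] := by
    have h0 := hm.add_left_two (Y.bracket _ (S.ρ W a) (S.ρ W c))
      (-Y.bracket _ (S.ρ W a) (S.ρ W c)) (S.ρ W b)
    have h1 := hm.add_left_two 0 0 (S.ρ W b)
    rw [add_zero] at h1
    rw [add_neg_cancel] at h0
    linear_combination -h0 - h1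
  rw [e3] at e2
  apply τX_inj
  simp only [pow_zero, one_smul, zero_add, τX_add, τX_sub, τX_neg] at e1 e2 ⊢
  linear_combination e1 - e2

theorem pull_obs : cochainRes f L.le (cochainPull f 𝒱 L.obs) = totalDiff f 𝒰 L.obsMap := by
  funext p q s
  by_cases h : p + q = 2
  · obtain ⟨rfl, rfl⟩ | ⟨rfl, rfl⟩ | ⟨rfl, rfl⟩ : (p = 2 ∧ q = 0) ∨ (p = 1 ∧ q = 1) ∨
        (p = 0 ∧ q = 2) := by omega
    · exact L.pull_obs_two_zero s
    · exact L.pull_obs_one_one s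
    · exact L.pull_obs_zero_two s
  · rw [totalDiff_eq_zero_of_ne L.obsMap_mem h,
      (cochainRes_mem f L.le 2 _ (cochainPull_mem f 𝒱 2 _ L.obs_mem)).2 p q h]

end LocalData

variable (S) in
/-- Local data which satisfy the cocycle condition and are compatible with the Poisson brackets. -/
structure GluingData (𝒱 : PtCover Y.scheme) (𝒰 : PtCover X.scheme) extends S.LocalData 𝒱 𝒰 where
  θ_θ : ∀ {x y z : Y.scheme} {W : S.𝒴.affineOpens} (hx : S.fib W ≤ 𝒱.nhd x)
    (hy : S.fib W ≤ 𝒱.nhd y) (hz : S.fib W ≤ 𝒱.nhd z) (p), θ hx hy (θ hy hz p) = θ hx hz p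
  θ_br : ∀ {x y : Y.scheme} {W : S.𝒴.affineOpens} (hx : S.fib W ≤ 𝒱.nhd x)
    (hy : S.fib W ≤ 𝒱.nhd y) (p p'), θ hx hy (br hy p p') = br hx (θ hx hy p) (θ hx hy p')
  jacobi : ∀ {x : Y.scheme} {W : S.𝒴.affineOpens} (hx : S.fib W ≤ 𝒱.nhd x) (p p' p''),
    jacobiator (br hx) p p' p'' = 0
  g_comp_θ : ∀ {u v : X.scheme} {U : S.𝒳'.affineOpens} {W : S.𝒴.affineOpens}
    (hu : S.η.incl ⁻¹ᵁ U.1 ≤ 𝒰.nhd u) (hv : S.η.incl ⁻¹ᵁ U.1 ≤ 𝒰.nhd v)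
    (wu : S.fib W ≤ 𝒱.nhd (f u)) (wv : S.fib W ≤ 𝒱.nhd (f v))
    (hUW : S.i ⁻¹ᵁ U.1 ≤ S.ξ.map ⁻¹ᵁ W.1) (p), g hu wu hUW (θ wu wv p) = g hv wv hUW p
  g_br : ∀ {u : X.scheme} {U : S.𝒳'.affineOpens} {W : S.𝒴.affineOpens}
    (hu : S.η.incl ⁻¹ᵁ U.1 ≤ 𝒰.nhd u) (wu : S.fib W ≤ 𝒱.nhd (f u))
    (hUW : S.i ⁻¹ᵁ U.1 ≤ S.ξ.map ⁻¹ᵁ W.1) (p p'),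
    g hu wu hUW (br wu p p') = S.η.total.bracket U.1 (g hu wu hUW p) (g hu wu hUW p')

end SmallSetup

end

/-! ### Correcting the local data -/

section

open TensorProduct

variable {k : Type u} [Field k]

theorem IsMultider.neg_left_two {K B M : Type*} [CommRing K] [CommRing B] [CommRing M]
    {c : K →+* B} {ψ : B →+* M} {E : (Fin 2 → B) → M} (hE : IsMultider c ψ (q := 1) E) (x z : B) :
    E ![-x, z] = -E ![x, z] := by
  have h0 := hE.add_left_two x (-x) z
  have h1 := hE.add_left_two 0 0 z
  rw [add_zero] at h1
  rw [add_neg_cancel] at h0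
  linear_combination -h0 - h1

namespace SmallSetup

variable {X Y : PoissonScheme k} {f : X.scheme ⟶ Y.scheme} {S : SmallSetup X Y f}

set_option maxHeartbeats 1600000 in
-- The cochains of `exists_correction` are spent as follows: `a` in bidegree `(1, 0)` changes the
-- transitions, `a` in bidegree `(0, 1)` changes the brackets, and `c` changes the local
-- homomorphisms. All other fields survive, since changing by multiples of `t` is invisible over
-- `A`.
theorem exists_gluingData (h₁ : Function.Surjective (hyperPullback S.f_poisson 1))
    (h₂ : Function.Injective (hyperPullback S.f_poisson 2)) :
    ∃ (𝒱 : PtCover Y.scheme) (𝒰 : PtCover X.scheme), Nonempty (S.GluingData 𝒱 𝒰) := by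
  obtain ⟨𝒱₀, 𝒰₀, ⟨L⟩⟩ := S.exists_localData
  obtain ⟨𝒱, 𝒰, hv, hu, hle, a, c, ha, hc, ea, ec⟩ := exists_correction S.f_poisson h₁ h₂ L.le
    L.obs_mem_cocycles L.obsMap_mem L.pull_obs
  have nY : ∀ {x : Y.scheme} {W : S.𝒴.affineOpens}, S.fib W ≤ 𝒱.nhd x → S.fib W ≤ 𝒱₀.nhd x :=
    fun {x W} h => h.trans (hv x)
  have nX : ∀ {u : X.scheme} {U : S.𝒳'.affineOpens}, S.η.incl ⁻¹ᵁ U.1 ≤ 𝒰.nhd u →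
      S.η.incl ⁻¹ᵁ U.1 ≤ 𝒰₀.nhd u := fun {u U} h => h.trans (hu u)
  -- The sign is negative because `d a` equals the obstruction itself.
  have exθ : ∀ (x y : Y.scheme) (W : S.𝒴.affineOpens) (hx : S.fib W ≤ 𝒱.nhd x)
      (hy : S.fib W ≤ 𝒱.nhd y), ∃ θ' : S.P W →+* S.P W, (∀ r, θ' (S.cP W r) = S.cP W r) ∧
      (∀ p, L.q (nY hx) (θ' p) = L.q (nY hx) (L.θ (nY hx) (nY hy) p)) ∧
      ∀ p, θ' p = L.θ (nY hx) (nY hy) p + S.τ W (S.evY (-(a 1 0 ![x, y]))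
        (PtCover.le_inter_two hx hy) ![S.ρ W p]) := fun x y W hx hy =>
    (L.thick (nY hx)).exists_add_der (L.θ_cP (nY hx) (nY hy))
      (fun p => L.ρ_θ (nY hx) (nY hy) p)
      (S.evY_isMultider (ha.1 1 0 ![x, y]).neg (PtCover.le_inter_two hx hy))
      (fun r => ⟨_, ρ_cP W r⟩)
  have exg : ∀ (z : X.scheme) (U : S.𝒳'.affineOpens) (W : S.𝒴.affineOpens)
      (hU : S.η.incl ⁻¹ᵁ U.1 ≤ 𝒰.nhd z) (hW : S.fib W ≤ 𝒱.nhd (f z))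
      (hUW : S.i ⁻¹ᵁ U.1 ≤ S.ξ.map ⁻¹ᵁ W.1), ∃ g' : S.P W →+* Γ(S.𝒳', U.1),
      (∀ r, g' (S.cP W r) = constants S.η.total.str U.1 r) ∧
      (∀ p, pullFun S.i U.1 (S.i ⁻¹ᵁ U.1) le_rfl (g' p) =
        pullFun S.i U.1 (S.i ⁻¹ᵁ U.1) le_rfl (L.g (nX hU) (nY hW) hUW p)) ∧
      ∀ p, g' p = L.g (nX hU) (nY hW) hUW p +
        S.τX U (S.evX (c 0 0 ![z]) (PtCover.le_inter_one hU) hUW ![S.ρ W p]) :=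
    fun z U W hU hW hUW => (S.thickX U.2).exists_add_der (L.g_cP (nX hU) (nY hW) hUW)
      (fun p => L.ρX_g (nX hU) (nY hW) hUW p)
      (S.evX_isMultider (hc.1 0 0 ![z]) (PtCover.le_inter_one hU) hUW)
      (fun r => ⟨_, ρ_cP W r⟩)
  choose θ θ_c θ_q hθ using exθ
  choose g g_c g_i hg using exg
  have hθ' : ∀ x y W hx hy p, θ x y W hx hy p = L.θ (nY hx) (nY hy) p - S.τ W (S.evY (a 1 0 ![x, y])
      (PtCover.le_inter_two hx hy) ![S.ρ W p]) := fun x y W hx hy p => by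
    rw [hθ, evY_neg, τ_neg, sub_eq_add_neg]
  have ρθ : ∀ x y W hx hy p, S.ρ W (θ x y W hx hy p) = S.ρ W p := fun x y W hx hy p => by
    rw [hθ', map_sub, ρ_τ, sub_zero, LocalData.ρ_θ]
  -- The bracket is shifted by a biderivation of the special fibre, so it remains an alternating
  -- biderivation.
  obtain ⟨br, hbr⟩ : ∃ br : ∀ (x : Y.scheme) (W : S.𝒴.affineOpens), S.fib W ≤ 𝒱.nhd x →
      S.P W → S.P W → S.P W, ∀ x W hx, br x W hx = fun p p' => L.br (nY hx) p p' -
        S.τ W (S.evY (a 0 1 ![x]) (PtCover.le_inter_one hx) ![S.ρ W p, S.ρ W p']) :=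
    ⟨_, fun _ _ _ => rfl⟩
  have br_bider : ∀ x W hx, IsAltBider (S.cP W) (br x W hx) := fun x W hx => by
    rw [hbr]
    exact (S.thickP W).isAltBider_sub (L.br_bider (nY hx)) (fun _ => rfl)
      (S.evY_isMultider (ha.1 0 1 ![x]) (PtCover.le_inter_one hx)) (fun r => ⟨_, ρ_cP W r⟩)
  replace hbr : ∀ x W hx p p', br x W hx p p' = L.br (nY hx) p p' -
      S.τ W (S.evY (a 0 1 ![x]) (PtCover.le_inter_one hx) ![S.ρ W p, S.ρ W p']) :=
    fun x W hx p p' => by rw [hbr]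
  have ρbr : ∀ x W hx p p', S.ρ W (br x W hx p p') =
      Y.bracket (S.fib W) (S.ρ W p) (S.ρ W p') := fun x W hx p p' => by
    rw [hbr, map_sub, ρ_τ, sub_zero, LocalData.ρ_br]
  have evY1 : ∀ {W W' : S.𝒴.affineOpens} {O : Y.scheme.Opens} {D : Sec (𝟙 Y.scheme) 0 O}
      (_ : IsPolyvector Y.str (𝟙 Y.scheme) D) (h : S.fib W ≤ O) (h' : W' ≤ W) (p : S.P W),
      resFun Y.scheme (S.e.preimage_mono h') (S.evY D h ![S.ρ W p]) =
        S.evY D ((S.e.preimage_mono h').trans h) ![S.ρ W' (S.resP h' p)] := by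
    intro W W' O D hD h h' p
    rw [S.evY_res hD h h', S.ρ_resP]
    exact congrArg _ (vec_one_eq _)
  have evY2 : ∀ {W W' : S.𝒴.affineOpens} {O : Y.scheme.Opens} {D : Sec (𝟙 Y.scheme) 1 O}
      (_ : IsPolyvector Y.str (𝟙 Y.scheme) D) (h : S.fib W ≤ O) (h' : W' ≤ W) (p p' : S.P W),
      resFun Y.scheme (S.e.preimage_mono h') (S.evY D h ![S.ρ W p, S.ρ W p']) =
        S.evY D ((S.e.preimage_mono h').trans h)
          ![S.ρ W' (S.resP h' p), S.ρ W' (S.resP h' p')] := by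
    intro W W' O D hD h h' p p'
    rw [S.evY_res hD h h', S.ρ_resP, S.ρ_resP]
    exact congrArg _ (vec_two_eq _)
  -- The three bidegrees of `d a = obs`, evaluated on functions: here, in `B` and in `Cj`.
  have A : ∀ x y z W (hx : S.fib W ≤ 𝒱.nhd x) (hy : S.fib W ≤ 𝒱.nhd y) (hz : S.fib W ≤ 𝒱.nhd z) v,
      S.evY (a 1 0 ![y, z]) (PtCover.le_inter_two hy hz) v -
        S.evY (a 1 0 ![x, z]) (PtCover.le_inter_two hx hz) v +
        S.evY (a 1 0 ![x, y]) (PtCover.le_inter_two hx hy) v =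
      S.evY (L.obs 2 0 ![x, y, z]) (PtCover.le_inter_three (nY hx) (nY hy) (nY hz)) v := by
    intro x y z W hx hy hz v
    have h := PtCover.le_inter_three hx hy hz
    have := congrArg (fun c => S.evY (c 2 0 ![x, y, z]) h v) ea
    rwa [evY_totalDiff, evY_vertDiff_zero, add_zero, evY_cechDiff_two S _ h
      (PtCover.le_inter_two hy hz) (PtCover.le_inter_two hx hz) (PtCover.le_inter_two hx hy),
      S.evY_cochainRes hv _ _ h (PtCover.le_inter_three (nY hx) (nY hy) (nY hz))] at this
  have B : ∀ x y W (hx : S.fib W ≤ 𝒱.nhd x) (hy : S.fib W ≤ 𝒱.nhd y) b b',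
      S.evY (a 0 1 ![y]) (PtCover.le_inter_one hy) ![b, b'] -
        S.evY (a 0 1 ![x]) (PtCover.le_inter_one hx) ![b, b'] -
        (Y.bracket _ (S.evY (a 1 0 ![x, y]) (PtCover.le_inter_two hx hy) ![b]) b' -
          Y.bracket _ (S.evY (a 1 0 ![x, y]) (PtCover.le_inter_two hx hy) ![b']) b -
          S.evY (a 1 0 ![x, y]) (PtCover.le_inter_two hx hy) ![Y.bracket _ b b']) =
      S.evY (L.obs 1 1 ![x, y]) (PtCover.le_inter_two (nY hx) (nY hy)) ![b, b'] := by
    intro x y W hx hy b b'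
    have h := PtCover.le_inter_two hx hy
    have := congrArg (fun c => S.evY (c 1 1 ![x, y]) h ![b, b']) ea
    rwa [evY_totalDiff, evY_vertDiff, evY_poissonDiff_zero, pow_one, neg_one_smul,
      ← sub_eq_add_neg, evY_cechDiff_one S _ h
      (PtCover.le_inter_one hx) (PtCover.le_inter_one hy),
      S.evY_cochainRes hv _ _ h (PtCover.le_inter_two (nY hx) (nY hy))] at this
  have Cj : ∀ x W (hx : S.fib W ≤ 𝒱.nhd x) b b' b'',
      S.evY (poissonDiff (X := Y) (Y := Y) (𝟙 Y.scheme) 1 _ (a 0 1 ![x])) (PtCover.le_inter_one hx)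
        ![b, b', b''] =
      S.evY (L.obs 0 2 ![x]) (PtCover.le_inter_one (nY hx)) ![b, b', b''] := by
    intro x W hx b b' b''
    have h := PtCover.le_inter_one hx
    have := congrArg (fun c => S.evY (c 0 2 ![x]) h ![b, b', b'']) ea
    rwa [evY_totalDiff, evY_vertDiff, pow_zero, one_smul, evY_cechDiff_zero, zero_add,
      S.evY_cochainRes hv _ _ h (PtCover.le_inter_one (nY hx))] at this
  -- The two bidegrees of `f^* a + d c = obsMap`: here and in `Em`.
  have Dm : ∀ u v (U : S.𝒳'.affineOpens) (W : S.𝒴.affineOpens) (hU : S.η.incl ⁻¹ᵁ U.1 ≤ 𝒰.nhd u) (hV : S.η.incl ⁻¹ᵁ U.1 ≤ 𝒰.nhd v)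
      (wu : S.fib W ≤ 𝒱.nhd (f u)) (wv : S.fib W ≤ 𝒱.nhd (f v))
      (hUW : S.i ⁻¹ᵁ U.1 ≤ S.ξ.map ⁻¹ᵁ W.1) b,
      S.fR hUW (S.evY (a 1 0 ![f u, f v]) (PtCover.le_inter_two wu wv) b) +
        (S.evX (c 0 0 ![v]) (PtCover.le_inter_one hV) hUW b -
          S.evX (c 0 0 ![u]) (PtCover.le_inter_one hU) hUW b) =
      S.evX (L.obsMap 1 0 ![u, v]) (PtCover.le_inter_two (nX hU) (nX hV)) hUW b := by
    intro u v U W hU hV wu wv hUW b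
    have h := PtCover.le_inter_two hU hV
    have := congrArg (fun c => S.evX (c 1 0 ![u, v]) h hUW b) ec
    simp only [Pi.add_apply] at this
    have hs : f ∘ ![u, v] = ![f u, f v] := by ext i; fin_cases i <;> rfl
    rwa [evX_add, S.evX_cochainPull hle a _ hUW h hs (PtCover.le_inter_two wu wv), evX_totalDiff,
      evX_vertDiff_zero, add_zero, evX_cechDiff_one S _ hUW h (PtCover.le_inter_one hU)
      (PtCover.le_inter_one hV), S.evX_cochainRes hu _ _ h
      (PtCover.le_inter_two (nX hU) (nX hV))] at this
  have Em : ∀ u (U : S.𝒳'.affineOpens) (W : S.𝒴.affineOpens) (hU : S.η.incl ⁻¹ᵁ U.1 ≤ 𝒰.nhd u)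
      (wu : S.fib W ≤ 𝒱.nhd (f u)) (hUW : S.i ⁻¹ᵁ U.1 ≤ S.ξ.map ⁻¹ᵁ W.1) b b',
      S.fR hUW (S.evY (a 0 1 ![f u]) (PtCover.le_inter_one wu) ![b, b']) +
        (X.bracket _ (S.evX (c 0 0 ![u]) (PtCover.le_inter_one hU) hUW ![b]) (S.fR hUW b') -
          X.bracket _ (S.evX (c 0 0 ![u]) (PtCover.le_inter_one hU) hUW ![b']) (S.fR hUW b) -
          S.evX (c 0 0 ![u]) (PtCover.le_inter_one hU) hUW ![Y.bracket _ b b']) =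
      S.evX (L.obsMap 0 1 ![u]) (PtCover.le_inter_one (nX hU)) hUW ![b, b'] := by
    intro u U W hU wu hUW b b'
    have h := PtCover.le_inter_one hU
    have := congrArg (fun c => S.evX (c 0 1 ![u]) h hUW ![b, b']) ec
    simp only [Pi.add_apply] at this
    have hs : f ∘ ![u] = ![f u] := by ext i; fin_cases i; rfl
    rwa [evX_add, S.evX_cochainPull hle a _ hUW h hs (PtCover.le_inter_one wu), evX_totalDiff,
      evX_vertDiff, evX_cechDiff_zero, zero_add, pow_zero, one_smul, evX_poissonDiff_zero,
      S.evX_cochainRes hu _ _ h (PtCover.le_inter_one (nX hU))] at this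
  refine ⟨𝒱, 𝒰, ⟨{
    r := fun {x W} h => L.r (nY h)
    r_const := fun {x W} h => L.r_const (nY h)
    e_r := fun {x W} h => L.e_r (nY h)
    r_res := fun {x W W'} h => L.r_res (nY h)
    le := hle
    θ := fun {x y W} hx hy => θ x y W hx hy
    θ_cP := fun {x y W} hx hy => θ_c x y W hx hy
    q_θ := fun {x y W} hx hy p => (θ_q x y W hx hy p).trans (L.q_θ (nY hx) (nY hy) p)
    θ_res := fun {x y W W'} hx hy h p => ?_
    br := fun {x W} hx => br x W hx
    br_bider := fun {x W} hx => br_bider x W hx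
    q_br := fun {x W} hx p p' => ?_
    br_res := fun {x W W'} hx h p p' => ?_
    g := fun {z U W} hU hW hUW => g z U W hU hW hUW
    g_cP := fun {z U W} hU hW hUW => g_c z U W hU hW hUW
    i_g := fun {z U W} hU hW hUW p => (g_i z U W hU hW hUW p).trans (L.i_g _ _ _ _)
    g_res := fun {z U U' W W'} hU hW hUW hUW' h h' p => ?_
    θ_θ := fun {x y z W} hx hy hz p => ?_
    θ_br := fun {x y W} hx hy p p' => ?_
    jacobi := fun {x W} hx p p' p'' => ?_
    g_comp_θ := fun {u v U W} hU hV wu wv hUW p => ?_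
    g_br := fun {u U W} hU wu hUW p p' => ?_ }⟩⟩
  · rw [hθ', hθ', map_sub, LocalData.θ_res, S.resP_τ, evY1 (ha.1 1 0 _)]
  · change L.q (nY hx) (br x W hx p p') = _
    rw [hbr, map_sub, L.q_br]
    exact sub_eq_self.2 ((L.thick (nY hx)).q_tau _)
  · rw [hbr, hbr, map_sub, LocalData.br_res, S.resP_τ, evY2 (ha.1 0 1 _)]
  · rw [hg, hg, map_add, L.g_res _ _ hUW hUW' h h', S.resFun_τX,
      S.evX_res (hc.1 0 0 _) _ hUW h h' hUW', S.ρ_resP]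
    exact congrArg (fun v => _ + S.τX U' (S.evX _ _ _ v)) (vec_one_eq _)
  -- From here on, each of the five compatibilities is its defect formula for the original data,
  -- with the defect replaced by the matching component of the coboundary. Terms quadratic in the
  -- corrections vanish.
  · rw [hθ', ρθ, hθ' y z, hθ' x z, map_sub, LocalData.θ_τ, L.θ_comp (nY hx) (nY hy) (nY hz)
      (PtCover.le_inter_three (nY hx) (nY hy) (nY hz)), ← A x y z W hx hy hz, τ_add, τ_sub]
    ring
  · have b := L.br_bider (nY hx)
    rw [hθ' x y W hx hy (br y W hy p p'), ρbr, hbr, hbr, map_sub, LocalData.θ_τ,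
      L.θ_bracket (nY hx) (nY hy) (PtCover.le_inter_two (nY hx) (nY hy)), ← B x y W hx hy,
      ρθ, ρθ, hθ' x y W hx hy p, hθ' x y W hx hy p', b.sub_left, b.sub_right, b.sub_right,
      LocalData.br_τ, LocalData.br_τ, LocalData.br_τ_left, LocalData.ρ_θ, LocalData.ρ_θ, ρ_τ,
      (Y.isAltBider _).zero_left, τ_zero,
      (Y.isAltBider _).anti (S.ρ W p)
        (S.evY (a 1 0 ![x, y]) (PtCover.le_inter_two hx hy) ![S.ρ W p'])]
    simp only [τ_sub, τ_neg]
    ring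
  · have b := L.br_bider (nY hx)
    have key : ∀ p p' p'', br x W hx (br x W hx p p') p'' =
        L.br (nY hx) (L.br (nY hx) p p') p'' -
        S.τ W (Y.bracket _ (S.evY (a 0 1 ![x]) (PtCover.le_inter_one hx) ![S.ρ W p, S.ρ W p'])
          (S.ρ W p'')) -
        S.τ W (S.evY (a 0 1 ![x]) (PtCover.le_inter_one hx)
          ![Y.bracket _ (S.ρ W p) (S.ρ W p'), S.ρ W p'']) := by
      intro p p' p''
      rw [hbr x W hx (br x W hx p p') p'', ρbr, hbr, b.sub_left, LocalData.br_τ_left]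
    have e := L.br_jacobi (nY hx) (PtCover.le_inter_one (nY hx)) p p' p''
    rw [← Cj x W hx, evY_poissonDiff_one] at e
    have hm := S.evY_isMultider (ha.1 0 1 ![x]) (PtCover.le_inter_one hx)
    change br x W hx (br x W hx p p') p'' + br x W hx (br x W hx p' p'') p +
      br x W hx (br x W hx p'' p) p' = 0
    rw [key, key, key, hm.anti_two (S.ρ W p'') (S.ρ W p), (Y.isAltBider _).neg_left,
      (Y.isAltBider _).anti (S.ρ W p'') (S.ρ W p), hm.neg_left_two]
    simp only [τ_sub, τ_neg, τ_add, jacobiator] at e ⊢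
    linear_combination e
  · rw [hg, hg, ρθ, hθ', map_sub, LocalData.g_τ, L.g_θ (nX hU) (nX hV) (nY wu) (nY wv) hUW
      (PtCover.le_inter_two (nX hU) (nX hV)), ← Dm u v U W hU hV wu wv hUW, τX_add, τX_sub]
    ring
  · have b := S.η.total.isAltBider U.1
    rw [hg u U W hU wu hUW (br (f u) W wu p p'), ρbr, hbr, map_sub, LocalData.g_τ,
      L.g_bracket (nX hU) (nY wu) hUW (PtCover.le_inter_one (nX hU)), ← Em u U W hU wu hUW,
      hg, hg, b.add_left, b.add_right, b.add_right, bracket_τX, bracket_τX, bracket_τX_left,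
      LocalData.ρX_g, LocalData.ρX_g, ρX_τX, (X.isAltBider _).zero_left, τX_zero,
      (X.isAltBider _).anti (S.fR hUW (S.ρ W p))
        (S.evX (c 0 0 ![u]) (PtCover.le_inter_one hU) hUW ![S.ρ W p'])]
    simp only [τX_sub, τX_neg, τX_add]
    ring

end SmallSetup

end

section

/-! ### Gluing morphisms and schemes from rings -/

section GlueMorphisms

variable {Z T : Scheme.{u}}

theorem exists_pullFun_eq {U : Z.Opens} {V : T.Opens} (hU : IsAffineOpen U) (hV : IsAffineOpen V)
    (g : Γ(T, V) →+* Γ(Z, U)) (m : Z ⟶ T)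
    (hm : hU.fromSpec ≫ m = Spec.map (CommRingCat.ofHom g) ≫ hV.fromSpec) :
    ∃ h : U ≤ m ⁻¹ᵁ V, pullFun m V U h = g := by
  have h : U ≤ m ⁻¹ᵁ V := by
    intro z hz
    rw [← hU.opensRange_fromSpec] at hz
    obtain ⟨y, rfl⟩ := hz
    have : m (hU.fromSpec y) = hV.fromSpec (Spec.map (CommRingCat.ofHom g) y) := by
      rw [← Scheme.Hom.comp_apply, hm, Scheme.Hom.comp_apply]
    change m (hU.fromSpec y) ∈ V
    rw [this]
    have := hV.opensRange_fromSpec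
    exact this.le ⟨_, rfl⟩
  refine ⟨h, ?_⟩
  rw [← IsAffineOpen.SpecMap_appLE_fromSpec m hV hU h, cancel_mono] at hm
  have := Spec.map_injective hm
  rw [pullFun, this]
  rfl

theorem hom_ext_of_pullFun {m m' : Z ⟶ T} (h : ∀ z : Z, ∃ (U : Z.Opens) (V : T.Opens)
    (e : U ≤ m ⁻¹ᵁ V) (e' : U ≤ m' ⁻¹ᵁ V), IsAffineOpen U ∧ IsAffineOpen V ∧ z ∈ U ∧
      ∀ a, pullFun m V U e a = pullFun m' V U e' a) : m = m' := by
  refine Scheme.hom_ext_of_forall _ _ fun z => ?_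
  obtain ⟨U, V, e, e', hU, hV, hz, ha⟩ := h z
  refine ⟨U, hz, ?_⟩
  have h1 : m.appLE V U e = m'.appLE V U e' := CommRingCat.hom_ext (RingHom.ext ha)
  rw [← hU.isoSpec_hom_fromSpec, Category.assoc, Category.assoc,
    ← IsAffineOpen.SpecMap_appLE_fromSpec m hV hU e,
    ← IsAffineOpen.SpecMap_appLE_fromSpec m' hV hU e', h1]

/-- The pieces are morphisms of spectra of coordinate rings. Agreement on an overlap follows by
comparing both pieces, near each point, with a third and smaller one. -/
theorem exists_hom_of_affine {ι : Type u} (U : ι → Z.Opens) (hU : ∀ i, IsAffineOpen (U i))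
    (V : ι → T.Opens) (hV : ∀ i, IsAffineOpen (V i))
    (g : ∀ i, Γ(T, (V i)) →+* Γ(Z, (U i))) (hcov : ∀ z, ∃ i, z ∈ (U i))
    (hg : ∀ i j z, z ∈ (U i) → z ∈ (U j) → ∃ (l : ι) (hi : (U l) ≤ (U i))
      (hj : (U l) ≤ (U j)) (hi' : (V l) ≤ (V i)) (hj' : (V l) ≤ (V j)), z ∈ (U l) ∧
      (∀ a, resFun Z hi (g i a) = g l (resFun T hi' a)) ∧
      (∀ a, resFun Z hj (g j a) = g l (resFun T hj' a))) :
    ∃ m : Z ⟶ T, ∀ i, ∃ h : (U i) ≤ m ⁻¹ᵁ (V i), pullFun m (V i) (U i) h = g i := by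
  choose idx hidx using hcov
  let 𝒰 : Z.OpenCover :=
    { I₀ := ι
      X := fun i => Spec Γ(Z, (U i))
      f := fun i => (hU i).fromSpec
      mem₀ := by
        rw [Scheme.ofArrows_mem_precoverage_iff]
        refine ⟨fun z => ⟨idx z, ?_⟩, fun i => inferInstanceAs (IsOpenImmersion (hU i).fromSpec)⟩
        rw [(hU (idx z)).range_fromSpec]
        exact hidx z }
  let f : ∀ i, 𝒰.X i ⟶ T := fun i => Spec.map (CommRingCat.ofHom (g i)) ≫ (hV i).fromSpec
  -- If a scheme maps to piece `i` through the smaller piece `l`, the two local morphisms agree on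
  -- it.
  have key : ∀ {N : Scheme.{u}} (l i : ι) (hi : (U l) ≤ (U i)) (hi' : (V l) ≤ (V i))
      (_ : ∀ a, resFun Z hi (g i a) = g l (resFun T hi' a)) (κ : N ⟶ Spec Γ(Z, (U l)))
      (μ : N ⟶ Spec Γ(Z, (U i))),
      μ ≫ (hU i).fromSpec = κ ≫ (hU l).fromSpec → μ ≫ f i = κ ≫ f l := by
    intro N l i hi hi' H κ μ h
    rw [← (hU i).map_fromSpec (hU l) (homOfLE hi).op, ← Category.assoc, cancel_mono] at h
    rw [h]
    have h2 : CommRingCat.ofHom (g i) ≫ Z.presheaf.map (homOfLE hi).op =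
        T.presheaf.map (homOfLE hi').op ≫ CommRingCat.ofHom (g l) :=
      CommRingCat.hom_ext (RingHom.ext H)
    simp only [f, Category.assoc]
    rw [← Spec.map_comp_assoc, h2, Spec.map_comp_assoc,
      (hV i).map_fromSpec (hV l) (homOfLE hi').op]
  refine ⟨𝒰.glueMorphisms f fun i j => ?_, fun i => exists_pullFun_eq (hU i) (hV i) (g i) _ ?_⟩
  · refine Scheme.hom_ext_of_forall _ _ fun p => ?_
    let a := Limits.pullback.fst (𝒰.f i) (𝒰.f j)
    let b := Limits.pullback.snd (𝒰.f i) (𝒰.f j)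
    have hab : a ≫ (hU i).fromSpec = b ≫ (hU j).fromSpec := Limits.pullback.condition
    have hi : (a ≫ (hU i).fromSpec) p ∈ (U i) := by
      have := (hU i).opensRange_fromSpec
      exact this.le ⟨a p, rfl⟩
    have hj : (a ≫ (hU i).fromSpec) p ∈ (U j) := by
      rw [hab]
      have := (hU j).opensRange_fromSpec
      exact this.le ⟨b p, rfl⟩
    obtain ⟨l, hi, hj, hi', hj', hl, H, H'⟩ := hg i j _ hi hj
    refine ⟨(a ≫ (hU i).fromSpec) ⁻¹ᵁ (U l), hl, ?_⟩
    let N := (a ≫ (hU i).fromSpec) ⁻¹ᵁ (U l)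
    let κ := IsOpenImmersion.lift (hU l).fromSpec (N.ι ≫ a ≫ (hU i).fromSpec) (by
      rw [(hU l).range_fromSpec]
      rintro _ ⟨y, rfl⟩
      exact y.2)
    have hκ : κ ≫ (hU l).fromSpec = N.ι ≫ a ≫ (hU i).fromSpec := IsOpenImmersion.lift_fac _ _ _
    have h1 := key l i hi hi' H κ (N.ι ≫ a) (by rw [hκ, Category.assoc])
    have h2 := key l j hj hj' H' κ (N.ι ≫ b) (by rw [hκ, Category.assoc, hab])
    rw [← Category.assoc, ← Category.assoc]
    exact h1.trans h2.symm
  · exact 𝒰.ι_glueMorphisms f _ i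

end GlueMorphisms

end

/-! ### Gluing spectra of a directed system of thickenings -/

section

section SpecPieces

theorem top_le_preimage_opensRange {X Z : Scheme.{u}} (m : X ⟶ Z) [IsOpenImmersion m] :
    (⊤ : X.Opens) ≤ m ⁻¹ᵁ m.opensRange :=
  fun x _ => ⟨x, rfl⟩

theorem isIso_appLE_opensRange {X Z : Scheme.{u}} (m : X ⟶ Z) [IsOpenImmersion m] :
    IsIso (m.appLE m.opensRange ⊤ (top_le_preimage_opensRange m)) := by
  have h1 : IsIso (m.app m.opensRange) := Scheme.Hom.isIso_app m _ le_rfl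
  have : IsIso (homOfLE (top_le_preimage_opensRange m)) :=
    ⟨homOfLE le_top, Subsingleton.elim _ _, Subsingleton.elim _ _⟩
  have h2 : m.appLE m.opensRange ⊤ (top_le_preimage_opensRange m) = m.app m.opensRange ≫
    X.presheaf.map (homOfLE (top_le_preimage_opensRange m)).op := rfl
  rw [h2]
  infer_instance

/-- The coordinate ring of the image of an open immersion from `Spec Q`. -/
def rangeEquiv {Q : Type u} [CommRing Q] {Z : Scheme.{u}} (m : Spec (.of Q) ⟶ Z) [IsOpenImmersion m] :
    Γ(Z, m.opensRange) ≃+* Q :=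
  (RingEquiv.ofBijective (m.appLE m.opensRange ⊤ (top_le_preimage_opensRange m)).hom
    (by
      have := isIso_appLE_opensRange m
      exact ConcreteCategory.bijective_of_isIso _)).trans
    (Scheme.ΓSpecIso (.of Q)).commRingCatIsoToRingEquiv

theorem rangeEquiv_apply {Q : Type u} [CommRing Q] {Z : Scheme.{u}} (m : Spec (.of Q) ⟶ Z)
    [IsOpenImmersion m] (z) : rangeEquiv m z = (Scheme.ΓSpecIso (.of Q)).hom.hom
      (pullFun m m.opensRange ⊤ (top_le_preimage_opensRange m) z) := rfl

theorem spec_rangeEquiv_fromSpec {Q : Type u} [CommRing Q] {Z : Scheme.{u}}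
    (m : Spec (.of Q) ⟶ Z) [IsOpenImmersion m] :
    Spec.map (CommRingCat.ofHom (rangeEquiv m).toRingHom) ≫
      (isAffineOpen_opensRange m).fromSpec = m := by
  have h0 : (⊤ : (Spec (.of Q)).Opens) ≤ m ⁻¹ᵁ m.opensRange := top_le_preimage_opensRange m
  have : CommRingCat.ofHom (rangeEquiv m).toRingHom = m.appLE m.opensRange ⊤ h0 ≫
    (Scheme.ΓSpecIso (.of Q)).hom := rfl
  rw [this, Spec.map_comp, Category.assoc, IsAffineOpen.SpecMap_appLE_fromSpec m
    (isAffineOpen_opensRange m) (isAffineOpen_top _) h0, IsAffineOpen.fromSpec_top]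
  rw [SpecMap_ΓSpecIso_hom, ← Scheme.isoSpec_hom, Iso.hom_inv_id_assoc]

theorem opensRange_le {Q Q' : Type u} [CommRing Q] [CommRing Q'] {Z : Scheme.{u}}
    (m : Spec (.of Q) ⟶ Z) (m' : Spec (.of Q') ⟶ Z) [IsOpenImmersion m] [IsOpenImmersion m']
    (T : Q →+* Q') (h : Spec.map (CommRingCat.ofHom T) ≫ m = m') :
    m'.opensRange ≤ m.opensRange := by
  subst h
  rintro _ ⟨x, rfl⟩
  exact ⟨Spec.map (CommRingCat.ofHom T) x, rfl⟩

theorem rangeEquiv_resFun {Q Q' : Type u} [CommRing Q] [CommRing Q'] {Z : Scheme.{u}}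
    (m : Spec (.of Q) ⟶ Z) (m' : Spec (.of Q') ⟶ Z) [IsOpenImmersion m] [IsOpenImmersion m']
    (T : Q →+* Q') (h : Spec.map (CommRingCat.ofHom T) ≫ m = m')
    (hle : m'.opensRange ≤ m.opensRange) (z) :
    rangeEquiv m' (resFun Z hle z) = T (rangeEquiv m z) := by
  have h0 : (⊤ : (Spec (.of Q)).Opens) ≤ m ⁻¹ᵁ m.opensRange := top_le_preimage_opensRange m
  have h1 : (⊤ : (Spec (.of Q')).Opens) ≤ Spec.map (CommRingCat.ofHom T) ⁻¹ᵁ ⊤ := fun x _ => trivial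
  rw [rangeEquiv_apply, rangeEquiv_apply, pullFun_restrict, ← pullFun_congr h (le_comp_preimage h1 h0),
    ← pullFun_pullFun _ _ h1 h0]
  have := Scheme.ΓSpecIso_naturality (CommRingCat.ofHom T)
  have h2 := congrArg (fun g => g.hom (pullFun m m.opensRange ⊤ h0 z)) this
  simp only [CommRingCat.hom_comp, RingHom.comp_apply, CommRingCat.hom_ofHom] at h2
  rw [← h2]
  congr 1

end SpecPieces

section GluedScheme

theorem spec_surjective {R S : Type u} [CommRing R] [CommRing S] (q : R →+* S)
    (hq : Function.Surjective q) (hn : ∀ r, q r = 0 → IsNilpotent r) :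
    Function.Surjective (Spec.map (CommRingCat.ofHom q)) := by
  have h2 : Set.range (PrimeSpectrum.comap q) = Set.univ := by
    rw [_root_.range_comap_of_surjective _ _ hq]
    refine Set.eq_univ_of_forall fun x a ha => ?_
    obtain ⟨n, hn⟩ := hn a ha
    exact x.2.mem_of_pow_mem n (hn ▸ Ideal.zero_mem _)
  exact Set.range_eq_univ.1 h2

theorem spec_injective {R S : Type u} [CommRing R] [CommRing S] (q : R →+* S)
    (hq : Function.Surjective q) : Function.Injective (Spec.map (CommRingCat.ofHom q)) :=
  have := IsClosedImmersion.spec_of_surjective (CommRingCat.ofHom q) hq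
  (Spec.map (CommRingCat.ofHom q)).isClosedEmbedding.injective

variable {Y : Scheme.{u}} {J : Type u} [Preorder J] {U : J → Y.Opens}
  (hU : ∀ i, IsAffineOpen (U i)) (hmono : ∀ {i j}, i ≤ j → U i ≤ U j)
  (Q : J → Type u) [∀ i, CommRing (Q i)] (T : ∀ {i j}, i ≤ j → (Q j →+* Q i))
  (T_self : ∀ i (h : i ≤ i) p, T h p = p)
  (T_T : ∀ {i j l} (h : i ≤ j) (h' : j ≤ l) p, T h (T h' p) = T (h.trans h') p)
  (q : ∀ i, Q i →+* Γ(Y, U i)) (q_surj : ∀ i, Function.Surjective (q i))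
  (q_nil : ∀ i p, q i p = 0 → IsNilpotent p)
  (q_T : ∀ {i j} (h : i ≤ j) p, q i (T h p) = resFun Y (hmono h) (q j p))

/-- The diagram of the spectra of a compatible system of rings. -/
def specDiagram : J ⥤ Scheme.{u} where
  obj i := Spec (.of (Q i))
  map h := Spec.map (CommRingCat.ofHom (T (leOfHom h)))
  map_id i := by
    have : CommRingCat.ofHom (T (leOfHom (𝟙 i))) = 𝟙 _ :=
      CommRingCat.hom_ext (RingHom.ext fun p => T_self i _ p)
    rw [this, Spec.map_id]
  map_comp h h' := by
    rw [← Spec.map_comp]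
    congr 1
    exact CommRingCat.hom_ext (RingHom.ext fun p => (T_T (leOfHom h) (leOfHom h') p).symm)

include q_T in
theorem spec_T_spec_q {i j : J} (h : i ≤ j) (a : Spec Γ(Y, U i)) :
    Spec.map (CommRingCat.ofHom (T h)) (Spec.map (CommRingCat.ofHom (q i)) a) =
      Spec.map (CommRingCat.ofHom (q j)) (Spec.map (Y.presheaf.map (homOfLE (hmono h)).op) a) := by
  rw [← Scheme.Hom.comp_apply, ← Scheme.Hom.comp_apply, ← Spec.map_comp]
  have : CommRingCat.ofHom (T h) ≫ CommRingCat.ofHom (q i) =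
      CommRingCat.ofHom (q j) ≫ Y.presheaf.map (homOfLE (hmono h)).op :=
    CommRingCat.hom_ext (RingHom.ext fun p => q_T h p)
  rw [this, Spec.map_comp]

omit [Preorder J] in
theorem fromSpec_spec_res {i j : J} (h : U i ≤ U j) (a : Spec Γ(Y, U i)) :
    (hU j).fromSpec (Spec.map (Y.presheaf.map (homOfLE h).op) a) = (hU i).fromSpec a := by
  rw [← Scheme.Hom.comp_apply, (hU j).map_fromSpec (hU i)]

theorem exists_fromSpec_eq {V : Y.Opens} (hV : IsAffineOpen V) {y : Y} (hy : y ∈ V) :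
    ∃ a, hV.fromSpec a = y := by
  rw [← hV.opensRange_fromSpec] at hy
  exact hy

theorem fromSpec_mem {V : Y.Opens} (hV : IsAffineOpen V) (a) : hV.fromSpec a ∈ V := by
  have := hV.opensRange_fromSpec
  exact this.le ⟨a, rfl⟩

include q_T q_surj q_nil hU T_self T_T in
-- Each `Spec (Q i)` is a thickening of `U i` with the same points, so the combinatorics of the
-- diagram is that of opens of `Y`. It is a locally directed diagram of open immersions, whose
-- colimit contains the pieces as opens.
theorem exists_glued_scheme (hcov : ∀ y, ∃ i, y ∈ U i)
    (hdir : ∀ i j y, y ∈ U i → y ∈ U j → ∃ l, l ≤ i ∧ l ≤ j ∧ y ∈ U l)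
    (hopen : ∀ {i j} (h : i ≤ j), IsOpenImmersion (Spec.map (CommRingCat.ofHom (T h)))) :
    ∃ (Z : Scheme.{u}) (V : J → Z.Opens) (m : Y ⟶ Z) (_ : ∀ i, IsAffineOpen (V i))
      (hm : ∀ i, m ⁻¹ᵁ V i = U i) (b : ∀ i, Γ(Z, V i) ≃+* Q i), Surjective m ∧
      (∀ {i j} (h : i ≤ j) (h' : V i ≤ V j) z, b i (resFun Z h' z) = T h (b j z)) ∧
      ∀ i z, pullFun m (V i) (U i) (hm i).ge z = q i (b i z) := by
  let F := specDiagram Q T T_self T_T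
  have hF : ∀ {i j} (h : i ⟶ j), IsOpenImmersion (F.map h) := fun h => hopen _
  -- Points of the spectra are read as points of `Y`; two that agree in a larger piece are the same
  -- point of `Y`, which lies in some smaller `U n`.
  have hdirF : (F ⋙ Scheme.forget).IsLocallyDirected := by
    refine ⟨fun {i j l} fi fj xi xj h => ?_⟩
    obtain ⟨a, rfl⟩ := spec_surjective (q i) (q_surj i) (q_nil i) xi
    obtain ⟨a', rfl⟩ := spec_surjective (q j) (q_surj j) (q_nil j) xj
    have h1 : Spec.map (CommRingCat.ofHom (T (leOfHom fi))) (Spec.map (CommRingCat.ofHom (q i)) a) =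
      Spec.map (CommRingCat.ofHom (T (leOfHom fj))) (Spec.map (CommRingCat.ofHom (q j)) a') := h
    rw [spec_T_spec_q hmono Q T q q_T, spec_T_spec_q hmono Q T q q_T] at h1
    have h2 := spec_injective (q l) (q_surj l) h1
    have h3 : (hU i).fromSpec a = (hU j).fromSpec a' := by
      rw [← fromSpec_spec_res hU (hmono (leOfHom fi)), h2, fromSpec_spec_res hU]
    obtain ⟨n, ni, nj, hn⟩ := hdir i j _ (fromSpec_mem (hU i) a) (h3 ▸ fromSpec_mem (hU j) a')
    obtain ⟨c, hc⟩ := exists_fromSpec_eq (hU n) hn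
    refine ⟨n, homOfLE ni, homOfLE nj, Spec.map (CommRingCat.ofHom (q n)) c, ?_, ?_⟩
    · refine (spec_T_spec_q hmono Q T q q_T ni c).trans (congrArg _ ?_)
      exact (hU i).fromSpec.isOpenEmbedding.injective
        ((fromSpec_spec_res hU (hmono ni) c).trans hc)
    · refine (spec_T_spec_q hmono Q T q q_T nj c).trans (congrArg _ ?_)
      exact (hU j).fromSpec.isOpenEmbedding.injective
        ((fromSpec_spec_res hU (hmono nj) c).trans (hc.trans h3))
  let Z := Limits.colimit F
  let ι : ∀ i, Spec (.of (Q i)) ⟶ Z := fun i => Limits.colimit.ι F i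
  have hι : ∀ i, IsOpenImmersion (ι i) := fun i =>
    inferInstanceAs (IsOpenImmersion (Limits.colimit.ι F i))
  have w : ∀ {i j} (h : i ≤ j), Spec.map (CommRingCat.ofHom (T h)) ≫ ι j = ι i :=
    fun h => Limits.colimit.w F (homOfLE h)
  obtain ⟨m, hm⟩ := exists_hom_of_affine U hU (fun i => (ι i).opensRange)
    (fun i => isAffineOpen_opensRange (ι i)) (fun i => (q i).comp (rangeEquiv (ι i)).toRingHom) hcov
    (fun i j z hi hj => by
      obtain ⟨l, li, lj, hl⟩ := hdir i j z hi hj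
      refine ⟨l, hmono li, hmono lj, opensRange_le _ _ _ (w li), opensRange_le _ _ _ (w lj), hl,
        fun a => ?_, fun a => ?_⟩
      · refine (q_T li _).symm.trans (congrArg (q l) ?_)
        exact (rangeEquiv_resFun _ _ _ (w li) _ _).symm
      · refine (q_T lj _).symm.trans (congrArg (q l) ?_)
        exact (rangeEquiv_resFun _ _ _ (w lj) _ _).symm)
  have hpt : ∀ i a, m ((hU i).fromSpec a) = ι i (Spec.map (CommRingCat.ofHom (q i)) a) := by
    intro i a
    obtain ⟨h, he⟩ := hm i
    rw [← Scheme.Hom.comp_apply, ← IsAffineOpen.SpecMap_appLE_fromSpec m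
      (isAffineOpen_opensRange (ι i)) (hU i) h, ← Scheme.Hom.comp_apply]
    have h1 : m.appLE (ι i).opensRange (U i) h =
        CommRingCat.ofHom (rangeEquiv (ι i)).toRingHom ≫ CommRingCat.ofHom (q i) :=
      CommRingCat.hom_ext he
    rw [h1, Spec.map_comp, Category.assoc, spec_rangeEquiv_fromSpec]
  refine ⟨Z, fun i => (ι i).opensRange, m, fun i => isAffineOpen_opensRange (ι i), fun i => ?_,
    fun i => rangeEquiv (ι i), ⟨fun z => ?_⟩, fun h h' z => ?_, fun i z => ?_⟩
  · refine le_antisymm ?_ (hm i).choose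
    rintro y ⟨x, hx⟩
    obtain ⟨j, hj⟩ := hcov y
    obtain ⟨a, rfl⟩ := exists_fromSpec_eq (hU j) hj
    have hx' : ι i x = m ((hU j).fromSpec a) := hx
    rw [hpt] at hx'
    -- Points identified in the colimit come from a common smaller piece, so the point of `Y`
    -- already lies in `U i`.
    obtain ⟨l, fi, fj, c, hc, hc'⟩ := Scheme.IsLocallyDirected.ι_eq_ι_iff F |>.1 hx'
    obtain ⟨c, rfl⟩ := spec_surjective (q l) (q_surj l) (q_nil l) c
    have h1 := (spec_T_spec_q hmono Q T q q_T (leOfHom fj) c).symm.trans hc'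
    have h2 := spec_injective (q j) (q_surj j) h1
    rw [← h2, fromSpec_spec_res hU]
    exact hmono (leOfHom fi) (fromSpec_mem (hU l) c)
  · obtain ⟨i, x, rfl⟩ := Scheme.IsLocallyDirected.ι_jointly_surjective F z
    obtain ⟨a, rfl⟩ := spec_surjective (q i) (q_surj i) (q_nil i) x
    exact ⟨_, hpt i a⟩
  · exact rangeEquiv_resFun _ _ _ (w h) h' z
  · exact RingHom.congr_fun (hm i).choose_spec z

end GluedScheme

end

/-! ### Flatness, Cartesian squares and open immersions tested on affine covers -/

section

open TensorProduct

section

variable {R R' : Type u} [CommRing R] [CommRing R']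

theorem hom_ext_of_constants {Z : Scheme.{u}} {p p' : Z ⟶ Spec (.of R)}
    (h : ∀ z : Z, ∃ U : Z.Opens, IsAffineOpen U ∧ z ∈ U ∧ constants p U = constants p' U) :
    p = p' := by
  refine hom_ext_of_pullFun fun z => ?_
  obtain ⟨U, hU, hz, e⟩ := h z
  refine ⟨U, ⊤, fun _ _ => trivial, fun _ _ => trivial, hU, isAffineOpen_top _, hz, fun a => ?_⟩
  obtain ⟨r, rfl⟩ := (ConcreteCategory.bijective_of_isIso (Scheme.ΓSpecIso (.of R)).inv).2 a
  exact RingHom.congr_fun e r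

theorem flat_of_constants {Z : Scheme.{u}} (p : Z ⟶ Spec (.of R)) {ι : Type*} (V : ι → Z.Opens)
    (hV : ∀ i, IsAffineOpen (V i)) (hcov : ∀ z, ∃ i, z ∈ V i)
    (h : ∀ i, (constants p (V i)).Flat) : Flat p := by
  refine (HasRingHomProperty.iff_of_iSup_eq_top (P := @Flat) (fun i => ⟨V i, hV i⟩) ?_).2
    fun i => ?_
  · exact top_le_iff.1 fun z _ => Opens.mem_iSup.2 (hcov z)
  · have h1 : (p.appLE ⊤ (V i) le_top).hom =
        (constants p (V i)).comp (Scheme.ΓSpecIso (.of R)).hom.hom := by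
      have : p.appLE ⊤ (V i) le_top = (Scheme.ΓSpecIso (.of R)).hom ≫
          ((Scheme.ΓSpecIso (.of R)).inv ≫ p.appLE ⊤ (V i) le_top) := by simp
      exact congrArg CommRingCat.Hom.hom this
    rw [h1]
    exact RingHom.Flat.comp (RingHom.Flat.of_bijective
      (ConcreteCategory.bijective_of_isIso (Scheme.ΓSpecIso (.of R)).hom)) (h i)

theorem exists_hom_of_constants {Z : Scheme.{u}} {ι : Type u} [Preorder ι] (V : ι → Z.Opens)
    (hV : ∀ i, IsAffineOpen (V i)) (hcov : ∀ z, ∃ i, z ∈ V i) (c : ∀ i, R →+* Γ(Z, V i))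
    (hc : ∀ i j z, z ∈ V i → z ∈ V j → ∃ (l : ι) (hi : V l ≤ V i) (hj : V l ≤ V j), z ∈ V l ∧
      (∀ r, resFun Z hi (c i r) = c l r) ∧ ∀ r, resFun Z hj (c j r) = c l r) :
    ∃ p : Z ⟶ Spec (.of R), ∀ i, constants p (V i) = c i := by
  obtain ⟨p, hp⟩ := exists_hom_of_affine V hV (fun _ => (⊤ : (Spec (.of R)).Opens))
    (fun _ => isAffineOpen_top _) (fun i => (c i).comp (Scheme.ΓSpecIso (.of R)).hom.hom) hcov
    (fun i j z hi hj => by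
      obtain ⟨l, li, lj, hl, H, H'⟩ := hc i j z hi hj
      refine ⟨l, li, lj, le_rfl, le_rfl, hl, fun a => ?_, fun a => ?_⟩
      · rw [resFun_self]; exact H _
      · rw [resFun_self]; exact H' _)
  refine ⟨p, fun i => RingHom.ext fun r => ?_⟩
  obtain ⟨h, e⟩ := hp i
  rw [constants_apply p h, e]
  exact congrArg (c i) (by
    rw [← CommRingCat.comp_apply, Iso.inv_hom_id]; rfl)

theorem isIso_of_app_bijective {Z T : Scheme.{u}} (l : Z ⟶ T) {ι : Type*} (V : ι → T.Opens)
    (hV : ∀ i, IsAffineOpen (V i)) (hV' : ∀ i, IsAffineOpen (l ⁻¹ᵁ V i))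
    (hcov : ∀ z, ∃ i, z ∈ V i)
    (h : ∀ i, Function.Bijective (pullFun l (V i) (l ⁻¹ᵁ V i) le_rfl)) : IsIso l := by
  have inst :=
    instHasAffinePropertyIsomorphismsSchemeAndIsAffineIsIsoCommRingCatAppTop.{u}
  change MorphismProperty.isomorphisms Scheme l
  refine (@HasAffineProperty.iff_of_iSup_eq_top _ _ inst _ _ _ _
    (fun i => ⟨V i, hV i⟩) (top_le_iff.1 fun z _ => Opens.mem_iSup.2 (hcov z))).2 fun i => ?_
  refine ⟨hV' i, ?_⟩
  have h1 : IsIso (l.app (V i)) := by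
    rw [ConcreteCategory.isIso_iff_bijective]
    have := h i
    rwa [pullFun, ← Scheme.Hom.app_eq_appLE] at this
  have h2 : IsIso (l.app ((V i).ι ''ᵁ ⊤)) := by rwa [Scheme.Opens.ι_image_top]
  change IsIso (l ∣_ V i).appTop
  rw [morphismRestrict_appTop]
  exact IsIso.comp_isIso' h2 (Functor.map_isIso _ _)

/-- The comparison map to the fibre product is an isomorphism: over each affine `V i` both sides
have as functions the quotient by the ideal generated by `ker φ`. -/
theorem isPullback_of_cover {Z Z' : Scheme.{u}} {m : Z ⟶ Z'} {p : Z ⟶ Spec (.of R)}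
    {p' : Z' ⟶ Spec (.of R')} {φ : R' →+* R} (hφ : Function.Surjective φ)
    (w : m ≫ p' = p ≫ Spec.map (CommRingCat.ofHom φ)) {ι : Type*} (V : ι → Z'.Opens)
    (hV : ∀ i, IsAffineOpen (V i)) (hV' : ∀ i, IsAffineOpen (m ⁻¹ᵁ V i))
    (hcov : ∀ z, ∃ i, z ∈ V i)
    (hsurj : ∀ i, Function.Surjective (pullFun m (V i) (m ⁻¹ᵁ V i) le_rfl))
    (hker : ∀ i a, pullFun m (V i) (m ⁻¹ᵁ V i) le_rfl a = 0 →
      a ∈ (RingHom.ker φ).map (constants p' (V i))) :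
    IsPullback m p p' (Spec.map (CommRingCat.ofHom φ)) := by
  let s := Spec.map (CommRingCat.ofHom φ)
  have H := IsPullback.of_hasPullback p' s
  let l := Limits.pullback.lift m p w
  have hl : l ≫ Limits.pullback.fst p' s = m := Limits.pullback.lift_fst _ _ _
  have hl' : l ≫ Limits.pullback.snd p' s = p := Limits.pullback.lift_snd _ _ _
  have hc : IsClosedImmersion (Limits.pullback.fst p' s) := isClosedImmersion_of_isPullback H hφ
  have hpre : ∀ i, l ⁻¹ᵁ (Limits.pullback.fst p' s ⁻¹ᵁ V i) = m ⁻¹ᵁ V i := fun i => by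
    rw [← Scheme.Hom.comp_preimage, hl]
  have hcomp : ∀ i a, pullFun l _ (l ⁻¹ᵁ (Limits.pullback.fst p' s ⁻¹ᵁ V i)) le_rfl
      (pullFun (Limits.pullback.fst p' s) (V i) _ le_rfl a) =
      pullFun m (V i) _ (hpre i).le a := fun i a => by
    rw [pullFun_pullFun, pullFun_congr hl]
  have hiso : IsIso l := by
    refine isIso_of_app_bijective l (fun i => Limits.pullback.fst p' s ⁻¹ᵁ V i)
      (fun i => (hV i).preimage _) (fun i => by rw [hpre]; exact hV' i) (fun z => hcov _)
      fun i => ⟨?_, ?_⟩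
    · rw [injective_iff_map_eq_zero]
      intro a ha
      obtain ⟨a, rfl⟩ := pullFun_surjective (i := Limits.pullback.fst p' s) (hV i) a
      rw [hcomp, ← resFun_pullFun m le_rfl (hpre i).le] at ha
      have ha' : pullFun m (V i) (m ⁻¹ᵁ V i) le_rfl a = 0 := by
        have := congrArg (resFun Z (hpre i).ge) ha
        rwa [resFun_resFun, resFun_self, map_zero] at this
      exact (pullFun_eq_zero_iff H hφ (hV i) a).2 (hker i a ha')
    · intro a
      obtain ⟨b, hb⟩ := hsurj i (resFun Z (hpre i).ge a)
      refine ⟨pullFun (Limits.pullback.fst p' s) (V i) _ le_rfl b, ?_⟩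
      rw [hcomp, ← resFun_pullFun m le_rfl (hpre i).le, hb, resFun_resFun, resFun_self]
  exact IsPullback.of_iso_pullback ⟨w⟩ (asIso l) hl hl'

end

variable {k : Type u} [Field k]

theorem isOpenImmersion_spec_resFun {Z : Scheme.{u}} {U U' : Z.Opens} (hU : IsAffineOpen U)
    (hU' : IsAffineOpen U') (h : U' ≤ U) :
    IsOpenImmersion (Spec.map (CommRingCat.ofHom (resFun Z h))) := by
  have h1 : Spec.map (CommRingCat.ofHom (resFun Z h)) ≫ hU.fromSpec = hU'.fromSpec :=
    hU.map_fromSpec hU' (homOfLE h).op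
  have : IsOpenImmersion (Spec.map (CommRingCat.ofHom (resFun Z h)) ≫ hU.fromSpec) := by
    rw [h1]; infer_instance
  exact IsOpenImmersion.of_comp _ hU.fromSpec

/-- It exhibits `R ⊗ B → R ⊗ B'` as a base change of `B → B'`, so restriction maps of trivial
deformations still define open immersions. -/
theorem isPushout_mapTensor (R : Type u) [CommRing R] [Algebra k R] {B B' : Type u} [CommRing B]
    [Algebra k B] [CommRing B'] [Algebra k B'] (g : B →+* B')
    (hg : ∀ a, g (algebraMap k B a) = algebraMap k B' a) :
    IsPushout (CommRingCat.ofHom (incl k R B)) (CommRingCat.ofHom g)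
      (CommRingCat.ofHom (mapTensor R g hg)) (CommRingCat.ofHom (incl k R B')) := by
  have w : CommRingCat.ofHom (incl k R B) ≫ CommRingCat.ofHom (mapTensor R g hg) =
      CommRingCat.ofHom g ≫ CommRingCat.ofHom (incl k R B') :=
    CommRingCat.hom_ext (RingHom.ext fun b => mapTensor_incl R g hg b)
  have halg : ∀ a, algebraMap R (R ⊗[k] B) (algebraMap k R a) = incl k R B (algebraMap k B a) :=
    fun a => by
      rw [← IsScalarTower.algebraMap_apply]
      exact (AlgHom.commutes _ _).symm
  have hcond : ∀ (s : Limits.PushoutCocone (CommRingCat.ofHom (incl k R B)) (CommRingCat.ofHom g)) b,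
      s.inl.hom (incl k R B b) = s.inr.hom (g b) := fun s b =>
    congrArg (fun m => m.hom b) s.condition
  have hk : ∀ (s : Limits.PushoutCocone (CommRingCat.ofHom (incl k R B)) (CommRingCat.ofHom g)) a,
      (s.inl.hom.comp (algebraMap R (R ⊗[k] B))) (algebraMap k R a) =
        s.inr.hom (algebraMap k B' a) := fun s a => by
    rw [RingHom.comp_apply, halg, hcond, hg]
  refine ⟨⟨w⟩, ⟨Limits.PushoutCocone.IsColimit.mk w
    (fun s => CommRingCat.ofHom (tensorLift (s.inl.hom.comp (algebraMap R _)) s.inr.hom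
      (hk s))) (fun s => ?_) (fun s => ?_)
    (fun s m hm hm' => ?_)⟩⟩
  · refine CommRingCat.hom_ext (tensorHom_ext (fun r => ?_) fun b => ?_)
    · exact (congrArg (tensorLift _ _ (hk s)) (mapTensor_algebraMap R g hg r)).trans
        (tensorLift_algebraMap _ _ (hk s) _)
    · exact (congrArg (tensorLift _ _ (hk s)) (mapTensor_incl R g hg b)).trans
        ((tensorLift_incl _ _ (hk s) _).trans (hcond s b).symm)
  · exact CommRingCat.hom_ext (RingHom.ext fun b => tensorLift_incl _ _ (hk s) _)
  · refine CommRingCat.hom_ext (tensorHom_ext (fun r => ?_) fun b => ?_)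
    · refine Eq.trans ?_ (tensorLift_algebraMap _ _ (hk s) _).symm
      rw [← mapTensor_algebraMap R g hg r]
      exact congrArg (fun m => m.hom (algebraMap R _ r)) hm
    · refine Eq.trans ?_ (tensorLift_incl _ _ (hk s) _).symm
      exact congrArg (fun m => m.hom b) hm'

theorem isOpenImmersion_spec_mapTensor (R : Type u) [CommRing R] [Algebra k R] {B B' : Type u}
    [CommRing B] [Algebra k B] [CommRing B'] [Algebra k B'] (g : B →+* B')
    (hg : ∀ a, g (algebraMap k B a) = algebraMap k B' a)
    (h : IsOpenImmersion (Spec.map (CommRingCat.ofHom g))) :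
    IsOpenImmersion (Spec.map (CommRingCat.ofHom (mapTensor R g hg))) :=
  MorphismProperty.of_isPullback (P := @IsOpenImmersion)
    (isPullback_SpecMap_of_isPushout _ _ _ _ (isPushout_mapTensor R g hg)).flip h

theorem isOpenImmersion_spec_comp {A B C : Type u} [CommRing A] [CommRing B] [CommRing C]
    (g : A →+* B) (h : B →+* C) (hg : IsOpenImmersion (Spec.map (CommRingCat.ofHom g)))
    (hh : Function.Bijective h) : IsOpenImmersion (Spec.map (CommRingCat.ofHom (h.comp g))) := by
  have h1 : IsIso (CommRingCat.ofHom h) := (ConcreteCategory.isIso_iff_bijective _).2 hh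
  rw [CommRingCat.ofHom_comp, Spec.map_comp]
  infer_instance

end

section

open TensorProduct

/-! ### The glued deformation of the target -/

variable {k : Type u} [Field k]

namespace SmallSetup

variable {X Y : PoissonScheme k} {f : X.scheme ⟶ Y.scheme} {S : SmallSetup X Y f}

/-- The affine opens of `𝒴` which are small of order `𝒱`. -/
abbrev SmallOpen (S : SmallSetup X Y f) (𝒱 : PtCover Y.scheme) : Type u :=
  {W : S.𝒴.affineOpens // ∃ x, S.fib W ≤ 𝒱.nhd x}

namespace SmallOpen

variable {𝒱 : PtCover Y.scheme} (W : S.SmallOpen 𝒱)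

/-- A chosen point whose neighbourhood contains the small open. -/
def pt : Y.scheme := W.2.choose

theorem pt_le : S.fib W.1 ≤ 𝒱.nhd W.pt := W.2.choose_spec

theorem pt_le_of_le {W W' : S.SmallOpen 𝒱} (h : W' ≤ W) : S.fib W'.1 ≤ 𝒱.nhd W.pt :=
  (S.fib_mono h).trans W.pt_le

theorem exists_mem_le {y : S.𝒴} {N : S.𝒴.Opens} (hy : y ∈ N) :
    ∃ W : S.SmallOpen 𝒱, y ∈ W.1.1 ∧ W.1.1 ≤ N := by
  obtain ⟨x, rfl⟩ := S.e.surjective y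
  obtain ⟨W, hx, hW⟩ := exists_affine_preimage_le S.e (V := 𝒱.nhd x ⊓ S.e ⁻¹ᵁ N) ⟨𝒱.mem x, hy⟩
  exact ⟨⟨W, x, hW.trans inf_le_left⟩, hx,
    (preimage_le_preimage_iff S.e).1 (hW.trans inf_le_right)⟩

end SmallOpen

namespace GluingData

variable {𝒱 : PtCover Y.scheme} {𝒰 : PtCover X.scheme} (G : S.GluingData 𝒱 𝒰)

/-- By the cocycle condition `θ hx hx` kills the differences `θ p - p`. These are multiples of `t`,
which transitions fix, so they vanish. -/
theorem θ_self {x : Y.scheme} {W : S.𝒴.affineOpens} (hx : S.fib W ≤ 𝒱.nhd x) (p : S.P W) :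
    G.θ hx hx p = p := by
  have h0 : G.θ hx hx (G.θ hx hx p - p) = 0 := by rw [map_sub, G.θ_θ, sub_self]
  have hq : G.q hx (G.θ hx hx p - p) = 0 := by rw [map_sub, G.q_θ, sub_self]
  obtain ⟨n, hn⟩ := ((G.thick hx).ker_q _).1 hq
  have hn' : G.θ hx hx p - p = S.τ W (S.ρ W n) := hn.trans ((S.thickP W).tau_rho n).symm
  rw [hn', LocalData.θ_τ, ← hn'] at h0
  exact sub_eq_zero.1 h0

theorem θ_bijective {x y : Y.scheme} {W : S.𝒴.affineOpens} (hx : S.fib W ≤ 𝒱.nhd x)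
    (hy : S.fib W ≤ 𝒱.nhd y) : Function.Bijective (G.θ hx hy) :=
  Function.bijective_iff_has_inverse.2 ⟨G.θ hy hx, fun p => by rw [G.θ_θ, G.θ_self],
    fun p => by rw [G.θ_θ, G.θ_self]⟩

/-- The transition maps of the rings `P W`. -/
def T {W' W : S.SmallOpen 𝒱} (h : W' ≤ W) : S.P W.1 →+* S.P W'.1 :=
  (G.θ W'.pt_le (SmallOpen.pt_le_of_le h)).comp (S.resP h)

theorem T_apply {W' W : S.SmallOpen 𝒱} (h : W' ≤ W) (p) :
    G.T h p = G.θ W'.pt_le (SmallOpen.pt_le_of_le h) (S.resP h p) := rfl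

theorem T_cP {W' W : S.SmallOpen 𝒱} (h : W' ≤ W) (r) : G.T h (S.cP W.1 r) = S.cP W'.1 r := by
  rw [T_apply, resP_cP, G.θ_cP]

theorem T_br {W' W : S.SmallOpen 𝒱} (h : W' ≤ W) (p p') :
    G.T h (G.br W.pt_le p p') = G.br W'.pt_le (G.T h p) (G.T h p') := by
  rw [T_apply, G.br_res W.pt_le h, G.θ_br]; rfl

theorem T_self (W : S.SmallOpen 𝒱) (h : W ≤ W) (p) : G.T h p = p := by
  rw [T_apply, S.resP_self]
  exact G.θ_self _ _

/-- Functoriality of the diagram to be glued is the cocycle condition, once every small open has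
been assigned a point. -/
theorem T_T {W'' W' W : S.SmallOpen 𝒱} (h : W'' ≤ W') (h' : W' ≤ W) (p) :
    G.T h (G.T h' p) = G.T (h.trans h') p := by
  rw [T_apply, T_apply, T_apply, G.θ_res _ _ h, G.θ_θ, S.resP_resP]

theorem q_T {W' W : S.SmallOpen 𝒱} (h : W' ≤ W) (p) :
    G.q W'.pt_le (G.T h p) = resFun S.𝒴 h (G.q W.pt_le p) := by
  rw [T_apply, G.q_θ, G.q_resP W.pt_le h]

theorem isOpenImmersion_T {W' W : S.SmallOpen 𝒱} (h : W' ≤ W) :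
    IsOpenImmersion (Spec.map (CommRingCat.ofHom (G.T h))) :=
  isOpenImmersion_spec_comp _ _ (isOpenImmersion_spec_mapTensor _ _ _
    (isOpenImmersion_spec_resFun (S.isAffineOpen_fib _) (S.isAffineOpen_fib _) _))
    (G.θ_bijective _ _)

/-- A scheme glued from the spectra of the rings `P W`. -/
structure Glued where
  Z : Scheme.{u}
  str : Z ⟶ Spec (.of S.A'.carrier)
  m : S.𝒴 ⟶ Z
  surj : Surjective m
  V : S.SmallOpen 𝒱 → Z.Opens
  hV : ∀ W, IsAffineOpen (V W)
  hm : ∀ W, m ⁻¹ᵁ V W = W.1.1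
  b : ∀ W, Γ(Z, V W) ≃+* S.P W.1
  b_res : ∀ {W' W} (h : W' ≤ W) (h' : V W' ≤ V W) z, b W' (resFun Z h' z) = G.T h (b W z)
  m_b : ∀ W z, pullFun m (V W) W.1.1 (hm W).ge z = G.q W.pt_le (b W z)
  b_const : ∀ W r, b W (constants str (V W) r) = S.cP W.1 r

theorem nonempty_glued : Nonempty G.Glued := by
  obtain ⟨Z, V, m, hV, hm, b, hs, b_res, m_b⟩ := exists_glued_scheme
    (U := fun W : S.SmallOpen 𝒱 => W.1.1) (fun W => W.1.2) (fun h => h) (fun W => S.P W.1)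
    (fun h => G.T h) G.T_self G.T_T (fun W => G.q W.pt_le) (fun W => (G.thick W.pt_le).q_surj)
    (fun W p hp => by
      obtain ⟨n, hn⟩ := (G.thick W.pt_le).isNilpotent_ker
      exact ⟨n, by simpa [hn] using Ideal.pow_mem_pow (show p ∈ RingHom.ker (G.q W.pt_le) from hp) n⟩)
    G.q_T (fun y => (SmallOpen.exists_mem_le (N := ⊤) (y := y) trivial).imp fun W h => h.1)
    (fun W W' y hy hy' => (SmallOpen.exists_mem_le (N := W.1.1 ⊓ W'.1.1) ⟨hy, hy'⟩).imp fun W h =>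
      ⟨h.2.trans inf_le_left, h.2.trans inf_le_right, h.1⟩)
    G.isOpenImmersion_T
  have hle : ∀ {W' W : S.SmallOpen 𝒱}, W' ≤ W → V W' ≤ V W := fun {W' W} h =>
    (preimage_le_preimage_iff m).1 (by rw [hm, hm]; exact h)
  have hres : ∀ {W' W : S.SmallOpen 𝒱} (h : W' ≤ W) r,
      resFun Z (hle h) ((b W).symm (S.cP W.1 r)) = (b W').symm (S.cP W'.1 r) := fun {W' W} h r => by
    rw [RingEquiv.eq_symm_apply, b_res h, RingEquiv.apply_symm_apply, G.T_cP]
  obtain ⟨p, hp⟩ := exists_hom_of_constants V hV (fun z => by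
      obtain ⟨y, rfl⟩ := m.surjective z
      obtain ⟨W, hy, -⟩ := SmallOpen.exists_mem_le (𝒱 := 𝒱) (N := ⊤) (y := y) trivial
      rw [← hm W] at hy
      exact ⟨W, hy⟩)
    (fun W => (b W).symm.toRingHom.comp (S.cP W.1)) (fun W W' z hz hz' => by
      obtain ⟨y, rfl⟩ := m.surjective z
      have hz1 : y ∈ m ⁻¹ᵁ V W ⊓ m ⁻¹ᵁ V W' := ⟨hz, hz'⟩
      rw [hm, hm] at hz1
      obtain ⟨W₁, hy, h⟩ := SmallOpen.exists_mem_le (𝒱 := 𝒱) hz1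
      rw [← hm W₁] at hy
      exact ⟨W₁, hle (h.trans inf_le_left), hle (h.trans inf_le_right), hy,
        fun r => hres (h.trans inf_le_left) r, fun r => hres (h.trans inf_le_right) r⟩)
  exact ⟨⟨Z, p, m, hs, V, hV, hm, b, fun {W' W} h h' z => b_res h h' z, m_b, fun W r => by
    rw [hp]; exact (b W).apply_symm_apply _⟩⟩

end GluingData

end SmallSetup

end

/-! ### The Poisson deformation structure on the glued scheme -/

section

open TensorProduct

variable {k : Type u} [Field k]

theorem IsAltBider.transport {R M N : Type*} [CommRing R] [CommRing M] [CommRing N]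
    {c : R →+* M} {β : M → M → M} (h : IsAltBider c β) (b : N ≃+* M) {c' : R →+* N}
    (hc : ∀ r, b (c' r) = c r) : IsAltBider c' (fun x y => b.symm (β (b x) (b y))) where
  add_left x y z := by simp only [map_add, h.add_left]
  add_right x y z := by simp only [map_add, h.add_right]
  self x := by simp only [h.self, map_zero]
  mul_right x y z := by
    simp only [map_mul, h.mul_right, map_add, RingEquiv.symm_apply_apply]
  const_right x r := by simp only [hc, h.const_right, map_zero]

theorem jacobiator_transport {M N : Type*} [CommRing M] [CommRing N] {β : M → M → M}
    (b : N ≃+* M) (x y z : N) : jacobiator (fun x y => b.symm (β (b x) (b y))) x y z =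
      b.symm (jacobiator β (b x) (b y) (b z)) := by
  simp only [jacobiator, RingEquiv.apply_symm_apply, map_add]

theorem constants_comp_spec {R R' : Type u} [CommRing R] [CommRing R'] {Z : Scheme.{u}}
    (p : Z ⟶ Spec (.of R)) (φ : R' →+* R) (U : Z.Opens) (r : R') :
    constants (p ≫ Spec.map (CommRingCat.ofHom φ)) U r = constants p U (φ r) := by
  have h : U ≤ 𝟙 Z ⁻¹ᵁ U := le_rfl
  refine Eq.trans ?_ (pullFun_constants_of_comm (𝟙 Z) p (p ≫ Spec.map (CommRingCat.ofHom φ)) φ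
    (Category.id_comp _) h r)
  rw [pullFun_id, resFun_self]

namespace SmallSetup

variable {X Y : PoissonScheme k} {f : X.scheme ⟶ Y.scheme} {S : SmallSetup X Y f}

namespace GluingData.Glued

variable {𝒱 : PtCover Y.scheme} {𝒰 : PtCover X.scheme} {G : S.GluingData 𝒱 𝒰} (D : G.Glued)

instance : Surjective D.m := D.surj

theorem V_le_iff {W' W : S.SmallOpen 𝒱} : D.V W' ≤ D.V W ↔ W' ≤ W := by
  rw [← preimage_le_preimage_iff D.m, D.hm, D.hm]; rfl

theorem exists_mem_V (z : D.Z) : ∃ W, z ∈ D.V W := by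
  obtain ⟨y, rfl⟩ := D.m.surjective z
  obtain ⟨W, hy, -⟩ := SmallOpen.exists_mem_le (𝒱 := 𝒱) (N := ⊤) (y := y) trivial
  rw [← D.hm W] at hy
  exact ⟨W, hy⟩

theorem constants_eq (W : S.SmallOpen 𝒱) (r) :
    constants D.str (D.V W) r = (D.b W).symm (S.cP W.1 r) := by
  rw [RingEquiv.eq_symm_apply, D.b_const]

theorem flat : Flat D.str := by
  refine flat_of_constants _ D.V D.hV D.exists_mem_V fun W => ?_
  have : constants D.str (D.V W) = (D.b W).symm.toRingHom.comp (S.cP W.1) :=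
    RingHom.ext fun r => D.constants_eq W r
  rw [this]
  exact RingHom.Flat.comp ((RingHom.flat_algebraMap_iff).2 inferInstance)
    (RingHom.Flat.of_bijective (D.b W).symm.bijective)

theorem pullFun_m (W : S.SmallOpen 𝒱) (z) : pullFun D.m (D.V W) (D.m ⁻¹ᵁ D.V W) le_rfl z =
    resFun S.𝒴 (D.hm W).le (G.q W.pt_le (D.b W z)) := by
  rw [← D.m_b, resFun_pullFun]

theorem m_str : D.m ≫ D.str = S.ξ.cod.total.str ≫ specMap S.φ := by
  refine hom_ext_of_constants fun y => ?_
  obtain ⟨W, hy, -⟩ := SmallOpen.exists_mem_le (𝒱 := 𝒱) (N := ⊤) (y := y) trivial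
  refine ⟨W.1.1, W.1.2, hy, RingHom.ext fun r => ?_⟩
  rw [← pullFun_constants D.m _ D.str rfl (D.hm W).ge, D.m_b, D.b_const, Charts.q_cP]
  exact (constants_comp_spec _ S.φ.toRingHom _ r).symm

/-- On each piece the kernel of reduction to `𝒴` is generated by `t`, which is exactly base change
along `φ`. -/
theorem isPullback : IsPullback D.m S.ξ.cod.total.str D.str (specMap S.φ) := by
  refine isPullback_of_cover S.φ_surj D.m_str D.V D.hV
    (fun W => by rw [D.hm]; exact W.1.2) D.exists_mem_V (fun W a => ?_) (fun W a ha => ?_)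
  · obtain ⟨p, hp⟩ := (G.thick W.pt_le).q_surj (resFun S.𝒴 (D.hm W).ge a)
    refine ⟨(D.b W).symm p, ?_⟩
    rw [D.pullFun_m, RingEquiv.apply_symm_apply, hp, resFun_resFun, resFun_self]
  · rw [D.pullFun_m] at ha
    have ha' := congrArg (resFun S.𝒴 (D.hm W).ge) ha
    rw [resFun_resFun, resFun_self, map_zero] at ha'
    obtain ⟨n, hn⟩ := ((G.thick W.pt_le).ker_q _).1 ha'
    refine (S.mem_map_ker_φ _ _).2 ⟨(D.b W).symm n, ?_⟩
    rw [D.constants_eq, ← map_mul, ← hn, RingEquiv.symm_apply_apply]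

theorem exists_mem_V_le {z : D.Z} {N : D.Z.Opens} (hz : z ∈ N) : ∃ W, z ∈ D.V W ∧ D.V W ≤ N := by
  obtain ⟨y, rfl⟩ := D.m.surjective z
  obtain ⟨W, hy, h⟩ := SmallOpen.exists_mem_le (𝒱 := 𝒱) (N := D.m ⁻¹ᵁ N) (y := y) hz
  rw [← D.hm W] at hy h
  exact ⟨W, hy, (preimage_le_preimage_iff D.m).1 h⟩

/-- The local brackets agree on smaller pieces because transitions preserve them, and the pieces
form a basis. -/
theorem exists_brackets : ∃ br : ∀ U : D.Z.Opens, Γ(D.Z, U) → Γ(D.Z, U) → Γ(D.Z, U),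
      (∀ U, IsAltBider (constants D.str U) (br U)) ∧ (∀ U x y z, jacobiator (br U) x y z = 0) ∧
      (∀ {U U' : D.Z.Opens} (h : U' ≤ U) a b, resFun D.Z h (br U a b) =
        br U' (resFun D.Z h a) (resFun D.Z h b)) ∧
      ∀ W, br (D.V W) = fun x y => (D.b W).symm (G.br W.pt_le (D.b W x) (D.b W y)) := by
  refine exists_poissonScheme_of_basis D.Z D.str D.V (fun U z hz => D.exists_mem_V_le hz) _
    (fun W => (G.br_bider W.pt_le).transport (D.b W) (D.b_const W))
    (fun W x y z => by rw [jacobiator_transport, G.jacobi, map_zero]) (fun W' W h x y => ?_)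
  have h' := D.V_le_iff.1 h
  rw [RingEquiv.eq_symm_apply, D.b_res h', D.b_res h', D.b_res h', RingEquiv.apply_symm_apply,
    G.T_br]

end GluingData.Glued

/-- A deformation of the target glued from the rings `P W`, lifting the given one. -/
structure GluingData.GluedDeformation {𝒱 : PtCover Y.scheme} {𝒰 : PtCover X.scheme}
    (G : S.GluingData 𝒱 𝒰) where
  cod : Deformation Y S.A'
  m : S.𝒴 ⟶ cod.total.scheme
  surj : Surjective m
  isBaseChange : Deformation.IsBaseChange S.φ m
  V : S.SmallOpen 𝒱 → cod.total.scheme.Opens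
  hV : ∀ W, IsAffineOpen (V W)
  hm : ∀ W, m ⁻¹ᵁ V W = W.1.1
  b : ∀ W, Γ(cod.total.scheme, V W) ≃+* S.P W.1
  b_res : ∀ {W' W} (h : W' ≤ W) (h' : V W' ≤ V W) z,
    b W' (resFun cod.total.scheme h' z) = G.T h (b W z)
  m_b : ∀ W z, pullFun m (V W) W.1.1 (hm W).ge z = G.q W.pt_le (b W z)
  b_const : ∀ W r, b W (constants cod.total.str (V W) r) = S.cP W.1 r
  b_bracket : ∀ W x y, b W (cod.total.bracket (V W) x y) = G.br W.pt_le (b W x) (b W y)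

theorem GluingData.nonempty_gluedDeformation {𝒱 : PtCover Y.scheme} {𝒰 : PtCover X.scheme}
    (G : S.GluingData 𝒱 𝒰) : Nonempty G.GluedDeformation := by
  obtain ⟨D⟩ := G.nonempty_glued
  obtain ⟨br, h, hj, hres, hbr⟩ := D.exists_brackets
  let Z := PoissonScheme.ofBrackets D.Z D.str br h hj hres
  have hZ : ∀ W x y, D.b W (br (D.V W) x y) = G.br W.pt_le (D.b W x) (D.b W y) := fun W x y => by
    rw [hbr, RingEquiv.apply_symm_apply]
  have hP : IsPoissonMap S.ξ.cod.total Z D.m := by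
    refine IsPoissonMap.of_local fun y V hy => ?_
    obtain ⟨W, hW, hle⟩ := D.exists_mem_V_le hy
    refine ⟨D.V W, W.1.1, (D.hm W).ge, hle, (D.hm W).le hW, fun a a' => ?_⟩
    refine (D.m_b W _).trans ?_
    refine ((congrArg _ (hZ W a a')).trans (G.q_br _ _ _)).trans ?_
    exact congrArg₂ _ (D.m_b W a).symm (D.m_b W a').symm
  have haug : specMap S.A.aug ≫ specMap S.φ = specMap S.A'.aug := by
    rw [specMap, specMap, specMap, ← Spec.map_comp]
    congr 1
    exact CommRingCat.hom_ext (RingHom.ext fun r => Art.aug_comp S.φ r)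
  exact ⟨{
    cod := ⟨Z, D.flat, S.e ≫ D.m, by
      have := S.ξ.cod.isPullback.paste_horiz D.isPullback
      rwa [haug] at this, S.ξ.cod.incl_poisson.comp hP⟩
    m := D.m
    surj := D.surj
    isBaseChange := ⟨D.isPullback, rfl, hP⟩
    V := D.V
    hV := D.hV
    hm := D.hm
    b := D.b
    b_res := D.b_res
    m_b := D.m_b
    b_const := D.b_const
    b_bracket := hZ }⟩

end SmallSetup

end

section

open TensorProduct

/-! ### The glued morphism -/

variable {k : Type u} [Field k]

namespace SmallSetup

variable {X Y : PoissonScheme k} {f : X.scheme ⟶ Y.scheme} {S : SmallSetup X Y f}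

namespace GluingData

variable {𝒱 : PtCover Y.scheme} {𝒰 : PtCover X.scheme} (G : S.GluingData 𝒱 𝒰)

section

variable {z : X.scheme} {U : S.𝒳'.affineOpens} {W : S.SmallOpen 𝒱}
  (hU : S.η.incl ⁻¹ᵁ U.1 ≤ 𝒰.nhd z) (hW : S.fib W.1 ≤ 𝒱.nhd (f z))
  (hUW : S.i ⁻¹ᵁ U.1 ≤ S.ξ.map ⁻¹ᵁ W.1.1)

/-- The local lifts of the morphism, in terms of the chosen points of small opens. -/
def gW : S.P W.1 →+* Γ(S.𝒳', U.1) := (G.g hU hW hUW).comp (G.θ hW W.pt_le)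

theorem gW_apply (p) : G.gW hU hW hUW p = G.g hU hW hUW (G.θ hW W.pt_le p) := rfl

theorem gW_cP (r) : G.gW hU hW hUW (S.cP W.1 r) = constants S.η.total.str U.1 r := by
  rw [gW_apply, G.θ_cP, G.g_cP]

theorem i_gW (p) : pullFun S.i U.1 (S.i ⁻¹ᵁ U.1) le_rfl (G.gW hU hW hUW p) =
    pullFun S.ξ.map W.1.1 (S.i ⁻¹ᵁ U.1) hUW (G.q W.pt_le p) := by
  rw [gW_apply, G.i_g, G.q_θ]

theorem gW_br (p p') : G.gW hU hW hUW (G.br W.pt_le p p') =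
    S.η.total.bracket U.1 (G.gW hU hW hUW p) (G.gW hU hW hUW p') := by
  rw [gW_apply, G.θ_br, G.g_br]; rfl

/-- Changing the point of `X` from `z` to `z'` is absorbed by `g_comp_θ`, and changing the point
assigned to the small open by the cocycle condition. The local homomorphisms thus depend on no
choice of point. -/
theorem gW_res {z' : X.scheme} {U' : S.𝒳'.affineOpens} {W' : S.SmallOpen 𝒱}
    (hU' : S.η.incl ⁻¹ᵁ U'.1 ≤ 𝒰.nhd z') (hW' : S.fib W'.1 ≤ 𝒱.nhd (f z'))
    (hUW' : S.i ⁻¹ᵁ U'.1 ≤ S.ξ.map ⁻¹ᵁ W'.1.1) (h : U' ≤ U) (h' : W' ≤ W) (p) :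
    resFun S.𝒳' h (G.gW hU hW hUW p) = G.gW hU' hW' hUW' (G.T h' p) := by
  have hz : S.fib W'.1 ≤ 𝒱.nhd (f z) := (S.fib_mono h').trans hW
  rw [gW_apply, gW_apply, G.g_res hU hW hUW hUW' h h', G.θ_res _ _ h', T_apply, G.θ_θ,
    ← G.θ_θ hW' hz, G.g_comp_θ hU' ((S.η.incl.preimage_mono h).trans hU)]

end

namespace GluedDeformation

variable {G} (D : G.GluedDeformation)

instance : Surjective D.m := D.surj

theorem V_le_iff {W' W : S.SmallOpen 𝒱} : D.V W' ≤ D.V W ↔ W' ≤ W := by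
  rw [← preimage_le_preimage_iff D.m, D.hm, D.hm]; rfl

theorem exists_gW {z : X.scheme} {N : X.scheme.Opens} (hz : z ∈ N) {N' : S.𝒴.Opens}
    (hz' : f z ∈ S.e ⁻¹ᵁ N') : ∃ (U : S.𝒳'.affineOpens) (W : S.SmallOpen 𝒱),
      z ∈ S.η.incl ⁻¹ᵁ U.1 ∧ S.η.incl ⁻¹ᵁ U.1 ≤ 𝒰.nhd z ∧ S.η.incl ⁻¹ᵁ U.1 ≤ N ∧
      S.fib W.1 ≤ 𝒱.nhd (f z) ∧ W.1.1 ≤ N' ∧ S.i ⁻¹ᵁ U.1 ≤ S.ξ.map ⁻¹ᵁ W.1.1 := by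
  obtain ⟨W, hx, hW⟩ := exists_affine_preimage_le S.e (V := 𝒱.nhd (f z) ⊓ S.e ⁻¹ᵁ N')
    ⟨𝒱.mem _, hz'⟩
  obtain ⟨U, hzU, hUN, hUW⟩ := S.exists_pair (N := 𝒰.nhd z ⊓ N) ⟨𝒰.mem z, hz⟩ hx
  exact ⟨U, ⟨W, _, hW.trans inf_le_left⟩, hzU, hUN.trans inf_le_left, hUN.trans inf_le_right,
    hW.trans inf_le_left, (preimage_le_preimage_iff S.e).1 (hW.trans inf_le_right), hUW⟩

theorem exists_hom : ∃ Ψ : S.𝒳' ⟶ D.cod.total.scheme,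
    ∀ {z : X.scheme} {U : S.𝒳'.affineOpens} {W : S.SmallOpen 𝒱}
      (hU : S.η.incl ⁻¹ᵁ U.1 ≤ 𝒰.nhd z) (hW : S.fib W.1 ≤ 𝒱.nhd (f z))
      (hUW : S.i ⁻¹ᵁ U.1 ≤ S.ξ.map ⁻¹ᵁ W.1.1), ∃ h : U.1 ≤ Ψ ⁻¹ᵁ D.V W,
        ∀ a, pullFun Ψ (D.V W) U.1 h a = G.gW hU hW hUW (D.b W a) := by
  let ι : Type u := {p : X.scheme × S.𝒳'.affineOpens × S.SmallOpen 𝒱 //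
    S.η.incl ⁻¹ᵁ p.2.1.1 ≤ 𝒰.nhd p.1 ∧ S.fib p.2.2.1 ≤ 𝒱.nhd (f p.1) ∧
      S.i ⁻¹ᵁ p.2.1.1 ≤ S.ξ.map ⁻¹ᵁ p.2.2.1.1}
  obtain ⟨Ψ, hΨ⟩ := exists_hom_of_affine (fun p : ι => p.1.2.1.1) (fun p => p.1.2.1.2)
    (fun p => D.V p.1.2.2) (fun p => D.hV _)
    (fun p => (G.gW p.2.1 p.2.2.1 p.2.2.2).comp (D.b p.1.2.2).toRingHom)
    (fun u => by
      obtain ⟨x, rfl⟩ := S.η.incl.surjective u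
      obtain ⟨U, W, hx, hU, -, hW, -, hUW⟩ := exists_gW (𝒱 := 𝒱) (𝒰 := 𝒰) (S := S) (z := x) (N := ⊤)
        trivial (N' := ⊤) trivial
      exact ⟨⟨⟨x, U, W⟩, hU, hW, hUW⟩, hx⟩)
    (fun p p' u hu hu' => by
      obtain ⟨x, rfl⟩ := S.η.incl.surjective u
      obtain ⟨U, W, hx, hU, hUN, hW, hWN, hUW⟩ := exists_gW (𝒱 := 𝒱) (𝒰 := 𝒰) (S := S) (z := x)
        (N := S.η.incl ⁻¹ᵁ p.1.2.1.1 ⊓ S.η.incl ⁻¹ᵁ p'.1.2.1.1) ⟨hu, hu'⟩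
        (N' := p.1.2.2.1.1 ⊓ p'.1.2.2.1.1)
        ⟨S.preimage_i_le p.2.2.2 hu, S.preimage_i_le p'.2.2.2 hu'⟩
      have h1 : U ≤ p.1.2.1 := S.le_of_incl_le (hUN.trans inf_le_left)
      have h2 : U ≤ p'.1.2.1 := S.le_of_incl_le (hUN.trans inf_le_right)
      have h3 : W ≤ p.1.2.2 := hWN.trans inf_le_left
      have h4 : W ≤ p'.1.2.2 := hWN.trans inf_le_right
      refine ⟨⟨⟨x, U, W⟩, hU, hW, hUW⟩, h1, h2, D.V_le_iff.2 h3, D.V_le_iff.2 h4, hx,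
        fun a => ?_, fun a => ?_⟩
      · exact (G.gW_res p.2.1 p.2.2.1 p.2.2.2 hU hW hUW h1 h3 _).trans
          (congrArg _ (D.b_res h3 _ a).symm)
      · exact (G.gW_res p'.2.1 p'.2.2.1 p'.2.2.2 hU hW hUW h2 h4 _).trans
          (congrArg _ (D.b_res h4 _ a).symm))
  refine ⟨Ψ, fun {z U W} hU hW hUW => ?_⟩
  obtain ⟨h, e⟩ := hΨ ⟨⟨z, U, W⟩, hU, hW, hUW⟩
  exact ⟨h, fun a => RingHom.congr_fun e a⟩

end GluedDeformation

end GluingData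

/-- The case of a small extension, and the place where the cohomological hypotheses act.
Compatibility of the glued morphism with the base, the brackets and the reduction is checked on
small pairs, where it is known for the local homomorphisms. -/
theorem exists_lift (S : SmallSetup X Y f) (h₁ : Function.Surjective (hyperPullback S.f_poisson 1))
    (h₂ : Function.Injective (hyperPullback S.f_poisson 2)) :
    ∃ (cod : Deformation Y S.A') (m : S.ξ.cod.total.scheme ⟶ cod.total.scheme)
      (Ψ : S.η.total.scheme ⟶ cod.total.scheme),
      Deformation.IsBaseChange S.φ m ∧ Ψ ≫ cod.total.str = S.η.total.str ∧
        IsPoissonMap S.η.total cod.total Ψ ∧ S.i ≫ Ψ = S.ξ.map ≫ m := by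
  obtain ⟨𝒱, 𝒰, ⟨G⟩⟩ := S.exists_gluingData h₁ h₂
  obtain ⟨D⟩ := G.nonempty_gluedDeformation
  obtain ⟨Ψ, hΨ⟩ := D.exists_hom
  have hcomm : S.i ≫ Ψ = S.ξ.map ≫ D.m := by
    refine hom_ext_of_pullFun fun u => ?_
    obtain ⟨x, hx'⟩ := S.η.incl.surjective (S.i u)
    obtain ⟨U, W, hx, hU, -, hW, -, hUW⟩ := GluingData.GluedDeformation.exists_gW (𝒱 := 𝒱) (𝒰 := 𝒰)
      (S := S) (z := x) (N := ⊤) trivial (N' := ⊤) trivial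
    obtain ⟨h, e⟩ := hΨ hU hW hUW
    refine ⟨S.i ⁻¹ᵁ U.1, D.V W, le_comp_preimage le_rfl h, le_comp_preimage hUW (D.hm W).ge,
      U.2.preimage S.i, D.hV W, ?_, fun a => ?_⟩
    · change S.i u ∈ U.1
      rw [← hx']; exact hx
    · rw [← pullFun_pullFun S.i Ψ le_rfl h, e, G.i_gW, ← D.m_b, pullFun_pullFun]
  refine ⟨D.cod, D.m, Ψ, D.isBaseChange, ?_, ?_, hcomm⟩
  · refine hom_ext_of_constants fun u => ?_
    obtain ⟨x, rfl⟩ := S.η.incl.surjective u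
    obtain ⟨U, W, hx, hU, -, hW, -, hUW⟩ := GluingData.GluedDeformation.exists_gW (𝒱 := 𝒱) (𝒰 := 𝒰)
      (S := S) (z := x) (N := ⊤) trivial (N' := ⊤) trivial
    obtain ⟨h, e⟩ := hΨ hU hW hUW
    refine ⟨U.1, U.2, hx, RingHom.ext fun r => ?_⟩
    rw [← pullFun_constants Ψ _ D.cod.total.str rfl h, e, D.b_const, G.gW_cP]
  · refine IsPoissonMap.of_local fun u V hu => ?_
    obtain ⟨x, rfl⟩ := S.η.incl.surjective u
    have h1 : S.η.incl ≫ Ψ = f ≫ S.e ≫ D.m := by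
      have h2 : S.ξ.dom.incl ≫ S.i = S.η.incl := S.isBaseChange.2.1
      rw [← h2, Category.assoc, hcomm, ← Category.assoc, S.ξ.induces, Category.assoc]
    have h3 : f x ∈ S.e ⁻¹ᵁ D.m ⁻¹ᵁ V := by
      have : Ψ (S.η.incl x) = D.m (S.e (f x)) := by
        rw [← Scheme.Hom.comp_apply, h1]; rfl
      rw [this] at hu
      exact hu
    obtain ⟨U, W, hx, hU, -, hW, hWV, hUW⟩ := GluingData.GluedDeformation.exists_gW (𝒱 := 𝒱)
      (𝒰 := 𝒰) (S := S) (z := x) (N := ⊤) trivial h3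
    obtain ⟨h, e⟩ := hΨ hU hW hUW
    refine ⟨D.V W, U.1, h, ?_, hx, fun a b => ?_⟩
    · rw [← preimage_le_preimage_iff D.m, D.hm]; exact hWV
    · rw [e, e, e, D.b_bracket, G.gW_br]

end SmallSetup

end

section

/-! ### Base change of Poisson schemes -/

section

variable {R R' : Type u} [CommRing R] [CommRing R'] {P : PoissonScheme R'} {Z : Scheme.{u}}
  {m : Z ⟶ P.scheme} {p : Z ⟶ Spec (.of R)} {φ : R' →+* R}

/-- The kernel of restriction is generated by constants, and constants are central; so it is a
Poisson ideal and the bracket descends. -/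
theorem pullFun_bracket_eq_zero (H : IsPullback m p P.str (Spec.map (CommRingCat.ofHom φ)))
    (hφ : Function.Surjective φ) {U : P.scheme.Opens} (hU : IsAffineOpen U) (c a : Γ(P.scheme, U))
    (ha : pullFun m U (m ⁻¹ᵁ U) le_rfl a = 0) :
    pullFun m U (m ⁻¹ᵁ U) le_rfl (P.bracket U c a) = 0 := by
  have ha' := (pullFun_eq_zero_iff H hφ hU a).1 ha
  clear ha
  rw [Ideal.map] at ha'
  induction ha' using Submodule.span_induction with
  | mem x hx =>
    obtain ⟨r, -, rfl⟩ := hx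
    rw [P.bracket_const_right, map_zero]
  | zero => rw [(P.isAltBider U).zero_right, map_zero]
  | add x y _ _ hx hy => rw [P.bracket_add_right, map_add, hx, hy, add_zero]
  | smul s x hx hx' =>
    rw [smul_eq_mul, P.bracket_mul_right, map_add, map_mul, map_mul, hx', mul_zero, add_zero,
      (pullFun_eq_zero_iff H hφ hU x).2 hx, mul_zero]

theorem pullFun_bracket_congr (H : IsPullback m p P.str (Spec.map (CommRingCat.ofHom φ)))
    (hφ : Function.Surjective φ) {U : P.scheme.Opens} (hU : IsAffineOpen U)
    {a a' b b' : Γ(P.scheme, U)}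
    (ha : pullFun m U (m ⁻¹ᵁ U) le_rfl a = pullFun m U (m ⁻¹ᵁ U) le_rfl a')
    (hb : pullFun m U (m ⁻¹ᵁ U) le_rfl b = pullFun m U (m ⁻¹ᵁ U) le_rfl b') :
    pullFun m U (m ⁻¹ᵁ U) le_rfl (P.bracket U a b) =
      pullFun m U (m ⁻¹ᵁ U) le_rfl (P.bracket U a' b') := by
  have h := P.isAltBider U
  have h1 := pullFun_bracket_eq_zero H hφ hU a (b - b') (by rw [map_sub, hb, sub_self])
  have h2 := pullFun_bracket_eq_zero H hφ hU b' (a - a') (by rw [map_sub, ha, sub_self])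
  have e : P.bracket U a b = P.bracket U a' b' + P.bracket U a (b - b') -
      P.bracket U b' (a - a') := by
    rw [sub_eq_add_neg b, sub_eq_add_neg a, h.add_right, h.add_right, h.anti b', h.anti b',
      h.neg_left, h.anti a (-b'), h.neg_left, h.anti b' a]
    ring
  rw [e, map_sub, map_add, h1, h2, add_zero, sub_zero]

/-- Affine opens of the closed subscheme cut out by affine opens form a basis. On them functions
lift, and the descended bracket does not depend on the lifts. -/
theorem exists_baseChange (H : IsPullback m p P.str (Spec.map (CommRingCat.ofHom φ)))
    (hφ : Function.Surjective φ) (hn : IsNilpotent (RingHom.ker φ)) :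
    ∃ br : ∀ U : Z.Opens, Γ(Z, U) → Γ(Z, U) → Γ(Z, U),
      (∀ U, IsAltBider (constants p U) (br U)) ∧ (∀ U x y z, jacobiator (br U) x y z = 0) ∧
      (∀ {U U' : Z.Opens} (h : U' ≤ U) a b, resFun Z h (br U a b) =
        br U' (resFun Z h a) (resFun Z h b)) ∧
      ∀ (U : P.scheme.Opens), IsAffineOpen U → ∀ a b,
        br (m ⁻¹ᵁ U) (pullFun m U _ le_rfl a) (pullFun m U _ le_rfl b) =
          pullFun m U _ le_rfl (P.bracket U a b) := by
  have hc := isClosedImmersion_of_isPullback H hφ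
  have hs := surjective_of_isPullback H hφ hn
  let ℓ : ∀ U : P.scheme.affineOpens, Γ(Z, m ⁻¹ᵁ U.1) → Γ(P.scheme, U.1) := fun U =>
    Function.surjInv (pullFun_surjective (i := m) U.2)
  have hℓ : ∀ U x, pullFun m U.1 _ le_rfl (ℓ U x) = x := fun U x => Function.surjInv_eq _ x
  obtain ⟨b, hb⟩ : ∃ b : ∀ U : P.scheme.affineOpens, Γ(Z, m ⁻¹ᵁ U.1) → Γ(Z, m ⁻¹ᵁ U.1) →
      Γ(Z, m ⁻¹ᵁ U.1), ∀ U a a', b U (pullFun m U.1 _ le_rfl a) (pullFun m U.1 _ le_rfl a') =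
        pullFun m U.1 _ le_rfl (P.bracket U.1 a a') :=
    ⟨fun U x y => pullFun m U.1 _ le_rfl (P.bracket U.1 (ℓ U x) (ℓ U y)), fun U a a' =>
      pullFun_bracket_congr H hφ U.2 (hℓ U _) (hℓ U _)⟩
  have hsurj : ∀ (U : P.scheme.affineOpens) (x : Γ(Z, m ⁻¹ᵁ U.1)), ∃ a,
    pullFun m U.1 _ le_rfl a = x := fun U x => ⟨_, hℓ U x⟩
  have hA : ∀ U, IsAltBider (constants p (m ⁻¹ᵁ U.1)) (b U) := fun U => by
    refine ⟨fun x y z => ?_, fun x y z => ?_, fun x => ?_, fun x y z => ?_, fun x r => ?_⟩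
    · obtain ⟨x, rfl⟩ := hsurj U x
      obtain ⟨y, rfl⟩ := hsurj U y
      obtain ⟨z, rfl⟩ := hsurj U z
      rw [← map_add, hb, hb, hb, ← map_add, P.bracket_add_left]
    · obtain ⟨x, rfl⟩ := hsurj U x
      obtain ⟨y, rfl⟩ := hsurj U y
      obtain ⟨z, rfl⟩ := hsurj U z
      rw [← map_add, hb, hb, hb, ← map_add, P.bracket_add_right]
    · obtain ⟨x, rfl⟩ := hsurj U x
      rw [hb, P.bracket_self, map_zero]
    · obtain ⟨x, rfl⟩ := hsurj U x
      obtain ⟨y, rfl⟩ := hsurj U y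
      obtain ⟨z, rfl⟩ := hsurj U z
      rw [← map_mul, hb, hb, hb, ← map_mul, ← map_mul, ← map_add, P.bracket_mul_right]
    · obtain ⟨x, rfl⟩ := hsurj U x
      obtain ⟨r, rfl⟩ := hφ r
      rw [← pullFun_constants_of_comm m p P.str φ H.w le_rfl, hb, P.bracket_const_right, map_zero]
  have hJ : ∀ U x y z, jacobiator (b U) x y z = 0 := fun U x y z => by
    obtain ⟨x, rfl⟩ := hsurj U x
    obtain ⟨y, rfl⟩ := hsurj U y
    obtain ⟨z, rfl⟩ := hsurj U z
    have := P.jacobiator_eq_zero U.1 x y z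
    rw [jacobiator] at this ⊢
    rw [hb, hb, hb, hb, hb, hb, ← map_add, ← map_add, this, map_zero]
  have hR : ∀ (U' U : P.scheme.affineOpens) (h : m ⁻¹ᵁ U'.1 ≤ m ⁻¹ᵁ U.1) x y,
      resFun Z h (b U x y) = b U' (resFun Z h x) (resFun Z h y) := fun U' U h x y => by
    obtain ⟨x, rfl⟩ := hsurj U x
    obtain ⟨y, rfl⟩ := hsurj U y
    have hle : U'.1 ≤ U.1 := (preimage_le_preimage_iff m).1 h
    have key : ∀ a : Γ(P.scheme, U.1), resFun Z h (pullFun m U.1 _ le_rfl a) =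
        pullFun m U'.1 _ le_rfl (resFun P.scheme hle a) := fun a => by
      rw [resFun_pullFun, pullFun_restrict]
    rw [hb, key, key, key, hb, P.bracket_res]
  obtain ⟨br, h1, h2, h3, h4⟩ := exists_poissonScheme_of_basis Z p
    (fun U : P.scheme.affineOpens => m ⁻¹ᵁ U.1)
    (fun N z hz => exists_affine_preimage_le m hz) b hA hJ hR
  refine ⟨br, h1, h2, h3, fun U hU a a' => ?_⟩
  have := h4 ⟨U, hU⟩
  rw [this]
  exact hb ⟨U, hU⟩ a a'

theorem isPoissonMap_of_affine {R R' : Type u} [CommRing R] [CommRing R'] {Q : PoissonScheme R}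
    {P : PoissonScheme R'} {m : Q.scheme ⟶ P.scheme}
    (h : ∀ (U : P.scheme.Opens), IsAffineOpen U → ∀ a b,
        Q.bracket (m ⁻¹ᵁ U) (pullFun m U _ le_rfl a) (pullFun m U _ le_rfl b) =
          pullFun m U _ le_rfl (P.bracket U a b)) : IsPoissonMap Q P m := by
  refine IsPoissonMap.of_local fun x V hx => ?_
  obtain ⟨U, hxU, hU⟩ := exists_affine_le hx
  exact ⟨U.1, m ⁻¹ᵁ U.1, le_rfl, hU, hxU, fun a b => (h U.1 U.2 a b).symm⟩

/-- Functions on small affine opens of `Q` are restrictions of functions on `P`, so it suffices to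
test the brackets on the latter. -/
theorem IsPoissonMap.of_comp_closedImmersion {R R' R'' : Type u} [CommRing R] [CommRing R']
    [CommRing R''] {T : PoissonScheme R''} {Q : PoissonScheme R} {P : PoissonScheme R'}
    {g : T.scheme ⟶ Q.scheme} {m : Q.scheme ⟶ P.scheme} [IsClosedImmersion m]
    (hm : IsPoissonMap Q P m) (h : IsPoissonMap T P (g ≫ m)) : IsPoissonMap T Q g := by
  refine IsPoissonMap.of_local fun x V hx => ?_
  obtain ⟨U, hxU, hU⟩ := exists_affine_preimage_le m hx
  refine ⟨m ⁻¹ᵁ U.1, g ⁻¹ᵁ m ⁻¹ᵁ U.1, le_rfl, hU, hxU, fun a b => ?_⟩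
  obtain ⟨a, rfl⟩ := pullFun_surjective (i := m) U.2 a
  obtain ⟨b, rfl⟩ := pullFun_surjective (i := m) U.2 b
  rw [← hm.pullFun_bracket, pullFun_pullFun, pullFun_pullFun, pullFun_pullFun, h.pullFun_bracket]

end

end

section

/-! ### Lifting along surjections -/

variable {k : Type u} [Field k]

theorem specMap_comp {A A' A'' : Art k} (φ : A'.carrier →ₐ[k] A.carrier)
    (ψ : A''.carrier →ₐ[k] A'.carrier) : specMap φ ≫ specMap ψ = specMap (φ.comp ψ) := by
  rw [specMap, specMap, specMap, ← Spec.map_comp]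
  rfl

theorem specMap_aug_comp {A A' : Art k} (φ : A'.carrier →ₐ[k] A.carrier) :
    specMap A.aug ≫ specMap φ = specMap A'.aug := by
  rw [specMap, specMap, specMap, ← Spec.map_comp]
  congr 1
  exact CommRingCat.hom_ext (RingHom.ext fun r => Art.aug_comp φ r)

theorem Deformation.IsBaseChange.comp {X : PoissonScheme k} {A A' A'' : Art k}
    {φ : A'.carrier →ₐ[k] A.carrier} {ψ : A''.carrier →ₐ[k] A'.carrier} {η : Deformation X A}
    {η' : Deformation X A'} {η'' : Deformation X A''} {j : η.total.scheme ⟶ η'.total.scheme}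
    {j' : η'.total.scheme ⟶ η''.total.scheme} (h : IsBaseChange φ j) (h' : IsBaseChange ψ j') :
    IsBaseChange (φ.comp ψ) (j ≫ j') := by
  refine ⟨?_, ?_, h.2.2.comp h'.2.2⟩
  · have := h.1.paste_horiz h'.1
    rwa [specMap_comp] at this
  · rw [← Category.assoc, h.2.1, h'.2.1]

theorem Deformation.exists_baseChange {X : PoissonScheme k} {A B : Art k}
    (ψ : B.carrier →ₐ[k] A.carrier) (hψ : Function.Surjective ψ) (η : Deformation X B) :
    ∃ (η' : Deformation X A) (j : η'.total.scheme ⟶ η.total.scheme), IsBaseChange ψ j := by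
  have H := IsPullback.of_hasPullback η.total.str (specMap ψ)
  obtain ⟨br, h1, h2, h3, h4⟩ :=
    PoissonDeformationTheory.exists_baseChange H hψ (Art.isNilpotent_ker ψ)
  let Q := PoissonScheme.ofBrackets _ (Limits.pullback.snd η.total.str (specMap ψ)) br h1 h2 h3
  let m : Q.scheme ⟶ η.total.scheme := Limits.pullback.fst η.total.str (specMap ψ)
  have hm : IsPoissonMap Q η.total m := isPoissonMap_of_affine h4
  have hc : IsClosedImmersion m := isClosedImmersion_of_isPullback H hψ
  have hf : Flat Q.str := by
    have := η.flat
    exact MorphismProperty.of_isPullback (P := @Flat) H this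
  have w : η.incl ≫ η.total.str = (X.str ≫ specMap A.aug) ≫ specMap ψ := by
    rw [Category.assoc, specMap_aug_comp, η.isPullback.w]
  let c : X.scheme ⟶ Q.scheme := H.lift _ _ w
  have hcm : c ≫ m = η.incl := H.lift_fst _ _ w
  have hP : IsPullback (c ≫ m) X.str η.total.str (specMap A.aug ≫ specMap ψ) := by
    rw [specMap_aug_comp, hcm]
    exact η.isPullback
  refine ⟨⟨Q, hf, c, IsPullback.of_right hP (H.lift_snd _ _ w) H,
    IsPoissonMap.of_comp_closedImmersion hm ?_⟩, m, H, hcm, hm⟩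
  rw [hcm]
  exact η.incl_poisson

/-- A base change along a composite passes through the intermediate one, by the universal property
of the fibre product. This splits a lifting problem into two. -/
theorem Deformation.IsBaseChange.factor {X : PoissonScheme k} {A A' A'' : Art k}
    {φ : A'.carrier →ₐ[k] A.carrier} {ψ : A''.carrier →ₐ[k] A'.carrier}
    (hψ : Function.Surjective ψ) {η : Deformation X A} {η' : Deformation X A'}
    {η'' : Deformation X A''} {i : η.total.scheme ⟶ η''.total.scheme}
    {j' : η'.total.scheme ⟶ η''.total.scheme} (h : IsBaseChange (φ.comp ψ) i)
    (h' : IsBaseChange ψ j') :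
    ∃ j : η.total.scheme ⟶ η'.total.scheme, IsBaseChange φ j ∧ j ≫ j' = i := by
  have w : i ≫ η''.total.str = (η.total.str ≫ specMap φ) ≫ specMap ψ := by
    rw [Category.assoc, specMap_comp, h.1.w]
  let j := h'.1.lift _ _ w
  have hj : j ≫ j' = i := h'.1.lift_fst _ _ w
  have hj' : j ≫ η'.total.str = η.total.str ≫ specMap φ := h'.1.lift_snd _ _ w
  have hc : IsClosedImmersion j' := isClosedImmersion_of_isPullback h'.1 hψ
  have hP : IsPullback (j ≫ j') η.total.str η''.total.str (specMap φ ≫ specMap ψ) := by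
    rw [specMap_comp, hj]
    exact h.1
  refine ⟨j, ⟨IsPullback.of_right hP hj' h'.1, h'.1.hom_ext ?_ ?_,
    IsPoissonMap.of_comp_closedImmersion h'.2.2 (by rw [hj]; exact h.2.2)⟩, hj⟩
  · rw [Category.assoc, hj, h.2.1, h'.2.1]
  · rw [Category.assoc, hj', ← Category.assoc, η.isPullback.w, Category.assoc, specMap_aug_comp,
      η'.isPullback.w]

section Quotient

/-- The quotient of a local Artinian algebra by a proper ideal. -/
def Art.quotient (B : Art k) (I : Ideal B.carrier) (hI : I ≤ RingHom.ker B.aug.toRingHom) : Art k :=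
  have : Nontrivial (B.carrier ⧸ I) := Ideal.Quotient.nontrivial_iff.2 fun h => by
    have : (1 : B.carrier) ∈ RingHom.ker B.aug.toRingHom := hI (h ▸ trivial)
    exact one_ne_zero ((map_one B.aug).symm.trans this)
  have := IsLocalRing.of_surjective' (Ideal.Quotient.mk I) Ideal.Quotient.mk_surjective
  { carrier := B.carrier ⧸ I
    aug := Ideal.Quotient.liftₐ I B.aug fun a ha => hI ha }

/-- Among the ideals `m ^ l * I`, the last nonzero one is killed by `m`; any of its nonzero elements
will do. -/
theorem exists_mem_mul_eq_bot {R : Type*} [CommRing R] {m I : Ideal R} (hm : IsNilpotent m)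
    (hI : I ≠ ⊥) : ∃ t ∈ I, t ≠ 0 ∧ ∀ r ∈ m, r * t = 0 := by
  obtain ⟨n, hn⟩ := hm
  have hex : ∃ n, m ^ n * I = ⊥ := ⟨n, by rw [hn]; exact Ideal.bot_mul I⟩
  obtain ⟨N, hN, hmin⟩ : ∃ N, m ^ N * I = ⊥ ∧ ∀ l, l < N → m ^ l * I ≠ ⊥ := by
    classical
    exact ⟨Nat.find hex, Nat.find_spec hex, fun l hl => Nat.find_min hex hl⟩
  obtain _ | l := N
  · exact absurd (by rwa [pow_zero, one_mul] at hN) hI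
  obtain ⟨J, hJ, h1, h2⟩ : ∃ J ≤ I, J ≠ ⊥ ∧ m * J = ⊥ :=
    ⟨m ^ l * I, Ideal.mul_le_right, hmin l (Nat.lt_succ_self l), by
      rwa [← mul_assoc, ← pow_succ']⟩
  obtain ⟨t, ht, ht0⟩ := Submodule.exists_mem_ne_zero_of_ne_bot h1
  refine ⟨t, hJ ht, ht0, fun r hr => ?_⟩
  have : r * t ∈ m * J := Ideal.mul_mem_mul hr ht
  rw [h2] at this
  exact (Submodule.mem_bot _).1 this

/-- Outside the maximal ideal elements are units and cannot kill `t ≠ 0`, so the annihilator is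
exactly the kernel of the augmentation. -/
theorem exists_socle (B : Art k) {I : Ideal B.carrier} (hI : I ≠ ⊥) :
    ∃ t ∈ I, ∀ r, r * t = 0 ↔ B.aug r = 0 := by
  obtain ⟨t, ht, ht0, h⟩ := exists_mem_mul_eq_bot B.isNilpotent_ker_aug hI
  refine ⟨t, ht, fun r => ⟨fun h0 => ?_, fun hr => h r hr⟩⟩
  by_contra hr
  have hu : IsUnit r := by
    by_contra hu
    have h1 : r ∈ IsLocalRing.maximalIdeal B.carrier := (IsLocalRing.mem_maximalIdeal r).2 hu
    rw [← B.ker_aug] at h1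
    exact hr h1
  exact ht0 ((hu.mul_right_eq_zero).1 h0)

end Quotient

section Bijective

theorem isPoissonMap_inv {R R' : Type u} [CommRing R] [CommRing R'] {Q : PoissonScheme R}
    {P : PoissonScheme R'} (i : Q.scheme ⟶ P.scheme) [IsIso i] (h : IsPoissonMap Q P i) :
    IsPoissonMap P Q (inv i) :=
  IsPoissonMap.of_comp_closedImmersion h (by
    rw [IsIso.inv_hom_id]; exact IsPoissonMap.refl P)

theorem PoissonScheme.exists_restrictScalars {R R' : Type u} [CommRing R] [CommRing R']
    (P : PoissonScheme R) (φ : R' →+* R) (hφ : Function.Bijective φ) :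
    ∃ (Q : PoissonScheme R') (m : P.scheme ⟶ Q.scheme),
      IsPullback m P.str Q.str (Spec.map (CommRingCat.ofHom φ)) ∧ IsPoissonMap P Q m := by
  have h1 : IsIso (CommRingCat.ofHom φ) := (ConcreteCategory.isIso_iff_bijective _).2 hφ
  let Q : PoissonScheme R' :=
    { P with
      str := P.str ≫ Spec.map (CommRingCat.ofHom φ)
      bracket_const_right := fun U a r => by rw [constants_comp_spec, P.bracket_const_right] }
  exact ⟨Q, 𝟙 P.scheme, IsPullback.of_horiz_isIso ⟨Category.id_comp _⟩, IsPoissonMap.refl P⟩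

/-- Base case of the induction: all base change maps are isomorphisms, and the target is the given
one with its scalars restricted along `φ`. -/
theorem exists_lift_of_bijective {X Y : PoissonScheme k} {f : X.scheme ⟶ Y.scheme} {A' A : Art k}
    (φ : A'.carrier →ₐ[k] A.carrier) (hφ : Function.Bijective φ) (ξ : MorDeformation X Y f A)
    (η : Deformation X A') (i : ξ.dom.total.scheme ⟶ η.total.scheme)
    (hi : Deformation.IsBaseChange φ i) :
    ∃ (cod : Deformation Y A') (m : ξ.cod.total.scheme ⟶ cod.total.scheme)
      (Ψ : η.total.scheme ⟶ cod.total.scheme), Deformation.IsBaseChange φ m ∧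
        Ψ ≫ cod.total.str = η.total.str ∧ IsPoissonMap η.total cod.total Ψ ∧ i ≫ Ψ = ξ.map ≫ m := by
  have h1 : IsIso (CommRingCat.ofHom φ.toRingHom) := (ConcreteCategory.isIso_iff_bijective _).2 hφ
  have h2 : IsIso (specMap φ) := inferInstanceAs (IsIso (Spec.map _))
  have h3 : IsIso i := MorphismProperty.of_isPullback (P := MorphismProperty.isomorphisms Scheme)
    hi.1.flip h2
  obtain ⟨Q, m, hsq, hQ⟩ := ξ.cod.total.exists_restrictScalars φ.toRingHom hφ
  have h4 : IsIso m := MorphismProperty.of_isPullback (P := MorphismProperty.isomorphisms Scheme)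
    hsq.flip h2
  have hf : Flat Q.str := by
    have := ξ.cod.flat
    have h5 : Q.str = inv m ≫ ξ.cod.total.str ≫ specMap φ := by
      rw [IsIso.eq_inv_comp]; exact hsq.w
    rw [h5]
    infer_instance
  have hP := ξ.cod.isPullback.paste_horiz hsq
  change IsPullback _ _ _ (specMap A.aug ≫ specMap φ) at hP
  rw [specMap_aug_comp] at hP
  refine ⟨⟨Q, hf, ξ.cod.incl ≫ m, hP, ξ.cod.incl_poisson.comp hQ⟩, m, inv i ≫ ξ.map ≫ m,
    ⟨hsq, rfl, hQ⟩, ?_, ?_, ?_⟩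
  · change (inv i ≫ ξ.map ≫ m) ≫ Q.str = _
    have h6 : m ≫ Q.str = ξ.cod.total.str ≫ specMap φ := hsq.w
    rw [Category.assoc, Category.assoc, h6, ← Category.assoc ξ.map, ξ.map_str, ← hi.1.w,
      IsIso.inv_hom_id_assoc]
  · exact (isPoissonMap_inv i hi.2.2).comp (ξ.map_poisson.comp hQ)
  · rw [IsIso.hom_inv_id_assoc]

end Bijective

section Induction

variable {X Y : PoissonScheme k} {f : X.scheme ⟶ Y.scheme} (hsm : Smooth Y.str)
  (hsep : IsSeparated Y.str) (hf : IsPoissonMap X Y f)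
  (h₁ : Function.Surjective (hyperPullback hf 1)) (h₂ : Function.Injective (hyperPullback hf 2))

include hsm hsep h₁ h₂

/-- A nonzero kernel contains a socle element `t`. The lifting problem is solved over the quotient
by `t`, then along the small extension by `exists_lift`. -/
theorem exists_lift_of_surjective {A' A : Art k} (φ : A'.carrier →ₐ[k] A.carrier)
    (hφ : Function.Surjective φ) (ξ : MorDeformation X Y f A) (η : Deformation X A')
    (i : ξ.dom.total.scheme ⟶ η.total.scheme) (hi : Deformation.IsBaseChange φ i) :
    ∃ (cod : Deformation Y A') (m : ξ.cod.total.scheme ⟶ cod.total.scheme)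
      (Ψ : η.total.scheme ⟶ cod.total.scheme), Deformation.IsBaseChange φ m ∧
        Ψ ≫ cod.total.str = η.total.str ∧ IsPoissonMap η.total cod.total Ψ ∧ i ≫ Ψ = ξ.map ≫ m := by
  -- The ring over which one lifts changes during the induction. It is recorded as a quotient of the
  -- fixed ring `A'` with kernel `K`, and ideals of a Noetherian ring allow induction on larger `K`.
  suffices H : ∀ (K : Ideal A'.carrier) (B : Art k) (π : A'.carrier →ₐ[k] B.carrier),
      Function.Surjective π → RingHom.ker π.toRingHom = K → ∀ (φ : B.carrier →ₐ[k] A.carrier),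
      Function.Surjective φ → ∀ (η : Deformation X B) (i : ξ.dom.total.scheme ⟶ η.total.scheme),
      Deformation.IsBaseChange φ i →
      ∃ (cod : Deformation Y B) (m : ξ.cod.total.scheme ⟶ cod.total.scheme)
        (Ψ : η.total.scheme ⟶ cod.total.scheme), Deformation.IsBaseChange φ m ∧
          Ψ ≫ cod.total.str = η.total.str ∧ IsPoissonMap η.total cod.total Ψ ∧
            i ≫ Ψ = ξ.map ≫ m from
    H _ A' (AlgHom.id k _) Function.surjective_id rfl φ hφ η i hi
  clear hi i η hφ φ
  intro K
  induction K using WellFoundedGT.induction with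
  | ind K IH =>
  rintro B π hπ rfl φ hφ η i hi
  by_cases hK : RingHom.ker φ.toRingHom = ⊥
  · exact exists_lift_of_bijective φ ⟨(RingHom.injective_iff_ker_eq_bot _).2 hK, hφ⟩ ξ η i hi
  obtain ⟨t, ht, ht'⟩ := exists_socle B hK
  have hφt : φ t = 0 := ht
  have ht0 : t ≠ 0 := fun h => by simpa [h] using (ht' 1).1 (by simp [h])
  have hle : Ideal.span {t} ≤ RingHom.ker φ.toRingHom := by
    rw [Ideal.span_singleton_le_iff_mem]; exact ht
  have hle' : Ideal.span {t} ≤ RingHom.ker B.aug.toRingHom := fun r hr => by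
    have : φ r = 0 := hle hr
    change B.aug r = 0
    rw [← Art.aug_comp φ, this, map_zero]
  let B' := B.quotient (Ideal.span {t}) hle'
  let ψ : B.carrier →ₐ[k] B'.carrier := Ideal.Quotient.mkₐ k (Ideal.span {t})
  have hψ : Function.Surjective ψ := Ideal.Quotient.mk_surjective
  have hψ0 : ∀ r, ψ r = 0 ↔ ∃ s, r = t * s := fun r =>
    (Ideal.Quotient.eq_zero_iff_mem.trans Ideal.mem_span_singleton)
  let φ' : B'.carrier →ₐ[k] A.carrier := Ideal.Quotient.liftₐ (Ideal.span {t}) φ fun a ha => hle ha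
  have hφ' : Function.Surjective φ' := fun a => by
    obtain ⟨b, rfl⟩ := hφ a
    exact ⟨ψ b, rfl⟩
  have hcomp : φ = φ'.comp ψ := AlgHom.ext fun _ => rfl
  obtain ⟨η', j, hj⟩ := η.exists_baseChange ψ hψ
  rw [hcomp] at hi
  obtain ⟨i', hi', hij⟩ := hi.factor hψ hj
  have hlt : RingHom.ker π.toRingHom < RingHom.ker (ψ.comp π).toRingHom := by
    refine lt_of_le_of_ne (fun r hr => ?_) fun h => ?_
    · have : π r = 0 := hr
      change ψ (π r) = 0
      rw [this, map_zero]
    · obtain ⟨s, hs⟩ := hπ t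
      have : s ∈ RingHom.ker (ψ.comp π).toRingHom := by
        change ψ (π s) = 0
        rw [hs, hψ0]; exact ⟨1, by simp⟩
      rw [← h] at this
      exact ht0 (hs.symm.trans this)
  -- Dividing by `t` enlarges the kernel strictly, so the lift over `B'` exists; it is the input of
  -- the small extension `B → B'`.
  obtain ⟨cod', m', Ψ', hm', hs', hP', hc'⟩ := IH _ hlt B' (ψ.comp π) (hψ.comp hπ) rfl φ' hφ' η' i' hi'
  let S : SmallSetup X Y f :=
    { A' := B
      A := B'
      φ := ψ
      φ_surj := hψ
      t := t
      mul_t := ht'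
      ker_φ := hψ0
      ξ := ⟨η', cod', Ψ', hs', hP', by
        rw [← hi'.2.1, Category.assoc, hc', ← Category.assoc, ξ.induces, Category.assoc, hm'.2.1]⟩
      η := η
      i := j
      isBaseChange := hj
      smooth := hsm
      separated := hsep
      f_poisson := hf }
  obtain ⟨cod, m, Ψ, hm, hs, hP, hc⟩ := S.exists_lift h₁ h₂
  refine ⟨cod, m' ≫ m, Ψ, hcomp ▸ hm'.comp hm, hs, hP, ?_⟩
  rw [← hij, Category.assoc, hc]
  change i' ≫ Ψ' ≫ m = _
  rw [← Category.assoc, hc', Category.assoc]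

end Induction

end

section

/-! ### The main theorem -/

section

attribute [local instance] MvPolynomial.gradedAlgebra

theorem IsProjectiveOver.isSeparated {k : Type u} [Field k] {X : Scheme.{u}}
    {p : X ⟶ Spec (.of k)} (h : IsProjectiveOver p) : IsSeparated p := by
  obtain ⟨n, i, hi, rfl⟩ := h
  infer_instance

end

variable {k : Type u} [Field k]

/-- The field `k` as a local Artinian `k`-algebra. -/
def Art.base (k : Type u) [Field k] : Art k where
  carrier := k
  aug := AlgHom.id k k

instance : IsIso (specMap (Art.base k).aug) :=
  inferInstanceAs (IsIso (Spec.map (𝟙 (CommRingCat.of k))))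

theorem comp_specMap_aug_base {Z : Scheme.{u}} (p : Z ⟶ Spec (.of k)) :
    p ≫ specMap (Art.base k).aug = p :=
  (congrArg (p ≫ ·) (Spec.map_id (CommRingCat.of k))).trans (Category.comp_id p)

/-- The trivial deformation over `k`. -/
def Deformation.base (X : PoissonScheme k) (h : Flat X.str) : Deformation X (Art.base k) where
  total := X
  flat := h
  incl := 𝟙 _
  isPullback :=
    IsPullback.of_horiz_isIso ⟨(Category.id_comp _).trans (comp_specMap_aug_base X.str).symm⟩
  incl_poisson := IsPoissonMap.refl X

/-- Equality of deformation classes yields only an isomorphism, which has to be absorbed into the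
base change map. -/
theorem Deformation.IsBaseChange.of_isIsom {X : PoissonScheme k} {A' A : Art k}
    {φ : A'.carrier →ₐ[k] A.carrier} {η' : Deformation X A'} {η ζ : Deformation X A}
    {j : η.total.scheme ⟶ η'.total.scheme} (h : IsBaseChange φ j)
    {r : ζ.total.scheme ≅ η.total.scheme} (hr : IsIsom r) : IsBaseChange φ (r.hom ≫ j) := by
  refine ⟨?_, ?_, hr.2.2.1.comp h.2.2⟩
  · have h1 : IsPullback r.hom ζ.total.str η.total.str (𝟙 _) :=
      IsPullback.of_horiz_isIso ⟨by rw [hr.1, Category.comp_id]⟩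
    have := h1.paste_horiz h.1
    rwa [Category.id_comp] at this
  · rw [← Category.assoc, hr.2.1, h.2.1]

end

end PoissonDeformationTheory

end

theorem mainTheorem9 {k : Type u} [Field k] [IsAlgClosed k] [CharZero k]
    (X Y : PoissonScheme k) (hX : X.IsNonsingularProjectiveVariety)
    (hY : Y.IsNonsingularProjectiveVariety)
    (f : X.scheme ⟶ Y.scheme) (hfk : f ≫ Y.str = X.str) (hf : IsPoissonMap X Y f)
    (h₁ : Function.Surjective (hyperPullback hf 1))
    (h₂ : Function.Injective (hyperPullback hf 2)) :
    ForgetXIsSmooth f ∧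
      ∀ (A : Art k) (𝒳 : Deformation X A),
        ∃ (𝒴 : Deformation Y A) (Φ : 𝒳.total.scheme ⟶ 𝒴.total.scheme),
          Φ ≫ 𝒴.total.str = 𝒳.total.str ∧ IsPoissonMap 𝒳.total 𝒴.total Φ ∧
            𝒳.incl ≫ Φ = f ≫ 𝒴.incl := by
  have hsep := hY.projective.isSeparated
  refine ⟨fun A' A φ hφ x y' hxy => ?_, fun A 𝒳 => ?_⟩
  · obtain ⟨η', η, j, rfl, hη, hj⟩ := hxy
    obtain ⟨ξ, rfl⟩ := Quotient.exists_rep x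
    -- The base change of the given class is only isomorphic to the source of the chosen `ξ`; after
    -- composing with `r`, the lift has source exactly `η'`.
    obtain ⟨r, hr⟩ : ξ.dom ≈ η := Quotient.exact hη
    have hi := hj.of_isIsom hr
    obtain ⟨cod, m, Ψ, hm, hs, hP, hc⟩ :=
      exists_lift_of_surjective hY.smooth hsep hf h₁ h₂ φ hφ ξ η' _ hi
    let ξ' : MorDeformation X Y f A' := ⟨η', cod, Ψ, hs, hP, by
      rw [← hi.2.1, Category.assoc, hc, ← Category.assoc, ξ.induces, Category.assoc, hm.2.1]⟩
    exact ⟨Quotient.mk _ ξ', ⟨ξ', ξ, _, m, rfl, rfl, hi, hm, hc⟩, rfl⟩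
  · have hXf : Flat X.str := by
      have := hX.smooth
      infer_instance
    have hYf : Flat Y.str := by
      have := hY.smooth
      infer_instance
    -- The morphism `f` is its own deformation over `k`, and an arbitrary `𝒳` extends its source
    -- along the augmentation of `A`.
    let ξ : MorDeformation X Y f (Art.base k) :=
      ⟨Deformation.base X hXf, Deformation.base Y hYf, f, hfk, hf,
        (Category.id_comp f).trans (Category.comp_id f).symm⟩
    obtain ⟨cod, m, Ψ, hm, hs, hP, hc⟩ :=
      exists_lift_of_surjective hY.smooth hsep hf h₁ h₂ (A := Art.base k) A.aug
        A.aug_surjective ξ 𝒳 𝒳.incl ⟨𝒳.isPullback, Category.id_comp _, 𝒳.incl_poisson⟩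
    refine ⟨cod, Ψ, hs, hP, hc.trans ?_⟩
    -- The initial target is `Y` with the identity as inclusion, so the base change map is the
    -- inclusion of the special fibre.
    have : m = cod.incl := (Category.id_comp m).symm.trans hm.2.1
    rw [this]
    rfl
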